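/- Let $k$ be a field and let $X$ be a smooth variety over $k$ (an integral separated scheme of finite type, smooth over $k$). (1) Let $\varphi\colon E\to F$ be a morphism of locally free sheaves on $X$ of ranks $m\ge n$, and put $r=m-n$. Let $Y=D_{n-1}(\varphi)$ be the degeneracy locus of $\varphi$, i.e. the closed subscheme of $X$ whose ideal is locally generated by the $n\times n$ minors of $\varphi$. Assume that $Y$ is smooth over $k$ and that $Y$ is either empty or of the expected codimension $m-n+1$ (so that $\varphi$ generically has full rank). Let $\pi\colon \mathrm{Gr}(r,E)\to X$ be the Grassmann bundle of rank $r$ subbundles of $E$ (which exists), with tautological subbundle $S\hookrightarrow\pi^*E$. Then the composition $S\hookrightarrow \pi^*E\xrightarrow{\pi^*\varphi}\pi^*F$ is a regular section $s$ of $\mathcal{H}om(S,\pi^*F)$, and its zero locus $Z(s)\subset \mathrm{Gr}(r,E)$, with the projection $\pi|_{Z(s)}\colon Z(s)\to X$, is the blow-up $\mathrm{Bl}_Y X\to X$ of $X$ along $Y$. (2) Let $r\ge 0$, let $E=L_0\oplus\dots\oplus L_r$ be a direct sum of $r+1$ line bundles on $X$, and let $Z\subset X$ be the zero locus of a regular section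 $s$ of $E$. Let $\pi\colon\mathrm{Gr}(r,E^\vee)\to X$ be the Grassmann bundle of rank $r$ subbundles of $E^\vee$ (which exists), with tautological subbundle $S\hookrightarrow\pi^*E^\vee$. Then the composition $S\hookrightarrow\pi^*E^\vee\xrightarrow{\pi^*s^\vee}\mathcal{O}$ is a regular section of $S^\vee$, and its zero locus, with its projection to $X$, is the blow-up $\mathrm{Bl}_Z X\to X$ of $X$ along $Z$. Here a section of a locally free sheaf is regular if at each point where it vanishes its coordinates in a local frame form a regular sequence in the local ring. -/

import Mathlib

open CategoryTheory Limits AlgebraicGeometry TopologicalSpace Opposite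
universe u
noncomputable section
namespace GrassmannBlowup

variable {X : Scheme.{u}}

/-- Restriction of sections of an `𝒪_X`-module. -/
def res (M : X.Modules) {U V : X.Opens} (h : V ≤ U) : Γ(M, U) →+ Γ(M, V) :=
  (M.presheaf.map (homOfLE h).op).hom

/-- Restriction of functions. -/
def resFun (X : Scheme.{u}) {U V : X.Opens} (h : V ≤ U) : Γ(X, U) →+* Γ(X, V) :=
  (X.presheaf.map (homOfLE h).op).hom

lemma res_smul (M : X.Modules) {U V : X.Opens} (h : V ≤ U) (r : Γ(X, U)) (m : Γ(M, U)) :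
    res M h (r • m) = resFun X h r • res M h m :=
  Scheme.Modules.map_smul M (homOfLE h) r m

lemma res_res (M : X.Modules) {U V W : X.Opens} (h : V ≤ U) (h' : W ≤ V) (m : Γ(M, U)) :
    res M h' (res M h m) = res M (h'.trans h) m := by
  simp only [res]
  rw [← AddMonoidHom.comp_apply, ← AddCommGrpCat.hom_comp, ← Functor.map_comp]
  rfl

lemma res_self (M : X.Modules) {U : X.Opens} (m : Γ(M, U)) :
    res M le_rfl m = m := by
  have : (homOfLE (le_refl U)).op = 𝟙 (op U) := rfl
  simp only [res, this, CategoryTheory.Functor.map_id]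
  rfl

lemma resFun_resFun {U V W : X.Opens} (h : V ≤ U) (h' : W ≤ V) (m : Γ(X, U)) :
    resFun X h' (resFun X h m) = resFun X (h'.trans h) m := by
  simp only [resFun]
  rw [← RingHom.comp_apply, ← CommRingCat.hom_comp, ← Functor.map_comp]
  rfl

/-- The sections over `U` of the sheaf `Hom(M, N)`: the morphisms `M|_U ⟶ N|_U`. -/
@[ext]
structure LocalHom (M N : X.Modules) (U : X.Opens) : Type u where
  app : ∀ V : X.Opens, V ≤ U → (Γ(M, V) →ₗ[Γ(X, V)] Γ(N, V))
  res_app : ∀ (V W : X.Opens) (hV : V ≤ U) (hW : W ≤ V) (m : Γ(M, V)),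
    res N hW (app V hV m) = app W (hW.trans hV) (res M hW m)

namespace LocalHom

variable {M N : X.Modules} {U : X.Opens}

instance : Zero (LocalHom M N U) := ⟨⟨fun _ _ => 0, by simp⟩⟩
instance : Add (LocalHom M N U) :=
  ⟨fun f g => ⟨fun V h => f.app V h + g.app V h, by simp [f.res_app, g.res_app]⟩⟩
instance : Neg (LocalHom M N U) :=
  ⟨fun f => ⟨fun V h => -f.app V h, by simp [f.res_app]⟩⟩
instance : SMul Γ(X, U) (LocalHom M N U) :=
  ⟨fun r f => ⟨fun V h => resFun X h r • f.app V h,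
    by intros; simp [f.res_app, res_smul, resFun_resFun]⟩⟩

@[simp] lemma zero_app (V : X.Opens) (h : V ≤ U) : (0 : LocalHom M N U).app V h = 0 := rfl
@[simp] lemma add_app (f g : LocalHom M N U) (V : X.Opens) (h : V ≤ U) :
    (f + g).app V h = f.app V h + g.app V h := rfl
@[simp] lemma neg_app (f : LocalHom M N U) (V : X.Opens) (h : V ≤ U) :
    (-f).app V h = -f.app V h := rfl
@[simp] lemma smul_app (r : Γ(X, U)) (f : LocalHom M N U) (V : X.Opens) (h : V ≤ U) :
    (r • f).app V h = resFun X h r • f.app V h := rfl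

instance : AddCommGroup (LocalHom M N U) where
  add_assoc f g k := by ext; simp [add_assoc]
  zero_add f := by ext; simp
  add_zero f := by ext; simp
  add_comm f g := by ext; simp [add_comm]
  neg_add_cancel f := by ext; simp
  nsmul := nsmulRec
  zsmul := zsmulRec

instance : Module Γ(X, U) (LocalHom M N U) where
  one_smul f := by ext; simp
  mul_smul r s f := by ext; simp [mul_smul]
  smul_zero r := by ext; simp
  smul_add r f g := by ext; simp
  add_smul r s f := by ext; simp [add_smul]
  zero_smul f := by ext; simp

/-- Restriction of local homomorphisms. -/
def restr {V : X.Opens} (h : V ≤ U) : LocalHom M N U →+ LocalHom M N V where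
  toFun f := ⟨fun W hW => f.app W (hW.trans h), fun V' W _ hW m => f.res_app V' W _ hW m⟩
  map_zero' := rfl
  map_add' _ _ := rfl

lemma restr_smul {V : X.Opens} (h : V ≤ U) (r : Γ(X, U)) (f : LocalHom M N U) :
    restr h (r • f) = resFun X h r • restr h f := by
  refine LocalHom.ext ?_
  funext W hW
  change resFun X _ r • _ = resFun X _ (resFun X h r) • _
  rw [resFun_resFun]
  rfl

end LocalHom

/-- The presheaf `U ↦ Hom(M|_U, N|_U)`. -/
def homPresheaf (M N : X.Modules) : TopCat.Presheaf Ab X where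
  obj U := AddCommGrpCat.of (LocalHom M N U.unop)
  map i := AddCommGrpCat.ofHom (LocalHom.restr (leOfHom i.unop))

instance (M N : X.Modules) (U : (TopologicalSpace.Opens X)ᵒᵖ) :
    Module (X.ringCatSheaf.obj.obj U) ((homPresheaf M N).obj U) :=
  inferInstanceAs (Module Γ(X, U.unop) (LocalHom M N U.unop))

lemma exists_glue (N : X.Modules) {ι : Type u} (U : ι → X.Opens) (V : X.Opens) (h : ∀ i, U i ≤ V)
    (hV : V ≤ ⨆ i, U i) (s : ∀ i, Γ(N, U i))
    (hs : ∀ i j, res N (inf_le_left : U i ⊓ U j ≤ U i) (s i) = res N inf_le_right (s j)) :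
    ∃! t : Γ(N, V), ∀ i, res N (h i) t = s i :=
  TopCat.Sheaf.existsUnique_gluing' (⟨N.presheaf, N.isSheaf⟩ : TopCat.Sheaf Ab X) U V
    (fun i => homOfLE (h i)) hV s hs

lemma eq_of_res_eq (N : X.Modules) {ι : Type u} (U : ι → X.Opens) (V : X.Opens)
    (h : ∀ i, U i ≤ V) (hV : V ≤ ⨆ i, U i) (s t : Γ(N, V))
    (hs : ∀ i, res N (h i) s = res N (h i) t) : s = t :=
  TopCat.Sheaf.eq_of_locally_eq' (⟨N.presheaf, N.isSheaf⟩ : TopCat.Sheaf Ab X) U V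
    (fun i => homOfLE (h i)) hV s t hs

lemma LocalHom.app_congr {M N : X.Modules} {U U' : X.Opens} {f : LocalHom M N U}
    {g : LocalHom M N U'} (h : LocalHom.restr inf_le_left f =
      (LocalHom.restr inf_le_right g : LocalHom M N (U ⊓ U'))) (V : X.Opens) (hV : V ≤ U)
    (hV' : V ≤ U') : f.app V hV = g.app V hV' :=
  congr_fun (congr_fun (congr_arg LocalHom.app h) V) (le_inf hV hV')

lemma homPresheaf_isSheaf (M N : X.Modules) : (homPresheaf M N).IsSheaf := by
  rw [TopCat.Presheaf.isSheaf_iff_isSheafUniqueGluing]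
  intro ι U f hf
  change ∀ i, LocalHom M N (U i) at f
  have hf' : ∀ i j (V : X.Opens) (hi : V ≤ U i) (hj : V ≤ U j),
      (f i).app V hi = (f j).app V hj := fun i j V hi hj =>
    LocalHom.app_congr (hf i j) V hi hj
  have cover : ∀ V : X.Opens, V ≤ iSup U → V ≤ ⨆ i, V ⊓ U i := fun V hV => by
    rw [← inf_iSup_eq]; exact le_inf le_rfl hV
  have key : ∀ (V : X.Opens) (hV : V ≤ iSup U) (m : Γ(M, V)), ∃! t : Γ(N, V),
      ∀ i, res N (inf_le_left : V ⊓ U i ≤ V) t =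
        (f i).app (V ⊓ U i) inf_le_right (res M inf_le_left m) := by
    intro V hV m
    refine exists_glue N (fun i => V ⊓ U i) V (fun i => inf_le_left) (cover V hV) _ ?_
    intro i j
    rw [LocalHom.res_app, LocalHom.res_app, res_res, res_res]
    rw [hf' i j _ _ (inf_le_right.trans inf_le_right)]
  choose t ht htu using key
  simp only at ht htu
  refine ⟨(⟨fun V hV => ⟨⟨t V hV, ?_⟩, ?_⟩, ?_⟩ : LocalHom M N (iSup U)), ?_, ?_⟩
  · intro m m'
    refine (htu V hV _ _ fun i => ?_).symm
    simp [ht]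
  · intro r m
    refine (htu V hV _ _ fun i => ?_).symm
    simp [ht, res_smul]
  · intro V W hV hW m
    refine htu W _ _ _ fun i => ?_
    change res N _ (res N _ (t V hV m)) = _
    rw [res_res, res_res, ← res_res N inf_le_left (inf_le_inf_right _ hW : W ⊓ U i ≤ V ⊓ U i), ht,
      LocalHom.res_app, res_res]
  · intro i
    refine LocalHom.ext ?_
    funext V hV
    ext m
    refine (htu V _ _ _ fun j => ?_).symm
    rw [LocalHom.res_app, hf' i j]
  · intro g hg
    change LocalHom M N (iSup U) at g
    refine LocalHom.ext ?_
    funext V hV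
    ext m
    refine htu V _ _ _ fun i => ?_
    rw [LocalHom.res_app, ← hg i]
    rfl

/-- The sheaf `Hom(M, N)` of homomorphisms of `𝒪_X`-modules. -/
def sheafHom (M N : X.Modules) : X.Modules where
  val := PresheafOfModules.ofPresheaf (homPresheaf M N) fun _ _ i r f =>
    LocalHom.restr_smul (leOfHom i.unop) r f
  isSheaf := homPresheaf_isSheaf M N

/-- The structure sheaf as a module over itself. -/
abbrev structureModule (X : Scheme.{u}) : X.Modules := SheafOfModules.unit X.ringCatSheaf

/-- The dual `M^∨ = Hom(M, 𝒪_X)`. -/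
abbrev dual (M : X.Modules) : X.Modules := sheafHom M (structureModule X)

/-- A morphism of `𝒪_X`-modules as a global section of the sheaf of homomorphisms. -/
def homSection {M N : X.Modules} (φ : M ⟶ N) : Γ(sheafHom M N, ⊤) :=
  (⟨fun V _ => ⟨⟨φ.app V, (φ.app V).hom.map_add⟩, φ.app_smul⟩, fun _ _ _ hW m =>
    (ConcreteCategory.congr_hom (φ.mapPresheaf.naturality (homOfLE hW).op) m).symm⟩ :
    LocalHom M N ⊤)

/-- The morphism `s^∨ : E^∨ ⟶ 𝒪_X`, `α ↦ α(s)`, given by a global section `s` of `E`. -/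
def evalAt {E : X.Modules} (s : Γ(E, ⊤)) : dual E ⟶ structureModule X where
  val := PresheafOfModules.homMk
    { app U := AddCommGrpCat.ofHom
        { toFun (α : LocalHom E (structureModule X) U.unop) := α.app U.unop le_rfl (res E le_top s)
          map_zero' := rfl
          map_add' _ _ := rfl }
      naturality U V i := by
        ext (α : LocalHom E (structureModule X) U.unop)
        have := α.res_app U.unop V.unop le_rfl (leOfHom i.unop) (res E le_top s)
        rw [res_res] at this
        exact this.symm }
    (by
      intro U r (α : LocalHom E (structureModule X) U.unop)
      change (resFun X le_rfl r • α.app U.unop le_rfl) _ = _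
      have : resFun X (le_refl U.unop) r = r := by
        have h : (homOfLE (le_refl U.unop)).op = 𝟙 (op U.unop) := rfl
        simp only [resFun, h, CategoryTheory.Functor.map_id]
        rfl
      rw [this]
      rfl)

/-! ### Locally free sheaves -/

/-- A frame of `M` over `U`, i.e. an isomorphism `M|_U ≅ 𝒪_U^ι`: a family of sections of `M`
over `U` whose restriction to every open `V ≤ U` is a basis of `Γ(M, V)` over `Γ(X, V)`. -/
structure Frame (M : X.Modules) (U : X.Opens) (ι : Type) where
  basis : Module.Basis ι Γ(X, U) Γ(M, U)
  linearIndependent_res (V : X.Opens) (h : V ≤ U) :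
    LinearIndependent Γ(X, V) fun i => res M h (basis i)
  span_res (V : X.Opens) (h : V ≤ U) :
    Submodule.span Γ(X, V) (Set.range fun i => res M h (basis i)) = ⊤

/-- `M` is locally free of finite rank (the rank may vary). -/
def IsLocallyFree (M : X.Modules) : Prop :=
  ∀ x : X, ∃ U : X.Opens, x ∈ U ∧ ∃ n : ℕ, Nonempty (Frame M U (Fin n))

/-- `M` is locally free of rank `n`. -/
def IsLocallyFreeOfRank (M : X.Modules) (n : ℕ) : Prop :=
  ∀ x : X, ∃ U : X.Opens, x ∈ U ∧ Nonempty (Frame M U (Fin n))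

/-! ### Zero loci, regular sections, degeneracy loci -/

/-- The ideal sheaf of the zero locus of a global section `s` of a locally free sheaf `M`:
it is generated by the coordinates of `s` in the local frames of `M`. -/
def zeroIdeal {M : X.Modules} (s : Γ(M, ⊤)) : X.IdealSheafData :=
  sInf {I | ∀ (U : X.affineOpens) (n : ℕ) (b : Frame M U (Fin n)) (i : Fin n),
    b.basis.repr (res M le_top s) i ∈ I.ideal U}

/-- A global section `s` of a locally free sheaf is regular if, at every point where it vanishes,
the germs of its coordinates in a local frame form a regular sequence in the local ring. -/
def IsRegularSection {M : X.Modules} (s : Γ(M, ⊤)) : Prop :=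
  ∀ x : X, ∃ (U : X.Opens) (hx : x ∈ U) (n : ℕ) (b : Frame M U (Fin n)),
    (∀ i, X.presheaf.germ U x hx (b.basis.repr (res M le_top s) i) ∈
      IsLocalRing.maximalIdeal (X.presheaf.stalk x)) →
    RingTheory.Sequence.IsRegular (X.presheaf.stalk x)
      (List.ofFn fun i => X.presheaf.germ U x hx (b.basis.repr (res M le_top s) i))

/-- The matrix of `φ : E ⟶ F` over `U` in frames of `E` and `F`. -/
def matrixOf {E F : X.Modules} (φ : E ⟶ F) {U : X.Opens} {ι κ : Type} (e : Frame E U ι)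
    (f : Frame F U κ) : Matrix κ ι Γ(X, U) :=
  Matrix.of fun i j => f.basis.repr (φ.app U (e.basis j)) i

/-- The ideal sheaf generated by the `p × p` minors of the matrices of a morphism `φ : E ⟶ F` of
locally free sheaves in local frames. The closed subscheme which it defines is the degeneracy locus
`D_{p-1}(φ)`, whose points are the `x` with `rk φ(x) < p`. -/
def minorIdeal {E F : X.Modules} (φ : E ⟶ F) (p : ℕ) : X.IdealSheafData :=
  sInf {I | ∀ (U : X.affineOpens) (m n : ℕ) (e : Frame E U (Fin m)) (f : Frame F U (Fin n))
    (row : Fin p → Fin n) (col : Fin p → Fin m),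
    ((matrixOf φ e f).submatrix row col).det ∈ I.ideal U}

/-- The codimension of a subset of a scheme (used for closed subsets), with value `⊤` for the
empty subset. -/
def codim (Z : Set X) : WithBot ℕ∞ := ⨅ z ∈ Z, ringKrullDim (X.presheaf.stalk z)

/-! ### Blow-ups -/

/-- The closed subscheme defined by the ideal sheaf `I` is an effective Cartier divisor:
`I` is locally generated by a nonzerodivisor. -/
def IsEffectiveCartier (I : X.IdealSheafData) : Prop :=
  ∀ x : X, ∃ U : X.affineOpens, x ∈ U.1 ∧ ∃ a ∈ nonZeroDivisors Γ(X, U),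
    I.ideal U = Ideal.span {a}

/-- `p : B ⟶ X` is the blow-up of `X` along the closed subscheme defined by `I`: the inverse image
of this subscheme in `B` is an effective Cartier divisor, and `p` is universal among the morphisms
to `X` with this property. -/
structure IsBlowup {B : Scheme.{u}} (p : B ⟶ X) (I : X.IdealSheafData) : Prop where
  isEffectiveCartier : IsEffectiveCartier (I.comap p)
  universal (T : Scheme.{u}) (g : T ⟶ X) (hg : IsEffectiveCartier (I.comap g)) :
    ∃! h : T ⟶ B, h ≫ p = g

/-! ### Grassmann bundles -/

/-- `κ : K ⟶ E` is (the inclusion of) a subbundle of rank `r` of the locally free sheaf `E`. -/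
structure IsSubbundle {E K : X.Modules} (r : ℕ) (κ : K ⟶ E) : Prop where
  mono : Mono κ
  isLocallyFreeOfRank : IsLocallyFreeOfRank K r
  isLocallyFree_cokernel : IsLocallyFree (cokernel κ)

/-- The pullback of `κ : K ⟶ π^*E` along `g : T ⟶ G`, viewed as a morphism to `f^*E` where
`f = g ≫ π`. -/
def pullbackSub {E : X.Modules} {G T : Scheme.{u}} {π : G ⟶ X} {K : G.Modules}
    (κ : K ⟶ (Scheme.Modules.pullback π).obj E) (g : T ⟶ G) {f : T ⟶ X} (h : g ≫ π = f) :
    (Scheme.Modules.pullback g).obj K ⟶ (Scheme.Modules.pullback f).obj E :=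
  (Scheme.Modules.pullback g).map κ ≫ (Scheme.Modules.pullbackComp g π).hom.app E ≫
    (Scheme.Modules.pullbackCongr h).hom.app E

/-- The Grassmann bundle `π : Gr(r, E) ⟶ X` of rank `r` subbundles of `E`, with its tautological
subbundle `S ↪ π^*E`: for every `f : T ⟶ X`, each subbundle of rank `r` of `f^*E` is the pullback of
`S` along a unique `X`-morphism `T ⟶ Gr(r, E)`. -/
structure GrassmannBundle (E : X.Modules) (r : ℕ) where
  scheme : Scheme.{u}
  π : scheme ⟶ X
  S : scheme.Modules
  incl : S ⟶ (Scheme.Modules.pullback π).obj E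
  isSubbundle : IsSubbundle r incl
  universal (T : Scheme.{u}) (f : T ⟶ X) (K : T.Modules)
    (κ : K ⟶ (Scheme.Modules.pullback f).obj E) (hκ : IsSubbundle r κ) :
    ∃! g : T ⟶ scheme, ∃ (h : g ≫ π = f) (e : (Scheme.Modules.pullback g).obj S ≅ K),
      e.hom ≫ κ = pullbackSub incl g h

/-- The canonical isomorphism `π^*𝒪_X ⟶ 𝒪_G`, as a morphism: it is adjoint to the morphism
`𝒪_X ⟶ π_*𝒪_G` given by `π`. -/
def pullbackStructure {G : Scheme.{u}} (π : G ⟶ X) :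
    (Scheme.Modules.pullback π).obj (structureModule X) ⟶ structureModule G :=
  ((Scheme.Modules.pullbackPushforwardAdjunction π).homEquiv _ _).symm
    (SheafOfModules.unitToPushforwardObjUnit π.toRingCatSheafHom)

/-- The direct sum of finitely many `𝒪_X`-modules. -/
def directSum {n : ℕ} (L : Fin n → X.Modules) : X.Modules :=
  haveI : HasFiniteBiproducts X.Modules := Abelian.hasFiniteBiproducts
  ⨁ L

namespace GrassmannBundle

variable {E : X.Modules} {r : ℕ}

/-- The section of `Hom(S, π^*F)` on `Gr(r, E)` given by the composite `S ↪ π^*E ⟶ π^*F`, for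
`φ : E ⟶ F`. -/
def tautSection (Gr : GrassmannBundle E r) {F : X.Modules} (φ : E ⟶ F) :
    Γ(sheafHom Gr.S ((Scheme.Modules.pullback Gr.π).obj F), ⊤) :=
  homSection (Gr.incl ≫ (Scheme.Modules.pullback Gr.π).map φ)

/-- The section of `S^∨` on `Gr(r, E^∨)` given by the composite
`S ↪ π^*E^∨ ⟶ π^*𝒪_X = 𝒪`, where the second arrow is `π^*s^∨`, for a global section `s` of `E`. -/
def tautDualSection (Gr : GrassmannBundle (dual E) r) (s : Γ(E, ⊤)) : Γ(dual Gr.S, ⊤) :=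
  homSection
    (Gr.incl ≫ (Scheme.Modules.pullback Gr.π).map (evalAt s) ≫ pullbackStructure Gr.π)

end GrassmannBundle

end GrassmannBlowup

end

/-! Both parts are instances of one statement. Suppose that locally, in suitable frames, `φ : E ⟶ F`
is the block diagonal matrix of an identity of size `p` and a row `g = (g_0, …, g_r)` whose germs
form a regular sequence wherever they all vanish (`HasRegularNormalForm`). The ideal of
`(p+1)`-minors is then generated by `g`. In part (2), `φ` is the evaluation `E^∨ ⟶ 𝒪` at `s`, so `p
= 0` and `g` is the row of coordinates of `s`. An isomorphism `θ` out of `π^*F` accounts for the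
identification `π^*𝒪 ≅ 𝒪` there; in part (1) it is the identity.

Universal property. A morphism from `T` to the zero locus over `f : T ⟶ X` amounts to a rank `r`
subbundle of `f^*E` killed by `f^*φ` (`comap_zeroIdeal_eq_bot_iff`). If the degeneracy ideal becomes
invertible on `T`, then locally some `g_l` is a nonzerodivisor dividing the other entries. The
equation `∑ a_j g_j = 0` can then be solved for `a_l`, so the kernel of `f^*φ` is itself a rank `r`
subbundle (`isRank_ker`). A subbundle contained in another of the same rank equals it
(`Sub.IsRank.eq_of_le`). So the kernel is the only candidate, and the lift of `f` exists and is
unique.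

Regularity and the Cartier property. In a chart of the Grassmann bundle the subbundle is the graph
of a matrix `c`. Near a zero of the section its equations are, after reindexing, some of the entries
of `c` together with the functions `g_j + c_j g_0`. The local ring of the bundle is flat over the
polynomial ring in the entries of `c` over the local ring of `X`. It follows that the equations form
a regular sequence and that `g_0` is a nonzerodivisor modulo them (`isRegular_chart_equations`,
`exists_local_equations`). On the zero locus `g_j = -c_j g_0`, so the degeneracy ideal is generated
by `g_0`.

Normal form from smoothness, with `n = p + 1`. If all `p`-minors vanished at a point, the
differentials of the `n`-minors would lie in `𝔪 Ω`. Since the quotient by the ideal `J` of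
`n`-minors is smooth, this gives `J = 𝔪 J`, hence `J = 0`, against positive codimension. So some
`p`-minor is a unit, and elimination gives the normal form. The `r + 1` entries of `g` generate an
ideal of height at least `r + 1` with smooth quotient. Their differentials are therefore independent
modulo `𝔪`, the map `k[x_0, …, x_r] ⟶ 𝒪_{X,x}` is flat, and `g` is regular
(`hasRegularNormalForm_of_smooth`).

Grassmann bundles exist because locally split subsheaves form a Zariski sheaf covered by open
subfunctors represented by affine spaces. A target `F` of rank zero has no normal form with `n = p +
1` and is treated apart. -/

noncomputable section

namespace GrassmannBlowup

/-! ### Sections of modules and morphisms described by sections -/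

section

variable {X : Scheme.{u}}

lemma resFun_self {U : X.Opens} (m : Γ(X, U)) : resFun X le_rfl m = m := by
  have : (homOfLE (le_refl U)).op = 𝟙 (op U) := rfl
  simp only [resFun, this, CategoryTheory.Functor.map_id]
  rfl

lemma eq_of_locally_eq (M : X.Modules) {U : X.Opens} {s t : Γ(M, U)}
    (h : ∀ x ∈ U, ∃ (W : X.Opens) (hW : W ≤ U), x ∈ W ∧ res M hW s = res M hW t) : s = t := by
  choose W hW hxW hst using h
  refine eq_of_res_eq M (fun x : U => W x.1 x.2) U (fun x => hW _ _) ?_ s t fun x => hst _ _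
  intro x hx
  exact Opens.mem_iSup.mpr ⟨⟨x, hx⟩, hxW x hx⟩

lemma fun_eq_of_locally_eq {U : X.Opens} {s t : Γ(X, U)}
    (h : ∀ x ∈ U, ∃ (W : X.Opens) (hW : W ≤ U), x ∈ W ∧ resFun X hW s = resFun X hW t) :
    s = t :=
  eq_of_locally_eq (structureModule X) h

/-- Sections that are unique for a property which is local on the base glue. -/
lemma exists_of_locally_unique (M : X.Modules) {U : X.Opens} (P : ∀ W : X.Opens, Γ(M, W) → Prop)
    (hres : ∀ (W W' : X.Opens) (h : W' ≤ W) (s : Γ(M, W)), W ≤ U → P W s → P W' (res M h s))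
    (huniq : ∀ (W : X.Opens) (s t : Γ(M, W)), W ≤ U → P W s → P W t → s = t)
    (hloc : ∀ x ∈ U, ∃ W : X.Opens, x ∈ W ∧ W ≤ U ∧ ∃ s, P W s) :
    ∃ s : Γ(M, U), ∀ x ∈ U, ∃ (W : X.Opens) (h : W ≤ U), x ∈ W ∧ P W (res M h s) := by
  choose W hxW hW s hs using hloc
  obtain ⟨t, ht, -⟩ := exists_glue M (fun x : U => W x.1 x.2) U (fun x => hW _ _)
    (fun x hx => Opens.mem_iSup.mpr ⟨⟨x, hx⟩, hxW x hx⟩) (fun x => s x.1 x.2) (by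
      intro i j
      exact huniq _ _ _ (inf_le_left.trans (hW _ _)) (hres _ _ _ _ (hW _ _) (hs _ _))
        (hres _ _ _ _ (hW _ _) (hs _ _)))
  exact ⟨t, fun x hx => ⟨W x hx, hW x hx, hxW x hx, by rw [ht ⟨x, hx⟩]; exact hs x hx⟩⟩

/-- The morphism of `𝒪_X`-modules given by compatible linear maps on sections. -/
def mkHom {M N : X.Modules} (app : ∀ U : X.Opens, Γ(M, U) →ₗ[Γ(X, U)] Γ(N, U))
    (h : ∀ (U V : X.Opens) (hV : V ≤ U) (m : Γ(M, U)),
      res N hV (app U m) = app V (res M hV m)) : M ⟶ N where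
  val := PresheafOfModules.homMk
    { app U := AddCommGrpCat.ofHom (app U.unop).toAddMonoidHom
      naturality U V i := by
        ext m
        exact (h U.unop V.unop (leOfHom i.unop) m).symm }
    (fun U r m => (app U.unop).map_smul r m)

lemma res_app {M N : X.Modules} (φ : M ⟶ N) {U V : X.Opens} (h : V ≤ U) (m : Γ(M, U)) :
    res N h (φ.app U m) = φ.app V (res M h m) :=
  (ConcreteCategory.congr_hom (φ.mapPresheaf.naturality (homOfLE h).op) m).symm

lemma hom_ext_app {M N : X.Modules} {φ ψ : M ⟶ N} (h : ∀ U (m : Γ(M, U)), φ.app U m = ψ.app U m) :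
    φ = ψ := by
  ext U m
  exact h U m

lemma comp_app_apply {M N K : X.Modules} (φ : M ⟶ N) (ψ : N ⟶ K) (U : X.Opens) (m : Γ(M, U)) :
    (φ ≫ ψ).app U m = ψ.app U (φ.app U m) := rfl

lemma app_sum {M N : X.Modules} (φ : M ⟶ N) (U : X.Opens) {ι : Type*} (s : Finset ι)
    (m : ι → Γ(M, U)) : φ.app U (∑ i ∈ s, m i) = ∑ i ∈ s, φ.app U (m i) :=
  map_sum (φ.app U).hom m s

lemma app_sum_smul {M N : X.Modules} (φ : M ⟶ N) (U : X.Opens) {ι : Type*} [Fintype ι]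
    (a : ι → Γ(X, U)) (m : ι → Γ(M, U)) :
    φ.app U (∑ i, a i • m i) = ∑ i, a i • φ.app U (m i) := by
  rw [app_sum]
  simp

lemma res_sum_smul (M : X.Modules) {U V : X.Opens} (h : V ≤ U) {ι : Type*} [Fintype ι]
    (a : ι → Γ(X, U)) (m : ι → Γ(M, U)) :
    res M h (∑ i, a i • m i) = ∑ i, resFun X h (a i) • res M h (m i) := by
  simp [res_smul]

lemma mulVec_bijective {R ι : Type*} [CommRing R] [Fintype ι] [DecidableEq ι] {P : Matrix ι ι R}
    (hP : IsUnit P) : Function.Bijective P.mulVec := by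
  have := hP.invertible
  exact ⟨fun v w h => by
    have h' := congr_arg (⅟P).mulVec h
    simpa using h', Matrix.mulVec_surjective_of_invertible P⟩

/-! ### Frames as families of sections -/

/-- The sections `b i` form an isomorphism `𝒪_U^ι ≅ M|_U`. -/
def IsFrame (M : X.Modules) (U : X.Opens) {ι : Type} [Fintype ι] (b : ι → Γ(M, U)) : Prop :=
  ∀ (V : X.Opens) (h : V ≤ U),
    Function.Bijective fun a : ι → Γ(X, V) => ∑ i, a i • res M h (b i)

namespace IsFrame

variable {M N : X.Modules} {U : X.Opens} {ι κ : Type} [Fintype ι] [Fintype κ] {b : ι → Γ(M, U)}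

/-- The coordinates in a frame. -/
def coord (hb : IsFrame M U b) {V : X.Opens} (h : V ≤ U) : Γ(M, V) →ₗ[Γ(X, V)] (ι → Γ(X, V)) :=
  (LinearEquiv.ofBijective (Fintype.linearCombination Γ(X, V) fun i => res M h (b i))
    (hb V h)).symm.toLinearMap

lemma sum_coord (hb : IsFrame M U b) {V : X.Opens} (h : V ≤ U) (m : Γ(M, V)) :
    ∑ i, hb.coord h m i • res M h (b i) = m :=
  (LinearEquiv.ofBijective (Fintype.linearCombination Γ(X, V) fun i => res M h (b i))
    (hb V h)).apply_symm_apply m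

lemma coord_eq (hb : IsFrame M U b) {V : X.Opens} (h : V ≤ U) {m : Γ(M, V)} {a : ι → Γ(X, V)}
    (ha : ∑ i, a i • res M h (b i) = m) : hb.coord h m = a :=
  (hb V h).1 ((hb.sum_coord h m).trans ha.symm)

lemma coord_sum (hb : IsFrame M U b) {V : X.Opens} (h : V ≤ U) (a : ι → Γ(X, V)) :
    hb.coord h (∑ i, a i • res M h (b i)) = a :=
  hb.coord_eq h rfl

lemma coord_res (hb : IsFrame M U b) {V W : X.Opens} (h : V ≤ U) (h' : W ≤ V) (m : Γ(M, V)) :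
    hb.coord (h'.trans h) (res M h' m) = fun i => resFun X h' (hb.coord h m i) := by
  apply hb.coord_eq
  conv_rhs => rw [← hb.sum_coord h m]
  simp [res_smul, res_res]

lemma res (hb : IsFrame M U b) {V : X.Opens} (h : V ≤ U) :
    IsFrame M V fun i => GrassmannBlowup.res M h (b i) := by
  intro W hW
  simpa only [res_res] using hb W (hW.trans h)

lemma coord_res_res (hb : IsFrame M U b) {V W : X.Opens} (h : V ≤ U) (hW : W ≤ V)
    (m : Γ(M, W)) : (hb.res h).coord hW m = hb.coord (hW.trans h) m := by
  apply coord_eq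
  simp only [res_res]
  exact hb.sum_coord _ m

/-- Coordinates with respect to local frames are unique, so two of them agree if they agree locally,
and local ones glue. -/
lemma of_locally (h : ∀ x ∈ U, ∃ (W : X.Opens) (hW : W ≤ U), x ∈ W ∧
    IsFrame M W fun i => GrassmannBlowup.res M hW (b i)) : IsFrame M U b := by
  intro V hV
  have key : ∀ x ∈ V, ∃ (W : X.Opens) (hW : W ≤ V), x ∈ W ∧
      IsFrame M W fun i => GrassmannBlowup.res M (hW.trans hV) (b i) := by
    intro x hx
    obtain ⟨W, hW, hxW, hb⟩ := h x (hV hx)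
    refine ⟨W ⊓ V, inf_le_right, ⟨hxW, hx⟩, ?_⟩
    have := hb.res (inf_le_left : W ⊓ V ≤ W)
    simpa only [res_res] using this
  constructor
  · intro a a' haa'
    funext i
    apply fun_eq_of_locally_eq
    intro x hx
    obtain ⟨W, hW, hxW, hb⟩ := key x hx
    refine ⟨W, hW, hxW, ?_⟩
    have h1 := congr_arg (GrassmannBlowup.res M hW) haa'
    simp only [res_sum_smul, res_res] at h1
    have h2 := @(hb W le_rfl).1 (fun i => resFun X hW (a i)) (fun i => resFun X hW (a' i))
      (by simpa only [res_self] using h1)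
    exact congr_fun h2 i
  · intro m
    let P : ∀ W : X.Opens, W ≤ V → (ι → Γ(X, W)) → Prop := fun W hW a =>
      ∑ i, a i • GrassmannBlowup.res M (hW.trans hV) (b i) = GrassmannBlowup.res M hW m
    have hPres : ∀ (W W' : X.Opens) (hW : W ≤ V) (h : W' ≤ W) (a : ι → Γ(X, W)), P W hW a →
        P W' (h.trans hW) (fun i => resFun X h (a i)) := by
      intro W W' hW h a ha
      have := congr_arg (GrassmannBlowup.res M h) ha
      simpa only [res_sum_smul, res_res] using this
    choose W hW hxW hb using key
    have hs : ∀ x : V, ∃ a, P (W x.1 x.2) (hW x.1 x.2) a := by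
      intro x
      obtain ⟨a, ha⟩ := (hb x.1 x.2 _ le_rfl).2 (GrassmannBlowup.res M (hW _ _) m)
      exact ⟨a, by simpa only [P, res_self] using ha⟩
    choose a ha using hs
    -- On overlaps both families of coordinates express the same section, so injectivity forces them
    -- to coincide.
    have glue : ∀ i, ∃ t : Γ(X, V), ∀ x : V, resFun X (hW x.1 x.2) t = a x i := by
      intro i
      obtain ⟨t, ht, -⟩ := exists_glue (structureModule X) (fun x : V => W x.1 x.2) V
        (fun x => hW _ _) (fun x hx => Opens.mem_iSup.mpr ⟨⟨x, hx⟩, hxW x hx⟩) (fun x => a x i) (by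
          intro x y
          have h1 := hPres _ _ _ (inf_le_left : W x.1 x.2 ⊓ W y.1 y.2 ≤ _) _ (ha x)
          have h2 := hPres _ _ _ (inf_le_right : W x.1 x.2 ⊓ W y.1 y.2 ≤ _) _ (ha y)
          have h3 := @(hb x.1 x.2 _ inf_le_left).1 _ _
            (by simpa only [P, res_res] using h1.trans h2.symm)
          exact congr_fun h3 i)
      exact ⟨t, ht⟩
    choose t ht using glue
    refine ⟨t, ?_⟩
    apply eq_of_locally_eq
    intro x hx
    refine ⟨W x hx, hW x hx, hxW x hx, ?_⟩
    simp only [res_sum_smul, res_res]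
    have := ha ⟨x, hx⟩
    simp only [P] at this
    rw [← this]
    simp only [ht _ ⟨x, hx⟩]

lemma reindex (hb : IsFrame M U b) (e : κ ≃ ι) : IsFrame M U fun k => b (e k) := by
  intro V h
  have : (fun a : κ → Γ(X, V) => ∑ i, a i • GrassmannBlowup.res M h (b (e i))) =
      (fun a : ι → Γ(X, V) => ∑ i, a i • GrassmannBlowup.res M h (b i)) ∘
        (Equiv.arrowCongr e (Equiv.refl _)) := by
    funext a
    simp only [Function.comp_apply]
    rw [← Equiv.sum_comp e]
    simp
  rw [this]
  exact (hb V h).comp (Equiv.bijective _)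

/-- Change of frame by an invertible matrix. -/
lemma of_matrix [DecidableEq ι] (hb : IsFrame M U b) (P : Matrix ι ι Γ(X, U)) (hP : IsUnit P) :
    IsFrame M U fun j => ∑ i, P i j • b i := by
  intro V h
  have hPV : IsUnit (P.map (resFun X h)) := hP.map (resFun X h).mapMatrix
  have : (fun a : ι → Γ(X, V) => ∑ j, a j • GrassmannBlowup.res M h (∑ i, P i j • b i)) =
      (fun a : ι → Γ(X, V) => ∑ i, a i • GrassmannBlowup.res M h (b i)) ∘
        (P.map (resFun X h)).mulVec := by
    funext a
    simp only [Function.comp_apply, Matrix.mulVec, dotProduct, Matrix.map_apply, Finset.sum_smul]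
    simp_rw [res_sum_smul, Finset.smul_sum, smul_smul]
    rw [Finset.sum_comm]
    exact Finset.sum_congr rfl fun i _ => Finset.sum_congr rfl fun j _ => by rw [mul_comm]
  rw [this]
  exact (hb V h).comp (mulVec_bijective hPV)

/-- Transport of a frame by an isomorphism of sections. -/
lemma map_of_bijective (hb : IsFrame M U b) (φ : M ⟶ N)
    (hφ : ∀ V ≤ U, Function.Bijective (φ.app V)) : IsFrame N U fun i => φ.app U (b i) := by
  intro V h
  have : (fun a : ι → Γ(X, V) => ∑ i, a i • GrassmannBlowup.res N h (φ.app U (b i))) =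
      φ.app V ∘ (fun a : ι → Γ(X, V) => ∑ i, a i • GrassmannBlowup.res M h (b i)) := by
    funext a
    simp only [Function.comp_apply, app_sum_smul, res_app]
  rw [this]
  exact (hφ V h).comp (hb V h)

lemma map_iso (hb : IsFrame M U b) (φ : M ⟶ N) [IsIso φ] : IsFrame N U fun i => φ.app U (b i) :=
  hb.map_of_bijective φ fun V _ =>
    (ConcreteCategory.isIso_iff_bijective (φ.app V)).mp inferInstance

/-- The basis of sections given by a frame. -/
def toBasis (hb : IsFrame M U b) : Module.Basis ι Γ(X, U) Γ(M, U) :=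
  Module.Basis.ofEquivFun (LinearEquiv.ofBijective
    (Fintype.linearCombination Γ(X, U) fun i => GrassmannBlowup.res M le_rfl (b i))
      (hb U le_rfl)).symm

@[simp] lemma toBasis_apply (hb : IsFrame M U b) (i : ι) : hb.toBasis i = b i := by
  classical
  rw [toBasis, Module.Basis.coe_ofEquivFun, LinearEquiv.symm_symm]
  refine (Fintype.linearCombination_apply_single _ _ _ _).trans ?_
  rw [one_smul, res_self]

/-- The frame (with its basis) given by a family of sections. -/
def toFrame (hb : IsFrame M U b) : Frame M U ι where
  basis := hb.toBasis
  linearIndependent_res V h := by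
    simp only [toBasis_apply]
    exact linearIndependent_iff_injective_fintypeLinearCombination.mpr (hb V h).1
  span_res V h := by
    simp only [toBasis_apply]
    refine eq_top_iff.mpr fun m _ => ?_
    exact (Submodule.mem_span_range_iff_exists_fun _).mpr ((hb V h).2 m)

lemma toFrame_repr (hb : IsFrame M U b) (m : Γ(M, U)) (i : ι) :
    hb.toFrame.basis.repr m i = hb.coord le_rfl m i := by
  rfl

end IsFrame

lemma Frame.isFrame {M : X.Modules} {U : X.Opens} {ι : Type} [Fintype ι] (b : Frame M U ι) :
    IsFrame M U b.basis := by
  intro V h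
  constructor
  · exact (linearIndependent_iff_injective_fintypeLinearCombination.mp
      (b.linearIndependent_res V h))
  · intro m
    have : m ∈ Submodule.span Γ(X, V) (Set.range fun i => res M h (b.basis i)) := by
      rw [b.span_res]; trivial
    exact (Submodule.mem_span_range_iff_exists_fun _).mp this

end

section

variable {X : Scheme.{u}}

variable {T T' : Scheme.{u}}

/-! ### Pullback of sections -/

/-- Pullback of functions. -/
def funPull (f : T ⟶ X) (U : X.Opens) : Γ(X, U) →+* Γ(T, f ⁻¹ᵁ U) := (f.app U).hom

lemma resFun_funPull (f : T ⟶ X) {U V : X.Opens} (h : V ≤ U) (r : Γ(X, U)) :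
    resFun T (f.preimage_mono h) (funPull f U r) = funPull f V (resFun X h r) :=
  (ConcreteCategory.congr_hom (f.naturality (homOfLE h).op) r).symm

/-- Pullback of sections of modules, as the unit of the adjunction. -/
def pull (f : T ⟶ X) (M : X.Modules) (U : X.Opens) :
    Γ(M, U) →+ Γ((Scheme.Modules.pullback f).obj M, f ⁻¹ᵁ U) :=
  (((Scheme.Modules.pullbackPushforwardAdjunction f).unit.app M).app U).hom

lemma pull_smul (f : T ⟶ X) (M : X.Modules) (U : X.Opens) (r : Γ(X, U)) (m : Γ(M, U)) :
    pull f M U (r • m) = funPull f U r • pull f M U m :=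
  Scheme.Modules.Hom.app_smul ((Scheme.Modules.pullbackPushforwardAdjunction f).unit.app M) r m

lemma res_pull (f : T ⟶ X) (M : X.Modules) {U V : X.Opens} (h : V ≤ U) (m : Γ(M, U)) :
    res _ (f.preimage_mono h) (pull f M U m) = pull f M V (res M h m) :=
  res_app ((Scheme.Modules.pullbackPushforwardAdjunction f).unit.app M) h m

lemma pull_sum_smul (f : T ⟶ X) (M : X.Modules) (U : X.Opens) {ι : Type*} [Fintype ι]
    (a : ι → Γ(X, U)) (m : ι → Γ(M, U)) :
    pull f M U (∑ i, a i • m i) = ∑ i, funPull f U (a i) • pull f M U (m i) := by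
  simp [pull_smul]

lemma pull_naturality (f : T ⟶ X) {M N : X.Modules} (φ : M ⟶ N) (U : X.Opens) (m : Γ(M, U)) :
    ((Scheme.Modules.pullback f).map φ).app (f ⁻¹ᵁ U) (pull f M U m) = pull f N U (φ.app U m) := by
  have := (Scheme.Modules.pullbackPushforwardAdjunction f).unit.naturality φ
  exact (congr($(this).app U m)).symm

/-- The morphism out of a pullback adjoint to `ψ`. -/
def pullDesc (f : T ⟶ X) {M : X.Modules} {G : T.Modules}
    (ψ : M ⟶ (Scheme.Modules.pushforward f).obj G) : (Scheme.Modules.pullback f).obj M ⟶ G :=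
  ((Scheme.Modules.pullbackPushforwardAdjunction f).homEquiv _ _).symm ψ

lemma pullDesc_pull (f : T ⟶ X) {M : X.Modules} {G : T.Modules}
    (ψ : M ⟶ (Scheme.Modules.pushforward f).obj G) (U : X.Opens) (m : Γ(M, U)) :
    (pullDesc f ψ).app (f ⁻¹ᵁ U) (pull f M U m) = ψ.app U m := by
  have h := ((Scheme.Modules.pullbackPushforwardAdjunction f).homEquiv _ _).apply_symm_apply ψ
  rw [Adjunction.homEquiv_unit] at h
  exact congr($(h).app U m)

lemma pullback_hom_ext (f : T ⟶ X) {M : X.Modules} {G : T.Modules}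
    {α β : (Scheme.Modules.pullback f).obj M ⟶ G}
    (h : ∀ U (m : Γ(M, U)), α.app (f ⁻¹ᵁ U) (pull f M U m) = β.app (f ⁻¹ᵁ U) (pull f M U m)) :
    α = β := by
  apply ((Scheme.Modules.pullbackPushforwardAdjunction f).homEquiv _ _).injective
  rw [Adjunction.homEquiv_unit, Adjunction.homEquiv_unit]
  exact hom_ext_app h

/-- The comparison of pullbacks is conjugate to the comparison of pushforwards, which does nothing
on sections. Hence it carries the unit of the composite adjunction to the unit for `g ≫ f`. -/
lemma pullbackComp_pull (g : T' ⟶ T) (f : T ⟶ X) (M : X.Modules) (U : X.Opens) (m : Γ(M, U)) :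
    ((Scheme.Modules.pullbackComp g f).hom.app M).app (g ⁻¹ᵁ f ⁻¹ᵁ U)
      (pull g _ (f ⁻¹ᵁ U) (pull f M U m)) = pull (g ≫ f) M U m := by
  have h := unit_conjugateEquiv ((Scheme.Modules.pullbackPushforwardAdjunction f).comp
    (Scheme.Modules.pullbackPushforwardAdjunction g))
    (Scheme.Modules.pullbackPushforwardAdjunction (g ≫ f)) (Scheme.Modules.pullbackComp g f).inv M
  rw [Scheme.Modules.conjugateEquiv_pullbackComp_inv] at h
  have h2 := congr($(h).app U m)
  have h3 : pull g _ (f ⁻¹ᵁ U) (pull f M U m) =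
    ((Scheme.Modules.pullbackComp g f).inv.app M).app ((g ≫ f) ⁻¹ᵁ U) (pull (g ≫ f) M U m) := h2
  rw [h3]
  have h4 := congr($((Scheme.Modules.pullbackComp g f).inv_hom_id_app M).app ((g ≫ f) ⁻¹ᵁ U)
    (pull (g ≫ f) M U m))
  exact h4

lemma pullbackCongr_pull {f f' : T ⟶ X} (h : f = f') (M : X.Modules) (U : X.Opens) (m : Γ(M, U)) :
    ((Scheme.Modules.pullbackCongr h).hom.app M).app (f ⁻¹ᵁ U) (pull f M U m) =
      res _ (by rw [h]) (pull f' M U m) := by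
  subst h
  rw [res_self]
  rfl

/-- On opens inside the range of an open immersion, pulling back sections is bijective. -/
lemma pull_bijective (f : T ⟶ X) [IsOpenImmersion f] (M : X.Modules) (U : X.Opens)
    (hU : U ≤ f.opensRange) : Function.Bijective (pull f M U) := by
  -- Restriction along `f` is another left adjoint of the pushforward. Up to an isomorphism the unit
  -- is therefore the restriction map of `M` from `U` to `f(f⁻¹U)`, and these opens are equal.
  have h := Adjunction.unit_leftAdjointUniq_hom_app (Scheme.Modules.restrictAdjunction f)
    (Scheme.Modules.pullbackPushforwardAdjunction f) M
  have h2 : ⇑(pull f M U) = ((Scheme.Modules.restrictFunctorIsoPullback f).hom.app M).app (f ⁻¹ᵁ U) ∘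
      M.presheaf.map (homOfLE (f.image_preimage_le U)).op := by
    funext m
    exact (congr($(h).app U m)).symm
  rw [h2]
  have : f ''ᵁ f ⁻¹ᵁ U = U := by
    rw [Scheme.Hom.image_preimage_eq_opensRange_inf]; exact inf_eq_right.mpr hU
  have : IsIso (homOfLE (f.image_preimage_le U)) := by
    rw [show homOfLE (f.image_preimage_le U) = eqToHom this from rfl]; infer_instance
  exact ((ConcreteCategory.isIso_iff_bijective _).mp inferInstance).comp
    ((ConcreteCategory.isIso_iff_bijective _).mp inferInstance)

/-! ### Modules supported on an open -/

/-- The module `j_* j^* N`, for `j` the inclusion of the open `V`. -/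
def localize (V : T.Opens) (N : T.Modules) : T.Modules :=
  (Scheme.Modules.pushforward V.ι).obj (N.restrict V.ι)

/-- `V ⊓ W` in the form in which it appears in the sections of `localize`. -/
abbrev locOpen (V W : T.Opens) : T.Opens := V.ι ''ᵁ V.ι ⁻¹ᵁ W

lemma locOpen_eq (V W : T.Opens) : locOpen V W = V ⊓ W := by
  rw [locOpen, Scheme.Hom.image_preimage_eq_opensRange_inf, Scheme.Opens.opensRange_ι]

lemma locOpen_le_left (V W : T.Opens) : locOpen V W ≤ V := by rw [locOpen_eq]; exact inf_le_left

lemma locOpen_le_right (V W : T.Opens) : locOpen V W ≤ W := by rw [locOpen_eq]; exact inf_le_right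

lemma le_locOpen {V W : T.Opens} (h : W ≤ V) : W ≤ locOpen V W := by
  rw [locOpen_eq]; exact le_inf h le_rfl

/-- A section of `N` over `V ⊓ W` as a section of `localize V N` over `W`. -/
def toLoc (V W : T.Opens) (N : T.Modules) : Γ(N, locOpen V W) ≃+ Γ(localize V N, W) :=
  AddEquiv.refl _

lemma smul_toLoc (V W : T.Opens) (N : T.Modules) (r : Γ(T, W)) (n : Γ(N, locOpen V W)) :
    r • toLoc V W N n = toLoc V W N (resFun T (locOpen_le_right V W) r • n) := by
  have : (V.ι.appIso (V.ι ⁻¹ᵁ W)).inv.hom ((V.ι.app W).hom r) =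
      resFun T (locOpen_le_right V W) r := by
    simp
    rfl
  rw [← this]
  rfl

lemma res_toLoc (V : T.Opens) (N : T.Modules) {W W' : T.Opens} (h : W' ≤ W)
    (n : Γ(N, locOpen V W)) : res (localize V N) h (toLoc V W N n) =
      toLoc V W' N (res N (V.ι.image_mono (V.ι.preimage_mono h)) n) := rfl

/-- Sections of the structure sheaf as sections of the structure module. -/
def unitSec (W : T.Opens) : Γ(T, W) ≃ₗ[Γ(T, W)] Γ(structureModule T, W) :=
  LinearEquiv.refl _ Γ(T, W)

lemma res_unitSec {W W' : T.Opens} (h : W' ≤ W) (r : Γ(T, W)) :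
    res (structureModule T) h (unitSec W r) = unitSec W' (resFun T h r) := rfl

/-- A morphism `P ⟶ localize V N` in terms of sections of `N`. -/
structure LocHom (P N : T.Modules) (V : T.Opens) where
  app (W : T.Opens) : Γ(P, W) →+ Γ(N, locOpen V W)
  app_smul (W : T.Opens) (r : Γ(T, W)) (m : Γ(P, W)) :
    app W (r • m) = resFun T (locOpen_le_right V W) r • app W m
  res_app (W W' : T.Opens) (h : W' ≤ W) (m : Γ(P, W)) :
    res N (V.ι.image_mono (V.ι.preimage_mono h)) (app W m) = app W' (res P h m)

namespace LocHom

variable {P N : T.Modules} {V : T.Opens}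

/-- The morphism of modules of a `LocHom`. -/
def toHom (c : LocHom P N V) : P ⟶ localize V N :=
  mkHom (fun W =>
    { toFun := fun m => toLoc V W N (c.app W m)
      map_add' := fun m m' => by rw [map_add, map_add]
      map_smul' := fun r m => by rw [c.app_smul, RingHom.id_apply, smul_toLoc] })
    (fun W W' h m => by
      refine (res_toLoc V N h _).trans ?_
      rw [c.res_app]
      rfl)

lemma toHom_app (c : LocHom P N V) (W : T.Opens) (m : Γ(P, W)) :
    c.toHom.app W m = toLoc V W N (c.app W m) := rfl

/-- The `LocHom` of a morphism of modules. -/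
def ofHom (φ : P ⟶ localize V N) : LocHom P N V where
  app W := (toLoc V W N).symm.toAddMonoidHom.comp (φ.app W).hom
  app_smul W r m := by
    refine (toLoc V W N).injective ?_
    rw [← smul_toLoc]
    exact φ.app_smul r m
  res_app W W' h m := congr_arg (toLoc V W' N).symm (GrassmannBlowup.res_app φ h m)

/-- Sections of a pullback are accessible only through the adjunction. Using `localize` as target
turns a map defined over `V` into a morphism on all of `T`, to which the adjunction applies. -/
lemma ext_pull (f : T ⟶ X) {M : X.Modules}
    {c c' : LocHom ((Scheme.Modules.pullback f).obj M) N V}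
    (h : ∀ (W : X.Opens) (m : Γ(M, W)), c.app (f ⁻¹ᵁ W) (pull f M W m) =
      c'.app (f ⁻¹ᵁ W) (pull f M W m)) (W : T.Opens)
    (m : Γ((Scheme.Modules.pullback f).obj M, W)) : c.app W m = c'.app W m := by
  have : c.toHom = c'.toHom := pullback_hom_ext f fun U m => by
    rw [toHom_app, toHom_app, h]
  have h2 := congr($(this).app W m)
  exact (toLoc V W N).injective h2

end LocHom

namespace IsFrame

variable {ι : Type} [Fintype ι] {M : X.Modules} {U : X.Opens} {b : ι → Γ(M, U)}

lemma locOpen_preimage_le (f : T ⟶ X) (U W : X.Opens) :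
    locOpen (f ⁻¹ᵁ U) (f ⁻¹ᵁ W) ≤ f ⁻¹ᵁ (W ⊓ U) := by
  rw [locOpen_eq]
  exact fun x hx => ⟨hx.2, hx.1⟩

/-- The combination of the sections `n i` with the coordinates of `m` in a frame. -/
def locSum (hb : IsFrame M U b) (f : T ⟶ X) (N : T.Modules) (n : ι → Γ(N, f ⁻¹ᵁ U)) (W : X.Opens)
    (m : Γ(M, W)) : Γ(N, locOpen (f ⁻¹ᵁ U) (f ⁻¹ᵁ W)) :=
  ∑ i, resFun T (locOpen_preimage_le f U W) (funPull f (W ⊓ U)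
    (hb.coord inf_le_right (GrassmannBlowup.res M inf_le_left m) i)) •
      GrassmannBlowup.res N (locOpen_le_left _ _) (n i)

lemma locSum_add (hb : IsFrame M U b) (f : T ⟶ X) (N : T.Modules) (n : ι → Γ(N, f ⁻¹ᵁ U))
    (W : X.Opens) (m m' : Γ(M, W)) :
    hb.locSum f N n W (m + m') = hb.locSum f N n W m + hb.locSum f N n W m' := by
  simp [locSum, add_smul, Finset.sum_add_distrib]

lemma locSum_smul (hb : IsFrame M U b) (f : T ⟶ X) (N : T.Modules) (n : ι → Γ(N, f ⁻¹ᵁ U))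
    (W : X.Opens) (r : Γ(X, W)) (m : Γ(M, W)) : hb.locSum f N n W (r • m) =
      resFun T (locOpen_le_right (f ⁻¹ᵁ U) (f ⁻¹ᵁ W)) (funPull f W r) • hb.locSum f N n W m := by
  rw [locSum, locSum, Finset.smul_sum]
  refine Finset.sum_congr rfl fun i _ => ?_
  rw [smul_smul, res_smul, map_smul, Pi.smul_apply, smul_eq_mul, map_mul, map_mul,
    ← resFun_funPull, resFun_resFun]

lemma res_locSum (hb : IsFrame M U b) (f : T ⟶ X) (N : T.Modules) (n : ι → Γ(N, f ⁻¹ᵁ U))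
    (W W' : X.Opens) (h : W' ≤ W) (m : Γ(M, W)) :
    GrassmannBlowup.res N ((f ⁻¹ᵁ U).ι.image_mono ((f ⁻¹ᵁ U).ι.preimage_mono (f.preimage_mono h)))
      (hb.locSum f N n W m) = hb.locSum f N n W' (GrassmannBlowup.res M h m) := by
  rw [locSum, locSum, res_sum_smul]
  refine Finset.sum_congr rfl fun i _ => ?_
  rw [res_res, resFun_resFun]
  have := congr_fun (hb.coord_res inf_le_right (inf_le_inf_right U h)
    (GrassmannBlowup.res M inf_le_left m)) i
  rw [res_res] at this
  rw [res_res, this, ← resFun_funPull, resFun_resFun]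

/-- The morphism from the pullback of `M` with prescribed values on a frame. -/
lemma exists_locHom (hb : IsFrame M U b) (f : T ⟶ X) (N : T.Modules) (n : ι → Γ(N, f ⁻¹ᵁ U)) :
    ∃ c : LocHom ((Scheme.Modules.pullback f).obj M) N (f ⁻¹ᵁ U), ∀ (W : X.Opens) (m : Γ(M, W)),
      c.app (f ⁻¹ᵁ W) (GrassmannBlowup.pull f M W m) = hb.locSum f N n W m := by
  let ψ : M ⟶ (Scheme.Modules.pushforward f).obj (localize (f ⁻¹ᵁ U) N) :=
    mkHom (fun W =>
      { toFun := fun m => toLoc (f ⁻¹ᵁ U) (f ⁻¹ᵁ W) N (hb.locSum f N n W m)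
        map_add' := fun m m' => by
          rw [locSum_add]
          rfl
        map_smul' := fun r m => by
          rw [locSum_smul, RingHom.id_apply]
          exact (smul_toLoc (f ⁻¹ᵁ U) (f ⁻¹ᵁ W) N (funPull f W r) _).symm })
      (fun W W' h m => congr_arg (toLoc (f ⁻¹ᵁ U) (f ⁻¹ᵁ W') N) (hb.res_locSum f N n W W' h m))
  refine ⟨LocHom.ofHom (pullDesc f ψ), fun W m => ?_⟩
  exact congr_arg (toLoc (f ⁻¹ᵁ U) (f ⁻¹ᵁ W) N).symm (pullDesc_pull f ψ W m)

lemma coord_frame [DecidableEq ι] (hb : IsFrame M U b) {V : X.Opens} (h : V ≤ U) (j : ι) :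
    hb.coord h (GrassmannBlowup.res M h (b j)) = Pi.single j 1 := by
  apply coord_eq
  simp [Pi.single_apply]

lemma locSum_frame (hb : IsFrame M U b) (f : T ⟶ X) (N : T.Modules) (n : ι → Γ(N, f ⁻¹ᵁ U))
    (j : ι) : hb.locSum f N n U (b j) = GrassmannBlowup.res N (locOpen_le_left _ _) (n j) := by
  classical
  have : hb.coord inf_le_right (GrassmannBlowup.res M (inf_le_left : U ⊓ U ≤ U) (b j)) =
      Pi.single j 1 := hb.coord_frame inf_le_left j
  rw [locSum, this]
  simp [Pi.single_apply, apply_ite, ite_smul]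

/-- The pullback of a frame is a frame. -/
lemma pull (hb : IsFrame M U b) (f : T ⟶ X) :
    IsFrame ((Scheme.Modules.pullback f).obj M) (f ⁻¹ᵁ U)
      fun i => GrassmannBlowup.pull f M U (b i) := by
  classical
  set V := f ⁻¹ᵁ U with hV
  set P := (Scheme.Modules.pullback f).obj M with hP
  -- The coordinate functions of the pulled-back frame: the `i`-th is adjoint to the `i`-th
  -- coordinate function of `b`.
  have exc := fun i => hb.exists_locHom f (structureModule T)
    (fun j => unitSec V ((Pi.single i 1 : ι → Γ(T, V)) j))
  choose c' hc' using exc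
  let c : ∀ (i : ι) (W : T.Opens), Γ(P, W) →+ Γ(T, locOpen V W) := fun i W =>
    (unitSec (locOpen V W)).symm.toAddEquiv.toAddMonoidHom.comp ((c' i).app W)
  have c_smul : ∀ i W r m, c i W (r • m) = resFun T (locOpen_le_right V W) r * c i W m := by
    intro i W r m
    have := (c' i).app_smul W r m
    exact congr_arg (unitSec (locOpen V W)).symm this
  have c_res : ∀ i (W W' : T.Opens) (h : W' ≤ W) (m : Γ(P, W)),
      resFun T (V.ι.image_mono (V.ι.preimage_mono h)) (c i W m) =
        c i W' (GrassmannBlowup.res P h m) := by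
    intro i W W' h m
    have := (c' i).res_app W W' h m
    exact congr_arg (unitSec (locOpen V W')).symm this
  have c_frame : ∀ i j, c i V (GrassmannBlowup.pull f M U (b j)) =
      (Pi.single i 1 : ι → Γ(T, locOpen V V)) j := by
    intro i j
    have h1 := (hc' i U (b j)).trans (hb.locSum_frame _ _ _ _)
    have h2 : c i V (GrassmannBlowup.pull f M U (b j)) = resFun T (locOpen_le_left V V)
      ((Pi.single i 1 : ι → Γ(T, V)) j) := congr_arg (unitSec (locOpen V V)).symm h1
    rw [h2]
    simp only [Pi.single_apply]
    split_ifs <;> simp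
  have c_pull : ∀ i W m, c i (f ⁻¹ᵁ W) (GrassmannBlowup.pull f M W m) =
      resFun T (locOpen_preimage_le f U W) (funPull f (W ⊓ U)
          (hb.coord inf_le_right (GrassmannBlowup.res M inf_le_left m) i)) := by
    intro i W m
    have h1 : c i (f ⁻¹ᵁ W) (GrassmannBlowup.pull f M W m) =
      (unitSec (locOpen V _)).symm (hb.locSum f _ (fun j => unitSec V
        ((Pi.single i 1 : ι → Γ(T, V)) j)) W m) :=
      congr_arg (unitSec (locOpen V _)).symm (hc' i W m)
    rw [h1, locSum, map_sum, Finset.sum_eq_single i]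
    · rw [Pi.single_eq_same, res_unitSec, map_smul, map_one, LinearEquiv.symm_apply_apply]
      exact mul_one _
    · intro j _ hj
      rw [Pi.single_eq_of_ne hj, map_zero, map_zero, smul_zero, map_zero]
    · simp
  -- `d` rebuilds a section from its coordinates and `l` only restricts it. They agree on
  -- pulled-back sections, hence everywhere, so the pulled-back frame spans.
  let d : LocHom P P V :=
    { app := fun W => AddMonoidHom.mk' (fun m => ∑ i, c i W m •
          GrassmannBlowup.res P (locOpen_le_left _ _) (GrassmannBlowup.pull f M U (b i)))
          (fun m m' => by simp [add_smul, Finset.sum_add_distrib])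
      app_smul := fun W r m => by
        simp [c_smul, mul_smul, Finset.smul_sum]
      res_app := fun W W' h m => by
        simp only [AddMonoidHom.mk'_apply, map_sum, res_smul, res_res]
        exact Finset.sum_congr rfl fun i _ => by rw [← c_res] }
  let l : LocHom P P V :=
    { app := fun W => GrassmannBlowup.res P (locOpen_le_right _ _)
      app_smul := fun W r m => res_smul _ _ _ _
      res_app := fun W W' h m => by rw [res_res, res_res] }
  have hd : ∀ W m, d.app W m = l.app W m := by
    apply LocHom.ext_pull f
    intro W m
    have h3 := congr_arg (fun t => GrassmannBlowup.res P (locOpen_preimage_le f U W)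
      (GrassmannBlowup.pull f M (W ⊓ U) t))
      (hb.sum_coord inf_le_right (GrassmannBlowup.res M (inf_le_left : W ⊓ U ≤ W) m))
    simp only [pull_sum_smul, res_sum_smul] at h3
    rw [← res_pull f M inf_le_left m, res_res] at h3
    refine Eq.trans ?_ h3
    refine Finset.sum_congr rfl fun i _ => ?_
    rw [← res_pull f M inf_le_right (b i), res_res, c_pull]
  intro W hW
  constructor
  · intro a a' haa'
    have key : ∀ (a : ι → Γ(T, W)) (i : ι), c i W
        (∑ j, a j • GrassmannBlowup.res P hW (GrassmannBlowup.pull f M U (b j))) =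
          resFun T (locOpen_le_right V W) (a i) := by
      intro a i
      rw [map_sum, Finset.sum_eq_single i]
      · rw [c_smul, ← c_res, c_frame]
        simp
      · intro j _ hj
        rw [c_smul, ← c_res, c_frame, Pi.single_eq_of_ne hj]
        simp
      · simp
    funext i
    have h5 := (key a i).symm.trans ((congr_arg (c i W) haa').trans (key a' i))
    have h6 := congr_arg (resFun T (le_locOpen hW)) h5
    simpa only [resFun_resFun, resFun_self] using h6
  · intro m
    have h6 := congr_arg (GrassmannBlowup.res P (le_locOpen hW)) (hd W m)
    refine ⟨fun i => resFun T (le_locOpen hW) (c i W m), ?_⟩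
    have h7 : GrassmannBlowup.res P (le_locOpen hW) (∑ i, c i W m •
          GrassmannBlowup.res P (locOpen_le_left _ _) (GrassmannBlowup.pull f M U (b i))) =
        GrassmannBlowup.res P (le_locOpen hW) (GrassmannBlowup.res P (locOpen_le_right _ _) m) := h6
    rw [res_sum_smul, res_res, res_self] at h7
    simp only [res_res] at h7
    exact h7

end IsFrame

/-! ### Transition maps between pullbacks -/

/-- A morphism to a pushforward in terms of sections. -/
def mkHomPush (h : T' ⟶ T) {M : T.Modules} {G : T'.Modules}
    (α : ∀ U : T.Opens, Γ(M, U) →+ Γ(G, h ⁻¹ᵁ U))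
    (α_smul : ∀ U (r : Γ(T, U)) m, α U (r • m) = funPull h U r • α U m)
    (α_res : ∀ (U V : T.Opens) (hV : V ≤ U) m,
      res G (h.preimage_mono hV) (α U m) = α V (res M hV m)) :
    M ⟶ (Scheme.Modules.pushforward h).obj G :=
  mkHom (fun U => { toFun := α U, map_add' := (α U).map_add, map_smul' := α_smul U }) α_res

/-- Both families are morphisms `f^*E ⟶ h_*G`, and such a morphism is determined by its values on
sections pulled back from `X`. -/
lemma semilinear_ext (f : T ⟶ X) (h : T' ⟶ T) {E : X.Modules} {G : T'.Modules}
    (α β : ∀ U : T.Opens, Γ((Scheme.Modules.pullback f).obj E, U) →+ Γ(G, h ⁻¹ᵁ U))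
    (α_smul : ∀ U (r : Γ(T, U)) m, α U (r • m) = funPull h U r • α U m)
    (α_res : ∀ (U V : T.Opens) (hV : V ≤ U) m,
      res G (h.preimage_mono hV) (α U m) = α V (res _ hV m))
    (β_smul : ∀ U (r : Γ(T, U)) m, β U (r • m) = funPull h U r • β U m)
    (β_res : ∀ (U V : T.Opens) (hV : V ≤ U) m,
      res G (h.preimage_mono hV) (β U m) = β V (res _ hV m))
    (hαβ : ∀ (U : X.Opens) (m : Γ(E, U)), α (f ⁻¹ᵁ U) (pull f E U m) = β (f ⁻¹ᵁ U) (pull f E U m))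
    (U : T.Opens) (m : Γ((Scheme.Modules.pullback f).obj E, U)) : α U m = β U m := by
  have : mkHomPush h α α_smul α_res = mkHomPush h β β_smul β_res := pullback_hom_ext f hαβ
  exact congr($(this).app U m)

/-- The canonical isomorphism `h^*f^*E ⟶ f'^*E`, for `h ≫ f = f'`. -/
def transition {f : T ⟶ X} {f' : T' ⟶ X} (h : T' ⟶ T) (e : h ≫ f = f') (E : X.Modules) :
    (Scheme.Modules.pullback h).obj ((Scheme.Modules.pullback f).obj E) ⟶
      (Scheme.Modules.pullback f').obj E :=
  (Scheme.Modules.pullbackComp h f).hom.app E ≫ (Scheme.Modules.pullbackCongr e).hom.app E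

instance {f : T ⟶ X} {f' : T' ⟶ X} (h : T' ⟶ T) (e : h ≫ f = f') (E : X.Modules) :
    IsIso (transition h e E) := by
  delta transition; infer_instance

/-- `rho` is chosen from this statement, so that `rho_apply` is the only way to unfold it. -/
lemma exists_rho {f : T ⟶ X} {f' : T' ⟶ X} (h : T' ⟶ T) (e : h ≫ f = f') (E : X.Modules)
    (U : T.Opens) : ∃ ρ : Γ((Scheme.Modules.pullback f).obj E, U) →+
      Γ((Scheme.Modules.pullback f').obj E, h ⁻¹ᵁ U),
        ∀ m, ρ m = (transition h e E).app (h ⁻¹ᵁ U) (pull h _ U m) :=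
  ⟨((transition h e E).app (h ⁻¹ᵁ U)).hom.comp (pull h _ U), fun _ => rfl⟩

/-- The transition map from sections of `f^*E` to sections of `f'^*E`, for `h ≫ f = f'`. -/
def rho {f : T ⟶ X} {f' : T' ⟶ X} (h : T' ⟶ T) (e : h ≫ f = f') (E : X.Modules) (U : T.Opens) :
    Γ((Scheme.Modules.pullback f).obj E, U) →+ Γ((Scheme.Modules.pullback f').obj E, h ⁻¹ᵁ U) :=
  (exists_rho h e E U).choose

section rho

variable {f : T ⟶ X} {f' : T' ⟶ X} (h : T' ⟶ T) (e : h ≫ f = f') (E : X.Modules)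

lemma rho_apply (U : T.Opens) (m : Γ((Scheme.Modules.pullback f).obj E, U)) :
    rho h e E U m = (transition h e E).app (h ⁻¹ᵁ U) (pull h _ U m) :=
  (exists_rho h e E U).choose_spec m

lemma app_pull_smul {M : T.Modules} {G : T'.Modules} (φ : (Scheme.Modules.pullback h).obj M ⟶ G)
    (U : T.Opens) (r : Γ(T, U)) (m : Γ(M, U)) : φ.app (h ⁻¹ᵁ U) (pull h M U (r • m)) =
      funPull h U r • φ.app (h ⁻¹ᵁ U) (pull h M U m) := by
  rw [pull_smul, Scheme.Modules.Hom.app_smul]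

lemma res_app_pull {M : T.Modules} {G : T'.Modules} (φ : (Scheme.Modules.pullback h).obj M ⟶ G)
    {U V : T.Opens} (hV : V ≤ U) (m : Γ(M, U)) :
    res _ (h.preimage_mono hV) (φ.app (h ⁻¹ᵁ U) (pull h M U m)) =
      φ.app (h ⁻¹ᵁ V) (pull h M V (res _ hV m)) := by
  rw [res_app, res_pull]

lemma rho_smul (U : T.Opens) (r : Γ(T, U)) (m : Γ((Scheme.Modules.pullback f).obj E, U)) :
    rho h e E U (r • m) = funPull h U r • rho h e E U m := by
  rw [rho_apply]
  rw [app_pull_smul]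
  rw [← rho_apply]

lemma res_rho {U V : T.Opens} (hV : V ≤ U) (m : Γ((Scheme.Modules.pullback f).obj E, U)) :
    res _ (h.preimage_mono hV) (rho h e E U m) = rho h e E V (res _ hV m) := by
  rw [rho_apply]
  rw [res_app_pull]
  rw [← rho_apply]

lemma rho_sum_smul (U : T.Opens) {ι : Type*} [Fintype ι] (a : ι → Γ(T, U))
    (m : ι → Γ((Scheme.Modules.pullback f).obj E, U)) :
    rho h e E U (∑ i, a i • m i) = ∑ i, funPull h U (a i) • rho h e E U (m i) := by
  rw [map_sum]
  exact Finset.sum_congr rfl fun i _ => rho_smul _ _ _ _ _ _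

lemma preimage_eq_of_comp_eq (e : h ≫ f = f') (U : X.Opens) : h ⁻¹ᵁ f ⁻¹ᵁ U = f' ⁻¹ᵁ U := by
  subst e; rfl

lemma rho_pull (U : X.Opens) (m : Γ(E, U)) :
    rho h e E (f ⁻¹ᵁ U) (pull f E U m) =
      res _ (preimage_eq_of_comp_eq h e U).le (pull f' E U m) := by
  subst e
  rw [rho_apply]
  have h1 := pullbackComp_pull h f E U m
  have h2 := congrArg (fun t => ((Scheme.Modules.pullbackCongr (rfl : h ≫ f = h ≫ f)).hom.app
    E).app (h ⁻¹ᵁ f ⁻¹ᵁ U) t) h1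
  exact h2.trans (pullbackCongr_pull rfl E U m)

/-- The cocycle rule for transition maps. By `semilinear_ext` it only has to be checked on sections
coming from `X`, where every transition map is a pullback. -/
lemma rho_rho {T'' : Scheme.{u}} (k : T'' ⟶ T') {f'' : T'' ⟶ X} (e' : k ≫ f' = f'')
    (e'' : (k ≫ h) ≫ f = f'') (U : T.Opens) (m : Γ((Scheme.Modules.pullback f).obj E, U)) :
    rho k e' E (h ⁻¹ᵁ U) (rho h e E U m) = rho (k ≫ h) e'' E U m := by
  refine semilinear_ext f (k ≫ h) (G := (Scheme.Modules.pullback f'').obj E)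
    (fun U => (rho k e' E (h ⁻¹ᵁ U)).comp (rho h e E U))
    (fun U => rho (k ≫ h) e'' E U) ?_ ?_ (rho_smul _ _ _) (fun U V hV => res_rho _ _ _ hV) ?_ U m
  · intro U r m
    have h1 : rho k e' E (h ⁻¹ᵁ U) (rho h e E U (r • m)) =
        funPull k (h ⁻¹ᵁ U) (funPull h U r) • rho k e' E (h ⁻¹ᵁ U) (rho h e E U m) := by
      rw [rho_smul, rho_smul]
    refine h1.trans ?_
    have h2 : funPull (k ≫ h) U r = funPull k (h ⁻¹ᵁ U) (funPull h U r) := by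
      simp only [funPull, Scheme.Hom.comp_app]
      rfl
    rw [h2]
    rfl
  · intro U V hV m
    have h1 : res _ (k.preimage_mono (h.preimage_mono hV))
        (rho k e' E (h ⁻¹ᵁ U) (rho h e E U m)) =
        rho k e' E (h ⁻¹ᵁ V) (rho h e E V (res _ hV m)) := by
      rw [res_rho k e' E (h.preimage_mono hV), res_rho]
    exact h1
  · intro U m
    have h1 : rho k e' E (h ⁻¹ᵁ f ⁻¹ᵁ U) (rho h e E (f ⁻¹ᵁ U) (pull f E U m)) =
        rho (k ≫ h) e'' E (f ⁻¹ᵁ U) (pull f E U m) := by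
      rw [rho_pull, rho_pull, ← res_rho, rho_pull, res_res]
      rfl
    exact h1

lemma rho_id (e : 𝟙 T ≫ f = f) (U : T.Opens) (m : Γ((Scheme.Modules.pullback f).obj E, U)) :
    rho (𝟙 T) e E U m = m := by
  refine semilinear_ext f (𝟙 T) (G := (Scheme.Modules.pullback f).obj E)
    (fun U => rho (𝟙 T) e E U)
    (fun U => AddMonoidHom.id _) (rho_smul _ _ _) (fun U V hV => res_rho _ _ _ hV) ?_ ?_ ?_ U m
  · intro U r m
    have : funPull (𝟙 T) U r = r := by
      simp only [funPull, Scheme.Hom.id_app]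
      rfl
    rw [this]
    rfl
  · intro U V hV m
    rfl
  · intro U m
    refine (rho_pull _ _ _ _ _).trans ?_
    exact res_self _ _

lemma rho_naturality {E F : X.Modules} (φ : E ⟶ F) (U : T.Opens)
    (m : Γ((Scheme.Modules.pullback f).obj E, U)) :
    ((Scheme.Modules.pullback f').map φ).app (h ⁻¹ᵁ U) (rho h e E U m) =
      rho h e F U (((Scheme.Modules.pullback f).map φ).app U m) := by
  refine semilinear_ext f h
    (fun U => (((Scheme.Modules.pullback f').map φ).app (h ⁻¹ᵁ U)).hom.comp (rho h e E U))
    (fun U => (rho h e F U).comp (((Scheme.Modules.pullback f).map φ).app U).hom) ?_ ?_ ?_ ?_ ?_ U m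
  · intro U r m
    change ((Scheme.Modules.pullback f').map φ).app (h ⁻¹ᵁ U) (rho h e E U (r • m)) = _ •
      ((Scheme.Modules.pullback f').map φ).app (h ⁻¹ᵁ U) (rho h e E U m)
    rw [rho_smul, Scheme.Modules.Hom.app_smul]
  · intro U V hV m
    change res _ _ (((Scheme.Modules.pullback f').map φ).app (h ⁻¹ᵁ U) (rho h e E U m)) =
      ((Scheme.Modules.pullback f').map φ).app (h ⁻¹ᵁ V) (rho h e E V (res _ hV m))
    rw [res_app, res_rho]
  · intro U r m
    change rho h e F U (((Scheme.Modules.pullback f).map φ).app U (r • m)) = _ •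
      rho h e F U (((Scheme.Modules.pullback f).map φ).app U m)
    rw [Scheme.Modules.Hom.app_smul, rho_smul]
  · intro U V hV m
    change res _ _ (rho h e F U (((Scheme.Modules.pullback f).map φ).app U m)) =
      rho h e F V (((Scheme.Modules.pullback f).map φ).app V (res _ hV m))
    rw [res_rho, res_app]
  · intro U m
    change ((Scheme.Modules.pullback f').map φ).app (h ⁻¹ᵁ f ⁻¹ᵁ U)
        (rho h e E (f ⁻¹ᵁ U) (pull f E U m)) =
      rho h e F (f ⁻¹ᵁ U) (((Scheme.Modules.pullback f).map φ).app (f ⁻¹ᵁ U) (pull f E U m))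
    rw [rho_pull, ← res_app, pull_naturality, pull_naturality, rho_pull]

lemma IsFrame.rho {ι : Type} [Fintype ι] {U : T.Opens}
    {v : ι → Γ((Scheme.Modules.pullback f).obj E, U)}
    (hv : IsFrame ((Scheme.Modules.pullback f).obj E) U v) :
    IsFrame ((Scheme.Modules.pullback f').obj E) (h ⁻¹ᵁ U)
      fun i => GrassmannBlowup.rho h e E U (v i) := by
  simp only [rho_apply]
  exact (hv.pull h).map_iso (transition h e E)

lemma rho_bijective [IsOpenImmersion h] (U : T.Opens) (hU : U ≤ h.opensRange) :
    Function.Bijective (rho h e E U) := by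
  have h1 : Function.Bijective ((transition h e E).app (h ⁻¹ᵁ U)) :=
    (ConcreteCategory.isIso_iff_bijective _).mp inferInstance
  rw [show ⇑(rho h e E U) = _ from funext (rho_apply h e E U)]
  exact h1.comp (pull_bijective h _ U hU)

lemma pullbackSub_pull {E : X.Modules} {K : T.Modules}
    (κ : K ⟶ (Scheme.Modules.pullback f).obj E) (U : T.Opens) (m : Γ(K, U)) :
    (pullbackSub κ h e).app (h ⁻¹ᵁ U) (pull h K U m) = rho h e E U (κ.app U m) := by
  have h1 : pullbackSub κ h e = (Scheme.Modules.pullback h).map κ ≫ transition h e E := rfl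
  rw [h1, comp_app_apply, pull_naturality, rho_apply]

end rho

end

section

variable {X : Scheme.{u}}

/-! ### Subsheaves of modules -/

/-- A subsheaf of `𝒪_X`-submodules of `M`. -/
@[ext]
structure Sub (M : X.Modules) where
  carrier : ∀ U : X.Opens, Submodule Γ(X, U) Γ(M, U)
  res_mem : ∀ (U V : X.Opens) (h : V ≤ U) (m : Γ(M, U)), m ∈ carrier U → res M h m ∈ carrier V
  mem_of_locally : ∀ (U : X.Opens) (m : Γ(M, U)), (∀ x ∈ U, ∃ (W : X.Opens) (h : W ≤ U), x ∈ W ∧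
    res M h m ∈ carrier W) → m ∈ carrier U

namespace Sub

variable {M : X.Modules} (N : Sub M)

/-- The presheaf of abelian groups underlying a subsheaf of modules. -/
def presheaf : TopCat.Presheaf Ab X where
  obj U := AddCommGrpCat.of (N.carrier U.unop)
  map {U V} i := AddCommGrpCat.ofHom (AddMonoidHom.mk'
    (fun m : N.carrier U.unop => (⟨res M (leOfHom i.unop) m.1, N.res_mem _ _ _ _ m.2⟩ :
      N.carrier V.unop)) fun m m' => Subtype.ext (map_add (res M (leOfHom i.unop)) m.1 m'.1))
  map_id U := by
    ext (m : N.carrier U.unop)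
    exact res_self M m.1
  map_comp {U V W} i j := by
    ext (m : N.carrier U.unop)
    exact (res_res M (leOfHom i.unop) (leOfHom j.unop) m.1).symm

instance (U : (TopologicalSpace.Opens X)ᵒᵖ) :
    Module (X.ringCatSheaf.obj.obj U) (N.presheaf.obj U) :=
  inferInstanceAs (Module Γ(X, U.unop) (N.carrier U.unop))

lemma presheaf_isSheaf : N.presheaf.IsSheaf := by
  rw [TopCat.Presheaf.isSheaf_iff_isSheafUniqueGluing]
  intro ι U f hf
  change ∀ i, N.carrier (U i) at f
  obtain ⟨t, ht, htu⟩ := exists_glue M U (iSup U) (le_iSup U) le_rfl (fun i => (f i).1)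
    (fun i j => congr_arg Subtype.val (hf i j))
  have htN : t ∈ N.carrier (iSup U) := by
    apply N.mem_of_locally
    intro x hx
    obtain ⟨i, hi⟩ := Opens.mem_iSup.mp hx
    exact ⟨U i, le_iSup U i, hi, by rw [ht i]; exact (f i).2⟩
  refine ⟨(⟨t, htN⟩ : N.carrier (iSup U)), fun i => Subtype.ext (ht i), ?_⟩
  intro g hg
  change N.carrier (iSup U) at g
  exact Subtype.ext (htu g.1 fun i => congr_arg Subtype.val (hg i))

/-- The module given by a subsheaf. -/
def toModule : X.Modules where
  val := PresheafOfModules.ofPresheaf N.presheaf fun _ _ i r m =>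
    Subtype.ext (res_smul M (leOfHom i.unop) r m.1)
  isSheaf := N.presheaf_isSheaf

/-- Sections of the module of a subsheaf. -/
def sec (U : X.Opens) : Γ(N.toModule, U) ≃ₗ[Γ(X, U)] N.carrier U :=
  LinearEquiv.refl Γ(X, U) (N.carrier U)

lemma sec_res {U V : X.Opens} (h : V ≤ U) (m : Γ(N.toModule, U)) :
    (N.sec V (res _ h m) : Γ(M, V)) = res M h (N.sec U m) := rfl

/-- The inclusion of a subsheaf. -/
def incl : N.toModule ⟶ M :=
  mkHom (fun U => (N.carrier U).subtype ∘ₗ (N.sec U).toLinearMap) fun _ _ _ _ => rfl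

lemma incl_app (U : X.Opens) (m : Γ(N.toModule, U)) : N.incl.app U m = N.sec U m := rfl

lemma incl_injective (U : X.Opens) : Function.Injective (N.incl.app U) :=
  Subtype.val_injective.comp (N.sec U).injective

lemma mem_iff_exists_incl {U : X.Opens} {m : Γ(M, U)} :
    m ∈ N.carrier U ↔ ∃ n, N.incl.app U n = m :=
  ⟨fun h => ⟨(N.sec U).symm ⟨m, h⟩, by rw [incl_app, LinearEquiv.apply_symm_apply]⟩,
    fun ⟨n, hn⟩ => by rw [← hn, incl_app]; exact (N.sec U n).2⟩

/-- A morphism whose values lie in a subsheaf factors through it. -/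
def lift {K : X.Modules} (φ : K ⟶ M) (h : ∀ U (k : Γ(K, U)), φ.app U k ∈ N.carrier U) :
    K ⟶ N.toModule :=
  mkHom (fun U =>
    { toFun := fun k => (N.sec U).symm ⟨φ.app U k, h U k⟩
      map_add' := fun k k' => by
        rw [← map_add]
        exact congr_arg (N.sec U).symm (Subtype.ext (map_add (φ.app U).hom k k'))
      map_smul' := fun r k => by
        rw [RingHom.id_apply, ← map_smul]
        exact congr_arg (N.sec U).symm (Subtype.ext (φ.app_smul r k)) })
    (fun U V hV k => by
      apply (N.sec V).injective
      apply Subtype.ext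
      refine (N.sec_res hV _).trans ?_
      exact res_app φ hV k)

lemma lift_incl {K : X.Modules} (φ : K ⟶ M) (h : ∀ U (k : Γ(K, U)), φ.app U k ∈ N.carrier U) :
    N.lift φ h ≫ N.incl = φ := rfl

/-- The kernel of a morphism, as a subsheaf. -/
def ker {M' : X.Modules} (φ : M ⟶ M') : Sub M where
  carrier U :=
    { carrier := {m | φ.app U m = 0}
      add_mem' := fun {a b} ha hb => by
        have := map_add (φ.app U).hom a b
        exact this.trans (by rw [show (φ.app U).hom a = 0 from ha, show (φ.app U).hom b = 0 from hb,
          add_zero])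
      zero_mem' := map_zero (φ.app U).hom
      smul_mem' := fun r a ha => by
        exact (φ.app_smul r a).trans (by rw [show φ.app U a = 0 from ha, smul_zero]) }
  res_mem U V h m hm := (res_app φ h m).symm.trans (by
    rw [show φ.app U m = 0 from hm, map_zero])
  mem_of_locally U m hm := by
    apply eq_of_locally_eq
    intro x hx
    obtain ⟨W, h, hxW, hW⟩ := hm x hx
    refine ⟨W, h, hxW, ?_⟩
    rw [res_app, map_zero]
    exact hW

lemma mem_ker {M' : X.Modules} {φ : M ⟶ M'} {U : X.Opens} {m : Γ(M, U)} :
    m ∈ (ker φ).carrier U ↔ φ.app U m = 0 := Iff.rfl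

/-- The image of a morphism, as a subsheaf. -/
def image {K : X.Modules} (κ : K ⟶ M) : Sub M where
  carrier U :=
    { carrier := {m | ∀ x ∈ U, ∃ (W : X.Opens) (h : W ≤ U), x ∈ W ∧ ∃ k, κ.app W k = res M h m}
      add_mem' := fun {a b} ha hb x hx => by
        obtain ⟨W, h, hxW, k, hk⟩ := ha x hx
        obtain ⟨W', h', hxW', k', hk'⟩ := hb x hx
        refine ⟨W ⊓ W', inf_le_left.trans h, ⟨hxW, hxW'⟩,
          res K inf_le_left k + res K inf_le_right k', ?_⟩
        refine (map_add (κ.app (W ⊓ W')).hom _ _).trans ?_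
        have h1 := congr_arg (res M (inf_le_left : W ⊓ W' ≤ W)) hk
        have h2 := congr_arg (res M (inf_le_right : W ⊓ W' ≤ W')) hk'
        rw [res_app, res_res] at h1 h2
        rw [map_add]
        exact congr_arg₂ (· + ·) h1 h2
      zero_mem' := fun x hx => ⟨U, le_rfl, hx, 0, by
        exact (map_zero (κ.app U).hom).trans (map_zero _).symm⟩
      smul_mem' := fun r a ha x hx => by
        obtain ⟨W, h, hxW, k, hk⟩ := ha x hx
        refine ⟨W, h, hxW, resFun X h r • k, ?_⟩
        rw [Scheme.Modules.Hom.app_smul, hk, res_smul] }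
  res_mem U V h m hm x hx := by
    obtain ⟨W, hW, hxW, k, hk⟩ := hm x (h hx)
    refine ⟨W ⊓ V, inf_le_right, ⟨hxW, hx⟩, res K inf_le_left k, ?_⟩
    rw [← res_app, hk, res_res, res_res]
  mem_of_locally U m hm x hx := by
    obtain ⟨W, h, hxW, hW⟩ := hm x hx
    obtain ⟨W', h', hxW', k, hk⟩ := hW x hxW
    exact ⟨W', h'.trans h, hxW', k, by rw [hk, res_res]⟩

lemma mem_image_of_eq {K : X.Modules} {κ : K ⟶ M} {U : X.Opens} (k : Γ(K, U)) :
    κ.app U k ∈ (image κ).carrier U :=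
  fun _ hx => ⟨U, le_rfl, hx, k, by rw [res_self]⟩

/-- When `κ` is injective on sections, local preimages are unique and therefore glue. -/
lemma mem_image_iff {K : X.Modules} {κ : K ⟶ M} (hκ : ∀ U, Function.Injective (κ.app U))
    {U : X.Opens} {m : Γ(M, U)} : m ∈ (image κ).carrier U ↔ ∃ k, κ.app U k = m := by
  refine ⟨fun h => ?_, fun ⟨k, hk⟩ => hk ▸ mem_image_of_eq k⟩
  obtain ⟨k, hk⟩ := exists_of_locally_unique K (U := U)
    (fun W k => ∃ h : W ≤ U, κ.app W k = res M h m)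
    (fun W W' h s _ ⟨hW, hs⟩ => ⟨h.trans hW, by rw [← res_app, hs, res_res]⟩)
    (fun W s t _ ⟨_, hs⟩ ⟨_, ht⟩ => hκ W (hs.trans ht.symm))
    (fun x hx => by
      obtain ⟨W, hW, hxW, k, hk⟩ := h x hx
      exact ⟨W, hxW, hW, k, hW, hk⟩)
  refine ⟨k, eq_of_locally_eq M fun x hx => ?_⟩
  obtain ⟨W, hW, hxW, _, h2⟩ := hk x hx
  exact ⟨W, hW, hxW, by rw [res_app, h2]⟩

end Sub

/-- The linear map on sections of a morphism of modules. -/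
def appLin {M N : X.Modules} (φ : M ⟶ N) (U : X.Opens) : Γ(M, U) →ₗ[Γ(X, U)] Γ(N, U) where
  toFun := φ.app U
  map_add' := (φ.app U).hom.map_add
  map_smul' := φ.app_smul

lemma isIso_of_bijective {M N : X.Modules} (φ : M ⟶ N) (h : ∀ U, Function.Bijective (φ.app U)) :
    IsIso φ := by
  have inv : ∀ U, ∃ ψ : Γ(N, U) →ₗ[Γ(X, U)] Γ(M, U), ∀ n, φ.app U (ψ n) = n := by
    intro U
    let e := LinearEquiv.ofBijective (appLin φ U) (h U)
    exact ⟨e.symm.toLinearMap, fun n => e.apply_symm_apply n⟩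
  choose ψ hψ using inv
  refine ⟨mkHom ψ (fun U V hV m => (h V).1 ?_), hom_ext_app fun U m => (h U).1 ?_,
    hom_ext_app fun U m => ?_⟩
  · rw [← res_app, hψ, hψ]
  · exact hψ U _
  · exact hψ U _

/-- Cancelling `φ` shows that the inclusion of its kernel subsheaf is zero. -/
lemma app_injective_of_mono {M N : X.Modules} (φ : M ⟶ N) [Mono φ] (U : X.Opens) :
    Function.Injective (φ.app U) := by
  have h : (Sub.ker φ).incl = 0 := by
    rw [← cancel_mono φ, zero_comp]
    refine hom_ext_app fun V m => ?_
    exact Sub.mem_ker.mp ((Sub.ker φ).mem_iff_exists_incl.mpr ⟨m, rfl⟩)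
  refine (injective_iff_map_eq_zero (φ.app U).hom).mpr fun m hm => ?_
  obtain ⟨n, hn⟩ := (Sub.ker φ).mem_iff_exists_incl.mp (Sub.mem_ker.mpr hm)
  rw [← hn, h]
  rfl

lemma mono_of_injective {M N : X.Modules} (φ : M ⟶ N) (h : ∀ U, Function.Injective (φ.app U)) :
    Mono φ :=
  ⟨fun _ _ hαβ => hom_ext_app fun U m => h U congr($(hαβ).app U m)⟩

/-- Epimorphisms are locally surjective: the inclusion of the image subsheaf is both mono and epi,
hence an isomorphism in the abelian category of modules. -/
lemma mem_image_of_epi {M N : X.Modules} (φ : M ⟶ N) [Epi φ] {U : X.Opens} (n : Γ(N, U)) :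
    n ∈ (Sub.image φ).carrier U := by
  let I := Sub.image φ
  have h1 : Epi (I.lift φ (fun U k => Sub.mem_image_of_eq k) ≫ I.incl) := by
    rw [I.lift_incl]; infer_instance
  have : Epi I.incl := epi_of_epi (I.lift φ (fun U k => Sub.mem_image_of_eq k)) _
  have : Mono I.incl := mono_of_injective _ I.incl_injective
  have : IsIso I.incl := isIso_of_mono_of_epi _
  obtain ⟨k, hk⟩ := ((ConcreteCategory.isIso_iff_bijective (I.incl.app U)).mp inferInstance).2 n
  exact I.mem_iff_exists_incl.mpr ⟨k, hk⟩

/-- In an abelian category a monomorphism is the kernel of its cokernel, so the kernel subsheaf of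
the projection factors through `κ`. -/
lemma cokernel_app_eq_zero_iff {K M : X.Modules} (κ : K ⟶ M) [Mono κ] {U : X.Opens} (m : Γ(M, U)) :
    (cokernel.π κ).app U m = 0 ↔ ∃ k, κ.app U k = m := by
  constructor
  · intro h
    let N := Sub.ker (cokernel.π κ)
    have h0 : N.incl ≫ cokernel.π κ = 0 :=
      hom_ext_app fun V m => Sub.mem_ker.mp (N.mem_iff_exists_incl.mpr ⟨m, rfl⟩)
    obtain ⟨n, hn⟩ := N.mem_iff_exists_incl.mp (Sub.mem_ker.mpr h)
    have h1 := Abelian.monoLift_comp κ N.incl h0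
    exact ⟨(Abelian.monoLift κ N.incl h0).app U n, by rw [← comp_app_apply, h1, hn]⟩
  · rintro ⟨k, rfl⟩
    exact congr($(cokernel.condition κ).app U k)

/-! ### Locally split subsheaves -/

namespace Sub

variable {M : X.Modules}

/-- `N` is on `U` the span of the first part of the frame `e`. -/
structure IsSplit (N : Sub M) (U : X.Opens) {ι κ : Type} [Fintype ι] [Fintype κ]
    (e : ι ⊕ κ → Γ(M, U)) : Prop where
  isFrame : IsFrame M U e
  mem_iff : ∀ (V : X.Opens) (h : V ≤ U) (m : Γ(M, V)),
    m ∈ N.carrier V ↔ ∀ j, isFrame.coord h m (Sum.inr j) = 0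

namespace IsSplit

variable {N N' : Sub M} {U : X.Opens} {ι κ : Type} [Fintype ι] [Fintype κ] {e : ι ⊕ κ → Γ(M, U)}

lemma mem_iff_exists (h : N.IsSplit U e) {V : X.Opens} (hV : V ≤ U) {m : Γ(M, V)} :
    m ∈ N.carrier V ↔ ∃ a : ι → Γ(X, V), ∑ i, a i • GrassmannBlowup.res M hV (e (.inl i)) = m := by
  rw [h.mem_iff V hV]
  constructor
  · intro h0
    refine ⟨fun i => h.isFrame.coord hV m (.inl i), ?_⟩
    conv_rhs => rw [← h.isFrame.sum_coord hV m]
    simp [Fintype.sum_sum_type, h0]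
  · rintro ⟨a, rfl⟩ j
    have : ∑ i, a i • GrassmannBlowup.res M hV (e (.inl i)) = ∑ i : ι ⊕ κ,
        (Sum.elim a 0 : ι ⊕ κ → Γ(X, V)) i • GrassmannBlowup.res M hV (e i) := by
      simp [Fintype.sum_sum_type]
    rw [this, IsFrame.coord_sum]
    rfl

lemma inl_mem (h : N.IsSplit U e) (i : ι) : e (.inl i) ∈ N.carrier U := by
  classical
  refine (h.mem_iff_exists le_rfl).mpr ⟨Pi.single i 1, ?_⟩
  simp [Pi.single_apply, ite_smul, res_self]

lemma of_mem_iff_exists (he : IsFrame M U e) (h : ∀ (V : X.Opens) (hV : V ≤ U) (m : Γ(M, V)),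
    m ∈ N.carrier V ↔
      ∃ a : ι → Γ(X, V), ∑ i, a i • GrassmannBlowup.res M hV (e (.inl i)) = m) :
    N.IsSplit U e where
  isFrame := he
  mem_iff V hV m := by
    rw [h V hV]
    constructor
    · rintro ⟨a, rfl⟩ j
      have : ∑ i, a i • GrassmannBlowup.res M hV (e (.inl i)) = ∑ i : ι ⊕ κ,
          (Sum.elim a 0 : ι ⊕ κ → Γ(X, V)) i • GrassmannBlowup.res M hV (e i) := by
        simp [Fintype.sum_sum_type]
      rw [this, IsFrame.coord_sum]
      rfl
    · intro h0
      refine ⟨fun i => he.coord hV m (.inl i), ?_⟩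
      conv_rhs => rw [← he.sum_coord hV m]
      simp [Fintype.sum_sum_type, h0]

lemma res (h : N.IsSplit U e) {V : X.Opens} (hV : V ≤ U) :
    N.IsSplit V fun i => GrassmannBlowup.res M hV (e i) where
  isFrame := h.isFrame.res hV
  mem_iff W hW m := by
    rw [h.mem_iff W (hW.trans hV)]
    simp only [h.isFrame.coord_res_res]

end IsSplit

/-- Two subsheaves which are locally split by the same frame agree. -/
lemma ext_of_isSplit {N N' : Sub M} (h : ∀ x : X, ∃ (U : X.Opens) (ι κ : Type) (_ : Fintype ι)
    (_ : Fintype κ) (e : ι ⊕ κ → Γ(M, U)), x ∈ U ∧ N.IsSplit U e ∧ N'.IsSplit U e) : N = N' := by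
  have key : ∀ (V : X.Opens) (m : Γ(M, V)) (x : X) (_ : x ∈ V), ∃ (W : X.Opens) (h : W ≤ V), x ∈ W ∧
      (GrassmannBlowup.res M h m ∈ N.carrier W ↔ GrassmannBlowup.res M h m ∈ N'.carrier W) := by
    intro V m x hx
    obtain ⟨U, ι, κ, _, _, e, hxU, h1, h2⟩ := h x
    refine ⟨V ⊓ U, inf_le_left, ⟨hx, hxU⟩, ?_⟩
    rw [h1.mem_iff_exists inf_le_right, h2.mem_iff_exists inf_le_right]
  ext V m
  constructor
  · intro hm
    refine N'.mem_of_locally V m fun x hx => ?_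
    obtain ⟨W, h, hxW, hW⟩ := key V m x hx
    exact ⟨W, h, hxW, hW.mp (N.res_mem _ _ _ _ hm)⟩
  · intro hm
    refine N.mem_of_locally V m fun x hx => ?_
    obtain ⟨W, h, hxW, hW⟩ := key V m x hx
    exact ⟨W, h, hxW, hW.mpr (N'.res_mem _ _ _ _ hm)⟩

/-- `N` is locally split of rank `r`. -/
def IsRank (N : Sub M) (r : ℕ) : Prop :=
  ∀ x : X, ∃ (U : X.Opens) (n : ℕ) (e : Fin r ⊕ Fin n → Γ(M, U)), x ∈ U ∧ N.IsSplit U e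

end Sub

/-- The morphism `κ` is locally the inclusion of the first part of a frame. -/
def IsLocSplit {K M : X.Modules} (r : ℕ) (κ : K ⟶ M) : Prop :=
  ∀ x : X, ∃ (U : X.Opens) (n : ℕ) (k : Fin r → Γ(K, U)) (e : Fin r ⊕ Fin n → Γ(M, U)), x ∈ U ∧
    IsFrame K U k ∧ IsFrame M U e ∧ ∀ i, κ.app U (k i) = e (.inl i)

lemma exists_open_le {ι : Type*} [Finite ι] (W : ι → X.Opens) {x : X} (hx : ∀ i, x ∈ W i) :
    ∃ V : X.Opens, x ∈ V ∧ ∀ i, V ≤ W i :=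
  ⟨⟨⋂ i, W i, isOpen_iInter_of_finite fun i => (W i).2⟩, Set.mem_iInter.mpr hx,
    fun i => Set.iInter_subset _ i⟩

/-- A frame of the cokernel lifts to `M` on a smaller open. The lifts and a frame of `K` together
form a frame of `M`, because the sequence is exact on sections apart from local surjectivity at the
right end. -/
lemma IsSubbundle.isLocSplit {K M : X.Modules} {r : ℕ} {κ : K ⟶ M} (h : IsSubbundle r κ) :
    IsLocSplit r κ := by
  intro x
  have := h.mono
  obtain ⟨U₁, hx₁, ⟨k⟩⟩ := h.isLocallyFreeOfRank x
  obtain ⟨U₂, hx₂, n, ⟨q⟩⟩ := h.isLocallyFree_cokernel x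
  have hlift : ∀ j : Fin n, ∃ W : X.Opens, x ∈ W ∧ ∃ (hW : W ≤ U₂) (m : Γ(M, W)),
      (cokernel.π κ).app W m = res _ hW (q.basis j) := by
    intro j
    obtain ⟨W, h, hxW, m, hm⟩ := mem_image_of_epi (cokernel.π κ) (q.basis j) x hx₂
    exact ⟨W, hxW, h, m, hm⟩
  choose W hxW hW m hm using hlift
  obtain ⟨W₀, hxW₀, hW₀⟩ := exists_open_le W hxW
  let U : X.Opens := U₁ ⊓ U₂ ⊓ W₀
  have hU₁ : U ≤ U₁ := inf_le_left.trans inf_le_left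
  have hU₂ : U ≤ U₂ := inf_le_left.trans inf_le_right
  have hUW : ∀ j, U ≤ W j := fun j => inf_le_right.trans (hW₀ j)
  have hxU : x ∈ U := ⟨⟨hx₁, hx₂⟩, hxW₀⟩
  have hk := k.isFrame.res hU₁
  have hq := q.isFrame.res hU₂
  let e : Fin r ⊕ Fin n → Γ(M, U) := Sum.elim (fun i => κ.app U (res K hU₁ (k.basis i)))
    fun j => res M (hUW j) (m j)
  have he : ∀ j, (cokernel.π κ).app U (e (.inr j)) = res _ hU₂ (q.basis j) := by
    intro j
    change (cokernel.π κ).app U (res M (hUW j) (m j)) = _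
    rw [← res_app, hm, res_res]
  have he0 : ∀ i, (cokernel.π κ).app U (e (.inl i)) = 0 := fun i =>
    (cokernel_app_eq_zero_iff κ _).mpr ⟨_, rfl⟩
  have hπ : ∀ (V : X.Opens) (hV : V ≤ U) (a : Fin r ⊕ Fin n → Γ(X, V)),
      (cokernel.π κ).app V (∑ i, a i • res M hV (e i)) =
        ∑ j, a (.inr j) • res _ hV (res _ hU₂ (q.basis j)) := by
    intro V hV a
    rw [app_sum_smul, Fintype.sum_sum_type]
    simp only [← res_app, he, he0, map_zero, smul_zero, Finset.sum_const_zero, zero_add]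
  refine ⟨U, n, _, e, hxU, hk, ?_, fun i => rfl⟩
  intro V hV
  constructor
  · refine (injective_iff_map_eq_zero
      (Fintype.linearCombination Γ(X, V) fun i => res M hV (e i))).mpr fun a ha => ?_
    replace ha : ∑ i, a i • res M hV (e i) = 0 := ha
    have h1 := hπ V hV a
    rw [ha] at h1
    have h2 : (fun j => a (.inr j)) = 0 := by
      apply (hq V hV).1
      refine h1.symm.trans ((map_zero ((cokernel.π κ).app V).hom).trans ?_)
      simp
    have h2' : ∀ j, a (.inr j) = 0 := fun j => congr_fun h2 j
    rw [Fintype.sum_sum_type] at ha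
    simp only [h2', zero_smul, Finset.sum_const_zero, add_zero] at ha
    have h3 : (fun i => a (.inl i)) = 0 := by
      apply (hk V hV).1
      apply app_injective_of_mono κ V
      simp only [Pi.zero_apply, zero_smul, Finset.sum_const_zero]
      rw [app_sum_smul]
      refine Eq.trans ?_ (ha.trans (map_zero (κ.app V).hom).symm)
      exact Finset.sum_congr rfl fun i _ => congr_arg _ (res_app κ hV _).symm
    funext i
    cases i with
    | inl i => exact congr_fun h3 i
    | inr j => exact h2' j
  · intro s
    obtain ⟨b, hb⟩ := (hq V hV).2 ((cokernel.π κ).app V s)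
    have h1 : (cokernel.π κ).app V (s - ∑ j, b j • res M hV (e (.inr j))) = 0 := by
      refine (map_sub ((cokernel.π κ).app V).hom _ _).trans (sub_eq_zero.mpr ?_)
      refine hb.symm.trans ?_
      refine Eq.trans ?_ (app_sum_smul (cokernel.π κ) V _ _).symm
      simp only [← res_app, he]
    obtain ⟨t, ht⟩ := (cokernel_app_eq_zero_iff κ _).mp h1
    obtain ⟨a, rfl⟩ := (hk V hV).2 t
    refine ⟨Sum.elim a b, ?_⟩
    simp only [Fintype.sum_sum_type, Sum.elim_inl, Sum.elim_inr]
    rw [← eq_sub_iff_add_eq, ← ht]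
    simp only []
    rw [app_sum_smul]
    exact Finset.sum_congr rfl fun i _ => congr_arg _ (res_app κ hV _)

namespace IsLocSplit

variable {K M : X.Modules} {r : ℕ} {κ : K ⟶ M}

lemma injective (h : IsLocSplit r κ) (V : X.Opens) : Function.Injective (κ.app V) := by
  refine (injective_iff_map_eq_zero (κ.app V).hom).mpr fun s hs => ?_
  apply eq_of_locally_eq
  intro x hx
  obtain ⟨U, n, k, e, hxU, hk, he, hke⟩ := h x
  refine ⟨V ⊓ U, inf_le_left, ⟨hx, hxU⟩, ?_⟩
  rw [map_zero]
  have h1 : κ.app (V ⊓ U) (res K inf_le_left s) = 0 := by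
    rw [← res_app, show κ.app V s = 0 from hs, map_zero]
  obtain ⟨a, ha⟩ := (hk (V ⊓ U) inf_le_right).2 (res K inf_le_left s)
  simp only at ha
  rw [← ha, app_sum_smul] at h1
  have h2 : (Sum.elim a 0 : Fin r ⊕ Fin n → Γ(X, V ⊓ U)) = 0 := by
    apply (he (V ⊓ U) inf_le_right).1
    simp only [Fintype.sum_sum_type, Sum.elim_inl, Sum.elim_inr, Pi.zero_apply, zero_smul,
      Finset.sum_const_zero, add_zero]
    rw [← h1]
    simp only [← res_app, hke]
  have h3 : ∀ i, a i = 0 := fun i => congr_fun h2 (.inl i)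
  rw [← ha]
  simp [h3]

lemma isSplit_image (h : IsLocSplit r κ) {U : X.Opens} {ι ι' : Type} [Fintype ι] [Fintype ι']
    {k : ι → Γ(K, U)} {e : ι ⊕ ι' → Γ(M, U)} (hk : IsFrame K U k) (he : IsFrame M U e)
    (hke : ∀ i, κ.app U (k i) = e (.inl i)) : (Sub.image κ).IsSplit U e := by
  apply Sub.IsSplit.of_mem_iff_exists he
  intro V hV m
  rw [Sub.mem_image_iff h.injective]
  constructor
  · rintro ⟨t, rfl⟩
    obtain ⟨a, rfl⟩ := (hk V hV).2 t
    refine ⟨a, ?_⟩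
    simp only []
    rw [app_sum_smul]
    simp only [← res_app, hke]
  · rintro ⟨a, rfl⟩
    refine ⟨∑ i, a i • res K hV (k i), ?_⟩
    rw [app_sum_smul]
    simp only [← res_app, hke]

lemma isRank_image (h : IsLocSplit r κ) : (Sub.image κ).IsRank r := fun x => by
  obtain ⟨U, n, k, e, hxU, hk, he, hke⟩ := h x
  exact ⟨U, n, e, hxU, h.isSplit_image hk he hke⟩

lemma mono (h : IsLocSplit r κ) : Mono κ := mono_of_injective κ h.injective

/-- The second part of a splitting frame maps to a frame of the cokernel. Since the projection to
the cokernel is surjective only locally, coordinates are found locally and glued by injectivity. -/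
lemma isSubbundle (h : IsLocSplit r κ) : IsSubbundle r κ where
  mono := h.mono
  isLocallyFreeOfRank x := by
    obtain ⟨U, n, k, e, hxU, hk, he, hke⟩ := h x
    exact ⟨U, hxU, ⟨hk.toFrame⟩⟩
  isLocallyFree_cokernel x := by
    have := h.mono
    obtain ⟨U, n, k, e, hxU, hk, he, hke⟩ := h x
    have hsp := h.isSplit_image hk he hke
    suffices hf : IsFrame (cokernel κ) U fun j => (cokernel.π κ).app U (e (.inr j)) from
      ⟨U, hxU, n, ⟨hf.toFrame⟩⟩
    have hsum : ∀ (V : X.Opens) (hV : V ≤ U) (b : Fin n → Γ(X, V)),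
        ∑ j, b j • res _ hV ((cokernel.π κ).app U (e (.inr j))) =
          (cokernel.π κ).app V (∑ j, b j • res _ hV (e (.inr j))) := by
      intro V hV b
      rw [app_sum_smul]
      simp only [res_app]
    have hinj : ∀ (V : X.Opens) (hV : V ≤ U), Function.Injective fun b : Fin n → Γ(X, V) =>
        ∑ j, b j • res _ hV ((cokernel.π κ).app U (e (.inr j))) := by
      intro V hV
      refine (injective_iff_map_eq_zero (Fintype.linearCombination Γ(X, V)
        fun j => res _ hV ((cokernel.π κ).app U (e (.inr j))))).mpr fun b hb => ?_
      have h1 := (cokernel_app_eq_zero_iff κ _).mp ((hsum V hV b).symm.trans hb)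
      rw [← Sub.mem_image_iff h.injective, hsp.mem_iff V hV] at h1
      have h2 : ∑ j, b j • res _ hV (e (.inr j)) = ∑ i : Fin r ⊕ Fin n,
          (Sum.elim 0 b : Fin r ⊕ Fin n → Γ(X, V)) i • res M hV (e i) := by
        simp [Fintype.sum_sum_type]
      rw [h2, IsFrame.coord_sum] at h1
      exact funext h1
    intro V hV
    refine ⟨hinj V hV, fun q => ?_⟩
    have hex : ∀ x ∈ V, ∃ (W : X.Opens) (h : W ≤ V), x ∈ W ∧ ∃ b : Fin n → Γ(X, W),
        ∑ j, b j • res _ (h.trans hV) ((cokernel.π κ).app U (e (.inr j))) = res _ h q := by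
      intro x hx
      obtain ⟨W, h, hxW, m, hm⟩ := mem_image_of_epi (cokernel.π κ) q x hx
      refine ⟨W, h, hxW, fun j => he.coord (h.trans hV) m (.inr j), ?_⟩
      rw [hsum, ← hm]
      conv_rhs => rw [← he.sum_coord (h.trans hV) m, app_sum_smul, Fintype.sum_sum_type]
      rw [app_sum_smul]
      refine (zero_add _).symm.trans (congr_arg (· + _) (Eq.symm ?_))
      refine Finset.sum_eq_zero fun i _ => ?_
      rw [← hke, res_app, (cokernel_app_eq_zero_iff κ _).mpr ⟨_, rfl⟩, smul_zero]
    choose W hW hxW b hb using hex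
    have glue : ∀ j, ∃ t : Γ(X, V), ∀ x : V, resFun X (hW x.1 x.2) t = b x.1 x.2 j := by
      intro j
      obtain ⟨t, ht, -⟩ := exists_glue (structureModule X) (fun x : V => W x.1 x.2) V
        (fun x => hW _ _) (fun x hx => Opens.mem_iSup.mpr ⟨⟨x, hx⟩, hxW x hx⟩)
        (fun x => b x.1 x.2 j) (by
          intro x y
          have h1 := congr_arg (res _ (inf_le_left : W x.1 x.2 ⊓ W y.1 y.2 ≤ _)) (hb x.1 x.2)
          have h2 := congr_arg (res _ (inf_le_right : W x.1 x.2 ⊓ W y.1 y.2 ≤ _)) (hb y.1 y.2)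
          rw [res_sum_smul, res_res] at h1 h2
          simp only [res_res] at h1 h2
          exact congr_fun (hinj _ ((inf_le_left.trans (hW _ _)).trans hV) (h1.trans h2.symm)) j)
      exact ⟨t, ht⟩
    choose t ht using glue
    refine ⟨t, ?_⟩
    apply eq_of_locally_eq
    intro x hx
    refine ⟨W x hx, hW x hx, hxW x hx, ?_⟩
    simp only []
    rw [res_sum_smul, ← hb x hx]
    simp only [ht _ ⟨x, hx⟩, res_res]

end IsLocSplit

end

/-! ### Subsheaves as images of monomorphisms, and their base change -/

section

variable {X : Scheme.{u}}

lemma IsFrame.isFrame_of_injective {K M : X.Modules} {κ : K ⟶ M}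
    (hκ : ∀ V, Function.Injective (κ.app V)) {N : Sub M} (hN : ∀ V (m : Γ(M, V)),
      m ∈ N.carrier V ↔ ∃ k, κ.app V k = m) {U : X.Opens} {ι ι' : Type} [Fintype ι] [Fintype ι']
    {e : ι ⊕ ι' → Γ(M, U)} (h : N.IsSplit U e) {k : ι → Γ(K, U)}
    (hke : ∀ i, κ.app U (k i) = e (.inl i)) : IsFrame K U k := by
  intro V hV
  have hsum : ∀ a : ι → Γ(X, V), κ.app V (∑ i, a i • GrassmannBlowup.res K hV (k i)) =
      ∑ i, a i • GrassmannBlowup.res M hV (e (.inl i)) := by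
    intro a
    rw [app_sum_smul]
    simp only [← res_app, hke]
  constructor
  · intro a a' haa'
    have h1 : ∑ i, a i • GrassmannBlowup.res M hV (e (.inl i)) =
        ∑ i, a' i • GrassmannBlowup.res M hV (e (.inl i)) := by
      rw [← hsum, ← hsum]
      exact congr_arg (κ.app V) haa'
    have h2 := @(h.isFrame V hV).1 (Sum.elim a 0) (Sum.elim a' 0)
      (by simpa [Fintype.sum_sum_type] using h1)
    exact funext fun i => congr_fun h2 (.inl i)
  · intro s
    obtain ⟨a, ha⟩ := (h.mem_iff_exists hV).mp ((hN V _).mpr ⟨s, rfl⟩)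
    exact ⟨a, hκ V ((hsum a).trans ha)⟩

lemma Sub.IsSplit.exists_isFrame {K M : X.Modules} {κ : K ⟶ M}
    (hκ : ∀ V, Function.Injective (κ.app V)) {N : Sub M} (hN : ∀ V (m : Γ(M, V)),
      m ∈ N.carrier V ↔ ∃ k, κ.app V k = m) {U : X.Opens} {ι ι' : Type} [Fintype ι] [Fintype ι']
    {e : ι ⊕ ι' → Γ(M, U)} (h : N.IsSplit U e) :
    ∃ k : ι → Γ(K, U), IsFrame K U k ∧ ∀ i, κ.app U (k i) = e (.inl i) := by
  have := fun i => (hN U _).mp (h.inl_mem i)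
  choose k hk using this
  exact ⟨k, IsFrame.isFrame_of_injective hκ hN h hk, hk⟩

lemma Sub.IsRank.isLocSplit_incl {M : X.Modules} {N : Sub M} {r : ℕ} (h : N.IsRank r) :
    IsLocSplit r N.incl := by
  intro x
  obtain ⟨U, n, e, hxU, he⟩ := h x
  obtain ⟨k, hk, hke⟩ := he.exists_isFrame N.incl_injective fun V m => N.mem_iff_exists_incl
  exact ⟨U, n, k, e, hxU, hk, he.isFrame, hke⟩

lemma Sub.image_incl {M : X.Modules} (N : Sub M) : Sub.image N.incl = N := by
  ext V m
  rw [mem_image_iff N.incl_injective, N.mem_iff_exists_incl]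

/-- Monomorphisms with the same image have isomorphic sources. -/
lemma exists_iso_of_image_eq {K K' M : X.Modules} {κ : K ⟶ M} {κ' : K' ⟶ M}
    (h : ∀ V, Function.Injective (κ.app V)) (h' : ∀ V, Function.Injective (κ'.app V))
    (e : Sub.image κ = Sub.image κ') : ∃ i : K ≅ K', i.hom ≫ κ' = κ := by
  have key : ∀ V (m : Γ(M, V)), (∃ k, κ.app V k = m) ↔ ∃ k, κ'.app V k = m := fun V m => by
    rw [← Sub.mem_image_iff h, e, Sub.mem_image_iff h']
  have ex := fun V (k : Γ(K, V)) => (key V _).mp ⟨k, rfl⟩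
  choose g hg using ex
  let φ : K ⟶ K' := mkHom (fun V =>
    { toFun := g V
      map_add' := fun a b => h' V (by
        rw [hg]
        refine (map_add (κ.app V).hom a b).trans ?_
        refine Eq.trans ?_ (map_add (κ'.app V).hom _ _).symm
        exact congr_arg₂ (· + ·) (hg V a).symm (hg V b).symm)
      map_smul' := fun r a => h' V (by
        rw [hg, Scheme.Modules.Hom.app_smul, RingHom.id_apply, Scheme.Modules.Hom.app_smul, hg]) })
    (fun U V hV m => h' V (by
      refine (res_app κ' hV _).symm.trans ?_
      refine Eq.trans ?_ (hg V _).symm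
      rw [← res_app]
      exact congr_arg _ (hg U m)))
  have hφ : φ ≫ κ' = κ := hom_ext_app fun V m => hg V m
  have : IsIso φ := isIso_of_bijective φ fun V => by
    constructor
    · intro a b hab
      refine h V ?_
      rw [← hg V a, ← hg V b]
      exact congr_arg (κ'.app V) hab
    · intro k'
      obtain ⟨k, hk⟩ := (key V _).mpr ⟨k', rfl⟩
      exact ⟨k, h' V ((hg V k).trans hk)⟩
  exact ⟨asIso φ, hφ⟩

lemma image_eq_of_iso {K K' M : X.Modules} {κ : K ⟶ M} {κ' : K' ⟶ M} (i : K ≅ K')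
    (h : i.hom ≫ κ' = κ) : Sub.image κ = Sub.image κ' := by
  have h' : i.inv ≫ κ = κ' := by rw [← h, Iso.inv_hom_id_assoc]
  ext V m
  constructor
  · intro hm x hx
    obtain ⟨W, hW, hxW, k, hk⟩ := hm x hx
    exact ⟨W, hW, hxW, i.hom.app W k, by rw [← comp_app_apply, h, hk]⟩
  · intro hm x hx
    obtain ⟨W, hW, hxW, k, hk⟩ := hm x hx
    exact ⟨W, hW, hxW, i.inv.app W k, by rw [← comp_app_apply, h', hk]⟩

/-! ### Pullback of subsheaves -/

variable {T T' T'' : Scheme.{u}} {f : T ⟶ X} {f' : T' ⟶ X} {f'' : T'' ⟶ X} {E : X.Modules} {r : ℕ}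

lemma IsFrame.coord_rho (h : T' ⟶ T) (e : h ≫ f = f') {ι : Type} [Fintype ι] {U : T.Opens}
    {v : ι → Γ((Scheme.Modules.pullback f).obj E, U)}
    (hv : IsFrame ((Scheme.Modules.pullback f).obj E) U v) {V : T.Opens} (hV : V ≤ U)
    (m : Γ((Scheme.Modules.pullback f).obj E, V)) :
    (hv.rho h e E).coord (h.preimage_mono hV) (GrassmannBlowup.rho h e E V m) =
      fun i => funPull h V (hv.coord hV m i) := by
  apply IsFrame.coord_eq
  simp only [res_rho h e E hV]
  rw [← rho_sum_smul, hv.sum_coord]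

lemma IsLocSplit.pullbackSub {K : T.Modules} {κ : K ⟶ (Scheme.Modules.pullback f).obj E}
    (hκ : IsLocSplit r κ) (h : T' ⟶ T) (e : h ≫ f = f') : IsLocSplit r (pullbackSub κ h e) := by
  intro x
  obtain ⟨U, n, k, v, hxU, hk, hv, hkv⟩ := hκ (h x)
  refine ⟨h ⁻¹ᵁ U, n, _, _, hxU, hk.pull h, hv.rho h e E, fun i => ?_⟩
  rw [pullbackSub_pull, hkv]

/-- The pullback of a subsheaf of `f^*E` to a subsheaf of `f'^*E`, for `h ≫ f = f'`. -/
def Sub.pull (N : Sub ((Scheme.Modules.pullback f).obj E)) (h : T' ⟶ T) (e : h ≫ f = f') :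
    Sub ((Scheme.Modules.pullback f').obj E) :=
  Sub.image (pullbackSub N.incl h e)

/-- Being split by a frame is all that is needed to compare subsheaves, and `rho` transports
splitting frames. This is how pullbacks of subsheaves are computed below. -/
lemma IsLocSplit.isSplit_image_pullbackSub {K : T.Modules}
    {κ : K ⟶ (Scheme.Modules.pullback f).obj E} (hκ : IsLocSplit r κ) (h : T' ⟶ T)
    (e : h ≫ f = f') {U : T.Opens} {ι ι' : Type} [Fintype ι] [Fintype ι']
    {v : ι ⊕ ι' → Γ((Scheme.Modules.pullback f).obj E, U)} (hv : (Sub.image κ).IsSplit U v) :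
    (Sub.image (GrassmannBlowup.pullbackSub κ h e)).IsSplit (h ⁻¹ᵁ U)
      fun i => rho h e E U (v i) := by
  obtain ⟨k, hk, hkv⟩ := hv.exists_isFrame hκ.injective fun V m => Sub.mem_image_iff hκ.injective
  refine (hκ.pullbackSub h e).isSplit_image (hk.pull h) (hv.isFrame.rho h e E) fun i => ?_
  rw [pullbackSub_pull, hkv]

namespace Sub

variable {N : Sub ((Scheme.Modules.pullback f).obj E)}

lemma IsSplit.pull (hN : N.IsRank r) (h : T' ⟶ T) (e : h ≫ f = f') {U : T.Opens} {ι ι' : Type}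
    [Fintype ι] [Fintype ι'] {v : ι ⊕ ι' → Γ((Scheme.Modules.pullback f).obj E, U)}
    (hv : N.IsSplit U v) : (N.pull h e).IsSplit (h ⁻¹ᵁ U) fun i => rho h e E U (v i) :=
  hN.isLocSplit_incl.isSplit_image_pullbackSub h e (by rwa [image_incl])

lemma IsRank.pull (hN : N.IsRank r) (h : T' ⟶ T) (e : h ≫ f = f') : (N.pull h e).IsRank r := by
  intro x
  obtain ⟨U, n, v, hxU, hv⟩ := hN (h x)
  exact ⟨h ⁻¹ᵁ U, n, _, hxU, hv.pull hN h e⟩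

lemma IsRank.pull_id (hN : N.IsRank r) (e : 𝟙 T ≫ f = f) : N.pull (𝟙 T) e = N := by
  apply ext_of_isSplit
  intro x
  obtain ⟨U, n, v, hxU, hv⟩ := hN x
  refine ⟨U, Fin r, Fin n, inferInstance, inferInstance, v, hxU, ?_, hv⟩
  have := hv.pull hN (𝟙 T) e
  simp only [rho_id] at this
  exact this

lemma IsRank.pull_pull (hN : N.IsRank r) (h : T' ⟶ T) (e : h ≫ f = f') (k : T'' ⟶ T')
    (e' : k ≫ f' = f'') (e'' : (k ≫ h) ≫ f = f'') :
    (N.pull h e).pull k e' = N.pull (k ≫ h) e'' := by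
  apply ext_of_isSplit
  intro x
  obtain ⟨U, n, v, hxU, hv⟩ := hN (h (k x))
  have h1 := (hv.pull hN h e).pull (hN.pull h e) k e'
  simp only [rho_rho h e E k e' e''] at h1
  exact ⟨k ⁻¹ᵁ h ⁻¹ᵁ U, Fin r, Fin n, inferInstance, inferInstance, _, hxU, h1,
    hv.pull hN (k ≫ h) e''⟩

lemma _root_.GrassmannBlowup.IsLocSplit.image_pullbackSub {K : T.Modules}
    {κ : K ⟶ (Scheme.Modules.pullback f).obj E} (hκ : IsLocSplit r κ) (h : T' ⟶ T)
    (e : h ≫ f = f') :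
    Sub.image (GrassmannBlowup.pullbackSub κ h e) = (Sub.image κ).pull h e := by
  apply ext_of_isSplit
  intro x
  obtain ⟨U, n, v, hxU, hv⟩ := hκ.isRank_image (h x)
  exact ⟨h ⁻¹ᵁ U, Fin r, Fin n, inferInstance, inferInstance, _, hxU,
    hκ.isSplit_image_pullbackSub h e hv, hv.pull hκ.isRank_image h e⟩

lemma funPull_injective (h : T' ⟶ T) [IsOpenImmersion h] (U : T.Opens) (hU : U ≤ h.opensRange) :
    Function.Injective (funPull h U) := by
  have : IsIso (h.app U) := by
    exact h.isIso_app U hU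
  exact ((ConcreteCategory.isIso_iff_bijective (h.app U)).mp inferInstance).1

/-- Membership is the vanishing of some coordinates in a splitting frame, and functions on opens
inside the range of an open immersion pull back injectively. -/
lemma IsRank.rho_mem_iff (hN : N.IsRank r) (h : T' ⟶ T) [IsOpenImmersion h] (e : h ≫ f = f')
    {V : T.Opens} (hV : V ≤ h.opensRange) (m : Γ((Scheme.Modules.pullback f).obj E, V)) :
    rho h e E V m ∈ (N.pull h e).carrier (h ⁻¹ᵁ V) ↔ m ∈ N.carrier V := by
  have key : ∀ (U : T.Opens) (n : ℕ) (v : Fin r ⊕ Fin n → Γ((Scheme.Modules.pullback f).obj E, U)),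
      N.IsSplit U v → (rho h e E (V ⊓ U) (res _ inf_le_left m) ∈
        (N.pull h e).carrier (h ⁻¹ᵁ (V ⊓ U)) ↔ res _ inf_le_left m ∈ N.carrier (V ⊓ U)) := by
    intro U n v hv
    rw [hv.mem_iff (V ⊓ U) inf_le_right,
      (hv.pull hN h e).mem_iff (h ⁻¹ᵁ (V ⊓ U)) (h.preimage_mono inf_le_right)]
    refine forall_congr' fun j => ?_
    have := congr_fun (hv.isFrame.coord_rho h e inf_le_right
      (res _ (inf_le_left : V ⊓ U ≤ V) m)) (.inr j)
    rw [this]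
    exact map_eq_zero_iff _ (funPull_injective h (V ⊓ U) (inf_le_left.trans hV))
  constructor
  · intro hm
    apply N.mem_of_locally
    intro x hx
    obtain ⟨U, n, v, hxU, hv⟩ := hN x
    refine ⟨V ⊓ U, inf_le_left, ⟨hx, hxU⟩, (key U n v hv).mp ?_⟩
    rw [← res_rho]
    exact (N.pull h e).res_mem _ _ _ _ hm
  · intro hm
    apply (N.pull h e).mem_of_locally
    intro x hx
    obtain ⟨U, n, v, hxU, hv⟩ := hN (h x)
    refine ⟨h ⁻¹ᵁ (V ⊓ U), h.preimage_mono inf_le_left, ⟨hx, hxU⟩, ?_⟩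
    rw [res_rho h e E inf_le_left]
    exact (key U n v hv).mpr (N.res_mem _ _ _ _ hm)

end Sub

end

section

variable {X : Scheme.{u}}

/-! ### The functor of locally split subsheaves -/

variable {T T' T'' : Scheme.{u}} {f : T ⟶ X} {f' : T' ⟶ X} {f'' : T'' ⟶ X} {E : X.Modules} {r : ℕ}

lemma Sub.funPull_bijective (h : T' ⟶ T) [IsOpenImmersion h] (U : T.Opens)
    (hU : U ≤ h.opensRange) : Function.Bijective (funPull h U) := by
  have : IsIso (h.app U) := by
    exact h.isIso_app U hU
  exact (ConcreteCategory.isIso_iff_bijective (h.app U)).mp inferInstance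

lemma IsFrame.of_rho (h : T' ⟶ T) [IsOpenImmersion h] (e : h ≫ f = f') {ι : Type} [Fintype ι]
    {U : T.Opens} (hU : U ≤ h.opensRange) {v : ι → Γ((Scheme.Modules.pullback f).obj E, U)}
    (hv : IsFrame ((Scheme.Modules.pullback f').obj E) (h ⁻¹ᵁ U)
      fun i => GrassmannBlowup.rho h e E U (v i)) :
    IsFrame ((Scheme.Modules.pullback f).obj E) U v := by
  intro V hV
  have h1 := (hv (h ⁻¹ᵁ V) (h.preimage_mono hV)).comp
    ((Sub.funPull_bijective h V (hV.trans hU)).comp_left (α := ι))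
  refine (Function.Bijective.of_comp_iff' (rho_bijective h e E V (hV.trans hU)) _).mp ?_
  convert! h1 using 1
  funext a
  simp only [Function.comp_apply, rho_sum_smul, res_rho h e E hV]

lemma rho_congr {k k' : T' ⟶ T} (hk : k = k') (e : k ≫ f = f') (e' : k' ≫ f = f') (V : T.Opens)
    (m : Γ((Scheme.Modules.pullback f).obj E, V)) :
    rho k e E V m = res _ (by rw [hk]) (rho k' e' E V m) := by
  subst hk
  rw [res_self]

namespace Sub

lemma rho_mem_pull (N : Sub ((Scheme.Modules.pullback f).obj E)) (h : T' ⟶ T) (e : h ≫ f = f')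
    {V : T.Opens} {m : Γ((Scheme.Modules.pullback f).obj E, V)} (hm : m ∈ N.carrier V) :
    rho h e E V m ∈ (N.pull h e).carrier (h ⁻¹ᵁ V) := by
  obtain ⟨n, rfl⟩ := N.mem_iff_exists_incl.mp hm
  rw [← pullbackSub_pull]
  exact mem_image_of_eq _

lemma pull_congr (N : Sub ((Scheme.Modules.pullback f).obj E)) {k k' : T' ⟶ T} (hk : k = k')
    (e : k ≫ f = f') (e' : k' ≫ f = f') : N.pull k e = N.pull k' e' := by
  subst hk
  rfl

variable {ι : Type*} {Y : ι → Scheme.{u}} (u : ∀ i, Y i ⟶ T) [∀ i, IsOpenImmersion (u i)]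
  (hu : ∀ x : T, ∃ i, x ∈ (u i).opensRange) {v : ∀ i, Y i ⟶ X} (e : ∀ i, u i ≫ f = v i)

include hu in
/-- Locally split subsheaves which agree on an open cover are equal. -/
lemma ext_of_cover {N N' : Sub ((Scheme.Modules.pullback f).obj E)} (hN : N.IsRank r)
    (hN' : N'.IsRank r) (h : ∀ i, N.pull (u i) (e i) = N'.pull (u i) (e i)) : N = N' := by
  have key : ∀ (i : ι) (V : T.Opens), V ≤ (u i).opensRange → ∀ m,
      (m ∈ N.carrier V ↔ m ∈ N'.carrier V) := by
    intro i V hV m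
    rw [← hN.rho_mem_iff (u i) (e i) hV, ← hN'.rho_mem_iff (u i) (e i) hV, h]
  ext V m
  constructor
  · intro hm
    refine N'.mem_of_locally V m fun x hx => ?_
    obtain ⟨i, hi⟩ := hu x
    exact ⟨V ⊓ (u i).opensRange, inf_le_left, ⟨hx, hi⟩,
      (key i _ inf_le_right _).mp (N.res_mem _ _ _ _ hm)⟩
  · intro hm
    refine N.mem_of_locally V m fun x hx => ?_
    obtain ⟨i, hi⟩ := hu x
    exact ⟨V ⊓ (u i).opensRange, inf_le_left, ⟨hx, hi⟩,
      (key i _ inf_le_right _).mpr (N'.res_mem _ _ _ _ hm)⟩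

/-- The gluing of subsheaves given on an open cover. -/
def glue (N : ∀ i, Sub ((Scheme.Modules.pullback (v i)).obj E)) :
    Sub ((Scheme.Modules.pullback f).obj E) where
  carrier V :=
    { carrier := {m | ∀ i, rho (u i) (e i) E V m ∈ (N i).carrier (u i ⁻¹ᵁ V)}
      add_mem' := fun ha hb i => by
        rw [map_add]
        exact Submodule.add_mem _ (ha i) (hb i)
      zero_mem' := fun i => by
        rw [map_zero]
        exact Submodule.zero_mem _
      smul_mem' := fun a m hm i => by
        rw [rho_smul]
        exact Submodule.smul_mem _ _ (hm i) }
  res_mem U V h m hm i := by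
    rw [← res_rho (u i) (e i) E h]
    exact (N i).res_mem _ _ _ _ (hm i)
  mem_of_locally U m hm i := by
    refine (N i).mem_of_locally _ _ fun y hy => ?_
    obtain ⟨W, hW, hyW, h⟩ := hm (u i y) hy
    refine ⟨u i ⁻¹ᵁ W, (u i).preimage_mono hW, hyW, ?_⟩
    rw [res_rho (u i) (e i) E hW]
    exact h i

section glue

variable {N : ∀ i, Sub ((Scheme.Modules.pullback (v i)).obj E)} (hN : ∀ i, (N i).IsRank r)
  (hc : ∀ (i j : ι) (Z : Scheme.{u}) (gi : Z ⟶ Y i) (gj : Z ⟶ Y j) (w : Z ⟶ X)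
    (ei : gi ≫ v i = w) (ej : gj ≫ v j = w), gi ≫ u i = gj ≫ u j →
      (N i).pull gi ei = (N j).pull gj ej)

include hN hc in
-- For another index `j`, membership is tested on the fibre product of `Y i` and `Y j` over `T`. Its
-- projection to `Y j` is an open immersion whose range contains the preimage of `V`, and there the
-- two pulled-back subsheaves agree.
lemma mem_glue_iff (i : ι) {V : T.Opens} (hV : V ≤ (u i).opensRange)
    (m : Γ((Scheme.Modules.pullback f).obj E, V)) :
    m ∈ (glue u e N).carrier V ↔ rho (u i) (e i) E V m ∈ (N i).carrier (u i ⁻¹ᵁ V) := by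
  refine ⟨fun h => h i, fun h j => ?_⟩
  let gi := pullback.fst (u i) (u j)
  let gj := pullback.snd (u i) (u j)
  have hg : gi ≫ u i = gj ≫ u j := pullback.condition
  have hij : gi ≫ v i = gj ≫ v j := by
    rw [← e i, ← e j, ← Category.assoc, ← Category.assoc, hg]
  have hrange : u j ⁻¹ᵁ V ≤ gj.opensRange := by
    intro y hy
    have hy' : y ∈ Set.range gj := by
      rw [Scheme.Pullback.range_snd]
      exact hV hy
    exact hy'
  refine ((hN j).rho_mem_iff gj rfl hrange _).mp ?_
  rw [← hc i j _ gi gj _ hij rfl hg]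
  have hf : (gi ≫ u i) ≫ f = gj ≫ v j := by rw [Category.assoc, e, hij]
  have hf' : (gj ≫ u j) ≫ f = gj ≫ v j := by rw [Category.assoc, e]
  have h1 : rho gi hij E (u i ⁻¹ᵁ V) (rho (u i) (e i) E V m) ∈
      ((N i).pull gi hij).carrier (gi ⁻¹ᵁ u i ⁻¹ᵁ V) := rho_mem_pull _ _ _ h
  rw [rho_rho (u i) (e i) E gi hij hf] at h1
  rw [rho_rho (u j) (e j) E gj rfl hf', rho_congr hg.symm hf' hf]
  exact Sub.res_mem _ _ _ _ _ h1

include hN hc in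
-- A splitting frame on `Y i` descends to its open image in `T`, because `rho` is bijective over
-- opens in the range of an open immersion.
lemma exists_isSplit_glue (i : ι) (y : Y i) : ∃ (U : T.Opens) (n : ℕ)
    (t : Fin r ⊕ Fin n → Γ((Scheme.Modules.pullback f).obj E, U)), u i y ∈ U ∧
      (glue u e N).IsSplit U t ∧
        (N i).IsSplit (u i ⁻¹ᵁ U) fun j => rho (u i) (e i) E U (t j) := by
  obtain ⟨U, n, s, hyU, hs⟩ := hN i y
  have hU : u i ⁻¹ᵁ u i ''ᵁ U = U := (u i).preimage_image_eq U
  have hr : u i ''ᵁ U ≤ (u i).opensRange := (u i).image_le_opensRange U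
  choose t ht using fun j => (rho_bijective (u i) (e i) E (u i ''ᵁ U) hr).2 (res _ hU.le (s j))
  have hst : (N i).IsSplit (u i ⁻¹ᵁ u i ''ᵁ U)
      fun j => rho (u i) (e i) E (u i ''ᵁ U) (t j) := by
    simpa only [ht] using hs.res hU.le
  have htF : IsFrame ((Scheme.Modules.pullback f).obj E) (u i ''ᵁ U) t :=
    IsFrame.of_rho (u i) (e i) hr hst.isFrame
  refine ⟨u i ''ᵁ U, n, t, ⟨y, hyU, rfl⟩, ⟨htF, fun V hV m => ?_⟩, hst⟩
  rw [mem_glue_iff u e hN hc i (hV.trans hr), hst.mem_iff _ ((u i).preimage_mono hV),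
    htF.coord_rho (u i) (e i) hV]
  exact forall_congr' fun j => map_eq_zero_iff _ (funPull_bijective (u i) V (hV.trans hr)).1

include hu hN hc in
lemma isRank_glue : (glue u e N).IsRank r := by
  intro x
  obtain ⟨i, y, rfl⟩ := hu x
  obtain ⟨U, n, t, hy, ht, -⟩ := exists_isSplit_glue u e hN hc i y
  exact ⟨U, n, t, hy, ht⟩

include hu hN hc in
lemma pull_glue (i : ι) : (glue u e N).pull (u i) (e i) = N i := by
  apply ext_of_isSplit
  intro y
  obtain ⟨U, n, t, hy, ht, ht'⟩ := exists_isSplit_glue u e hN hc i y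
  exact ⟨u i ⁻¹ᵁ U, Fin r, Fin n, inferInstance, inferInstance, _, hy,
    ht.pull (isRank_glue u hu e hN hc) (u i) (e i), ht'⟩

end glue

end Sub

/-- A morphism to `X` with a locally split subsheaf of rank `r` of the pullback of `E`. -/
structure GrPoint (E : X.Modules) (r : ℕ) (T : Scheme.{u}) : Type u where
  hom : T ⟶ X
  sub : Sub ((Scheme.Modules.pullback hom).obj E)
  isRank : sub.IsRank r

namespace GrPoint

variable (p : GrPoint E r T)

/-- Pullback of points. -/
def map (h : T' ⟶ T) : GrPoint E r T' := ⟨h ≫ p.hom, p.sub.pull h rfl, p.isRank.pull h rfl⟩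

variable {p}

/-- The subsheaves live in pullbacks along different morphisms; comparing them after pullback along
the identity avoids transport along an equality. -/
lemma ext_pull {q : GrPoint E r T} (h : 𝟙 T ≫ p.hom = q.hom)
    (hs : p.sub.pull (𝟙 T) h = q.sub) : p = q := by
  obtain ⟨f, N, hN⟩ := p
  obtain ⟨g, N', hN'⟩ := q
  have : f = g := by simpa using h
  subst this
  have : N = N' := (hN.pull_id h).symm.trans hs
  subst this
  rfl

variable (p) in
lemma map_id : p.map (𝟙 T) = p :=
  (ext_pull (by simp [map]) rfl : p = p.map (𝟙 T)).symm

lemma eq_map_iff {p : GrPoint E r T'} {q : GrPoint E r T} (h : T' ⟶ T) :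
    q.map h = p ↔ ∃ e : h ≫ q.hom = p.hom, q.sub.pull h e = p.sub := by
  constructor
  · rintro rfl
    exact ⟨rfl, rfl⟩
  · rintro ⟨e, he⟩
    refine ext_pull (by simpa [map] using e) ?_
    refine Eq.trans ?_ he
    refine (q.isRank.pull_pull h rfl (𝟙 T') _ (by simpa using e)).trans ?_
    exact q.sub.pull_congr (Category.id_comp h) _ _

variable (p) in
lemma map_map (h : T' ⟶ T) (k : T'' ⟶ T') : (p.map h).map k = p.map (k ≫ h) := by
  refine ((eq_map_iff (k ≫ h)).mpr ⟨by simp [map], ?_⟩).symm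
  exact (p.isRank.pull_pull h rfl k rfl (by simp)).symm

lemma pull_eq_of_map_eq {q : GrPoint E r T'} {h : T'' ⟶ T} {k : T'' ⟶ T'}
    (hpq : p.map h = q.map k) {w : T'' ⟶ X} (e : h ≫ p.hom = w) (e' : k ≫ q.hom = w) :
    p.sub.pull h e = q.sub.pull k e' := by
  subst e'
  obtain ⟨e'', h2⟩ := (eq_map_iff h).mp hpq
  exact h2

end GrPoint

/-- The functor of points of the Grassmann bundle. -/
def grFunctor (E : X.Modules) (r : ℕ) : Scheme.{u}ᵒᵖ ⥤ Type u where
  obj T := GrPoint E r T.unop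
  map h := TypeCat.ofHom fun p : GrPoint E r _ => p.map h.unop
  map_id T := by
    ext p
    exact GrPoint.map_id p
  map_comp h k := by
    ext p
    exact (GrPoint.map_map p h.unop k.unop).symm

lemma GrPoint.existsUnique_glue {S : Scheme.{u}} (𝓤 : Scheme.OpenCover S)
    (x : ∀ i, GrPoint E r (𝓤.X i))
    (hx : ∀ (i j : 𝓤.I₀) (Z : Scheme.{u}) (gi : Z ⟶ 𝓤.X i) (gj : Z ⟶ 𝓤.X j),
      gi ≫ 𝓤.f i = gj ≫ 𝓤.f j → (x i).map gi = (x j).map gj) :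
    ∃! p : GrPoint E r S, ∀ i, p.map (𝓤.f i) = x i := by
  have hu : ∀ s : S, ∃ i, s ∈ (𝓤.f i).opensRange := fun s => 𝓤.exists_eq s
  let f : S ⟶ X := 𝓤.glueMorphisms (fun j => (x j).hom) fun i j =>
    congr_arg GrPoint.hom (hx i j _ _ _ pullback.condition)
  have e : ∀ i, 𝓤.f i ≫ f = (x i).hom := fun i => 𝓤.ι_glueMorphisms _ _ i
  have hc : ∀ (i j : 𝓤.I₀) (Z : Scheme.{u}) (gi : Z ⟶ 𝓤.X i) (gj : Z ⟶ 𝓤.X j) (w : Z ⟶ X)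
    (ei : gi ≫ (x i).hom = w) (ej : gj ≫ (x j).hom = w), gi ≫ 𝓤.f i = gj ≫ 𝓤.f j →
      (x i).sub.pull gi ei = (x j).sub.pull gj ej := fun i j Z gi gj w ei ej h =>
    GrPoint.pull_eq_of_map_eq (hx i j Z gi gj h) ei ej
  have hN := fun i => (x i).isRank
  let p : GrPoint E r S := ⟨f, Sub.glue 𝓤.f e fun i => (x i).sub, Sub.isRank_glue 𝓤.f hu e hN hc⟩
  have hp : ∀ i, p.map (𝓤.f i) = x i := fun i => (GrPoint.eq_map_iff _).mpr
    ⟨e i, Sub.pull_glue 𝓤.f hu e hN hc i⟩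
  refine ⟨p, hp, fun q hq => ?_⟩
  have hpq : q.hom = p.hom := 𝓤.hom_ext _ _ fun i =>
    congr_arg GrPoint.hom ((hq i).trans (hp i).symm)
  refine GrPoint.ext_pull (by simpa using hpq) ?_
  refine Sub.ext_of_cover 𝓤.f hu e (q.isRank.pull _ _) p.isRank fun i => ?_
  have e' : 𝓤.f i ≫ q.hom = (x i).hom := by rw [hpq]; exact e i
  refine Eq.trans (q.isRank.pull_pull _ _ _ _ (by simpa using e')) ?_
  refine Eq.trans ?_ (GrPoint.pull_eq_of_map_eq ((hq i).trans (hp i).symm) e' (e i))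
  exact q.sub.pull_congr (Category.comp_id _) _ _

lemma grFunctor_isSheaf (E : X.Modules) (r : ℕ) :
    Presieve.IsSheaf Scheme.zariskiTopology (grFunctor E r) := by
  rw [Precoverage.isSheaf_toGrothendieck_iff_of_isStableUnderBaseChange]
  rintro S R hR
  obtain ⟨(𝓤 : Scheme.OpenCover S), rfl⟩ := Scheme.exists_cover_of_mem_pretopology hR
  exact (Presieve.isSheafFor_arrows_iff _ _).mpr fun x hx => GrPoint.existsUnique_glue 𝓤 x hx

end

section

variable {X : Scheme.{u}}

/-! ### Graphs -/

section shear

variable {M : X.Modules} {U : X.Opens} {ι κ : Type} [Fintype ι] [Fintype κ]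

/-- The family `e_i + ∑ c_ji e_j, e_j`. -/
def shear (e : ι ⊕ κ → Γ(M, U)) (c : κ → ι → Γ(X, U)) : ι ⊕ κ → Γ(M, U) :=
  Sum.elim (fun i => e (.inl i) + ∑ j, c j i • e (.inr j)) fun j => e (.inr j)

omit [Fintype ι] in
lemma res_shear (e : ι ⊕ κ → Γ(M, U)) (c : κ → ι → Γ(X, U)) {V : X.Opens} (h : V ≤ U) :
    (fun i => res M h (shear e c i)) =
      shear (fun i => res M h (e i)) fun j i => resFun X h (c j i) := by
  funext i
  cases i with
  | inl i => simp [shear, res_smul]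
  | inr j => rfl

lemma IsFrame.shear {e : ι ⊕ κ → Γ(M, U)} (he : IsFrame M U e) (c : κ → ι → Γ(X, U)) :
    IsFrame M U (shear e c) := by
  classical
  have hP : IsUnit (Matrix.fromBlocks 1 0 (Matrix.of c) 1 : Matrix (ι ⊕ κ) (ι ⊕ κ) Γ(X, U)) := by
    rw [Matrix.isUnit_iff_isUnit_det]
    simp
  convert! he.of_matrix _ hP using 1
  funext i
  cases i with
  | inl i => simp [GrassmannBlowup.shear, Fintype.sum_sum_type, Matrix.one_apply, ite_smul]
  | inr j => simp [GrassmannBlowup.shear, Fintype.sum_sum_type, Matrix.one_apply, ite_smul]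

lemma IsFrame.coord_shear {e : ι ⊕ κ → Γ(M, U)} (he : IsFrame M U e) (c : κ → ι → Γ(X, U))
    {V : X.Opens} (h : V ≤ U) (m : Γ(M, V)) :
    (he.shear c).coord h m = Sum.elim (fun i => he.coord h m (.inl i)) fun j =>
      he.coord h m (.inr j) - ∑ i, resFun X h (c j i) * he.coord h m (.inl i) := by
  apply IsFrame.coord_eq
  conv_rhs => rw [← he.sum_coord h m]
  simp only [Fintype.sum_sum_type, GrassmannBlowup.shear, Sum.elim_inl, Sum.elim_inr, map_add,
    map_sum, res_smul, smul_add, sub_smul, Finset.sum_add_distrib, Finset.sum_sub_distrib,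
    Finset.sum_smul, Finset.smul_sum, smul_smul]
  rw [add_assoc, Finset.sum_comm (s := Finset.univ (α := ι))]
  congr 1
  rw [add_sub_left_comm, add_eq_left, sub_eq_zero]
  exact Finset.sum_congr rfl fun j _ => Finset.sum_congr rfl fun i _ => by rw [mul_comm]

end shear

namespace Sub

variable {M : X.Modules} {U V : X.Opens} {ι κ : Type} [Fintype ι] [Fintype κ]
  {N : Sub M} {e : ι ⊕ κ → Γ(M, U)}

/-- The subsheaf spanned over an open containing everything by the first part of a frame. -/
def ofFrame (he : IsFrame M U e) (hU : ⊤ ≤ U) : Sub M where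
  carrier V :=
    { carrier := {m | ∀ j, he.coord (le_top.trans hU) m (.inr j) = 0}
      add_mem' := fun ha hb j => by simp [ha j, hb j]
      zero_mem' := fun j => by simp
      smul_mem' := fun r m hm j => by simp [hm j] }
  res_mem V W h m hm j := by
    have := congr_fun (he.coord_res (le_top.trans hU) h m) (.inr j)
    rw [this, hm j, map_zero]
  mem_of_locally V m hm j := by
    apply fun_eq_of_locally_eq
    intro x hx
    obtain ⟨W, h, hxW, hW⟩ := hm x hx
    refine ⟨W, h, hxW, ?_⟩
    have := congr_fun (he.coord_res (le_top.trans hU) h m) (.inr j)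
    rw [map_zero]
    exact this.symm.trans (hW j)

lemma isSplit_ofFrame (he : IsFrame M U e) (hU : ⊤ ≤ U) : (ofFrame he hU).IsSplit U e :=
  ⟨he, fun _ _ _ => Iff.rfl⟩

lemma IsSplit.of_locally {v : ι ⊕ κ → Γ(M, V)} (h : ∀ x ∈ V, ∃ (W : X.Opens) (hW : W ≤ V), x ∈ W ∧
    N.IsSplit W fun i => GrassmannBlowup.res M hW (v i)) : N.IsSplit V v := by
  have hF : IsFrame M V v := IsFrame.of_locally fun x hx => by
    obtain ⟨W, hW, hxW, hs⟩ := h x hx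
    exact ⟨W, hW, hxW, hs.isFrame⟩
  refine ⟨hF, fun W hW m => ?_⟩
  have key : ∀ x ∈ W, ∃ (W' : X.Opens) (h : W' ≤ W), x ∈ W' ∧
      (GrassmannBlowup.res M h m ∈ N.carrier W' ↔ ∀ j, resFun X h (hF.coord hW m (.inr j)) = 0) := by
    intro x hx
    obtain ⟨W', hW', hxW', hs⟩ := h x (hW hx)
    refine ⟨W ⊓ W', inf_le_left, ⟨hx, hxW'⟩, ?_⟩
    rw [hs.mem_iff _ inf_le_right]
    refine forall_congr' fun j => ?_
    have h1 := congr_fun (hF.coord_res_res hW' (inf_le_right : W ⊓ W' ≤ W')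
      (GrassmannBlowup.res M inf_le_left m)) (.inr j)
    have h2 := congr_fun (hF.coord_res hW (inf_le_left : W ⊓ W' ≤ W) m) (.inr j)
    exact Eq.congr_left (h1.trans h2)
  constructor
  · intro hm j
    apply fun_eq_of_locally_eq
    intro x hx
    obtain ⟨W', h, hxW', hk⟩ := key x hx
    exact ⟨W', h, hxW', by rw [map_zero]; exact hk.mp (N.res_mem _ _ _ _ hm) j⟩
  · intro hm
    apply N.mem_of_locally
    intro x hx
    obtain ⟨W', h, hxW', hk⟩ := key x hx
    exact ⟨W', h, hxW', hk.mpr fun j => by rw [hm j, map_zero]⟩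

/-- `N` is on `V` the graph, in the frame `e`, of the matrix `c`. -/
def IsGraph (N : Sub M) (e : ι ⊕ κ → Γ(M, U)) (hV : V ≤ U) (c : κ → ι → Γ(X, V)) : Prop :=
  N.IsSplit V (shear (fun i => GrassmannBlowup.res M hV (e i)) c)

lemma IsGraph.res {hV : V ≤ U} {c : κ → ι → Γ(X, V)} (h : N.IsGraph e hV c) {W : X.Opens}
    (hW : W ≤ V) : N.IsGraph e (hW.trans hV) fun j i => resFun X hW (c j i) := by
  have := IsSplit.res h hW
  rw [res_shear] at this
  simp only [res_res] at this
  exact this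

/-- The vector `e_i + ∑ c'_ji e_j` lies in the graph of `c`, and the coordinates that must vanish
are the differences `c'_ji - c_ji`. -/
lemma IsGraph.unique (he : IsFrame M U e) {hV : V ≤ U} {c c' : κ → ι → Γ(X, V)}
    (h : N.IsGraph e hV c) (h' : N.IsGraph e hV c') : c = c' := by
  classical
  have heV := he.res hV
  funext j i
  have h1 := h'.inl_mem i
  have h2 : shear (fun i => GrassmannBlowup.res M hV (e i)) c' (.inl i) =
      ∑ k, (Sum.elim (Pi.single i 1) fun j => c' j i : ι ⊕ κ → Γ(X, V)) k •
        GrassmannBlowup.res M le_rfl (GrassmannBlowup.res M hV (e k)) := by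
    simp [shear, Fintype.sum_sum_type, Pi.single_apply, ite_smul, res_self]
  have h3 := (h.mem_iff V le_rfl _).mp h1 j
  have h4 := congr_fun (heV.coord_shear c le_rfl
    (shear (fun i => GrassmannBlowup.res M hV (e i)) c' (.inl i))) (.inr j)
  rw [h2, heV.coord_sum] at h4
  rw [← h2] at h4
  have h5 := h4.symm.trans h3
  simp [Pi.single_apply, resFun_self] at h5
  exact (sub_eq_zero.mp h5).symm

/-- The largest open on which `N` is a graph in the frame `e`. -/
def graphLocus (N : Sub M) (e : ι ⊕ κ → Γ(M, U)) : X.Opens :=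
  sSup {V | ∃ (hV : V ≤ U) (c : κ → ι → Γ(X, V)), N.IsGraph e hV c}

lemma mem_graphLocus {x : X} : x ∈ N.graphLocus e ↔ ∃ (V : X.Opens) (hV : V ≤ U)
    (c : κ → ι → Γ(X, V)), x ∈ V ∧ N.IsGraph e hV c := by
  simp only [graphLocus, Opens.mem_sSup, Set.mem_ofPred_eq]
  constructor
  · rintro ⟨V, ⟨hV, c, h⟩, hx⟩
    exact ⟨V, hV, c, hx, h⟩
  · rintro ⟨V, hV, c, hx, h⟩
    exact ⟨V, ⟨hV, c, h⟩, hx⟩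

lemma graphLocus_le : N.graphLocus e ≤ U := by
  intro x hx
  obtain ⟨V, hV, c, hxV, -⟩ := mem_graphLocus.mp hx
  exact hV hxV

/-- The local matrices agree on overlaps by `IsGraph.unique`, so they glue. -/
lemma exists_isGraph (he : IsFrame M U e) (hV : V ≤ N.graphLocus e) :
    ∃ c : κ → ι → Γ(X, V), N.IsGraph e (hV.trans graphLocus_le) c := by
  have key : ∀ x : V, ∃ (W : X.Opens) (h : W ≤ V) (_ : x.1 ∈ W) (c : κ → ι → Γ(X, W)),
      N.IsGraph e ((h.trans hV).trans graphLocus_le) c := by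
    rintro ⟨x, hx⟩
    obtain ⟨W, hW, c, hxW, h⟩ := mem_graphLocus.mp (hV hx)
    exact ⟨V ⊓ W, inf_le_left, ⟨hx, hxW⟩, _, h.res inf_le_right⟩
  choose W hW hxW c hc using key
  have glue : ∀ j i, ∃ t : Γ(X, V), ∀ x : V, resFun X (hW x) t = c x j i := by
    intro j i
    obtain ⟨t, ht, -⟩ := exists_glue (structureModule X) W V hW
      (fun x hx => Opens.mem_iSup.mpr ⟨⟨x, hx⟩, hxW ⟨x, hx⟩⟩) (fun x => c x j i) (by
        intro x y
        have h1 := (hc x).res (inf_le_left : W x ⊓ W y ≤ _)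
        have h2 := (hc y).res (inf_le_right : W x ⊓ W y ≤ _)
        exact congr_fun (congr_fun (h1.unique he h2) j) i)
    exact ⟨t, ht⟩
  choose t ht using glue
  refine ⟨t, IsSplit.of_locally fun x hx => ⟨W ⟨x, hx⟩, hW _, hxW _, ?_⟩⟩
  rw [res_shear]
  simp only [ht, res_res]
  exact hc ⟨x, hx⟩

end Sub

/-! ### Charts of the Grassmann functor -/

section chart

variable {T T' : Scheme.{u}} {f : T ⟶ X} {f' : T' ⟶ X} {E : X.Modules} {r n : ℕ}

lemma rho_shear (h : T' ⟶ T) (e : h ≫ f = f') {U : T.Opens} {ι κ : Type} [Fintype κ]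
    (v : ι ⊕ κ → Γ((Scheme.Modules.pullback f).obj E, U)) (c : κ → ι → Γ(T, U)) :
    (fun i => rho h e E U (shear v c i)) =
      shear (fun i => rho h e E U (v i)) fun j i => funPull h U (c j i) := by
  funext i
  cases i with
  | inl i =>
    simp only [shear, Sum.elim_inl, map_add]
    rw [rho_sum_smul]
  | inr j => rfl

namespace Sub

variable {N : Sub ((Scheme.Modules.pullback f).obj E)} {U V : T.Opens}

lemma IsGraph.pull (hN : N.IsRank r) (h : T' ⟶ T) (e : h ≫ f = f') {ι κ : Type} [Fintype ι]
    [Fintype κ] {b : ι ⊕ κ → Γ((Scheme.Modules.pullback f).obj E, U)} {hV : V ≤ U}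
    {c : κ → ι → Γ(T, V)} (hc : N.IsGraph b hV c) :
    (N.pull h e).IsGraph (fun i => rho h e E U (b i)) (h.preimage_mono hV)
      fun j i => funPull h V (c j i) := by
  have := IsSplit.pull hN h e hc
  rw [rho_shear] at this
  simp only [← res_rho h e E hV] at this
  exact this

/-- A graph projects isomorphically onto the span of the first block of `e`. The matrix is that of
the projection in the basis of `N` given by `v`; its inverse `Q` writes the graph vectors in that
basis. -/
lemma isUnit_det_of_isGraph {M : X.Modules} {N : Sub M} {U : X.Opens} {ι κ κ' : Type} [Fintype ι]
    [Fintype κ] [Fintype κ'] [DecidableEq ι] {e : ι ⊕ κ → Γ(M, U)} (he : IsFrame M U e)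
    {c : κ → ι → Γ(X, U)} (hc : N.IsGraph e le_rfl c) {v : ι ⊕ κ' → Γ(M, U)} (hv : N.IsSplit U v) :
    IsUnit (Matrix.of fun i j => he.coord le_rfl (v (.inl j)) (.inl i)).det := by
  have hw : ∀ i, shear (fun i => GrassmannBlowup.res M le_rfl (e i)) c (.inl i) ∈ N.carrier U :=
    fun i => hc.inl_mem i
  choose Q hQ using fun i => (hv.mem_iff_exists le_rfl).mp (hw i)
  have key : (Matrix.of fun i j => he.coord le_rfl (v (.inl j)) (.inl i)) *
      (Matrix.of fun j i => Q i j) = 1 := by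
    ext k i
    have h1 := congr_arg (fun m => he.coord le_rfl m (.inl k)) (hQ i)
    simp only [map_sum, map_smul, Finset.sum_apply, Pi.smul_apply, smul_eq_mul, res_self] at h1
    rw [Matrix.mul_apply]
    simp only [Matrix.of_apply]
    refine Eq.trans (Finset.sum_congr rfl fun j _ => mul_comm _ _) (h1.trans ?_)
    have h2 : shear e c (.inl i) = ∑ k, (Sum.elim (Pi.single i 1) fun j => c j i :
        ι ⊕ κ → Γ(X, U)) k • GrassmannBlowup.res M le_rfl (e k) := by
      simp [shear, Fintype.sum_sum_type, Pi.single_apply, ite_smul, res_self]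
    rw [h2, he.coord_sum]
    simp [Pi.single_apply, Matrix.one_apply]
  rw [← Matrix.isUnit_iff_isUnit_det]
  exact IsUnit.of_mul_eq_one _ key

/-- Multiplying the basis of `N` by the inverse of its first block makes that block the identity;
the remaining coordinates are the matrix of the graph. -/
lemma exists_isGraph_of_isUnit_det {M : X.Modules} {N : Sub M} {U : X.Opens} {ι κ κ' : Type}
    [Fintype ι] [Fintype κ] [Fintype κ'] [DecidableEq ι] {e : ι ⊕ κ → Γ(M, U)} (he : IsFrame M U e)
    {v : ι ⊕ κ' → Γ(M, U)} (hv : N.IsSplit U v)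
    (hdet : IsUnit (Matrix.of fun i j => he.coord le_rfl (v (.inl j)) (.inl i)).det) :
    ∃ c, N.IsGraph e le_rfl c := by
  set P : Matrix ι ι Γ(X, U) := Matrix.of fun i j => he.coord le_rfl (v (.inl j)) (.inl i) with hP
  rw [← Matrix.isUnit_iff_isUnit_det] at hdet
  obtain ⟨Q, hPQ, hQP⟩ := isUnit_iff_exists.mp hdet
  let w : ι → Γ(M, U) := fun i => ∑ j, Q j i • v (.inl j)
  have hw : ∀ i, w i ∈ N.carrier U := fun i =>
    Submodule.sum_mem _ fun j _ => Submodule.smul_mem _ _ (hv.inl_mem j)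
  have hwc : ∀ i k, he.coord le_rfl (w i) (.inl k) = (1 : Matrix ι ι Γ(X, U)) k i := by
    intro i k
    simp only [w, map_sum, map_smul, Finset.sum_apply, Pi.smul_apply, smul_eq_mul]
    rw [← hPQ, Matrix.mul_apply]
    exact Finset.sum_congr rfl fun j _ => mul_comm _ _
  let c : κ → ι → Γ(X, U) := fun j i => he.coord le_rfl (w i) (.inr j)
  have hwe : ∀ i, w i = shear e c (.inl i) := by
    intro i
    conv_lhs => rw [← he.sum_coord le_rfl (w i)]
    simp [Fintype.sum_sum_type, shear, c, hwc, Matrix.one_apply, ite_smul, res_self]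
  refine ⟨c, ?_⟩
  simp only [IsGraph, res_self]
  apply IsSplit.of_mem_iff_exists (he.shear c)
  intro W hW m
  rw [hv.mem_iff_exists hW]
  simp only [← hwe]
  have hwr : ∀ i, GrassmannBlowup.res M hW (w i) =
      ∑ j, resFun X hW (Q j i) • GrassmannBlowup.res M hW (v (.inl j)) := fun i =>
    res_sum_smul _ _ _ _
  constructor
  · rintro ⟨a, rfl⟩
    refine ⟨fun i => ∑ j, resFun X hW (P i j) * a j, ?_⟩
    simp only [hwr, Finset.smul_sum, smul_smul]
    rw [Finset.sum_comm]
    refine Finset.sum_congr rfl fun k _ => ?_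
    rw [← Finset.sum_smul]
    congr 1
    simp only [Finset.sum_mul]
    rw [Finset.sum_comm]
    have : ∀ j, ∑ i, resFun X hW (P i j) * a j * resFun X hW (Q k i) =
        resFun X hW ((1 : Matrix ι ι Γ(X, U)) k j) * a j := by
      intro j
      rw [← hQP, Matrix.mul_apply, map_sum, Finset.sum_mul]
      exact Finset.sum_congr rfl fun i _ => by rw [map_mul]; ring
    simp only [this]
    simp [Matrix.one_apply, apply_ite]
  · rintro ⟨a, rfl⟩
    refine ⟨fun j => ∑ i, a i * resFun X hW (Q j i), ?_⟩
    simp only [hwr, Finset.smul_sum, Finset.sum_smul, smul_smul]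
    rw [Finset.sum_comm]

lemma mem_graphLocus_of_mem_basicOpen {M : X.Modules} {N : Sub M} {U : X.Opens} {ι κ κ' : Type}
    [Fintype ι] [Fintype κ] [Fintype κ'] [DecidableEq ι] {e : ι ⊕ κ → Γ(M, U)} (he : IsFrame M U e)
    {v : ι ⊕ κ' → Γ(M, U)} (hv : N.IsSplit U v) {x : X} (hx : x ∈ X.basicOpen
      (Matrix.of fun i j => he.coord le_rfl (v (.inl j)) (.inl i)).det) : x ∈ N.graphLocus e := by
  set d := (Matrix.of fun i j => he.coord le_rfl (v (.inl j)) (.inl i)).det with hd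
  have hD : X.basicOpen d ≤ U := X.basicOpen_le d
  have heD := he.res hD
  obtain ⟨c, hc⟩ := exists_isGraph_of_isUnit_det heD (hv.res hD) (by
    have hdD : (Matrix.of fun i j => heD.coord le_rfl (GrassmannBlowup.res _ hD (v (.inl j)))
        (.inl i)).det = resFun X hD d := by
      refine Eq.trans ?_ (congr_arg (resFun X hD) hd).symm
      rw [RingHom.map_det]
      congr 1
      ext i j
      have h1 := congr_fun (he.coord_res_res hD le_rfl (GrassmannBlowup.res _ hD (v (.inl j))))
        (.inl i)
      have h2 := congr_fun (he.coord_res le_rfl hD (v (.inl j))) (.inl i)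
      exact h1.trans h2
    rw [hdD]
    exact X.toRingedSpace.isUnit_res_basicOpen d)
  refine mem_graphLocus.mpr ⟨X.basicOpen d, hD, c, hx, ?_⟩
  simp only [IsGraph, res_self] at hc ⊢
  exact hc

/-- Membership in the graph locus can be tested after pullback. -/
lemma mem_graphLocus_of_pull (hN : N.IsRank r) (h : T' ⟶ T) (e : h ≫ f = f') {κ : Type}
    [Fintype κ] {b : Fin r ⊕ κ → Γ((Scheme.Modules.pullback f).obj E, U)}
    (hb : IsFrame ((Scheme.Modules.pullback f).obj E) U b) {t : T'}
    (ht : t ∈ (N.pull h e).graphLocus fun i => rho h e E U (b i)) : h t ∈ N.graphLocus b := by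
  obtain ⟨V', hV', c, htV', hc⟩ := mem_graphLocus.mp ht
  obtain ⟨U₁, n, v, htU₁, hv⟩ := hN (h t)
  have hU : h t ∈ U := hV' htV'
  let W : T.Opens := U ⊓ U₁
  have hbW := hb.res (inf_le_left : W ≤ U)
  have hvW := hv.res (inf_le_right : W ≤ U₁)
  set d := (Matrix.of fun i j => hbW.coord le_rfl (res _ inf_le_right (v (.inl j))) (.inl i)).det
    with hd
  let W' : T'.Opens := h ⁻¹ᵁ W ⊓ V'
  have hW' : W' ≤ h ⁻¹ᵁ W := inf_le_left
  have hb' := (hbW.rho h e E).res hW'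
  have hc' : (N.pull h e).IsGraph (fun i => res _ hW' (rho h e E W (res _ inf_le_left (b i))))
      le_rfl fun j i => resFun T' inf_le_right (c j i) := by
    have := hc.res (inf_le_right : W' ≤ V')
    have hfun : (fun i => res _ hW' (rho h e E W (res _ inf_le_left (b i)))) =
        fun i => res _ (hW'.trans (h.preimage_mono inf_le_left)) (rho h e E U (b i)) := by
      funext i
      rw [← res_rho h e E (inf_le_left : W ≤ U), res_res]
    rw [hfun]
    simp only [IsGraph, res_self] at this ⊢
    exact this
  have hv' := (hvW.pull hN h e).res hW'
  have hdet := isUnit_det_of_isGraph hb' hc' hv'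
  have hd' : (Matrix.of fun i j => hb'.coord le_rfl (res _ hW' (rho h e E W
      (res _ inf_le_right (v (.inl j))))) (.inl i)).det = resFun T' hW' (funPull h W d) := by
    rw [hd, RingHom.map_det, RingHom.map_det]
    congr 1
    ext i j
    have h1 := congr_fun ((hbW.rho h e E).coord_res_res hW' le_rfl (res _ hW' (rho h e E W
      (res _ inf_le_right (v (.inl j)))))) (.inl i)
    have h2 := congr_fun ((hbW.rho h e E).coord_res le_rfl hW' (rho h e E W
      (res _ inf_le_right (v (.inl j))))) (.inl i)
    have h3 := congr_fun (hbW.coord_rho h e le_rfl (res _ inf_le_right (v (.inl j)))) (.inl i)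
    refine h1.trans (h2.trans ?_)
    exact congr_arg (resFun T' hW') h3
  rw [hd'] at hdet
  -- The determinant upstairs is the pullback of `d`, and basic opens pull back to basic opens, so
  -- its invertibility at `t` gives that of `d` at `h t`.
  have hmem : h t ∈ T.basicOpen d := by
    have h1 : t ∈ T'.basicOpen (resFun T' hW' (funPull h W d)) := by
      rw [T'.basicOpen_of_isUnit hdet]
      exact ⟨⟨hU, htU₁⟩, htV'⟩
    have h2 : t ∈ T'.basicOpen (funPull h W d) := by
      have := T'.basicOpen_res (funPull h W d) (homOfLE hW').op
      exact (this.le h1).2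
    exact (Scheme.preimage_basicOpen h d).ge h2
  have := mem_graphLocus_of_mem_basicOpen hbW hvW hmem
  obtain ⟨V, hV, c', hxV, hc'⟩ := mem_graphLocus.mp this
  refine mem_graphLocus.mpr ⟨V, hV.trans inf_le_left, c', hxV, ?_⟩
  simp only [IsGraph, res_res] at hc' ⊢
  exact hc'

end Sub

end chart

end

/-! ### Representability of the Grassmann functor by gluing affine charts -/

section

variable {X : Scheme.{u}}

variable {T T' : Scheme.{u}} {f : T ⟶ X} {f' : T' ⟶ X} {E : X.Modules} {r n : ℕ}

/-- A matrix with independent columns over a field has an invertible maximal minor. -/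
lemma exists_pivots {K : Type*} [Field K] {m : ℕ} (hm : m = r + n) (B : Matrix (Fin m) (Fin r) K)
    (hB : LinearIndependent K B.transpose.row) :
    ∃ σ : Fin r ⊕ Fin n ≃ Fin m, (B.submatrix (fun i => σ (.inl i)) id).det ≠ 0 := by
  obtain ⟨κ, a, ha, hspan, hli⟩ := exists_linearIndependent' K B.row
  have hrank : Module.finrank K (Submodule.span K (Set.range B.row)) = r := by
    rw [← Matrix.rank_eq_finrank_span_row, ← Matrix.rank_transpose, hB.rank_matrix,
      Fintype.card_fin]
  have : Finite κ := Finite.of_injective a ha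
  have : Fintype κ := Fintype.ofFinite κ
  have hcard : Fintype.card κ = r := by
    rw [← finrank_span_eq_card hli, hspan, hrank]
  let g : Fin r ≃ κ := (Fintype.equivFinOfCardEq hcard).symm
  let p : Fin r → Fin m := a ∘ g
  have hp : Function.Injective p := ha.comp g.injective
  have hc : Fintype.card ↥(Set.range p)ᶜ = n := by
    rw [Fintype.card_compl_set, Set.card_range_of_injective hp]
    simp [hm]
  let σ : Fin r ⊕ Fin n ≃ Fin m := (Equiv.sumCongr (Equiv.ofInjective p hp)
    (Fintype.equivFinOfCardEq hc).symm).trans (Equiv.Set.sumCompl (Set.range p))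
  have hσ : ∀ i, σ (.inl i) = p i := fun i => rfl
  refine ⟨σ, ?_⟩
  have hli' : LinearIndependent K (B.submatrix (fun i => σ (.inl i)) id).row :=
    hli.comp g g.injective
  rw [Matrix.linearIndependent_rows_iff_isUnit, Matrix.isUnit_iff_isUnit_det] at hli'
  exact hli'.ne_zero

namespace Sub

lemma IsGraph.pull_pull {N : Sub ((Scheme.Modules.pullback f).obj E)} (hN : N.IsRank r)
    {U : X.Opens} {ι κ : Type} [Fintype ι] [Fintype κ] {e : ι ⊕ κ → Γ(E, U)} {V : T.Opens}
    {hV : V ≤ f ⁻¹ᵁ U} {c : κ → ι → Γ(T, V)}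
    (hc : N.IsGraph (fun i => GrassmannBlowup.pull f E U (e i)) hV c) (h : T' ⟶ T)
    (e' : h ≫ f = f') :
    (N.pull h e').IsGraph (fun i => GrassmannBlowup.pull f' E U (e i))
      ((h.preimage_mono hV).trans (preimage_eq_of_comp_eq h e' U).le)
      fun j i => funPull h V (c j i) := by
  have h1 := hc.pull hN h e'
  simp only [rho_pull, IsGraph, res_res] at h1 ⊢
  exact h1

/-- Compatibility with base change is what makes a chart an open subfunctor. -/
lemma graphLocus_pull {N : Sub ((Scheme.Modules.pullback f).obj E)} (hN : N.IsRank r)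
    {U : X.Opens} {κ : Type} [Fintype κ] {e : Fin r ⊕ κ → Γ(E, U)} (he : IsFrame E U e)
    (h : T' ⟶ T) (e' : h ≫ f = f') :
    (N.pull h e').graphLocus (fun i => GrassmannBlowup.pull f' E U (e i)) =
      h ⁻¹ᵁ N.graphLocus (fun i => GrassmannBlowup.pull f E U (e i)) := by
  apply le_antisymm
  · intro t ht
    refine mem_graphLocus_of_pull hN h e' (he.pull f) ?_
    subst e'
    simp only [rho_pull]
    refine Eq.mp (congr_arg (t ∈ ·) (congr_arg (fun v => (N.pull h rfl).graphLocus
      (U := h ⁻¹ᵁ f ⁻¹ᵁ U) v) (funext fun i => ?_))) ht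
    exact (res_self _ _).symm
  · intro t ht
    obtain ⟨V, hV, c, htV, hc⟩ := mem_graphLocus.mp ht
    exact mem_graphLocus.mpr ⟨h ⁻¹ᵁ V, _, _, htV, hc.pull_pull hN h e'⟩

end Sub

/-- A frame of `E` over an open, giving a chart of the Grassmann functor. -/
structure Chart (E : X.Modules) (r n : ℕ) : Type u where
  U : X.Opens
  e : Fin r ⊕ Fin n → Γ(E, U)
  isFrame : IsFrame E U e

namespace Chart

variable (C : Chart E r n)

/-- The scheme of a chart. -/
abbrev scheme : Scheme.{u} := 𝔸(ULift.{u} (Fin n × Fin r); C.U)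

/-- The morphism to the base. -/
def toX : C.scheme ⟶ X := (𝔸(ULift.{u} (Fin n × Fin r); C.U) ↘ C.U) ≫ C.U.ι

/-- The coordinates of a chart. -/
def coordFn (j : Fin n) (i : Fin r) : Γ(C.scheme, ⊤) := AffineSpace.coord C.U ⟨(j, i)⟩

lemma top_le : ⊤ ≤ C.toX ⁻¹ᵁ C.U := by
  intro x _
  have : C.U.ι ((𝔸(ULift.{u} (Fin n × Fin r); C.U) ↘ C.U) x) ∈ C.U.ι.opensRange := ⟨_, rfl⟩
  rw [Scheme.Opens.opensRange_ι] at this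
  exact this

lemma isFrame_shear : IsFrame ((Scheme.Modules.pullback C.toX).obj E) ⊤
    (shear (fun i => res _ C.top_le (pull C.toX E C.U (C.e i))) C.coordFn) :=
  ((C.isFrame.pull C.toX).res C.top_le).shear C.coordFn

/-- The universal point over a chart. -/
def point : GrPoint E r C.scheme where
  hom := C.toX
  sub := Sub.ofFrame C.isFrame_shear le_rfl
  isRank _ := ⟨⊤, n, _, trivial, Sub.isSplit_ofFrame C.isFrame_shear le_rfl⟩

lemma isGraph_point : C.point.sub.IsGraph (fun i => pull C.toX E C.U (C.e i)) C.top_le C.coordFn :=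
  Sub.isSplit_ofFrame C.isFrame_shear le_rfl

/-- The locus where a point lies in a chart. -/
def locus (p : GrPoint E r T) : T.Opens := p.sub.graphLocus fun i => pull p.hom E C.U (C.e i)

lemma locus_map (p : GrPoint E r T) (h : T' ⟶ T) : C.locus (p.map h) = h ⁻¹ᵁ C.locus p :=
  Sub.graphLocus_pull p.isRank C.isFrame h rfl

lemma locus_point : C.locus C.point = ⊤ :=
  top_le_iff.mp fun _ _ => Sub.mem_graphLocus.mpr ⟨⊤, C.top_le, _, trivial, C.isGraph_point⟩

/-- The matrix of a graph is unique, so the point recovers the affine coordinates. -/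
lemma hom_ext {a a' : T ⟶ C.scheme} (h : C.point.map a = C.point.map a') : a = a' := by
  have h1 : a ≫ C.toX = a' ≫ C.toX := congr_arg GrPoint.hom h
  have h2 := GrPoint.pull_eq_of_map_eq h h1 rfl
  have h3 := C.isGraph_point.pull_pull C.point.isRank a h1
  have h4 := C.isGraph_point.pull_pull C.point.isRank a' rfl
  have h5 : C.point.sub.pull a h1 = C.point.sub.pull a' rfl := h2
  rw [h5] at h3
  have h6 := h3.unique (C.isFrame.pull _) h4
  apply AffineSpace.hom_ext
  · rw [← cancel_mono C.U.ι]
    simpa only [toX, Category.assoc] using h1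
  · rintro ⟨j, i⟩
    exact congr_fun (congr_fun h6 j) i

lemma exists_map_eq {p : GrPoint E r T} (h : C.locus p = ⊤) : ∃ a, C.point.map a = p := by
  obtain ⟨c, hc⟩ := Sub.exists_isGraph (C.isFrame.pull p.hom) h.ge
  have hU : Set.range p.hom ⊆ Set.range C.U.ι := by
    rintro _ ⟨t, rfl⟩
    have h1 : t ∈ C.locus p := by rw [h]; trivial
    have h2 : p.hom t ∈ C.U := Sub.graphLocus_le (U := p.hom ⁻¹ᵁ C.U) h1
    simpa using h2
  let g := IsOpenImmersion.lift C.U.ι p.hom hU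
  let a : T ⟶ C.scheme := AffineSpace.homOfVector g fun k => c k.down.1 k.down.2
  have ha : a ≫ C.toX = p.hom := by
    change a ≫ _ ≫ _ = _
    rw [← Category.assoc, AffineSpace.homOfVector_over, IsOpenImmersion.lift_fac]
  refine ⟨a, (GrPoint.eq_map_iff a).mpr ⟨ha, ?_⟩⟩
  apply Sub.ext_of_isSplit
  intro t
  have h1 := C.isGraph_point.pull_pull C.point.isRank a ha
  have h2 : ∀ j i, funPull a ⊤ (C.coordFn j i) = c j i := fun j i =>
    AffineSpace.homOfVector_appTop_coord _ _ _
  simp only [h2] at h1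
  exact ⟨⊤, Fin r, Fin n, inferInstance, inferInstance, _, trivial, h1, hc⟩

/-- The chart as a morphism to the Grassmann functor. -/
def toFunctor : yoneda.obj C.scheme ⟶ grFunctor E r := yonedaEquiv.symm C.point

/-- The fibre of the chart over the point `p` is the open locus where `p` is a graph in the frame of
`C`. -/
lemma isPullback (p : GrPoint E r T) (a : (C.locus p).toScheme ⟶ C.scheme)
    (ha : C.point.map a = p.map (C.locus p).ι) :
    IsPullback (yoneda.map a) (yoneda.map (C.locus p).ι) C.toFunctor
      (yonedaEquiv.symm p : yoneda.obj T ⟶ grFunctor E r) := by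
  apply IsPullback.of_forall_isPullback_app
  rintro ⟨S⟩
  rw [Types.isPullback_iff]
  refine ⟨?_, ?_, ?_⟩
  · ext b
    change S ⟶ (C.locus p).toScheme at b
    change C.point.map (b ≫ a) = p.map (b ≫ (C.locus p).ι)
    rw [← GrPoint.map_map, ha, GrPoint.map_map]
  · rintro b b' ⟨-, h⟩
    change S ⟶ (C.locus p).toScheme at b b'
    change b ≫ (C.locus p).ι = b' ≫ (C.locus p).ι at h
    exact (cancel_mono _).mp h
  · intro x y hxy
    change S ⟶ C.scheme at x
    change S ⟶ T at y
    change C.point.map x = p.map y at hxy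
    have h1 : y ⁻¹ᵁ C.locus p = ⊤ := by
      rw [← locus_map, ← hxy, locus_map, locus_point]
      rfl
    have h2 : Set.range y ⊆ Set.range (C.locus p).ι := by
      rintro _ ⟨s, rfl⟩
      have : s ∈ y ⁻¹ᵁ C.locus p := by rw [h1]; trivial
      simpa using this
    have h3 := IsOpenImmersion.lift_fac (C.locus p).ι y h2
    refine ⟨IsOpenImmersion.lift (C.locus p).ι y h2, ?_, h3⟩
    apply C.hom_ext
    change C.point.map (_ ≫ a) = _
    rw [← GrPoint.map_map, ha, GrPoint.map_map, h3, hxy]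

lemma exists_map_eq_locus (p : GrPoint E r T) :
    ∃ a : (C.locus p).toScheme ⟶ C.scheme, C.point.map a = p.map (C.locus p).ι := by
  apply C.exists_map_eq
  rw [locus_map]
  simp

lemma toFunctor_presheaf : IsOpenImmersion.presheaf C.toFunctor := by
  apply MorphismProperty.relative.of_exists
  intro T g
  obtain ⟨a, ha⟩ := C.exists_map_eq_locus (yonedaEquiv g : GrPoint E r T)
  have h := C.isPullback _ a ha
  rw [Equiv.symm_apply_apply] at h
  exact ⟨_, _, _, h, inferInstanceAs (IsOpenImmersion (C.locus _).ι)⟩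

/-- A morphism to a scheme representing the Grassmann functor which classifies a chart is an open
immersion. -/
lemma isOpenImmersion {G : Scheme.{u}} (p : GrPoint E r G)
    (hp : ∀ (T : Scheme.{u}) (q : GrPoint E r T), ∃! g : T ⟶ G, p.map g = q)
    (a : C.scheme ⟶ G) (ha : p.map a = C.point) : IsOpenImmersion a := by
  obtain ⟨b, hb⟩ := C.exists_map_eq_locus p
  have h1 : b ≫ a = (C.locus p).ι := (hp _ (p.map (C.locus p).ι)).unique
    (by rw [← GrPoint.map_map, ha, hb]) rfl
  have h2 : Set.range a ⊆ Set.range (C.locus p).ι := by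
    rintro _ ⟨s, rfl⟩
    have : s ∈ C.locus (p.map a) := by rw [ha, locus_point]; trivial
    rw [locus_map] at this
    simpa using this
  let c := IsOpenImmersion.lift (C.locus p).ι a h2
  have hc : c ≫ (C.locus p).ι = a := IsOpenImmersion.lift_fac _ _ _
  have hbc : b ≫ c = 𝟙 _ := by
    rw [← cancel_mono (C.locus p).ι, Category.assoc, hc, h1, Category.id_comp]
  have hcb : c ≫ b = 𝟙 _ := by
    apply C.hom_ext
    rw [← GrPoint.map_map, hb, GrPoint.map_map, hc, ha, GrPoint.map_id]
  have : IsIso c := ⟨b, hcb, hbc⟩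
  rw [← hc]
  infer_instance

end Chart

/-- Every point of the Grassmann functor lies locally in a chart. -/
lemma exists_chart_of_isFrame {m : ℕ} (hm : m = r + n) {U : X.Opens} {b : Fin m → Γ(E, U)}
    (hb₀ : IsFrame E U b) (p : GrPoint E r T) (t : T) (hU : p.hom t ∈ U) :
    ∃ σ : Fin r ⊕ Fin n ≃ Fin m,
      t ∈ Chart.locus ⟨U, fun i => b (σ i), hb₀.reindex σ⟩ p := by
  obtain ⟨V, l, v, htV, hv⟩ := p.isRank t
  have hb := hb₀.pull p.hom
  let W : T.Opens := p.hom ⁻¹ᵁ U ⊓ V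
  have htW : t ∈ W := ⟨hU, htV⟩
  have hbW := hb.res (inf_le_left : W ≤ p.hom ⁻¹ᵁ U)
  have hvW := hv.res (inf_le_right : W ≤ V)
  let B : Matrix (Fin m) (Fin r) Γ(T, W) :=
    Matrix.of fun i j => hbW.coord le_rfl (res _ inf_le_right (v (.inl j))) i
  let Q : Matrix (Fin r) (Fin m) Γ(T, W) :=
    Matrix.of fun j i => hvW.isFrame.coord le_rfl
      (res _ inf_le_left (pull p.hom E U (b i))) (.inl j)
  -- `B` writes a basis of the subbundle in the frame of `E`, and `Q` projects back. Its columns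
  -- therefore stay independent in the residue field at `t`, and some maximal minor is nonzero
  -- there.
  have hQB : Q * B = 1 := by
    ext j k
    have h1 := congr_arg (fun m => hvW.isFrame.coord le_rfl m (.inl j))
      (hbW.sum_coord le_rfl (res _ inf_le_right (v (.inl k))))
    simp only [map_sum, map_smul, Finset.sum_apply, Pi.smul_apply, smul_eq_mul] at h1
    rw [Matrix.mul_apply]
    refine (Finset.sum_congr rfl fun i _ => ?_).trans (h1.trans ?_)
    · rw [mul_comm, res_self]
      rfl
    · have := congr_fun (hvW.isFrame.coord_frame le_rfl (.inl k)) (.inl j)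
      rw [res_self] at this
      rw [this]
      simp [Pi.single_apply, Matrix.one_apply]
  let φ : Γ(T, W) →+* T.residueField t := (T.evaluation W t htW).hom
  have hφ : Q.map φ * B.map φ = 1 := by
    rw [← Matrix.map_mul, hQB]
    simp
  have hli : LinearIndependent (T.residueField t) (B.map φ).transpose.row := by
    refine Matrix.mulVec_injective_iff.mp (Function.LeftInverse.injective (g := (Q.map φ).mulVec)
      fun x => ?_)
    rw [Matrix.mulVec_mulVec, hφ, Matrix.one_mulVec]
  obtain ⟨σ, hσ⟩ := exists_pivots (n := n) hm (B.map φ) hli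
  refine ⟨σ, ?_⟩
  have hbσ := hbW.reindex σ
  have hdet : (Matrix.of fun i j => hbσ.coord le_rfl (res _ inf_le_right (v (.inl j)))
      (.inl i)) = B.submatrix (fun i => σ (.inl i)) id := by
    ext i j
    have h1 : hbσ.coord le_rfl (res _ inf_le_right (v (.inl j))) =
        fun i => hbW.coord le_rfl (res _ inf_le_right (v (.inl j))) (σ i) := by
      apply IsFrame.coord_eq
      exact (σ.sum_comp fun i => hbW.coord le_rfl (res _ inf_le_right (v (.inl j))) i •
        res _ le_rfl (res _ inf_le_left (pull p.hom E U (b i)))).trans (hbW.sum_coord _ _)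
    exact congr_fun h1 (.inl i)
  have h2 : t ∈ p.sub.graphLocus
      (fun i => res _ (inf_le_left : W ≤ p.hom ⁻¹ᵁ U) (pull p.hom E U (b (σ i)))) := by
    refine Sub.mem_graphLocus_of_mem_basicOpen hbσ hvW ?_
    rw [hdet, ← T.evaluation_ne_zero_iff_mem_basicOpen t htW]
    refine fun h0 => hσ ?_
    rw [← h0, Matrix.submatrix_map]
    exact (RingHom.map_det φ _).symm
  obtain ⟨V', hV', c', hxV', hc'⟩ := Sub.mem_graphLocus.mp h2
  refine Sub.mem_graphLocus.mpr ⟨V', hV'.trans inf_le_left, c', hxV', ?_⟩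
  simp only [Sub.IsGraph, res_res] at hc' ⊢
  exact hc'

lemma exists_chart (hE : IsLocallyFreeOfRank E (r + n)) (p : GrPoint E r T) (t : T) :
    ∃ C : Chart E r n, t ∈ C.locus p := by
  obtain ⟨U, hU, ⟨b⟩⟩ := hE (p.hom t)
  obtain ⟨σ, hσ⟩ := exists_chart_of_isFrame rfl b.isFrame p t hU
  exact ⟨_, hσ⟩

/-- The Grassmann functor of a locally free sheaf is representable. -/
lemma exists_universal_grPoint (hE : IsLocallyFreeOfRank E (r + n)) :
    ∃ (G : Scheme.{u}) (p : GrPoint E r G),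
      ∀ (T : Scheme.{u}) (q : GrPoint E r T), ∃! g : T ⟶ G, p.map g = q := by
  let F : Sheaf Scheme.zariskiTopology.{u} (Type u) :=
    ⟨grFunctor E r, (isSheaf_iff_isSheaf_of_type _ _).mpr (grFunctor_isSheaf E r)⟩
  let φ : (C : Chart E r n) → yoneda.obj C.scheme ⟶ F.1 := fun C => C.toFunctor
  have hφ : ∀ C, IsOpenImmersion.presheaf (φ C) := fun C => C.toFunctor_presheaf
  -- Each point of the functor is a graph near each `t`, so the loci of the charts cover.
  have : Presheaf.IsLocallySurjective Scheme.zariskiTopology (Sigma.desc φ) := by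
    refine ⟨fun {T} p => ?_⟩
    change GrPoint E r T at p
    choose C hC using exists_chart hE p
    let 𝓤 := T.openCoverOfIsOpenCover (fun t => (C t).locus p)
      (Opens.ext (by ext t; simpa using ⟨t, hC t⟩))
    refine GrothendieckTopology.superset_covering _ ?_ 𝓤.mem_grothendieckTopology
    rw [Sieve.generate_le_iff]
    rintro _ _ ⟨t⟩
    obtain ⟨a, ha⟩ := (C t).exists_map_eq_locus p
    refine ⟨(Sigma.ι (fun C : Chart E r n => yoneda.obj C.scheme) (C t)).app _ a, ?_⟩
    have h1 : Sigma.ι (fun C : Chart E r n => yoneda.obj C.scheme) (C t) ≫ Sigma.desc φ =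
      (C t).toFunctor := Sigma.ι_desc _ _
    have h2 := ConcreteCategory.congr_hom (NatTrans.congr_app h1 (op (𝓤.X t))) a
    exact h2.trans ha
  have R := Scheme.LocalRepresentability.representableBy (F := F) hφ
  refine ⟨_, R.homEquiv (𝟙 _), fun T q => ?_⟩
  have h : ∀ g : T ⟶ _, (R.homEquiv (𝟙 _) : GrPoint E r _).map g = R.homEquiv g := fun g =>
    (R.homEquiv_eq g).symm
  refine ⟨R.homEquiv.symm q, ?_, fun g hg => ?_⟩
  · exact (h _).trans (R.homEquiv.apply_symm_apply q)
  · exact R.homEquiv.injective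
      (((h g).symm.trans hg).trans (R.homEquiv.apply_symm_apply q).symm)

/-- Grassmann bundles exist. -/
theorem nonempty_grassmannBundle (hE : IsLocallyFreeOfRank E (r + n)) :
    Nonempty (GrassmannBundle E r) := by
  obtain ⟨G, p, hp⟩ := exists_universal_grPoint hE
  have hincl := p.isRank.isLocSplit_incl
  refine ⟨⟨G, p.hom, p.sub.toModule, p.sub.incl, hincl.isSubbundle, fun T f K κ hκ => ?_⟩⟩
  have hκ' := hκ.isLocSplit
  let q : GrPoint E r T := ⟨f, Sub.image κ, hκ'.isRank_image⟩
  have key : ∀ g : T ⟶ G, p.map g = q ↔ ∃ (h : g ≫ p.hom = f)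
      (e : (Scheme.Modules.pullback g).obj p.sub.toModule ≅ K),
        e.hom ≫ κ = pullbackSub p.sub.incl g h := by
    intro g
    rw [GrPoint.eq_map_iff]
    refine exists_congr fun h => ⟨fun he => ?_, fun ⟨e, he⟩ => image_eq_of_iso e he⟩
    exact exists_iso_of_image_eq (hincl.pullbackSub g h).injective hκ'.injective he
  obtain ⟨g, hg, hgu⟩ := hp T q
  exact ⟨g, (key g).mp hg, fun g' hg' => hgu g' ((key g').mpr hg')⟩

namespace GrassmannBundle

variable (Gr : GrassmannBundle E r)

/-- The tautological point of a Grassmann bundle. -/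
def point : GrPoint E r Gr.scheme :=
  ⟨Gr.π, Sub.image Gr.incl, Gr.isSubbundle.isLocSplit.isRank_image⟩

/-- Translates the universal property, stated for subbundles up to isomorphism of their sources,
into equality of image subsheaves. -/
lemma existsUnique_map_point_eq (q : GrPoint E r T) : ∃! g : T ⟶ Gr.scheme, Gr.point.map g = q := by
  have hincl := Gr.isSubbundle.isLocSplit
  have hq := q.isRank.isLocSplit_incl
  have key : ∀ g : T ⟶ Gr.scheme, Gr.point.map g = q ↔ ∃ (h : g ≫ Gr.π = q.hom)
      (e : (Scheme.Modules.pullback g).obj Gr.S ≅ q.sub.toModule),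
        e.hom ≫ q.sub.incl = pullbackSub Gr.incl g h := by
    intro g
    rw [GrPoint.eq_map_iff]
    refine exists_congr fun h => ?_
    have h1 : Gr.point.sub.pull g h = Sub.image (pullbackSub Gr.incl g h) :=
      (hincl.image_pullbackSub g h).symm
    rw [h1]
    constructor
    · intro he
      exact exists_iso_of_image_eq (hincl.pullbackSub g h).injective hq.injective
        (he.trans q.sub.image_incl.symm)
    · rintro ⟨e, he⟩
      exact (image_eq_of_iso e he).trans q.sub.image_incl
  obtain ⟨g, hg, hgu⟩ := Gr.universal T q.hom q.sub.toModule q.sub.incl hq.isSubbundle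
  exact ⟨g, (key g).mpr hg, fun g' hg' => hgu g' ((key g').mp hg')⟩

end GrassmannBundle

end

section

variable {X : Scheme.{u}}

open Scheme (IdealSheafData)

/-! ### Ideal sheaves and their local generators -/

lemma IsAffineOpen.exists_pow_mul_mem {U V : X.Opens} (hU : IsAffineOpen U) (f : Γ(X, U))
    (h : V ≤ U) (hV : V = X.basicOpen f) (I : Ideal Γ(X, U)) {t : Γ(X, U)}
    (ht : resFun X h t ∈ I.map (resFun X h)) : ∃ N : ℕ, f ^ N * t ∈ I := by
  let := (resFun X h).toAlgebra
  have : IsLocalization.Away f Γ(X, V) := hU.isLocalization_of_eq_basicOpen f (homOfLE h) hV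
  obtain ⟨_, ⟨N, rfl⟩, hN⟩ :=
    (IsLocalization.algebraMap_mem_map_algebraMap_iff (Submonoid.powers f) Γ(X, V) I t).mp ht
  exact ⟨N, hN⟩

lemma IsAffineOpen.exists_resFun_eq {U V : X.Opens} (hU : IsAffineOpen U) (f : Γ(X, U))
    (h : V ≤ U) (hV : V = X.basicOpen f) (s : Γ(X, V)) :
    ∃ (N : ℕ) (t : Γ(X, U)), resFun X h t = resFun X h f ^ N * s := by
  let := (resFun X h).toAlgebra
  have : IsLocalization.Away f Γ(X, V) := hU.isLocalization_of_eq_basicOpen f (homOfLE h) hV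
  obtain ⟨⟨t, _, N, rfl⟩, hN⟩ := IsLocalization.surj (Submonoid.powers f) s
  refine ⟨N, t, ?_⟩
  rw [← map_pow]
  exact hN.symm.trans (mul_comm _ _)

lemma isUnit_resFun {U V : X.Opens} (f : Γ(X, U)) (h : V ≤ U) (hV : V ≤ X.basicOpen f) :
    IsUnit (resFun X h f) := by
  have h1 := (X.toLocallyRingedSpace.toRingedSpace.isUnit_res_basicOpen f).map (resFun X hV)
  have h2 : resFun X hV (resFun X (X.basicOpen_le f) f) = resFun X h f := resFun_resFun _ _ _
  rw [← h2]
  exact h1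

lemma basicOpen_resFun {U V : X.Opens} (f : Γ(X, U)) (h : V ≤ U) :
    X.basicOpen (resFun X h f) = V ⊓ X.basicOpen f :=
  X.basicOpen_res f (homOfLE h).op

/-- Membership in an ideal of an affine open may be checked on a cover by basic opens. -/
lemma mem_of_forall_basicOpen {U : X.Opens} (hU : IsAffineOpen U) (S : Set Γ(X, U))
    (hS : Ideal.span S = ⊤) (I : Ideal Γ(X, U)) (t : Γ(X, U))
    (h : ∀ f ∈ S, resFun X (X.basicOpen_le f) t ∈ I.map (resFun X (X.basicOpen_le f))) : t ∈ I := by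
  refine Submodule.mem_of_span_eq_top_of_smul_pow_mem I S hS t fun f => ?_
  exact IsAffineOpen.exists_pow_mul_mem hU f.1 (X.basicOpen_le f.1) rfl I (h f.1 f.2)

/-- An ideal sheaf is given by compatible ideals on a basis of affine opens. -/
lemma exists_idealSheafData (good : Set X.affineOpens) (b : ∀ V : X.affineOpens, Ideal Γ(X, V))
    (hgood : ∀ V ∈ good, ∀ V' ≤ V, V' ∈ good)
    (hb : ∀ (V V' : X.affineOpens) (h : V' ≤ V), V ∈ good → b V' = (b V).map (resFun X h))
    (hcover : ∀ x : X, ∃ V ∈ good, x ∈ V.1) :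
    ∃ I : X.IdealSheafData, ∀ V ∈ good, I.ideal V = b V := by
  have hbres : ∀ (V V' : X.affineOpens) (h : V' ≤ V), V ∈ good → ∀ t ∈ b V,
      resFun X h t ∈ b V' := fun V V' h hV t ht => by
    rw [hb V V' h hV]; exact Ideal.mem_map_of_mem _ ht
  -- The sections whose restriction to every good affine open lies in the prescribed ideal. What has
  -- to be shown is that this is compatible with localization.
  let K : ∀ U : X.affineOpens, Ideal Γ(X, U) := fun U =>
    { carrier := {t | ∀ (V : X.affineOpens) (h : V ≤ U), V ∈ good → resFun X h t ∈ b V}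
      add_mem' := fun {s t} hs ht V h hV => by
        rw [map_add]; exact add_mem (hs V h hV) (ht V h hV)
      zero_mem' := fun V h hV => by rw [map_zero]; exact zero_mem _
      smul_mem' := fun c t ht V h hV => by
        rw [smul_eq_mul, map_mul]; exact Ideal.mul_mem_left _ _ (ht V h hV) }
  have hK : ∀ V ∈ good, K V = b V := by
    intro V hV
    refine le_antisymm (fun t ht => ?_) fun t ht V' h hV' => hbres V V' h hV t ht
    have := ht V le_rfl hV
    rwa [resFun_self] at this
  refine ⟨⟨K, fun U f => ?_, _, rfl⟩, hK⟩
  change (K U).map (resFun X (X.affineBasicOpen_le f)) = K (X.affineBasicOpen f)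
  refine le_antisymm ?_ ?_
  · refine Ideal.map_le_iff_le_comap.mpr ?_
    intro t ht V h hV
    have h' : V ≤ U := h.trans (X.affineBasicOpen_le f)
    have := ht V h' hV
    rwa [← resFun_resFun (X.affineBasicOpen_le f) h] at this
  · intro s hs
    have hspan : Ideal.span {h : Γ(X, U) | X.affineBasicOpen h ∈ good} = ⊤ := by
      rw [← U.2.self_le_iSup_basicOpen_iff]
      intro x hx
      obtain ⟨V, hV, hxV⟩ := hcover x
      obtain ⟨h, hhV, hxh⟩ := U.2.exists_basicOpen_le ⟨x, hxV⟩ hx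
      exact Opens.mem_iSup.mpr ⟨⟨h, hgood V hV (X.affineBasicOpen h) hhV⟩, hxh⟩
    obtain ⟨S, hSgood, hS⟩ := (Ideal.span_eq_top_iff_finite _).mp hspan
    obtain ⟨N, t, ht⟩ := IsAffineOpen.exists_resFun_eq U.2 f (X.affineBasicOpen_le f) rfl s
    -- On each member `D(h)` of the finite cover, `t` lies in the ideal after restriction to `D(h) ∩
    -- D(f)`, so some power of `f` times `t` lies in the ideal of `D(h)`. The largest exponent then
    -- works for all `h`.
    have key : ∀ h ∈ S, ∃ M : ℕ,
        resFun X (X.affineBasicOpen_le h) (f ^ M * t) ∈ b (X.affineBasicOpen h) := by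
      intro h hh
      have hg : X.affineBasicOpen h ∈ good := hSgood hh
      let W : X.affineOpens := X.affineBasicOpen (U := X.affineBasicOpen h)
        (resFun X (X.affineBasicOpen_le h) f)
      have hW : W.1 = X.basicOpen h ⊓ X.basicOpen f := basicOpen_resFun f (X.affineBasicOpen_le h)
      have hWh : W ≤ X.affineBasicOpen h := hW.le.trans inf_le_left
      have hWf : W ≤ X.affineBasicOpen f := hW.le.trans inf_le_right
      have h1 : resFun X hWh (resFun X (X.affineBasicOpen_le h) t) ∈
          (b (X.affineBasicOpen h)).map (resFun X hWh) := by
        rw [← hb _ _ hWh hg, resFun_resFun]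
        have h2 := hs W hWf (hgood _ hg _ hWh)
        have h3 := congr_arg (resFun X hWf) ht
        rw [resFun_resFun, map_mul] at h3
        have h4 := Ideal.mul_mem_left _ (resFun X hWf (resFun X (X.affineBasicOpen_le f) f ^ N)) h2
        rwa [← h3] at h4
      obtain ⟨M, hM⟩ := IsAffineOpen.exists_pow_mul_mem (X.affineBasicOpen h).2 _ hWh rfl _ h1
      exact ⟨M, by rw [map_mul, map_pow]; exact hM⟩
    choose! M hM using key
    have hmem : f ^ (S.sup M) * t ∈ K U := by
      intro V hVU hV
      refine mem_of_forall_basicOpen V.2 (resFun X hVU '' (S : Set Γ(X, U))) ?_ _ _ ?_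
      · rw [← Ideal.map_span, hS, Ideal.map_top]
      · rintro _ ⟨h, hh, rfl⟩
        let W : X.affineOpens := X.affineBasicOpen (resFun X hVU h)
        have hW : W.1 = V.1 ⊓ X.basicOpen h := basicOpen_resFun h hVU
        have hWV : W ≤ V := X.basicOpen_le _
        have hWh : W ≤ X.affineBasicOpen h := hW.le.trans inf_le_right
        have hle : M h ≤ S.sup M := Finset.le_sup hh
        change resFun X hWV _ ∈ (b V).map (resFun X hWV)
        rw [← hb V W hWV hV, resFun_resFun]
        have h1 := hbres _ _ hWh (hSgood hh) _ (hM h hh)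
        rw [resFun_resFun] at h1
        obtain ⟨c, hc⟩ := Nat.exists_eq_add_of_le hle
        rw [hc, add_comm, pow_add, mul_assoc, map_mul]
        exact Ideal.mul_mem_left _ _ h1
    have hu : IsUnit (resFun X (X.affineBasicOpen_le f) f) := isUnit_resFun f _ le_rfl
    have h1 := Ideal.mem_map_of_mem (resFun X (X.affineBasicOpen_le f)) hmem
    rw [map_mul, ht, ← mul_assoc, map_pow, ← pow_add] at h1
    exact (Ideal.unit_mul_mem_iff_mem _ (hu.pow _)).mp h1

lemma eq_of_forall_good {I J : X.IdealSheafData} (good : Set X.affineOpens)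
    (hcover : ∀ x : X, ∃ V ∈ good, x ∈ V.1) (h : ∀ V ∈ good, I.ideal V ≤ J.ideal V) : I ≤ J := by
  refine IdealSheafData.le_of_iSup_eq_top (fun V : good => V.1) ?_ fun V => h V.1 V.2
  refine Opens.ext (Set.eq_univ_of_forall fun x => ?_)
  obtain ⟨V, hV, hx⟩ := hcover x
  exact Opens.mem_iSup.mpr ⟨⟨V, hV⟩, hx⟩

/-- The values of the smallest ideal sheaf containing given sections. -/
lemma sInf_ideal_eq (good : Set X.affineOpens) (b : ∀ V : X.affineOpens, Set Γ(X, V))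
    (hgood : ∀ V ∈ good, ∀ V' ≤ V, V' ∈ good)
    (hb : ∀ (V V' : X.affineOpens) (h : V' ≤ V), V ∈ good →
      Ideal.span (b V') = (Ideal.span (b V)).map (resFun X h))
    (hcover : ∀ x : X, ∃ V ∈ good, x ∈ V.1) (hempty : ∀ V ∉ good, b V = ∅)
    (V : X.affineOpens) (hV : V ∈ good) :
    (sInf {I : X.IdealSheafData | ∀ U, b U ⊆ I.ideal U}).ideal V = Ideal.span (b V) := by
  obtain ⟨I, hI⟩ := exists_idealSheafData good (fun V => Ideal.span (b V)) hgood hb hcover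
  suffices h : sInf {I : X.IdealSheafData | ∀ U, b U ⊆ I.ideal U} = I by rw [h, hI V hV]
  refine le_antisymm (sInf_le fun U => ?_) (le_sInf fun J hJ => ?_)
  · by_cases hU : U ∈ good
    · rw [hI U hU]; exact Ideal.subset_span
    · rw [hempty U hU]; exact Set.empty_subset _
  · refine eq_of_forall_good good hcover fun V hV => ?_
    rw [hI V hV, Ideal.span_le]
    exact hJ V

end

/-! ### Determinantal ideals, and independence of zero loci and degeneracy loci from the frames -/

section

variable {X : Scheme.{u}}

open Scheme (IdealSheafData)

/-- The `p × p` minors of a matrix. -/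
def minors {R : Type*} [CommRing R] {κ ι : Type*} (Φ : Matrix κ ι R) (p : ℕ) : Set R :=
  {d | ∃ (row : Fin p → κ) (col : Fin p → ι), d = (Φ.submatrix row col).det}

section minors

variable {R : Type*} [CommRing R] {κ ι κ' ι' : Type*}

lemma minors_transpose (Φ : Matrix κ ι R) (p : ℕ) : minors Φ.transpose p = minors Φ p := by
  ext d
  constructor
  · rintro ⟨row, col, rfl⟩
    exact ⟨col, row, by rw [← Matrix.transpose_submatrix, Matrix.det_transpose]⟩
  · rintro ⟨row, col, rfl⟩
    exact ⟨col, row, by rw [← Matrix.transpose_submatrix, Matrix.det_transpose]⟩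

/-- Each row of `A * Φ` is a combination of rows of `Φ`; expanding the determinant multilinearly in
its rows gives a combination of minors of `Φ`, possibly with repeated rows. -/
lemma span_minors_mul_le [Fintype κ] (A : Matrix κ' κ R) (Φ : Matrix κ ι R) (p : ℕ) :
    Ideal.span (minors (A * Φ) p) ≤ Ideal.span (minors Φ p) := by
  classical
  rw [Ideal.span_le]
  rintro _ ⟨row, col, rfl⟩
  have h : (A * Φ).submatrix row col = fun i => ∑ l, A (row i) l • fun j => Φ l (col j) := by
    funext i j
    simp [Matrix.mul_apply, Finset.sum_apply]
  have h2 : ((A * Φ).submatrix row col).det = ∑ r : Fin p → κ,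
      Matrix.detRowAlternating fun i => A (row i) (r i) • fun j => Φ (r i) (col j) := by
    rw [h]
    exact (Matrix.detRowAlternating (R := R) (n := Fin p)).toMultilinearMap.map_sum _
  rw [h2]
  refine Ideal.sum_mem _ fun r _ => ?_
  have h3 := (Matrix.detRowAlternating (R := R) (n := Fin p)).toMultilinearMap.map_smul_univ
    (fun i => A (row i) (r i)) fun i j => Φ (r i) (col j)
  exact h3 ▸ Ideal.mul_mem_left _ _ (Ideal.subset_span ⟨r, col, rfl⟩)

lemma span_minors_mul_mul_le [Fintype κ] [Fintype ι] (A : Matrix κ' κ R) (Φ : Matrix κ ι R)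
    (B : Matrix ι ι' R) (p : ℕ) :
    Ideal.span (minors (A * Φ * B) p) ≤ Ideal.span (minors Φ p) := by
  refine le_trans ?_ (span_minors_mul_le A Φ p)
  rw [← minors_transpose (A * Φ * B), ← minors_transpose (A * Φ), Matrix.transpose_mul]
  exact span_minors_mul_le _ _ p

lemma minors_map {S : Type*} [CommRing S] (f : R →+* S) (Φ : Matrix κ ι R) (p : ℕ) :
    minors (Φ.map f) p = f '' minors Φ p := by
  ext d
  constructor
  · rintro ⟨row, col, rfl⟩
    exact ⟨_, ⟨row, col, rfl⟩, RingHom.map_det f _⟩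
  · rintro ⟨_, ⟨row, col, rfl⟩, rfl⟩
    exact ⟨row, col, RingHom.map_det f _⟩

end minors

section coord

variable {M N : X.Modules} {U V : X.Opens} {ι κ ι' κ' : Type} [Fintype ι] [Fintype κ]
  [Fintype ι'] [Fintype κ']

lemma IsFrame.coord_mem_span {b : ι → Γ(M, U)} {b' : κ → Γ(M, U)} (hb : IsFrame M U b)
    (hb' : IsFrame M U b') (m : Γ(M, U)) (k : κ) :
    hb'.coord le_rfl m k ∈ Ideal.span (Set.range (hb.coord le_rfl m)) := by
  have h := congr_fun (congr_arg (hb'.coord le_rfl) (hb.sum_coord le_rfl m)) k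
  rw [← h, map_sum, Finset.sum_apply]
  refine Ideal.sum_mem _ fun i _ => ?_
  rw [map_smul, Pi.smul_apply, smul_eq_mul]
  exact Ideal.mul_mem_right _ _ (Ideal.subset_span ⟨i, rfl⟩)

lemma IsFrame.span_coord_eq {b : ι → Γ(M, U)} {b' : κ → Γ(M, U)} (hb : IsFrame M U b)
    (hb' : IsFrame M U b') (m : Γ(M, U)) :
    Ideal.span (Set.range (hb.coord le_rfl m)) = Ideal.span (Set.range (hb'.coord le_rfl m)) := by
  apply le_antisymm <;> rw [Ideal.span_le] <;> rintro _ ⟨i, rfl⟩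
  · exact hb'.coord_mem_span hb m i
  · exact hb.coord_mem_span hb' m i

lemma IsFrame.exists_frame_fin {b : ι → Γ(M, U)} (hb : IsFrame M U b) :
    ∃ (n : ℕ), Nonempty (Frame M U (Fin n)) :=
  ⟨Fintype.card ι, ⟨(hb.reindex (Fintype.equivFin ι).symm).toFrame⟩⟩

lemma IsFrame.coord_le_rfl {b : ι → Γ(M, U)} (hb : IsFrame M U b) (h : V ≤ U) (m : Γ(M, V)) :
    (hb.res h).coord le_rfl m = hb.coord h m :=
  (hb.res h).coord_eq le_rfl (by
    have := hb.sum_coord h m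
    simpa only [res_self] using this)

/-- The matrix of a morphism in two frames. -/
def IsFrame.matrix {e : ι → Γ(M, U)} {f : κ → Γ(N, U)} (_ : IsFrame M U e) (hf : IsFrame N U f)
    (φ : M ⟶ N) : Matrix κ ι Γ(X, U) :=
  Matrix.of fun i j => hf.coord le_rfl (φ.app U (e j)) i

lemma IsFrame.matrix_res {e : ι → Γ(M, U)} {f : κ → Γ(N, U)} (he : IsFrame M U e)
    (hf : IsFrame N U f) (φ : M ⟶ N) (h : V ≤ U) :
    (he.res h).matrix (hf.res h) φ = (he.matrix hf φ).map (resFun X h) := by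
  ext i j
  simp only [matrix, Matrix.of_apply, Matrix.map_apply]
  rw [← res_app, hf.coord_res_res h le_rfl, hf.coord_res le_rfl h]

lemma IsFrame.matrix_change {e : ι → Γ(M, U)} {f : κ → Γ(N, U)} {e' : ι' → Γ(M, U)}
    {f' : κ' → Γ(N, U)} (he : IsFrame M U e) (hf : IsFrame N U f) (he' : IsFrame M U e')
    (hf' : IsFrame N U f') (φ : M ⟶ N) :
    he'.matrix hf' φ = (Matrix.of fun i j => hf'.coord le_rfl (f j) i) * he.matrix hf φ *
      (Matrix.of fun i j => he.coord le_rfl (e' j) i) := by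
  ext i j
  simp only [matrix, Matrix.of_apply, Matrix.mul_apply, Finset.sum_mul]
  conv_lhs => rw [← he.sum_coord le_rfl (e' j), app_sum_smul, map_sum, Finset.sum_apply]
  refine Finset.sum_congr rfl fun l _ => ?_
  rw [map_smul, Pi.smul_apply, smul_eq_mul, res_self]
  conv_lhs => rw [← hf.sum_coord le_rfl (φ.app U (e l)), map_sum, Finset.sum_apply,
    Finset.mul_sum]
  refine Finset.sum_congr rfl fun k _ => ?_
  rw [map_smul, Pi.smul_apply, smul_eq_mul, res_self]
  ring

/-- Each of the two matrices is a product with the other as middle factor. This gives both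
inclusions without inverting anything, even for index sets of unrelated size. -/
lemma IsFrame.span_minors_eq {e : ι → Γ(M, U)} {f : κ → Γ(N, U)} {e' : ι' → Γ(M, U)}
    {f' : κ' → Γ(N, U)} (he : IsFrame M U e) (hf : IsFrame N U f) (he' : IsFrame M U e')
    (hf' : IsFrame N U f') (φ : M ⟶ N) (p : ℕ) :
    Ideal.span (minors (he.matrix hf φ) p) = Ideal.span (minors (he'.matrix hf' φ) p) := by
  refine le_antisymm ?_ ?_
  · rw [he'.matrix_change hf' he hf φ]; exact span_minors_mul_mul_le _ _ _ p
  · rw [he.matrix_change hf he' hf' φ]; exact span_minors_mul_mul_le _ _ _ p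

end coord

lemma exists_affine_mem_le {U : X.Opens} {x : X} (hx : x ∈ U) :
    ∃ V : X.affineOpens, x ∈ V.1 ∧ V.1 ≤ U := by
  obtain ⟨_, ⟨V, hV, rfl⟩, hxV, hVU⟩ := X.isBasis_affineOpens.exists_subset_of_mem_open hx U.2
  exact ⟨⟨V, hV⟩, hxV, hVU⟩

/-- The ideal of the zero locus of a section is locally generated by its coordinates. -/
lemma zeroIdeal_ideal {M : X.Modules} (hM : IsLocallyFree M) (s : Γ(M, ⊤)) {U : X.Opens}
    {ι : Type} [Fintype ι] {b : ι → Γ(M, U)} (hb : IsFrame M U b) (V : X.affineOpens)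
    (h : V.1 ≤ U) :
    (zeroIdeal s).ideal V = Ideal.span (Set.range (hb.coord h (res M le_top s))) := by
  let B : ∀ V : X.affineOpens, Set Γ(X, V) := fun V =>
    {c | ∃ (n : ℕ) (b : Frame M V (Fin n)) (i : Fin n), c = b.basis.repr (res M le_top s) i}
  -- Affine opens without a frame impose no condition in `zeroIdeal`, since `B` is empty there.
  let good : Set X.affineOpens := {V | ∃ n : ℕ, Nonempty (Frame M V (Fin n))}
  have hrepr : ∀ (V : X.affineOpens) (n : ℕ) (b : Frame M V (Fin n)) (i : Fin n),
      b.basis.repr (res M le_top s) i = b.isFrame.coord le_rfl (res M le_top s) i := by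
    intro V n b i
    refine (congr_fun (b.isFrame.coord_eq le_rfl (m := res M le_top s)
      (a := b.basis.repr (res M le_top s)) ?_) i).symm
    simp only [res_self]
    exact b.basis.sum_repr _
  have hB : ∀ (V : X.affineOpens) {ι : Type} [Fintype ι] {b : ι → Γ(M, V.1)}
      (hb : IsFrame M V b),
      Ideal.span (B V) = Ideal.span (Set.range (hb.coord le_rfl (res M le_top s))) := by
    intro V ι _ b hb
    refine le_antisymm ?_ ?_
    · rw [Ideal.span_le]
      rintro _ ⟨n, b', i, rfl⟩
      rw [hrepr]
      exact hb.coord_mem_span b'.isFrame _ i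
    · rw [hb.span_coord_eq (hb.reindex (Fintype.equivFin ι).symm)]
      refine Ideal.span_mono ?_
      rintro _ ⟨i, rfl⟩
      exact ⟨_, (hb.reindex (Fintype.equivFin ι).symm).toFrame, i, (IsFrame.toFrame_repr _ _ _).symm⟩
  have key := sInf_ideal_eq good B (fun V ⟨n, ⟨b⟩⟩ V' hV' => ⟨n, ⟨(b.isFrame.res hV').toFrame⟩⟩)
    (fun V V' hV' ⟨n, ⟨b⟩⟩ => by
      rw [hB V b.isFrame, hB V' (b.isFrame.res hV'), Ideal.map_span, ← Set.range_comp]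
      congr 2
      funext i
      simp only [Function.comp_apply]
      rw [b.isFrame.coord_le_rfl, ← res_res M le_top hV', b.isFrame.coord_res le_rfl hV'])
    (fun x => by
      obtain ⟨U, hx, n, ⟨b⟩⟩ := hM x
      obtain ⟨V, hxV, hVU⟩ := exists_affine_mem_le hx
      exact ⟨V, ⟨n, ⟨(b.isFrame.res hVU).toFrame⟩⟩, hxV⟩)
    (fun V hV => Set.eq_empty_of_forall_notMem fun c ⟨n, b, _⟩ => hV ⟨n, ⟨b⟩⟩)
    V (hb.res h).exists_frame_fin
  have hset : zeroIdeal s = sInf {I : X.IdealSheafData | ∀ U, B U ⊆ I.ideal U} := by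
    refine congr_arg sInf (Set.ext fun I => ⟨?_, ?_⟩)
    · rintro hI U _ ⟨n, b, i, rfl⟩
      exact hI U n b i
    · exact fun hI U n b i => hI U ⟨n, b, i, rfl⟩
  rw [hset, key, hB V (hb.res h)]
  congr 2
  rw [hb.coord_le_rfl]

/-- The ideal of a degeneracy locus is locally generated by minors. -/
lemma minorIdeal_ideal {E F : X.Modules} (hE : IsLocallyFree E) (hF : IsLocallyFree F)
    (φ : E ⟶ F) (p : ℕ) {U : X.Opens} {ι κ : Type} [Fintype ι] [Fintype κ] {e : ι → Γ(E, U)}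
    {f : κ → Γ(F, U)} (he : IsFrame E U e) (hf : IsFrame F U f) (V : X.affineOpens)
    (h : V.1 ≤ U) :
    (minorIdeal φ p).ideal V = (Ideal.span (minors (he.matrix hf φ) p)).map (resFun X h) := by
  let B : ∀ V : X.affineOpens, Set Γ(X, V) := fun V =>
    {c | ∃ (m n : ℕ) (e : Frame E V (Fin m)) (f : Frame F V (Fin n)),
      c ∈ minors (e.isFrame.matrix f.isFrame φ) p}
  let good : Set X.affineOpens := {V | ∃ m n : ℕ, Nonempty (Frame E V (Fin m)) ∧
    Nonempty (Frame F V (Fin n))}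
  have hmat : ∀ (V : X.affineOpens) (m n : ℕ) (e : Frame E V (Fin m)) (f : Frame F V (Fin n)),
      matrixOf φ e f = e.isFrame.matrix f.isFrame φ := by
    intro V m n e f
    ext i j
    refine (congr_fun (f.isFrame.coord_eq le_rfl (m := φ.app V (e.basis j))
      (a := f.basis.repr (φ.app V (e.basis j))) ?_) i).symm
    simp only [res_self]
    exact f.basis.sum_repr _
  have hB : ∀ (V : X.affineOpens) {ι κ : Type} [Fintype ι] [Fintype κ] {e : ι → Γ(E, V.1)}
      {f : κ → Γ(F, V.1)} (he : IsFrame E V e) (hf : IsFrame F V f),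
      Ideal.span (B V) = Ideal.span (minors (he.matrix hf φ) p) := by
    intro V ι κ _ _ e f he hf
    refine le_antisymm ?_ ?_
    · rw [Ideal.span_le]
      rintro d ⟨m, n, e', f', hd⟩
      rw [SetLike.mem_coe, he.span_minors_eq hf e'.isFrame f'.isFrame]
      exact Ideal.subset_span hd
    · rw [he.span_minors_eq hf (he.reindex (Fintype.equivFin ι).symm).toFrame.isFrame
        (hf.reindex (Fintype.equivFin κ).symm).toFrame.isFrame]
      exact Ideal.span_mono fun d hd => ⟨_, _, _, _, hd⟩
  have key := sInf_ideal_eq good B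
    (fun V ⟨m, n, ⟨e⟩, ⟨f⟩⟩ V' hV' =>
      ⟨m, n, ⟨(e.isFrame.res hV').toFrame⟩, ⟨(f.isFrame.res hV').toFrame⟩⟩)
    (fun V V' hV' ⟨m, n, ⟨e⟩, ⟨f⟩⟩ => by
      rw [hB V e.isFrame f.isFrame, hB V' (e.isFrame.res hV') (f.isFrame.res hV'),
        IsFrame.matrix_res, minors_map, ← Ideal.map_span])
    (fun x => by
      obtain ⟨U, hx, m, ⟨e⟩⟩ := hE x
      obtain ⟨U', hx', n, ⟨f⟩⟩ := hF x
      obtain ⟨V, hxV, hVU⟩ := exists_affine_mem_le (U := U ⊓ U') ⟨hx, hx'⟩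
      exact ⟨V, ⟨m, n, ⟨(e.isFrame.res (hVU.trans inf_le_left)).toFrame⟩,
        ⟨(f.isFrame.res (hVU.trans inf_le_right)).toFrame⟩⟩, hxV⟩)
    (fun V hV => Set.eq_empty_of_forall_notMem fun c ⟨m, n, e, f, _⟩ => hV ⟨m, n, ⟨e⟩, ⟨f⟩⟩)
    V ⟨_, _, ⟨((he.res h).reindex (Fintype.equivFin ι).symm).toFrame⟩,
      ⟨((hf.res h).reindex (Fintype.equivFin κ).symm).toFrame⟩⟩
  have hset : minorIdeal φ p = sInf {I : X.IdealSheafData | ∀ U, B U ⊆ I.ideal U} := by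
    refine congr_arg sInf (Set.ext fun I => ⟨?_, ?_⟩)
    · rintro hI U _ ⟨m, n, e, f, row, col, rfl⟩
      rw [← hmat]
      exact hI U m n e f row col
    · intro hI U m n e f row col
      rw [hmat]
      exact hI U ⟨m, n, e, f, row, col, rfl⟩
  rw [hset, key, hB V (he.res h) (hf.res h), IsFrame.matrix_res, minors_map, ← Ideal.map_span]

/-! ### Inverse images of ideal sheaves -/

/-- Inverse image is left adjoint to direct image of ideal sheaves. On affine schemes the latter is
contraction along the ring homomorphism, whose left adjoint is extension of ideals. -/
lemma ideal_comap_of_isAffine {Y : Scheme.{u}} [IsAffine X] [IsAffine Y] (f : X ⟶ Y)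
    (I : Y.IdealSheafData) :
    (I.comap f).ideal ⟨⊤, isAffineOpen_top X⟩ =
      (I.ideal ⟨⊤, isAffineOpen_top Y⟩).map f.appTop.hom := by
  refine eq_of_forall_ge_iff fun J => ?_
  let J' := IdealSheafData.ofIdealTop J
  have hJ' : J'.ideal ⟨⊤, isAffineOpen_top X⟩ = J :=
    IdealSheafData.equivOfIsAffine.apply_symm_apply J
  rw [Ideal.map_le_iff_le_comap]
  have h1 : (J'.map f).ideal ⟨⊤, isAffineOpen_top Y⟩ = J.comap f.appTop.hom := by
    rw [IdealSheafData.ideal_map_of_isAffineHom]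
    conv_rhs => rw [← hJ']
    rfl
  rw [← h1]
  conv_lhs => rw [← hJ']
  have h2 := (IdealSheafData.le_map_iff_comap_le (I := J') (f := f) (J := I))
  constructor
  · intro h
    exact h2.mpr (IdealSheafData.le_of_isAffine h) _
  · intro h
    exact h2.mp (IdealSheafData.le_of_isAffine h) _

lemma ideal_comap_ι (V : X.affineOpens) (J : X.IdealSheafData)
    (hV : IsAffineOpen (⊤ : (V.1 : Scheme.{u}).Opens)) :
    (J.comap V.1.ι).ideal ⟨⊤, hV⟩ = (J.ideal V).map V.1.topIso.inv.hom := by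
  rw [IdealSheafData.ideal_comap_of_isOpenImmersion]
  have h : V.1.ι ''ᵁ ⊤ ≤ V.1 := V.1.ι_image_top.le
  have h1 := J.map_ideal (U := ⟨V.1.ι ''ᵁ ⊤, hV.image_of_isOpenImmersion V.1.ι⟩) (V := V) h
  refine Eq.trans ?_ h1.symm
  rw [Scheme.Opens.ι_appIso]
  exact Ideal.comap_id _

/-- The inverse image of an ideal sheaf is generated by the inverse images of sections. -/
lemma ideal_comap_eq_map {Y : Scheme.{u}} (f : X ⟶ Y) (I : Y.IdealSheafData) (U : Y.affineOpens)
    (V : X.affineOpens) (h : V.1 ≤ f ⁻¹ᵁ U.1) :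
    (I.comap f).ideal V = (I.ideal U).map (f.appLE U V h).hom := by
  have : IsAffine (V.1 : Scheme.{u}) := V.2
  have : IsAffine (U.1 : Scheme.{u}) := U.2
  let g : (V.1 : Scheme.{u}) ⟶ U.1 := f.resLE U V h
  have hg : g ≫ U.1.ι = V.1.ι ≫ f := f.resLE_comp_ι h
  have h1 : (I.comap f).comap V.1.ι = (I.comap U.1.ι).comap g := by
    rw [← IdealSheafData.comap_comp, ← IdealSheafData.comap_comp, hg]
  have h2 := ideal_comap_ι V (I.comap f) (isAffineOpen_top _)
  rw [h1, ideal_comap_of_isAffine] at h2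
  have h3 : U.1.topIso.inv ≫ g.appTop = f.appLE U V h ≫ V.1.topIso.inv := by
    exact (congr_arg (U.1.topIso.inv ≫ ·) (f.resLE_app_top h)).trans
      (Iso.inv_hom_id_assoc _ _)
  have h4 := congr_arg (Ideal.map g.appTop.hom) (ideal_comap_ι U I (isAffineOpen_top _))
  rw [Ideal.map_map, ← CommRingCat.hom_comp, h3, CommRingCat.hom_comp, ← Ideal.map_map] at h4
  have h5 := congr_arg (Ideal.map V.1.topIso.hom.hom) (h2.symm.trans h4)
  rw [Ideal.map_map, Ideal.map_map, ← CommRingCat.hom_comp, Iso.inv_hom_id, CommRingCat.hom_id,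
    Ideal.map_id, Ideal.map_id] at h5
  exact h5

end

section

open RingTheory.Sequence

/-! ### Regular sequences in polynomial rings -/

section polynomial

variable {σ : Type*} {A : Type*} [CommRing A]

open MvPolynomial

lemma X_mul_divMonomial_of_ne {i j : σ} (h : j ≠ i) (q : MvPolynomial σ A) :
    (X j * q).divMonomial (Finsupp.single i 1) = X j * q.divMonomial (Finsupp.single i 1) := by
  classical
  ext n
  rw [coeff_divMonomial, coeff_X_mul', coeff_X_mul', coeff_divMonomial]
  have hs : j ∈ (Finsupp.single i 1 + n).support ↔ j ∈ n.support := by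
    simp [h.symm]
  by_cases hj : j ∈ n.support
  · rw [if_pos hj, if_pos (hs.mpr hj)]
    congr 1
    ext l
    simp only [Finsupp.coe_add, Finsupp.coe_tsub, Pi.add_apply, Pi.sub_apply, Finsupp.single_apply]
    rw [Finsupp.mem_support_iff] at hj
    split_ifs <;> grind
  · rw [if_neg hj, if_neg fun h' => hj (hs.mp h')]

/-- The variables not in `s` are nonzerodivisors modulo the variables in `s` and constants. -/
lemma mem_of_X_mul_mem (I : Ideal A) (s : Set σ) {i : σ} (hi : i ∉ s) {p : MvPolynomial σ A}
    (hp : X i * p ∈ I.map C ⊔ Ideal.span (X '' s)) :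
    p ∈ I.map C ⊔ Ideal.span (X '' s : Set (MvPolynomial σ A)) := by
  have hK : I.map C ⊔ Ideal.span (X '' s : Set (MvPolynomial σ A)) =
      Ideal.span (C '' (I : Set A) ∪ X '' s) := by
    rw [Ideal.span_union]
    rfl
  rw [hK] at hp ⊢
  set K := Ideal.span (C '' (I : Set A) ∪ X '' s : Set (MvPolynomial σ A))
  -- Division by `X i`, discarding the monomials without `X i`, commutes with multiplication by
  -- constants and by the other variables, so it preserves an ideal generated by such elements.
  have key : ∀ q ∈ K, ∀ c, (c * q).divMonomial (Finsupp.single i 1) ∈ K := by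
    intro q hq
    induction hq using Submodule.span_induction with
    | mem q hq =>
      intro c
      rcases hq with ⟨a, ha, rfl⟩ | ⟨j, hj, rfl⟩
      · have h1 : (c * C a).divMonomial (Finsupp.single i 1) =
            c.divMonomial (Finsupp.single i 1) * C a := by
          ext n
          rw [mul_comm, mul_comm _ (C a), coeff_divMonomial, coeff_C_mul, coeff_C_mul,
            coeff_divMonomial]
        rw [h1]
        exact Ideal.mul_mem_left _ _ (Ideal.subset_span (Or.inl ⟨a, ha, rfl⟩))
      · rw [mul_comm, X_mul_divMonomial_of_ne (by rintro rfl; exact hi hj)]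
        exact Ideal.mul_mem_right _ _ (Ideal.subset_span (Or.inr ⟨j, hj, rfl⟩))
    | zero => intro c; rw [mul_zero, zero_divMonomial]; exact zero_mem _
    | add q q' _ _ h h' =>
      intro c
      rw [mul_add, add_divMonomial]
      exact add_mem (h c) (h' c)
    | smul a q _ h =>
      intro c
      rw [smul_eq_mul, ← mul_assoc]
      exact h _
  have := key _ hp 1
  rwa [one_mul, X_mul_divMonomial] at this

/-- A weakly regular sequence of constants, followed by distinct variables, is weakly regular. -/
lemma isWeaklyRegular_map_C_append {gs : List A} (hgs : IsWeaklyRegular A gs) {l : List σ}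
    (hl : l.Nodup) :
    IsWeaklyRegular (MvPolynomial σ A) (gs.map C ++ l.map (X : σ → MvPolynomial σ A)) := by
  induction l using List.reverseRecOn with
  | nil =>
    rw [List.map_nil, List.append_nil]
    exact hgs.of_flat (S := MvPolynomial σ A)
  | append_singleton l i ih =>
    rw [List.nodup_append] at hl
    have hi : i ∉ l := fun h => hl.2.2 i h i (List.mem_singleton_self i) rfl
    rw [List.map_append, ← List.append_assoc, isWeaklyRegular_append_iff]
    refine ⟨ih hl.1, ?_⟩
    rw [List.map_singleton, isWeaklyRegular_singleton_iff,
      isSMulRegular_quotient_iff_mem_of_smul_mem]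
    intro p hp
    rw [smul_eq_mul, Ideal.mul_top] at hp ⊢
    have h1 : Ideal.ofList (gs.map C ++ l.map (X : σ → MvPolynomial σ A)) =
        (Ideal.ofList gs).map C ⊔ Ideal.span (X '' {j | j ∈ l}) := by
      rw [Ideal.ofList_append, Ideal.map_ofList]
      have h2 : {q | q ∈ l.map (X : σ → MvPolynomial σ A)} = X '' {j | j ∈ l} :=
        Set.ext fun q => by simp
      have h3 : Ideal.ofList (l.map (X : σ → MvPolynomial σ A)) =
          Ideal.span {q | q ∈ l.map (X : σ → MvPolynomial σ A)} := rfl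
      rw [h3, h2]
    rw [h1] at hp ⊢
    exact mem_of_X_mul_mem (Ideal.ofList gs) {j | j ∈ l} (i := i) hi hp

lemma isWeaklyRegular_map_of_flat {B R : Type*} [CommRing B] [CommRing R] (ψ : B →+* R)
    (hψ : ψ.Flat) {l : List B} (hl : IsWeaklyRegular B l) : IsWeaklyRegular R (l.map ψ) := by
  let := ψ.toAlgebra
  have : Module.Flat B R := hψ
  exact hl.of_flat

end polynomial

/-- The list of values of a finite family. -/
def enum {T R : Type*} [Fintype T] (x : T → R) : List R := Finset.univ.toList.map x

section enum

variable {T T' R R' : Type*} [Fintype T] [Fintype T']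

lemma mem_enum {x : T → R} {a : R} : a ∈ enum x ↔ ∃ t, x t = a := by
  simp [enum]

lemma coe_enum (x : T → R) : (enum x : Multiset R) = Finset.univ.val.map x := by
  rw [enum, ← Multiset.map_coe, Finset.coe_toList]

lemma enum_comp_equiv (x : T → R) (e : T' ≃ T) : (enum fun t => x (e t)).Perm (enum x) := by
  rw [← Multiset.coe_eq_coe, coe_enum, coe_enum]
  have := Finset.univ_map_equiv_to_embedding e
  conv_rhs => rw [← this, Finset.map_val, Multiset.map_map]
  rfl

lemma ofFn_perm_enum {n : ℕ} (x : T → R) (e : Fin n ≃ T) :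
    (List.ofFn fun i => x (e i)).Perm (enum x) := by
  refine List.Perm.trans ?_ (enum_comp_equiv x e)
  rw [← Multiset.coe_eq_coe, coe_enum, List.ofFn_eq_map, ← Multiset.map_coe]
  rfl

lemma enum_sum (x : T ⊕ T' → R) :
    (enum x).Perm (enum (fun t => x (.inl t)) ++ enum fun t => x (.inr t)) := by
  rw [← Multiset.coe_eq_coe, ← Multiset.coe_add, coe_enum, coe_enum, coe_enum,
    ← Finset.univ_disjSum_univ, Finset.val_disjSum, Multiset.disjSum, Multiset.map_add,
    Multiset.map_map, Multiset.map_map]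
  rfl

lemma map_enum (x : T → R) (f : R → R') : (enum x).map f = enum fun t => f (x t) := by
  simp [enum]

lemma ofList_enum [CommRing R] (x : T → R) : Ideal.ofList (enum x) = Ideal.span (Set.range x) := by
  exact congr_arg Ideal.span (Set.ext fun a => mem_enum)

end enum

section local_ring

variable {B R : Type*} [CommRing B] [CommRing R] [IsLocalRing R] [IsNoetherianRing R] {σ : Type*}

open MvPolynomial IsLocalRing

omit [IsLocalRing R] [IsNoetherianRing R] in
/-- Adding multiples of the first element to the other elements of a sequence. -/
lemma isWeaklyRegular_cons_add {x : R} {J : Type*} [Fintype J] (a c : J → R) (l : List R) :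
    IsWeaklyRegular R (x :: (enum a ++ l)) ↔
      IsWeaklyRegular R (x :: (enum (fun j => a j + c j * x) ++ l)) := by
  rw [isWeaklyRegular_cons_iff', isWeaklyRegular_cons_iff', List.map_append, List.map_append,
    map_enum, map_enum]
  have : ∀ j, Ideal.Quotient.mk (Ideal.span {x}) (a j + c j * x) =
      Ideal.Quotient.mk (Ideal.span {x}) (a j) := fun j => by
    rw [Ideal.Quotient.mk_eq_mk_iff_sub_mem, add_sub_cancel_left]
    exact Ideal.mul_mem_left _ _ (Ideal.mem_span_singleton_self x)
  simp only [this]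

/-- Regular sequences in the maximal ideal of a noetherian local ring may be permuted; moving `a` to
the end shows that it is a nonzerodivisor modulo the rest. -/
lemma isRegular_enum_and_mem {T : Type*} [Fintype T] {x : T → R} {a : R} {l : List R}
    (hx : ∀ t, x t ∈ maximalIdeal R) (ha : a ∈ maximalIdeal R)
    (hl : IsWeaklyRegular R l) (hp : l.Perm (enum x ++ [a])) :
    IsRegular R (enum x) ∧ ∀ b, a * b ∈ Ideal.span (Set.range x) → b ∈ Ideal.span (Set.range x) := by
  have hmem : ∀ r ∈ enum x ++ [a], r ∈ maximalIdeal R := by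
    intro r hr
    rcases List.mem_append.mp hr with h | h
    · obtain ⟨t, rfl⟩ := mem_enum.mp h
      exact hx t
    · rw [List.mem_singleton.mp h]; exact ha
  have h1 := IsLocalRing.isWeaklyRegular_of_perm_of_subset_maximalIdeal hl hp
    fun r hr => hmem r (hp.mem_iff.mp hr)
  rw [isWeaklyRegular_append_iff, isWeaklyRegular_singleton_iff,
    isSMulRegular_quotient_iff_mem_of_smul_mem] at h1
  refine ⟨IsRegular.of_isWeaklyRegular_of_mem_maximalIdeal R
    (fun r hr => hmem r (List.mem_append_left _ hr)) h1.1, fun b hb => ?_⟩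
  have h2 := h1.2 b
  rw [smul_eq_mul, smul_eq_mul, Ideal.mul_top, ofList_enum] at h2
  exact h2 hb

/-- The equations of the zero locus in a chart of the Grassmann bundle form a regular sequence, and
`g₀` is a nonzerodivisor modulo them. -/
theorem isRegular_chart_equations (ψ : MvPolynomial σ B →+* R) (hψ : ψ.Flat)
    [IsLocalHom (ψ.comp C)] {J K : Type*} [Fintype J] [Fintype K] (g₀ : B) (g : J → B)
    (hg : g₀ ∈ nonunits B → (∀ j, g j ∈ nonunits B) → IsWeaklyRegular B (g₀ :: enum g) )
    (u : K ⊕ J → σ) (hu : Function.Injective u) (x : K ⊕ J → R)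
    (hx₁ : ∀ k, x (.inl k) = ψ (X (u (.inl k))))
    (hx₂ : ∀ j, x (.inr j) = ψ (C (g j)) + ψ (X (u (.inr j))) * ψ (C g₀))
    (hx : ∀ t, x t ∈ maximalIdeal R) :
    IsRegular R (enum x) ∧
      ∀ b, ψ (C g₀) * b ∈ Ideal.span (Set.range x) → b ∈ Ideal.span (Set.range x) := by
  -- If `g₀` is not a unit, neither is any `g j`, because the equations lie in the maximal ideal.
  -- Then `g₀`, the `g j` and the variables `u (.inl k)` form a weakly regular sequence in the
  -- polynomial ring, which stays weakly regular in `R` by flatness. Adding multiples of `g₀` to the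
  -- `g j` does not affect this.
  by_cases h0 : ψ (C g₀) ∈ maximalIdeal R
  · have hgm : ∀ j, ψ (C (g j)) ∈ maximalIdeal R := fun j => by
      have h1 := hx (.inr j)
      rw [hx₂] at h1
      exact (Ideal.add_mem_iff_left _ (Ideal.mul_mem_left _ _ h0)).mp h1
    have hB : ∀ b : B, ψ (C b) ∈ maximalIdeal R → b ∈ nonunits B := fun b hb hu =>
      hb (hu.map (ψ.comp C))
    have h1 := isWeaklyRegular_map_C_append (hg (hB _ h0) fun j => hB _ (hgm j))
      (l := Finset.univ.toList.map fun k : K => u (.inl k))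
      ((Finset.nodup_toList _).map (hu.comp Sum.inl_injective))
    have h2 := isWeaklyRegular_map_of_flat ψ hψ h1
    have h3 : ((g₀ :: enum g).map (C : B → MvPolynomial σ B) ++
        (Finset.univ.toList.map fun k : K => u (.inl k)).map X).map ψ =
        ψ (C g₀) :: (enum (fun j => ψ (C (g j))) ++ enum fun k => x (.inl k)) := by
      simp only [enum, hx₁, List.map_append, List.map_cons, List.map_map, List.cons_append]
      rfl
    rw [h3, isWeaklyRegular_cons_add _ (fun j => ψ (X (u (.inr j))))] at h2
    simp only [← hx₂] at h2
    refine isRegular_enum_and_mem hx h0 h2 ?_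
    refine List.Perm.trans ?_ (List.perm_append_comm (l₁ := [ψ (C g₀)]))
    exact ((List.perm_append_comm).trans (enum_sum x).symm).cons _
  · have hu0 : IsUnit (ψ (C g₀)) := by
      by_contra h; exact h0 h
    have hg0 : IsUnit g₀ := isUnit_of_map_unit (ψ.comp C) _ hu0
    refine ⟨?_, fun b hb => (Ideal.unit_mul_mem_iff_mem _ hu0).mp hb⟩
    obtain ⟨v, hv⟩ := hg0.exists_left_inv
    classical
    -- With `g₀` invertible, `X_j ↦ g_j + X_j g₀` is an automorphism with inverse `β`. The equations
    -- are thus images of distinct variables under a flat map.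
    let α : MvPolynomial σ B →ₐ[B] MvPolynomial σ B := aeval fun i =>
      if h : ∃ j, u (.inr j) = i then C (g h.choose) + X i * C g₀ else X i
    let β : MvPolynomial σ B →ₐ[B] MvPolynomial σ B := aeval fun i =>
      if h : ∃ j, u (.inr j) = i then (X i - C (g h.choose)) * C v else X i
    have hvg : (C v * C g₀ : MvPolynomial σ B) = 1 := by rw [← C_mul, hv, C_1]
    have hC : ∀ (f : MvPolynomial σ B →ₐ[B] MvPolynomial σ B) (b : B), f (C b) = C b :=
      fun f b => f.commutes b
    have hαβ : α.comp β = AlgHom.id _ _ := by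
      ext1 i
      by_cases h : ∃ j, u (.inr j) = i
      · simp only [AlgHom.comp_apply, β, aeval_X, dif_pos h, map_mul, map_sub, hC]
        simp only [α, aeval_X, dif_pos h, AlgHom.id_apply]
        linear_combination X i * hvg
      · simp [α, β, h]
    have hβα : β.comp α = AlgHom.id _ _ := by
      ext1 i
      by_cases h : ∃ j, u (.inr j) = i
      · simp only [AlgHom.comp_apply, α, aeval_X, dif_pos h, map_mul, map_add, hC]
        simp only [β, aeval_X, dif_pos h, AlgHom.id_apply]
        linear_combination (X i - C (g h.choose)) * hvg
      · simp [α, β, h]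
    let e : MvPolynomial σ B ≃ₐ[B] MvPolynomial σ B := AlgEquiv.ofAlgHom α β hαβ hβα
    have hflat : (ψ.comp (e : MvPolynomial σ B →+* MvPolynomial σ B)).Flat :=
      RingHom.Flat.comp (RingHom.Flat.of_bijective e.bijective) hψ
    have h1 := isWeaklyRegular_map_C_append (IsWeaklyRegular.nil B B)
      (l := Finset.univ.toList.map u) ((Finset.nodup_toList _).map hu)
    have h2 := isWeaklyRegular_map_of_flat _ hflat h1
    have h3 : (([] : List B).map (C : B → MvPolynomial σ B) ++
        (Finset.univ.toList.map u).map X).map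
          (ψ.comp (e : MvPolynomial σ B →+* MvPolynomial σ B)) = enum x := by
      rw [List.map_nil, List.nil_append, List.map_map, List.map_map]
      refine List.map_congr_left fun t _ => ?_
      change ψ (α (X (u t))) = x t
      cases t with
      | inl k =>
        have h : ¬ ∃ j, u (.inr j) = u (.inl k) := fun ⟨j, hj⟩ => by cases hu hj
        simp only [α, aeval_X, dif_neg h, hx₁]
      | inr j =>
        have h : ∃ j', u (.inr j') = u (.inr j) := ⟨j, rfl⟩
        have hj : h.choose = j := Sum.inr_injective (hu h.choose_spec)
        simp only [α, aeval_X, dif_pos h, hj, hx₂, map_add, map_mul]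
    rw [h3] at h2
    refine IsRegular.of_isWeaklyRegular_of_mem_maximalIdeal R (fun r hr => ?_) h2
    obtain ⟨t, rfl⟩ := mem_enum.mp hr
    exact hx t

end local_ring

end

section

variable {X : Scheme.{u}}

/-! ### Local rings of Grassmann bundles -/

lemma germ_flat {U : X.Opens} (hU : IsAffineOpen U) {x : X} (hx : x ∈ U) :
    (X.presheaf.germ U x hx).hom.Flat := by
  let := X.presheaf.algebra_section_stalk ⟨x, hx⟩
  have := hU.isLocalization_stalk ⟨x, hx⟩
  exact IsLocalization.flat _ (hU.primeIdealOf ⟨x, hx⟩).asIdeal.primeCompl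

open MvPolynomial in
-- `B[σ]` is a localization of `A[σ]`, so flatness may be tested over either ring. This passes from
-- the functions on an affine open to the local ring at a point.
lemma flat_eval₂Hom_of_isLocalization {A B R σ : Type*} [CommRing A] [CommRing B] [CommRing R]
    [Algebra A B] (M : Submonoid A) [IsLocalization M B] (h : B →+* R) (c : σ → R)
    (hf : (eval₂Hom (h.comp (algebraMap A B)) c).Flat) : (eval₂Hom h c).Flat := by
  let := algebraMvPolynomial (σ := σ) (R := A) (S := B)
  let := (eval₂Hom h c).toAlgebra
  let := (eval₂Hom (h.comp (algebraMap A B)) c).toAlgebra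
  have : IsScalarTower (MvPolynomial σ A) (MvPolynomial σ B) R := by
    refine .of_algebraMap_eq' ?_
    change eval₂Hom _ _ = (eval₂Hom h c).comp (algebraMap (MvPolynomial σ A) (MvPolynomial σ B))
    rw [MvPolynomial.algebraMap_def]
    ext <;> simp
  exact (Module.flat_iff_of_isLocalization (MvPolynomial σ B) (M.map (C (σ := σ))) R).mpr hf

lemma germ_resFun {U V : X.Opens} (h : V ≤ U) {x : X} (hx : x ∈ V) (s : Γ(X, U)) :
    X.presheaf.germ V x hx (resFun X h s) = X.presheaf.germ U x (h hx) s :=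
  X.presheaf.germ_res_apply (homOfLE h) x hx s

lemma stalkMap_germ {Y : Scheme.{u}} (f : X ⟶ Y) (U : Y.Opens) (x : X) (hx : f x ∈ U)
    (s : Γ(Y, U)) : f.stalkMap x (Y.presheaf.germ U (f x) hx s) =
      X.presheaf.germ (f ⁻¹ᵁ U) x hx (funPull f U s) :=
  ConcreteCategory.congr_hom (f.germ_stalkMap U x hx) s

lemma germ_funPull_comp {Y Z : Scheme.{u}} {f : X ⟶ Y} {g : Y ⟶ Z} {h : X ⟶ Z} (e : f ≫ g = h)
    (U : Z.Opens) (x : X) (hx : g (f x) ∈ U) (s : Γ(Z, U)) :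
    X.presheaf.germ (f ⁻¹ᵁ g ⁻¹ᵁ U) x hx (funPull f _ (funPull g U s)) =
      X.presheaf.germ (h ⁻¹ᵁ U) x (by rw [← e]; exact hx) (funPull h U s) := by
  subst e; rfl

variable {E : X.Modules} {r n : ℕ}

namespace Chart

variable (C : Chart E r n)

lemma exists_isOpenImmersion (Gr : GrassmannBundle E r) :
    ∃ a : C.scheme ⟶ Gr.scheme, IsOpenImmersion a ∧ Gr.point.map a = C.point ∧
      ∀ z ∈ C.locus Gr.point, ∃ w, a w = z := by
  obtain ⟨a, ha, -⟩ := Gr.existsUnique_map_point_eq C.point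
  obtain ⟨b, hb⟩ := C.exists_map_eq_locus Gr.point
  have h1 : b ≫ a = (C.locus Gr.point).ι :=
    (Gr.existsUnique_map_point_eq (Gr.point.map (C.locus Gr.point).ι)).unique
      (by rw [← GrPoint.map_map, ha, hb]) rfl
  refine ⟨a, C.isOpenImmersion Gr.point (fun T q => Gr.existsUnique_map_point_eq q) a ha, ha,
    fun z hz => ⟨b ⟨z, hz⟩, ?_⟩⟩
  have h2 := congr_arg (fun f : (C.locus Gr.point).toScheme ⟶ Gr.scheme => f ⟨z, hz⟩) h1
  exact (Scheme.Hom.comp_apply b a _).symm.trans h2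

open MvPolynomial in
/-- The polynomial ring over the functions on the base of an affine chart. -/
lemma isAffine_and_bijective (hU : IsAffineOpen C.U) : IsAffine C.scheme ∧ Function.Bijective
    (eval₂Hom ((C.scheme.presheaf.map (homOfLE C.top_le).op).hom.comp (C.toX.app C.U).hom)
      (fun kj : Fin n × Fin r => C.coordFn kj.1 kj.2)) := by
  have : IsAffine C.U := hU
  refine ⟨inferInstance, ?_⟩
  let S := (C.U : Scheme.{u})
  let I := ULift.{u} (Fin n × Fin r)
  have h1 : Function.Bijective (eval₂Hom ((𝔸(I; S) ↘ S).appTop).hom (AffineSpace.coord S)) := by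
    have h2 := AffineSpace.isoOfIsAffine_hom_appTop (n := I) S
    rw [← Iso.inv_comp_eq] at h2
    have h3 : IsIso (CommRingCat.ofHom
        (eval₂Hom ((𝔸(I; S) ↘ S).appTop).hom (AffineSpace.coord S))) := by
      rw [← h2]
      have : IsIso (AffineSpace.isoOfIsAffine I S).hom.appTop :=
        inferInstanceAs (IsIso ((AffineSpace.isoOfIsAffine I S).hom.app ⊤))
      exact IsIso.comp_isIso' inferInstance this
    exact (ConcreteCategory.isIso_iff_bijective _).mp h3
  let e : MvPolynomial (Fin n × Fin r) Γ(X, C.U) ≃+* MvPolynomial I Γ(S, ⊤) :=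
    (mapEquiv _ C.U.topIso.symm.commRingCatIsoToRingEquiv).trans
      (renameEquiv _ Equiv.ulift.symm).toRingEquiv
  have h4 : eval₂Hom ((C.scheme.presheaf.map (homOfLE C.top_le).op).hom.comp (C.toX.app C.U).hom)
      (fun kj : Fin n × Fin r => C.coordFn kj.1 kj.2) =
      (eval₂Hom ((𝔸(I; S) ↘ S).appTop).hom (AffineSpace.coord S)).comp e := by
    apply ringHom_ext
    · intro s
      simp only [coe_eval₂Hom, eval₂_C, RingHom.comp_apply]
      have : (e : MvPolynomial (Fin n × Fin r) Γ(X, C.U) →+* MvPolynomial I Γ(S, ⊤)) (.C s) =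
          .C (C.U.topIso.inv s) := by simp [e]
      rw [this, eval₂_C]
      let p := 𝔸(I; S) ↘ S
      have hU' : ⊤ ≤ C.U.ι ⁻¹ᵁ C.U := (C.U.ι_preimage_self).ge
      have h5 : C.toX.app C.U = C.U.ι.app C.U ≫ p.app (C.U.ι ⁻¹ᵁ C.U) :=
        Scheme.Hom.comp_app p C.U.ι C.U
      have h6 : p.app (C.U.ι ⁻¹ᵁ C.U) ≫ C.scheme.presheaf.map (homOfLE C.top_le).op =
          S.presheaf.map (homOfLE hU').op ≫ p.appTop := (p.naturality (homOfLE hU').op).symm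
      have h7 : C.U.ι.app C.U ≫ S.presheaf.map (homOfLE hU').op = C.U.topIso.inv := by
        rw [Scheme.Opens.ι_app]
        exact (X.presheaf.map_comp _ _).symm
      have h8 : C.toX.app C.U ≫ C.scheme.presheaf.map (homOfLE C.top_le).op =
          C.U.topIso.inv ≫ p.appTop := by
        refine (congr_arg (· ≫ C.scheme.presheaf.map (homOfLE C.top_le).op) h5).trans ?_
        refine (Category.assoc _ _ _).trans ((congr_arg (C.U.ι.app C.U ≫ ·) h6).trans ?_)
        exact (Category.assoc _ _ _).symm.trans (congr_arg (· ≫ p.appTop) h7)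
      exact ConcreteCategory.congr_hom h8 s
    · intro i
      simp [e, coordFn]
      rfl
  rw [h4]
  exact h1.comp e.bijective

open MvPolynomial in
-- Over an affine chart the functions form a polynomial ring in the graph coordinates over the
-- functions on the base, and the local ring of the Grassmann bundle is one of its localizations.
lemma flat_stalk (hU : IsAffineOpen C.U) (Gr : GrassmannBundle E r) {W : Gr.scheme.Opens}
    (hW : W ≤ Gr.π ⁻¹ᵁ C.U) {c : Fin n → Fin r → Γ(Gr.scheme, W)}
    (hc : Gr.point.sub.IsGraph (fun i => pull Gr.π E C.U (C.e i)) hW c) {z : Gr.scheme}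
    (hz : z ∈ W) :
    (eval₂Hom (Gr.π.stalkMap z).hom fun kj : Fin n × Fin r =>
      Gr.scheme.presheaf.germ W z hz (c kj.1 kj.2)).Flat := by
  obtain ⟨a, ha, hap, hw⟩ := C.exists_isOpenImmersion Gr
  obtain ⟨w, rfl⟩ := hw z (Sub.mem_graphLocus.mpr ⟨W, hW, c, hz, hc⟩)
  have hy : Gr.π (a w) ∈ C.U := hW hz
  let := X.presheaf.algebra_section_stalk ⟨Gr.π (a w), hy⟩
  have := hU.isLocalization_stalk ⟨Gr.π (a w), hy⟩
  refine flat_eval₂Hom_of_isLocalization (hU.primeIdealOf ⟨Gr.π (a w), hy⟩).asIdeal.primeCompl _ _ ?_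
  obtain ⟨hA, hbij⟩ := C.isAffine_and_bijective hU
  have hflat := (RingHom.Flat.of_bijective hbij).comp
    (germ_flat (isAffineOpen_top C.scheme) (Set.mem_univ w))
  have hs : Function.Bijective (a.stalkMap w).hom :=
    (ConcreteCategory.isIso_iff_bijective (a.stalkMap w)).mp inferInstance
  refine (RingHom.Flat.comp_iff_of_bijective_left hs).mp ?_
  have hπ : a ≫ Gr.π = C.toX := congr_arg GrPoint.hom hap
  convert! hflat using 1
  apply ringHom_ext
  · intro s
    simp only [RingHom.comp_apply, coe_eval₂Hom, eval₂_C]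
    refine (congr_arg (a.stalkMap w) (stalkMap_germ Gr.π C.U (a w) hy s)).trans ?_
    refine (stalkMap_germ a (Gr.π ⁻¹ᵁ C.U) w hy _).trans ?_
    refine (germ_funPull_comp hπ C.U w hy s).trans ?_
    exact (germ_resFun C.top_le (Set.mem_univ w) (funPull C.toX C.U s)).symm
  · intro kj
    simp only [RingHom.comp_apply, coe_eval₂Hom, eval₂_X]
    refine (stalkMap_germ a W w hz _).trans ?_
    have h1 := hc.pull_pull Gr.point.isRank a hπ
    obtain ⟨_, h2⟩ := (GrPoint.eq_map_iff a).mp hap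
    have h3 : Gr.point.sub.pull a hπ = C.point.sub := h2
    rw [h3] at h1
    have h4 := h1.unique (C.isFrame.pull C.toX)
      (C.isGraph_point.res (le_top : a ⁻¹ᵁ W ≤ ⊤))
    have h5 : funPull a W (c kj.1 kj.2) = resFun C.scheme le_top (C.coordFn kj.1 kj.2) :=
      congr_fun (congr_fun h4 kj.1) kj.2
    rw [h5]
    exact germ_resFun (X := C.scheme) (V := a ⁻¹ᵁ W) le_top hz (C.coordFn kj.1 kj.2)
end Chart

end

section

variable {X : Scheme.{u}}

/-! ### Frames of sheaves of homomorphisms -/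

section hom

variable {M N : X.Modules} {U V : X.Opens} {ι κ : Type} [Fintype ι] [Fintype κ]
  {k : ι → Γ(M, U)} {p : κ → Γ(N, U)}

/-- The elementary homomorphisms attached to two frames. -/
def IsFrame.elementaryHom (hk : IsFrame M U k) (p : κ → Γ(N, U)) (t : κ × ι) :
    Γ(sheafHom M N, U) :=
  (⟨fun _ hV => ((LinearMap.proj t.2).comp (hk.coord hV)).smulRight (GrassmannBlowup.res N hV (p t.1)),
    fun V W hV hW m => by
      simp only [LinearMap.smulRight_apply, LinearMap.comp_apply, LinearMap.proj_apply, res_smul,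
        res_res]
      rw [hk.coord_res hV hW]⟩ : LocalHom M N U)

/-- The local homomorphism underlying a section of the sheaf of homomorphisms. -/
def toLocalHom (α : Γ(sheafHom M N, U)) : LocalHom M N U := α

/-- Evaluation of local homomorphisms. -/
def evalHom (hV : V ≤ U) (m : Γ(M, V)) : Γ(sheafHom M N, U) →+ Γ(N, V) where
  toFun α := (toLocalHom α).app V hV m
  map_zero' := rfl
  map_add' _ _ := rfl

lemma IsFrame.toLocalHom_sum_app (hk : IsFrame M U k) (hV : V ≤ U) (a : κ × ι → Γ(X, V))
    {W : X.Opens} (hW : W ≤ V) (m : Γ(M, W)) :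
    (toLocalHom (∑ t, a t • GrassmannBlowup.res (sheafHom M N) hV (hk.elementaryHom p t))).app W hW m =
      ∑ t, resFun X hW (a t) • hk.coord (hW.trans hV) m t.2 • GrassmannBlowup.res N (hW.trans hV) (p t.1) := by
  exact map_sum (evalHom hW m) _ _

lemma IsFrame.sum_elementaryHom (hk : IsFrame M U k) (hp : IsFrame N U p) (hV : V ≤ U)
    (α : Γ(sheafHom M N, V)) :
    ∑ t : κ × ι, hp.coord hV ((toLocalHom α).app V le_rfl (GrassmannBlowup.res M hV (k t.2))) t.1 •
      GrassmannBlowup.res (sheafHom M N) hV (hk.elementaryHom p t) = α := by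
  change toLocalHom _ = toLocalHom α
  refine LocalHom.ext ?_
  funext W hW
  ext m
  refine (hk.toLocalHom_sum_app hV _ hW m).trans ?_
  conv_rhs => rw [← hk.sum_coord (hW.trans hV) m, map_sum]
  rw [Fintype.sum_prod_type, Finset.sum_comm]
  refine Finset.sum_congr rfl fun j _ => ?_
  rw [map_smul, ← res_res M hV hW, ← LocalHom.res_app (toLocalHom α) V W le_rfl hW]
  conv_rhs => rw [← hp.sum_coord (hW.trans hV) (GrassmannBlowup.res N hW _), Finset.smul_sum]
  refine Finset.sum_congr rfl fun i _ => ?_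
  rw [hp.coord_res hV hW, smul_comm]

lemma IsFrame.hom (hk : IsFrame M U k) (hp : IsFrame N U p) :
    IsFrame (sheafHom M N) U (hk.elementaryHom p) := by
  classical
  intro V hV
  constructor
  · intro a a' haa'
    funext ⟨i, j⟩
    have h1 := congr_arg (fun α => (toLocalHom α).app V le_rfl (GrassmannBlowup.res M hV (k j))) haa'
    simp only [hk.toLocalHom_sum_app hV] at h1
    have key : ∀ a : κ × ι → Γ(X, V), ∑ t, resFun X le_rfl (a t) •
        hk.coord (le_rfl.trans hV) (GrassmannBlowup.res M hV (k j)) t.2 • GrassmannBlowup.res N (le_rfl.trans hV) (p t.1) =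
          ∑ i, a (i, j) • GrassmannBlowup.res N hV (p i) := by
      intro a
      rw [Fintype.sum_prod_type]
      refine Finset.sum_congr rfl fun i _ => ?_
      rw [Finset.sum_eq_single j]
      · rw [resFun_self, hk.coord_frame hV j, Pi.single_eq_same, one_smul]
      · intro j' _ hj'
        rw [hk.coord_frame hV j, Pi.single_eq_of_ne hj', zero_smul, smul_zero]
      · exact fun h => absurd (Finset.mem_univ j) h
    rw [key, key] at h1
    exact congr_fun (@(hp V hV).1 (fun i => a (i, j)) (fun i => a' (i, j)) h1) i
  · exact fun α => ⟨_, hk.sum_elementaryHom hp hV α⟩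

lemma IsFrame.coord_hom (hk : IsFrame M U k) (hp : IsFrame N U p) (hV : V ≤ U)
    (α : Γ(sheafHom M N, V)) (i : κ) (j : ι) :
    (hk.hom hp).coord hV α (i, j) =
      hp.coord hV ((toLocalHom α).app V le_rfl (GrassmannBlowup.res M hV (k j))) i := by
  have h := (hk.hom hp).coord_eq hV (m := α)
    (a := fun t => hp.coord hV ((toLocalHom α).app V le_rfl (GrassmannBlowup.res M hV (k t.2))) t.1)
    (hk.sum_elementaryHom hp hV α)
  exact congr_fun h (i, j)

lemma IsFrame.coord_homSection (hk : IsFrame M U k) (hp : IsFrame N U p) (hV : V ≤ U)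
    (ψ : M ⟶ N) (i : κ) (j : ι) :
    (hk.hom hp).coord hV (GrassmannBlowup.res (sheafHom M N) le_top (homSection ψ)) (i, j) =
      hp.coord hV (ψ.app V (GrassmannBlowup.res M hV (k j))) i :=
  hk.coord_hom hp hV _ i j

lemma isLocallyFree_sheafHom (hM : IsLocallyFree M) (hN : IsLocallyFree N) :
    IsLocallyFree (sheafHom M N) := by
  intro x
  obtain ⟨U, hx, m, ⟨e⟩⟩ := hM x
  obtain ⟨U', hx', n, ⟨f⟩⟩ := hN x
  obtain ⟨l, hl⟩ := ((e.isFrame.res (inf_le_left : U ⊓ U' ≤ U)).hom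
    (f.isFrame.res inf_le_right)).exists_frame_fin
  exact ⟨U ⊓ U', ⟨hx, hx'⟩, l, hl⟩

lemma zeroIdeal_homSection_ideal (hM : IsLocallyFree M) (hN : IsLocallyFree N) (ψ : M ⟶ N)
    (hk : IsFrame M U k) (hp : IsFrame N U p) (V : X.affineOpens) (hV : V.1 ≤ U) :
    (zeroIdeal (homSection ψ)).ideal V = Ideal.span (Set.range fun t : κ × ι =>
      resFun X hV (hp.coord le_rfl (ψ.app U (k t.2)) t.1)) := by
  rw [zeroIdeal_ideal (isLocallyFree_sheafHom hM hN) _ (hk.hom hp) V hV]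
  congr 2
  funext ⟨i, j⟩
  rw [hk.coord_homSection hp hV, ← res_app, hp.coord_res le_rfl hV]

end hom

/-! ### Effective Cartier divisors on locally noetherian schemes -/

lemma mem_nonZeroDivisors_of_germ {U : X.Opens} {a : Γ(X, U)}
    (h : ∀ x (hx : x ∈ U), X.presheaf.germ U x hx a ∈ nonZeroDivisors (X.presheaf.stalk x)) :
    a ∈ nonZeroDivisors Γ(X, U) := by
  rw [mem_nonZeroDivisors_iff_right]
  intro b hb
  refine TopCat.Presheaf.section_ext X.sheaf U b 0 fun x hx => ?_
  rw [map_zero]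
  refine (mem_nonZeroDivisors_iff_right.mp (h x hx)) _ ?_
  exact (map_mul (X.presheaf.germ U x hx).hom b a).symm.trans (by rw [hb, map_zero])

lemma germ_mem_nonZeroDivisors {U : X.Opens} (hU : IsAffineOpen U) {a : Γ(X, U)}
    (ha : a ∈ nonZeroDivisors Γ(X, U)) (x : X) (hx : x ∈ U) :
    X.presheaf.germ U x hx a ∈ nonZeroDivisors (X.presheaf.stalk x) := by
  let := X.presheaf.algebra_section_stalk ⟨x, hx⟩
  have := hU.isLocalization_stalk ⟨x, hx⟩
  exact IsLocalization.map_nonZeroDivisors_le (hU.primeIdealOf ⟨x, hx⟩).asIdeal.primeCompl _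
    ⟨a, ha, rfl⟩

lemma resFun_mem_nonZeroDivisors {U V : X.Opens} (hU : IsAffineOpen U) (h : V ≤ U) {a : Γ(X, U)}
    (ha : a ∈ nonZeroDivisors Γ(X, U)) : resFun X h a ∈ nonZeroDivisors Γ(X, V) :=
  mem_nonZeroDivisors_of_germ fun x hx => by
    rw [germ_resFun]
    exact germ_mem_nonZeroDivisors hU ha x (h hx)

/-- On a noetherian affine open, a function whose germ is a nonzerodivisor is a nonzerodivisor
near the point. -/
lemma exists_basicOpen_mem_nonZeroDivisors {U : X.Opens} (hU : IsAffineOpen U)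
    [IsNoetherianRing Γ(X, U)] {a : Γ(X, U)} {x : X} (hx : x ∈ U)
    (ha : X.presheaf.germ U x hx a ∈ nonZeroDivisors (X.presheaf.stalk x)) :
    ∃ h : Γ(X, U), x ∈ X.basicOpen h ∧
      resFun X (X.basicOpen_le h) a ∈ nonZeroDivisors Γ(X, X.basicOpen h) := by
  -- The annihilator of `a` is finitely generated and vanishes in the stalk. A product of elements
  -- killing its generators, none of them vanishing at `x`, kills all of it.
  let K : Ideal Γ(X, U) := LinearMap.ker (LinearMap.mulLeft Γ(X, U) a)
  obtain ⟨S, hS⟩ := IsNoetherian.noetherian K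
  let := X.presheaf.algebra_section_stalk ⟨x, hx⟩
  have := hU.isLocalization_stalk ⟨x, hx⟩
  have key : ∀ b ∈ K, ∃ h : Γ(X, U), x ∈ X.basicOpen h ∧ h * b = 0 := by
    intro b hb
    have h1 : a * b = 0 := hb
    have h2 : X.presheaf.germ U x hx b = 0 := by
      refine (mem_nonZeroDivisors_iff_left.mp ha) _ ?_
      rw [← map_mul, h1, map_zero]
    obtain ⟨⟨h, hh⟩, h3⟩ := (IsLocalization.map_eq_zero_iff
      (hU.primeIdealOf ⟨x, hx⟩).asIdeal.primeCompl (X.presheaf.stalk x) b).mp h2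
    refine ⟨h, ?_, h3⟩
    rw [X.mem_basicOpen _ _ hx]
    exact IsLocalization.map_units (X.presheaf.stalk x) ⟨h, hh⟩
  choose! h hxh hh using key
  have hK : ∀ b ∈ S, b ∈ K := fun b hb => hS ▸ Submodule.subset_span hb
  refine ⟨∏ b ∈ S, h b, ?_, ?_⟩
  · rw [X.mem_basicOpen _ _ hx, map_prod]
    refine IsUnit.prod_iff.mpr fun b hb => ?_
    exact (X.mem_basicOpen _ _ hx).mp (hxh b (hK b hb))
  · classical
    set H := ∏ b ∈ S, h b
    have hH : ∀ b ∈ K, H * b = 0 := by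
      intro b hb
      rw [← hS] at hb
      induction hb using Submodule.span_induction with
      | mem b hb =>
        rw [show H = h b * ∏ b ∈ S.erase b, h b from (Finset.mul_prod_erase S h hb).symm,
          mul_right_comm, hh b (hK b hb), zero_mul]
      | zero => rw [mul_zero]
      | add b c _ _ h1 h2 => rw [mul_add, h1, h2, add_zero]
      | smul c b _ h1 => rw [smul_eq_mul, mul_left_comm, h1, mul_zero]
    rw [mem_nonZeroDivisors_iff_right]
    intro s hs
    obtain ⟨N, t, ht⟩ := IsAffineOpen.exists_resFun_eq hU H (X.basicOpen_le H) rfl s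
    have hu : IsUnit (resFun X (X.basicOpen_le H) H) := isUnit_resFun H _ le_rfl
    have h1 : resFun X (X.basicOpen_le H) (t * a) = 0 := by
      rw [map_mul, ht, mul_assoc, hs, mul_zero]
    obtain ⟨N', h2⟩ := IsAffineOpen.exists_pow_mul_mem hU H (X.basicOpen_le H) rfl ⊥
      (t := t * a) (by rw [h1]; exact zero_mem _)
    have h3 : H * (H ^ N' * t) = 0 := hH _ (by
      change a * (H ^ N' * t) = 0
      rw [← (Submodule.mem_bot _).mp h2]; ring)
    have h4 := congr_arg (resFun X (X.basicOpen_le H)) h3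
    rw [map_mul, map_mul, map_zero, map_pow, ht] at h4
    rwa [hu.mul_right_eq_zero, (hu.pow _).mul_right_eq_zero, (hu.pow _).mul_right_eq_zero] at h4

/-- An ideal sheaf which is locally generated by a function whose germ is a nonzerodivisor defines
an effective Cartier divisor. -/
lemma isEffectiveCartier_of_germ [IsLocallyNoetherian X] {I : X.IdealSheafData}
    (h : ∀ x : X, ∃ (U : X.affineOpens) (hx : x ∈ U.1) (a : Γ(X, U)),
      I.ideal U = Ideal.span {a} ∧
        X.presheaf.germ U x hx a ∈ nonZeroDivisors (X.presheaf.stalk x)) :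
    IsEffectiveCartier I := by
  intro x
  obtain ⟨U, hx, a, hI, ha⟩ := h x
  have : IsNoetherianRing Γ(X, U) := IsLocallyNoetherian.component_noetherian U
  obtain ⟨H, hxH, hH⟩ := exists_basicOpen_mem_nonZeroDivisors U.2 hx ha
  refine ⟨X.affineBasicOpen H, hxH, _, hH, ?_⟩
  have h1 := I.map_ideal (X.affineBasicOpen_le H)
  rw [hI, Ideal.map_span, Set.image_singleton] at h1
  exact h1.symm

end

section

variable {X : Scheme.{u}}

/-! ### Morphisms in normal form -/

lemma IsFrame.coord_reindex {M : X.Modules} {U V : X.Opens} {ι κ : Type} [Fintype ι] [Fintype κ]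
    {b : ι → Γ(M, U)} (hb : IsFrame M U b) (e : κ ≃ ι) (h : V ≤ U) (m : Γ(M, V)) (k : κ) :
    (hb.reindex e).coord h m k = hb.coord h m (e k) := by
  refine congr_fun ((hb.reindex e).coord_eq h (a := fun k => hb.coord h m (e k)) ?_) k
  rw [Equiv.sum_comp e fun i => hb.coord h m i • GrassmannBlowup.res M h (b i), hb.sum_coord]

lemma IsFrame.coord_map_iso {M N : X.Modules} {U V : X.Opens} {ι : Type} [Fintype ι]
    {b : ι → Γ(M, U)} (hb : IsFrame M U b) (φ : M ⟶ N) [IsIso φ] (h : V ≤ U) (m : Γ(M, V)) :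
    (hb.map_iso φ).coord h (φ.app V m) = hb.coord h m := by
  refine (hb.map_iso φ).coord_eq h ?_
  conv_rhs => rw [← hb.sum_coord h m, app_sum_smul]
  exact Finset.sum_congr rfl fun i _ => by rw [res_app]

/-- Frames in which a morphism is given by the block diagonal matrix with blocks an identity matrix
of size `p` and the row `g`. -/
structure NormalForm {E F : X.Modules} (φ : E ⟶ F) (p q : ℕ) where
  U : X.affineOpens
  e : Fin p ⊕ Fin q → Γ(E, U)
  f : Fin p ⊕ Unit → Γ(F, U)
  g : Fin q → Γ(X, U)
  isFrame_e : IsFrame E U e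
  isFrame_f : IsFrame F U f
  app_inl (i : Fin p) : φ.app U (e (.inl i)) = f (.inl i)
  app_inr (j : Fin q) : φ.app U (e (.inr j)) = g j • f (.inr ())

namespace NormalForm

variable {E F : X.Modules} {φ : E ⟶ F} {p q : ℕ} (D : NormalForm φ p q)

variable {T : Scheme.{u}}

lemma app_e_pull (f : T ⟶ X) (t : Fin p ⊕ Fin q) :
    ((Scheme.Modules.pullback f).map φ).app (f ⁻¹ᵁ D.U.1) (pull f E D.U.1 (D.e t)) =
      t.elim (fun i => pull f F D.U.1 (D.f (.inl i)))
        (fun j => funPull f D.U.1 (D.g j) • pull f F D.U.1 (D.f (.inr ()))) := by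
  rw [pull_naturality]
  obtain i | j := t
  · exact congr_arg (pull f F D.U.1) (D.app_inl i)
  · exact (congr_arg (pull f F D.U.1) (D.app_inr j)).trans (pull_smul f F D.U.1 _ _)

lemma coord_app (f : T ⟶ X) {W : T.Opens} (hW : W ≤ f ⁻¹ᵁ D.U.1)
    (m : Γ((Scheme.Modules.pullback f).obj E, W)) :
    (D.isFrame_f.pull f).coord hW (((Scheme.Modules.pullback f).map φ).app W m) =
      Sum.elim (fun i => (D.isFrame_e.pull f).coord hW m (.inl i)) fun _ =>
        ∑ j, (D.isFrame_e.pull f).coord hW m (.inr j) * resFun T hW (funPull f D.U.1 (D.g j)) := by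
  refine (D.isFrame_f.pull f).coord_eq hW ?_
  conv_rhs => rw [← (D.isFrame_e.pull f).sum_coord hW m, app_sum_smul]
  simp only [Fintype.sum_sum_type, Sum.elim_inl, Sum.elim_inr, Finset.univ_unique,
    Finset.sum_singleton, Finset.sum_smul]
  congr 1
  · refine Finset.sum_congr rfl fun i _ => ?_
    rw [← res_app, D.app_e_pull f (.inl i)]
    rfl
  · refine Finset.sum_congr rfl fun j _ => ?_
    rw [← res_app, D.app_e_pull f (.inr j), mul_smul]
    refine congr_arg ((D.isFrame_e.pull f).coord hW m (.inr j) • ·) ?_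
    exact (res_smul _ hW _ _).symm

lemma app_eq_zero_iff (f : T ⟶ X) {W : T.Opens} (hW : W ≤ f ⁻¹ᵁ D.U.1)
    (m : Γ((Scheme.Modules.pullback f).obj E, W)) :
    ((Scheme.Modules.pullback f).map φ).app W m = 0 ↔
      (∀ i, (D.isFrame_e.pull f).coord hW m (.inl i) = 0) ∧
      ∑ j, (D.isFrame_e.pull f).coord hW m (.inr j) * resFun T hW (funPull f D.U.1 (D.g j)) = 0 := by
  have h := D.coord_app f hW m
  constructor
  · intro h0
    rw [h0, map_zero] at h
    exact ⟨fun i => (congr_fun h (.inl i)).symm, (congr_fun h (.inr ())).symm⟩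
  · rintro ⟨h1, h2⟩
    rw [← (D.isFrame_f.pull f).sum_coord hW (((Scheme.Modules.pullback f).map φ).app W m), h]
    refine Finset.sum_eq_zero fun t _ => ?_
    obtain i | _ := t
    · rw [Sum.elim_inl, h1, zero_smul]
    · rw [Sum.elim_inr, h2, zero_smul]

lemma matrix_eq : D.isFrame_e.matrix D.isFrame_f φ =
    Matrix.fromBlocks 1 0 0 (Matrix.of fun _ j => D.g j) := by
  classical
  ext i j
  change D.isFrame_f.coord le_rfl (φ.app D.U (D.e j)) i = _
  have key : ∀ s, D.isFrame_f.coord le_rfl (D.f s) = Pi.single s 1 := fun s => by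
    have := D.isFrame_f.coord_frame le_rfl s
    rwa [res_self] at this
  obtain j | j := j
  · rw [D.app_inl, key]
    obtain i | i := i
    · by_cases h : i = j
      · subst h; simp
      · rw [Pi.single_eq_of_ne (by simpa using h)]; simp [Matrix.one_apply_ne h]
    · simp
  · rw [D.app_inr, map_smul, key]
    obtain i | i := i <;> simp

end NormalForm

section minors

variable {R : Type*} [CommRing R]

/-- A minor with distinct rows uses all `p + 1` of them, so it contains the last row, whose entries
are zero or entries of `g`. Conversely, the identity columns and the column `l` give `g l`. -/
lemma span_minors_fromBlocks_one {p q : ℕ} (g : Fin q → R) :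
    Ideal.span (minors (Matrix.fromBlocks (1 : Matrix (Fin p) (Fin p) R) 0 0
      (Matrix.of fun (_ : Unit) j => g j)) (p + 1)) = Ideal.span (Set.range g) := by
  classical
  set Φ := Matrix.fromBlocks (1 : Matrix (Fin p) (Fin p) R) 0 0 (Matrix.of fun (_ : Unit) j => g j)
  apply le_antisymm
  · rw [Ideal.span_le]
    rintro _ ⟨row, col, rfl⟩
    by_cases hrow : Function.Injective row
    · have hsurj : Function.Surjective row :=
        ((Fintype.bijective_iff_injective_and_card row).mpr ⟨hrow, by simp⟩).2
      obtain ⟨i, hi⟩ := hsurj (.inr ())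
      rw [SetLike.mem_coe, ← Ideal.Quotient.eq_zero_iff_mem, RingHom.map_det]
      refine Matrix.det_eq_zero_of_row_eq_zero i fun j => ?_
      simp only [RingHom.mapMatrix_apply, Matrix.map_apply, Matrix.submatrix_apply, hi, Φ]
      obtain k | k := col j
      · simp
      · exact Ideal.Quotient.eq_zero_iff_mem.mpr (Ideal.subset_span (Set.mem_range_self k))
    · rw [Function.Injective] at hrow
      push Not at hrow
      obtain ⟨i, i', h1, h2⟩ := hrow
      rw [Matrix.det_zero_of_row_eq h2 (by ext j; simp [h1])]
      exact zero_mem _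
  · rw [Ideal.span_le]
    rintro _ ⟨l, rfl⟩
    refine Ideal.subset_span ?_
    let s : Fin (p + 1) ≃ Fin p ⊕ Unit := Fintype.equivOfCardEq (by simp)
    refine ⟨s, fun i => (s i).elim .inl fun _ => .inr l, ?_⟩
    have : Φ.submatrix s (fun i => (s i).elim .inl fun _ => .inr l) =
        (Matrix.fromBlocks (1 : Matrix (Fin p) (Fin p) R) 0 0
          (Matrix.of fun (_ _ : Unit) => g l)).submatrix s s := by
      ext i j
      simp only [Matrix.submatrix_apply, Φ]
      obtain a | a := s i <;> obtain b | b := s j <;> simp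
    rw [this, Matrix.det_submatrix_equiv_self, Matrix.det_fromBlocks_zero₂₁]
    simp

end minors

namespace NormalForm

variable {E F : X.Modules} {φ : E ⟶ F} {p q : ℕ} (D : NormalForm φ p q)

lemma minorIdeal_ideal (hE : IsLocallyFree E) (hF : IsLocallyFree F) :
    (minorIdeal φ (p + 1)).ideal D.U = Ideal.span (Set.range D.g) := by
  rw [GrassmannBlowup.minorIdeal_ideal hE hF φ (p + 1) D.isFrame_e D.isFrame_f D.U le_rfl,
    D.matrix_eq, span_minors_fromBlocks_one]
  have : resFun X (le_refl D.U.1) = RingHom.id _ := RingHom.ext fun x => resFun_self x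
  rw [this, Ideal.map_id]

lemma comap_minorIdeal_ideal (hE : IsLocallyFree E) (hF : IsLocallyFree F) {T : Scheme.{u}}
    (f : T ⟶ X) (V : T.affineOpens) (hV : V.1 ≤ f ⁻¹ᵁ D.U.1) :
    ((minorIdeal φ (p + 1)).comap f).ideal V =
      Ideal.span (Set.range fun j => resFun T hV (funPull f D.U.1 (D.g j))) := by
  rw [ideal_comap_eq_map f _ D.U V hV, D.minorIdeal_ideal hE hF, Ideal.map_span]
  rw [← Set.range_comp]
  rfl

end NormalForm

/-- The change of frame is block triangular by `h`. Its diagonal block `D` is square with a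
one-sided inverse, hence invertible, and so the inverse change of frame is block triangular as well.
-/
lemma Sub.IsSplit.inl_mem_of_le {M : X.Modules} {N N' : Sub M} {U : X.Opens} {ι κ : Type}
    [Fintype ι] [Fintype κ] {v v' : ι ⊕ κ → Γ(M, U)} (hv : N.IsSplit U v) (hv' : N'.IsSplit U v')
    (h : ∀ i, v (.inl i) ∈ N'.carrier U) (i : ι) : v' (.inl i) ∈ N.carrier U := by
  classical
  let P (t s : ι ⊕ κ) := hv'.isFrame.coord le_rfl (v s) t
  let Q (t s : ι ⊕ κ) := hv.isFrame.coord le_rfl (v' s) t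
  have hP : ∀ k i, P (.inr k) (.inl i) = 0 := fun k i =>
    (hv'.mem_iff U le_rfl _).mp (h i) k
  have hPQ : ∀ t s, ∑ u, P t u * Q u s = if t = s then 1 else 0 := by
    intro t s
    have h1 := congr_arg (fun m => hv'.isFrame.coord le_rfl m t)
      (hv.isFrame.sum_coord le_rfl (v' s))
    simp only [map_sum, map_smul, Finset.sum_apply, Pi.smul_apply, smul_eq_mul, res_self] at h1
    have h2 := hv'.isFrame.coord_frame le_rfl s
    rw [res_self] at h2
    rw [h2, Pi.single_apply] at h1
    rw [← h1]
    exact Finset.sum_congr rfl fun u _ => mul_comm _ _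
  let D : Matrix κ κ Γ(X, U) := Matrix.of fun k l => P (.inr k) (.inr l)
  let D' : Matrix κ κ Γ(X, U) := Matrix.of fun k l => Q (.inr k) (.inr l)
  let Z : Matrix κ ι Γ(X, U) := Matrix.of fun k i => Q (.inr k) (.inl i)
  have h1 : D * D' = 1 := by
    ext k l
    have := hPQ (.inr k) (.inr l)
    rw [Fintype.sum_sum_type] at this
    simp only [hP, zero_mul, Finset.sum_const_zero, zero_add, Sum.inr.injEq] at this
    rw [Matrix.mul_apply, Matrix.one_apply]
    exact this
  have h2 : D * Z = 0 := by
    ext k l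
    have := hPQ (.inr k) (.inl l)
    rw [Fintype.sum_sum_type] at this
    simp only [hP, zero_mul, Finset.sum_const_zero, zero_add, reduceCtorEq, if_false] at this
    rw [Matrix.mul_apply]
    exact this
  have h3 : Z = 0 := by
    rw [← Matrix.one_mul Z, ← mul_eq_one_comm.mp h1, Matrix.mul_assoc, h2, Matrix.mul_zero]
  exact (hv.mem_iff U le_rfl _).mpr fun k => congr_fun (congr_fun h3 k) i

/-- A subbundle which is contained in a subbundle of the same rank is equal to it. -/
lemma Sub.IsRank.eq_of_le {M : X.Modules} {r : ℕ} {N N' : Sub M} (hN : N.IsRank r)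
    (hN' : N'.IsRank r) (h : ∀ U m, m ∈ N.carrier U → m ∈ N'.carrier U) : N = N' := by
  refine Sub.ext_of_isSplit fun x => ?_
  obtain ⟨U, n, v, hxU, hv⟩ := hN x
  obtain ⟨U', n', v', hxU', hv'⟩ := hN' x
  have hv := hv.res (inf_le_left : U ⊓ U' ≤ U)
  have hv' := hv'.res (inf_le_right : U ⊓ U' ≤ U')
  have : Nonempty (U ⊓ U' : X.Opens) := ⟨⟨x, hxU, hxU'⟩⟩
  -- The complementary ranks agree because bases over the nonzero ring of functions near `x` have
  -- the same cardinality.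
  obtain rfl : n = n' := by
    have := Fintype.card_congr (hv.isFrame.toBasis.indexEquiv hv'.isFrame.toBasis)
    simpa using this
  refine ⟨U ⊓ U', _, _, _, _, _, ⟨hxU, hxU'⟩, hv, .of_mem_iff_exists hv.isFrame fun V hV m => ?_⟩
  rw [← hv.mem_iff_exists hV]
  refine ⟨fun hm => ?_, h V m⟩
  obtain ⟨a, rfl⟩ := (hv'.mem_iff_exists hV).mp hm
  refine Submodule.sum_mem _ fun i _ => Submodule.smul_mem _ _ (N.res_mem _ _ _ _ ?_)
  exact hv.inl_mem_of_le hv' (fun i => h _ _ (hv.inl_mem i)) i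

end

section

variable {X : Scheme.{u}}

/-! ### Kernels of pullbacks under which the degeneracy locus becomes a divisor -/

/-- Near every point of a divisor which is defined by finitely many functions, one of them is a
nonzerodivisor and divides the others. -/
lemma IsEffectiveCartier.exists_generator {I : X.IdealSheafData} (hI : IsEffectiveCartier I)
    {ι : Type} [Fintype ι] {U : X.Opens} (g : ι → Γ(X, U))
    (hg : ∀ (V : X.affineOpens) (hV : V.1 ≤ U),
      I.ideal V = Ideal.span (Set.range fun i => resFun X hV (g i))) {x : X} (hx : x ∈ U) :
    ∃ (V : X.affineOpens) (hV : V.1 ≤ U) (i : ι) (s : ι → Γ(X, V)), x ∈ V.1 ∧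
      resFun X hV (g i) ∈ nonZeroDivisors Γ(X, V) ∧
      ∀ j, resFun X hV (g j) = s j * resFun X hV (g i) := by
  obtain ⟨V₀, hxV₀, a, ha, hIa⟩ := hI x
  obtain ⟨V, hxV, hV⟩ := exists_affine_mem_le (show x ∈ V₀.1 ⊓ U from ⟨hxV₀, hx⟩)
  have hVU := hV.trans inf_le_right
  have hV₀ : V ≤ V₀ := hV.trans inf_le_left
  have ha' := resFun_mem_nonZeroDivisors V₀.2 hV₀ ha
  have hIV := (I.map_ideal hV₀).symm
  rw [hIa, Ideal.map_span, Set.image_singleton, hg V hVU] at hIV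
  replace hIV : Ideal.span (Set.range fun i => resFun X hVU (g i)) =
    Ideal.span {resFun X hV₀ a} := hIV
  generalize resFun X hV₀ a = d at *
  have h1 : ∀ i, ∃ q, q * d = resFun X hVU (g i) := fun i =>
    Ideal.mem_span_singleton'.mp (hIV ▸ Ideal.subset_span ⟨i, rfl⟩)
  choose q hq using h1
  obtain ⟨b, hb⟩ := (Ideal.mem_span_range_iff_exists_fun).mp
    (hIV ▸ Ideal.mem_span_singleton_self d)
  -- With `g_i = q_i d` and `d = ∑ b_i g_i`, cancelling the nonzerodivisor `d` leaves this relation.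
  -- In the local ring at `x` some `q_i` must then be a unit, and that `g_i` generates.
  have h2 : ∑ i, b i * q i = 1 := by
    have : (∑ i, b i * q i) * d = 1 * d := by
      rw [Finset.sum_mul, one_mul]
      conv_rhs => rw [← hb]
      exact Finset.sum_congr rfl fun i _ => by rw [mul_assoc, hq]
    exact (mul_cancel_right_mem_nonZeroDivisors ha').mp this
  have h3 : ∃ i, IsUnit (X.presheaf.germ V x hxV (q i)) := by
    by_contra! hcon
    have h4 : (1 : X.presheaf.stalk x) ∈ IsLocalRing.maximalIdeal (X.presheaf.stalk x) := by
      rw [← map_one (X.presheaf.germ V x hxV).hom, ← h2, map_sum]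
      refine Submodule.sum_mem _ fun i _ => ?_
      rw [map_mul]
      exact Ideal.mul_mem_left _ _ ((IsLocalRing.mem_maximalIdeal _).mpr (hcon i))
    exact (Ideal.ne_top_iff_one _).mp (IsLocalRing.maximalIdeal.isMaximal _).ne_top h4
  obtain ⟨i, hi⟩ := h3
  let V' := X.affineBasicOpen (q i)
  have hV' : V' ≤ V := X.affineBasicOpen_le (q i)
  have hu : IsUnit (resFun X hV' (q i)) := isUnit_resFun (q i) hV' le_rfl
  have hd := resFun_mem_nonZeroDivisors V.2 hV' ha'
  have hVU' : V'.1 ≤ U := le_trans (show V'.1 ≤ V.1 from hV') hVU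
  have hq' : ∀ j, resFun X hVU' (g j) = resFun X hV' (q j) * resFun X hV' d := fun j => by
    rw [← map_mul, hq]
    exact (resFun_resFun hVU hV' (g j)).symm
  obtain ⟨v, hv⟩ := hu.exists_left_inv
  refine ⟨V', hVU', i, fun j => resFun X hV' (q j) * v,
    (X.mem_basicOpen _ _ hxV).mpr hi, ?_, fun j => ?_⟩
  · rw [hq']
    exact mul_mem hu.mem_nonZeroDivisors hd
  · rw [hq', hq', mul_assoc, ← mul_assoc v, hv, one_mul]

namespace NormalForm

variable {E F : X.Modules} {φ : E ⟶ F} {p r : ℕ}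

/-- The frame vectors of the source, with the vector `l` of the second block moved to the front of
the vectors of the first block. -/
def splitEquiv (p : ℕ) {r : ℕ} (l : Fin (r + 1)) : Fin r ⊕ Fin (p + 1) ≃ Fin p ⊕ Fin (r + 1) :=
  Equiv.ofBijective (Sum.elim (fun j => .inr (l.succAbove j)) (Fin.cases (.inr l) .inl)) <| by
    refine (Fintype.bijective_iff_injective_and_card _).mpr ⟨?_, by simp; omega⟩
    rintro (a | a) (b | b) h
    · simpa using h
    · obtain rfl | ⟨b, rfl⟩ := b.eq_zero_or_eq_succ
      · simp at h
      · simp at h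
    · obtain rfl | ⟨a, rfl⟩ := a.eq_zero_or_eq_succ
      · simp at h
      · simp at h
    · obtain rfl | ⟨a, rfl⟩ := a.eq_zero_or_eq_succ <;>
        obtain rfl | ⟨b, rfl⟩ := b.eq_zero_or_eq_succ <;> simp at h ⊢
      exact h

@[simp] lemma splitEquiv_inl (l : Fin (r + 1)) (j : Fin r) :
    splitEquiv p l (.inl j) = .inr (l.succAbove j) := rfl

@[simp] lemma splitEquiv_inr_zero (l : Fin (r + 1)) : splitEquiv p l (.inr 0) = .inr l := rfl

@[simp] lemma splitEquiv_inr_succ (l : Fin (r + 1)) (i : Fin p) :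
    splitEquiv p l (.inr i.succ) = .inl i := rfl

variable (D : NormalForm φ p (r + 1))

/-- A kernel vector has zero coordinates along the identity block and satisfies `∑ a_j g_j = 0`. As
`g_j = s_j g_l` with `g_l` a nonzerodivisor, this says `a_l = -∑ s_j a_j` over `j ≠ l`, which is the
first row of the graph; the other rows are zero. -/
lemma isGraph_ker {T : Scheme.{u}} (f : T ⟶ X) (V : T.affineOpens) (hV : V.1 ≤ f ⁻¹ᵁ D.U.1)
    (l : Fin (r + 1)) (s : Fin (r + 1) → Γ(T, V))
    (hl : resFun T hV (funPull f D.U.1 (D.g l)) ∈ nonZeroDivisors Γ(T, V))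
    (hs : ∀ j, resFun T hV (funPull f D.U.1 (D.g j)) =
      s j * resFun T hV (funPull f D.U.1 (D.g l))) :
    (Sub.ker ((Scheme.Modules.pullback f).map φ)).IsGraph
      (fun i => pull f E D.U.1 (D.e (splitEquiv p l i))) hV
      (Fin.cons (fun j => - s (l.succAbove j)) 0) := by
  have he := (D.isFrame_e.pull f).reindex (splitEquiv p l)
  refine ⟨(he.res hV).shear _, fun W hW m => ?_⟩
  rw [Sub.mem_ker, D.app_eq_zero_iff f (hW.trans hV)]
  simp only [(he.res hV).coord_shear, Sum.elim_inr, he.coord_res_res hV hW,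
    (D.isFrame_e.pull f).coord_reindex]
  rw [Fin.forall_fin_succ]
  simp only [splitEquiv_inl, splitEquiv_inr_zero, splitEquiv_inr_succ, Fin.cons_zero, Fin.cons_succ,
    Pi.zero_apply, map_zero, zero_mul, Finset.sum_const_zero, sub_zero, map_neg]
  rw [and_comm]
  refine and_congr_left' ?_
  have hd := resFun_mem_nonZeroDivisors V.2 hW hl
  set d := resFun T hW (resFun T hV (funPull f D.U.1 (D.g l))) with hdd
  set a := (D.isFrame_e.pull f).coord (hW.trans hV) m
  have h1 : ∀ j, resFun T (hW.trans hV) (funPull f D.U.1 (D.g j)) = resFun T hW (s j) * d :=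
    fun j => by rw [hdd, ← map_mul, ← hs, resFun_resFun]
  have h2 : resFun T (hW.trans hV) (funPull f D.U.1 (D.g l)) = d := by
    rw [hdd, resFun_resFun]
  rw [Fin.sum_univ_succAbove _ l, h2]
  have h3 : a (.inr l) * d + ∑ j, a (.inr (l.succAbove j)) *
      resFun T (hW.trans hV) (funPull f D.U.1 (D.g (l.succAbove j))) =
      (a (.inr l) - ∑ j, -resFun T hW (s (l.succAbove j)) * a (.inr (l.succAbove j))) * d := by
    rw [sub_mul, Finset.sum_mul, sub_eq_add_neg, ← Finset.sum_neg_distrib]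
    congr 1
    refine Finset.sum_congr rfl fun j _ => ?_
    rw [h1]
    ring
  rw [h3]
  exact ⟨fun h => (mem_nonZeroDivisors_iff_right.mp hd) _ h, fun h => by rw [h, zero_mul]⟩

end NormalForm

/-- If the degeneracy locus of `φ` pulls back to a divisor, the kernel of the pullback of `φ` is a
subbundle. -/
lemma isRank_ker {E F : X.Modules} {φ : E ⟶ F} {p r : ℕ} (hE : IsLocallyFree E)
    (hF : IsLocallyFree F) (hφ : ∀ x : X, ∃ D : NormalForm φ p (r + 1), x ∈ D.U.1)
    {T : Scheme.{u}} (f : T ⟶ X) (hf : IsEffectiveCartier ((minorIdeal φ (p + 1)).comap f)) :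
    (Sub.ker ((Scheme.Modules.pullback f).map φ)).IsRank r := by
  intro t
  obtain ⟨D, hD⟩ := hφ (f t)
  obtain ⟨V, hV, l, s, ht, hl, hs⟩ := hf.exists_generator (fun j => funPull f D.U.1 (D.g j))
    (D.comap_minorIdeal_ideal hE hF f) (x := t) hD
  exact ⟨V, p + 1, _, ht, D.isGraph_ker f V hV l s hl hs⟩

end

section

variable {X : Scheme.{u}}

/-! ### The zero locus of the tautological section -/

lemma IsLocallyFreeOfRank.isLocallyFree {M : X.Modules} {n : ℕ} (h : IsLocallyFreeOfRank M n) :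
    IsLocallyFree M := fun x => by
  obtain ⟨U, hx, b⟩ := h x
  exact ⟨U, hx, n, b⟩

lemma IsLocallyFree.of_iso {M N : X.Modules} (h : IsLocallyFree M) (φ : M ⟶ N) [IsIso φ] :
    IsLocallyFree N := fun x => by
  obtain ⟨U, hx, n, ⟨b⟩⟩ := h x
  exact ⟨U, hx, n, ⟨(b.isFrame.map_iso φ).toFrame⟩⟩

lemma IsLocallyFree.pullback {M : X.Modules} (h : IsLocallyFree M) {T : Scheme.{u}} (f : T ⟶ X) :
    IsLocallyFree ((Scheme.Modules.pullback f).obj M) := fun t => by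
  obtain ⟨U, hx, n, ⟨b⟩⟩ := h (f t)
  exact ⟨f ⁻¹ᵁ U, hx, n, ⟨(b.isFrame.pull f).toFrame⟩⟩

namespace GrassmannBundle

variable {E F : X.Modules} {r : ℕ} (Gr : GrassmannBundle E r) (φ : E ⟶ F) {P : Gr.scheme.Modules}
  (θ : (Scheme.Modules.pullback Gr.π).obj F ⟶ P)

/-- The section of `Hom(S, P)` given by `S ↪ π^*E ⟶ π^*F` and an isomorphism `π^*F ≅ P`. -/
def bundleSection : Γ(sheafHom Gr.S P, ⊤) :=
  homSection (Gr.incl ≫ (Scheme.Modules.pullback Gr.π).map φ ≫ θ)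

variable {Gr}

lemma exists_isFrame {W : Gr.scheme.Opens} {ι : Type} [Fintype ι]
    {v : Fin r ⊕ ι → Γ((Scheme.Modules.pullback Gr.π).obj E, W)} (hv : Gr.point.sub.IsSplit W v) :
    ∃ k : Fin r → Γ(Gr.S, W), IsFrame Gr.S W k ∧ ∀ i, Gr.incl.app W (k i) = v (.inl i) :=
  have hinj := Gr.isSubbundle.isLocSplit.injective
  Sub.IsSplit.exists_isFrame hinj (fun _ _ => Sub.mem_image_iff hinj) hv

variable [IsIso θ]

lemma coord_bundleSection {W : Gr.scheme.Opens} {κ : Type} [Fintype κ] {k : Fin r → Γ(Gr.S, W)}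
    {v : Fin r → Γ((Scheme.Modules.pullback Gr.π).obj E, W)}
    (hk : ∀ i, Gr.incl.app W (k i) = v i) {U : X.Opens} {b : κ → Γ(F, U)} (hb : IsFrame F U b)
    (hW : W ≤ Gr.π ⁻¹ᵁ U) (i : κ) (j : Fin r) :
    (((hb.pull Gr.π).map_iso θ).res hW).coord le_rfl
      ((Gr.incl ≫ (Scheme.Modules.pullback Gr.π).map φ ≫ θ).app W (k j)) i =
    (hb.pull Gr.π).coord hW (((Scheme.Modules.pullback Gr.π).map φ).app W (v j)) i := by
  rw [comp_app_apply, comp_app_apply, hk,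
    ((hb.pull Gr.π).map_iso θ).coord_res_res hW le_rfl, (hb.pull Gr.π).coord_map_iso θ]

lemma zeroIdeal_bundleSection_ideal (hF : IsLocallyFree F) {W : Gr.scheme.affineOpens}
    {ι κ : Type} [Fintype ι] [Fintype κ]
    {v : Fin r ⊕ ι → Γ((Scheme.Modules.pullback Gr.π).obj E, W.1)}
    (hv : Gr.point.sub.IsSplit W v) {U : X.Opens} {b : κ → Γ(F, U)} (hb : IsFrame F U b)
    (hW : W.1 ≤ Gr.π ⁻¹ᵁ U) :
    (zeroIdeal (Gr.bundleSection φ θ)).ideal W = Ideal.span (Set.range fun t : κ × Fin r =>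
      (hb.pull Gr.π).coord hW
        (((Scheme.Modules.pullback Gr.π).map φ).app W.1 (v (.inl t.2))) t.1) := by
  obtain ⟨k, hk, hkv⟩ := exists_isFrame hv
  refine (zeroIdeal_homSection_ideal Gr.isSubbundle.isLocallyFreeOfRank.isLocallyFree
    ((hF.pullback Gr.π).of_iso θ) _ hk (((hb.pull Gr.π).map_iso θ).res hW) W le_rfl).trans ?_
  congr 2
  funext t
  rw [resFun_self]
  exact coord_bundleSection φ θ hkv hb hW t.1 t.2

/-- This is the functor of points of the zero locus. Both sides say that the coordinates of `φ` on a
local frame of the tautological subbundle vanish after pullback to `T`. -/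
lemma comap_zeroIdeal_eq_bot_iff (hF : IsLocallyFree F) {T : Scheme.{u}} (h : T ⟶ Gr.scheme)
    {f : T ⟶ X} (e : h ≫ Gr.π = f) :
    (zeroIdeal (Gr.bundleSection φ θ)).comap h = ⊥ ↔ ∀ U m,
      m ∈ (Gr.point.sub.pull h e).carrier U → ((Scheme.Modules.pullback f).map φ).app U m = 0 := by
  have key : ∀ t : T, ∃ (V₀ : T.Opens) (n : ℕ)
      (w : Fin r ⊕ Fin n → Γ((Scheme.Modules.pullback f).obj E, V₀)), t ∈ V₀ ∧
      (Gr.point.sub.pull h e).IsSplit V₀ w ∧ ∀ (V : T.affineOpens) (hV : V.1 ≤ V₀),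
        ((zeroIdeal (Gr.bundleSection φ θ)).comap h).ideal V = ⊥ ↔
          ∀ j, ((Scheme.Modules.pullback f).map φ).app V (res _ hV (w (.inl j))) = 0 := by
    intro t
    obtain ⟨W, n, v, htW, hv⟩ := Gr.point.isRank (h t)
    obtain ⟨U, htU, l, ⟨b⟩⟩ := hF (Gr.π (h t))
    obtain ⟨W', htW', hW'⟩ := exists_affine_mem_le (show h t ∈ W ⊓ Gr.π ⁻¹ᵁ U from ⟨htW, htU⟩)
    have hv' := hv.res (hW'.trans inf_le_left)
    have hWU := hW'.trans inf_le_right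
    have hb := b.isFrame
    refine ⟨h ⁻¹ᵁ W'.1, n, _, htW', hv'.pull Gr.point.isRank h e, fun V hV => ?_⟩
    have hrho := ((hb.pull Gr.π).res hWU).rho h e
    rw [ideal_comap_eq_map h _ W' V hV, zeroIdeal_bundleSection_ideal φ θ hF hv' hb hWU,
      Ideal.map_span, Ideal.span_eq_bot]
    rw [Set.forall_mem_image, Set.forall_mem_range, Prod.forall, forall_comm]
    refine forall_congr' fun j => ?_
    have h1 (m : Γ((Scheme.Modules.pullback Gr.π).obj E, W'.1)) : ((Scheme.Modules.pullback f).map φ).app V (res _ hV (rho h e E W' m)) =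
        ∑ i, (h.appLE W' V hV).hom ((hb.pull Gr.π).coord hWU
          (((Scheme.Modules.pullback Gr.π).map φ).app W' m) i) •
            res _ hV (rho h e F W' (res _ hWU (pull Gr.π F U (b.basis i)))) := by
      rw [← res_app, rho_naturality]
      conv_lhs => rw [← (hb.pull Gr.π).sum_coord hWU
        (((Scheme.Modules.pullback Gr.π).map φ).app W' m), rho_sum_smul, res_sum_smul]
      rfl
    refine Iff.trans ?_ (Eq.congr_left (h1 _)).symm
    constructor
    · intro h2
      exact Finset.sum_eq_zero fun i _ => by rw [h2 i, zero_smul]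
    · intro h2 i
      exact congr_fun (@(hrho V.1 hV).1 _ 0 (h2.trans (by simp))) i
  constructor
  · intro hbot U m hm
    refine eq_of_locally_eq _ fun t ht => ?_
    obtain ⟨V₀, n, w, htV, hw, hV₀⟩ := key t
    obtain ⟨V, htV, hV⟩ := exists_affine_mem_le (show t ∈ V₀ ⊓ U from ⟨htV, ht⟩)
    refine ⟨V.1, hV.trans inf_le_right, htV, ?_⟩
    have h1 := (hV₀ V (hV.trans inf_le_left)).mp (by rw [hbot]; rfl)
    obtain ⟨a, ha⟩ := (hw.mem_iff_exists (hV.trans inf_le_left)).mp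
      ((Gr.point.sub.pull h e).res_mem _ _ (hV.trans inf_le_right) _ hm)
    rw [res_app, ← ha, app_sum_smul, map_zero]
    exact Finset.sum_eq_zero fun i _ => by rw [h1, smul_zero]
  · intro h0
    rw [eq_bot_iff]
    refine eq_of_forall_good {V | ((zeroIdeal (Gr.bundleSection φ θ)).comap h).ideal V = ⊥}
      (fun t => ?_) fun V hV => hV.le
    obtain ⟨V₀, n, w, htV, hw, hV₀⟩ := key t
    obtain ⟨V, htV, hV⟩ := exists_affine_mem_le htV
    refine ⟨V, (hV₀ V hV).mpr fun j => h0 _ _ ?_, htV⟩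
    exact (Gr.point.sub.pull h e).res_mem _ _ _ _ (hw.inl_mem j)

/-- The universal property of the blow-up, for the zero locus of the tautological section. -/
lemma isBlowup_of_isRank_ker (hF : IsLocallyFree F) (I : X.IdealSheafData)
    (hI : IsEffectiveCartier
      (I.comap ((zeroIdeal (Gr.bundleSection φ θ)).subschemeι ≫ Gr.π)))
    (hker : ∀ (T : Scheme.{u}) (f : T ⟶ X), IsEffectiveCartier (I.comap f) →
      (Sub.ker ((Scheme.Modules.pullback f).map φ)).IsRank r) :
    IsBlowup ((zeroIdeal (Gr.bundleSection φ θ)).subschemeι ≫ Gr.π) I where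
  isEffectiveCartier := hI
  universal T f hf := by
    set J := zeroIdeal (Gr.bundleSection φ θ)
    -- The kernel of `f^*φ` is the subbundle that classifies the lift.
    let p : GrPoint E r T := ⟨f, _, hker T f hf⟩
    obtain ⟨h, hh, hu⟩ := Gr.existsUnique_map_point_eq p
    obtain ⟨e, he⟩ := (GrPoint.eq_map_iff h).mp hh
    have hJ : J.comap h = ⊥ := by
      refine (comap_zeroIdeal_eq_bot_iff φ θ hF h e).mpr fun U m hm => ?_
      exact Sub.mem_ker.mp ((congr_arg (fun N => m ∈ N.carrier U) he).mp hm)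
    have hle : Scheme.Hom.ker J.subschemeι ≤ Scheme.Hom.ker h := by
      rw [J.ker_subschemeι, ← Scheme.IdealSheafData.map_bot,
        Scheme.IdealSheafData.le_map_iff_comap_le, hJ]
    refine ⟨IsClosedImmersion.lift J.subschemeι h hle, ?_, fun h' hh' => ?_⟩
    · change _ ≫ _ ≫ _ = _
      rw [IsClosedImmersion.lift_fac_assoc]
      exact e
    · have hh' : (h' ≫ J.subschemeι) ≫ Gr.π = f := (Category.assoc _ _ _).trans hh'
      have hJ' : J.comap (h' ≫ J.subschemeι) = ⊥ := by
        rw [eq_bot_iff, ← Scheme.IdealSheafData.le_map_iff_comap_le,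
          Scheme.IdealSheafData.map_bot]
        refine J.ker_subschemeι.ge.trans ?_
        rw [← Scheme.IdealSheafData.map_bot, ← Scheme.IdealSheafData.map_bot,
          Scheme.IdealSheafData.map_comp]
        exact Scheme.IdealSheafData.map_mono _ bot_le
      -- Any other lift yields a subbundle of rank `r` inside the kernel, hence equal to it.
      have h1 := (comap_zeroIdeal_eq_bot_iff φ θ hF _ hh').mp hJ'
      have h2 : Gr.point.sub.pull (h' ≫ J.subschemeι) hh' = p.sub :=
        (Gr.point.isRank.pull _ hh').eq_of_le p.isRank fun U m hm => Sub.mem_ker.mpr (h1 U m hm)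
      have h3 := hu _ ((GrPoint.eq_map_iff _).mpr ⟨hh', h2⟩)
      rw [← cancel_mono J.subschemeι, h3, IsClosedImmersion.lift_fac]

end GrassmannBundle

end

section

variable {X : Scheme.{u}}

/-! ### Local equations of the zero locus of the tautological section -/

/-- Counting: if the `r` free vectors of a chart all belong to the second block of the normal form,
the `p + 1` others are the whole first block and one vector of the second. The index `e none` of
that vector singles out the entry of `g` which will generate the degeneracy ideal. -/
lemma exists_equiv_option {p r : ℕ} (σ : Fin r ⊕ Fin (p + 1) ≃ Fin p ⊕ Fin (r + 1))
    (h : ∀ i j, σ (.inl j) ≠ .inl i) :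
    ∃ (κ : Fin p → Fin (p + 1)) (k₀ : Fin (p + 1)) (e : Option (Fin r) ≃ Fin (r + 1)),
      (∀ i, σ (.inr (κ i)) = .inl i) ∧ σ (.inr k₀) = .inr (e none) ∧
        ∀ j, σ (.inl j) = .inr (e (some j)) := by
  have h1 : ∀ i, ∃ k, σ (.inr k) = .inl i := fun i => by
    obtain ⟨s, hs⟩ := σ.surjective (.inl i)
    obtain j | k := s
    · exact absurd hs (h i j)
    · exact ⟨k, hs⟩
  have h2 : ∀ j, ∃ l, σ (.inl j) = .inr l := fun j => by
    rcases hs : σ (.inl j) with i | l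
    · exact absurd hs (h i j)
    · exact ⟨l, rfl⟩
  have h3 : ∃ k l, σ (.inr k) = .inr l := by
    by_contra! hcon
    have : ∀ k, ∃ i, σ (.inr k) = .inl i := fun k => by
      rcases hs : σ (.inr k) with i | l
      · exact ⟨i, rfl⟩
      · exact absurd hs (hcon k l)
    choose f hf using this
    have hinj : Function.Injective f := fun k k' hk =>
      Sum.inr_injective (σ.injective (by rw [hf, hf, hk]))
    have := Fintype.card_le_of_injective f hinj
    simp at this
  choose κ hκ using h1
  choose lam hlam using h2
  obtain ⟨k₀, l₀, hk₀⟩ := h3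
  refine ⟨κ, k₀, Equiv.ofBijective (fun o => o.elim l₀ lam)
    ((Fintype.bijective_iff_injective_and_card _).mpr ⟨?_, by simp⟩), hκ, hk₀, hlam⟩
  rintro (_ | j) (_ | j') hj
  · rfl
  · have hj : l₀ = lam j' := hj
    have := σ.injective (hk₀.trans ((congr_arg _ hj).trans (hlam j').symm))
    simp at this
  · have hj : lam j = l₀ := hj
    have := σ.injective ((hlam j).trans ((congr_arg _ hj).trans hk₀.symm))
    simp at this
  · have hj : lam j = lam j' := hj
    have := σ.injective ((hlam j).trans ((congr_arg _ hj).trans (hlam j').symm))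
    rw [Sum.inl_injective this]

lemma enum_option {J R : Type*} [Fintype J] (y : Option J → R) :
    (enum y).Perm (y none :: enum fun j => y (some j)) := by
  rw [← Multiset.coe_eq_coe, coe_enum, ← Multiset.cons_coe, coe_enum, univ_option]
  simp [Finset.insertNone]

namespace GrassmannBundle

variable {E F : X.Modules} {r p : ℕ} (Gr : GrassmannBundle E r)

lemma exists_affine_isGraph {φ : E ⟶ F} (D : NormalForm φ p (r + 1)) {z : Gr.scheme}
    (hz : Gr.π z ∈ D.U.1) :
    ∃ (W : Gr.scheme.affineOpens) (_ : z ∈ W.1) (hW : W.1 ≤ Gr.π ⁻¹ᵁ D.U.1)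
      (σ : Fin r ⊕ Fin (p + 1) ≃ Fin p ⊕ Fin (r + 1)) (c : Fin (p + 1) → Fin r → Γ(Gr.scheme, W)),
      Gr.point.sub.IsGraph (fun i => pull Gr.π E D.U.1 (D.e (σ i))) hW c := by
  let τ : Fin (r + (p + 1)) ≃ Fin p ⊕ Fin (r + 1) := Fintype.equivOfCardEq (by simp; omega)
  obtain ⟨σ, hσ⟩ := exists_chart_of_isFrame (n := p + 1) rfl (D.isFrame_e.reindex τ) Gr.point z hz
  obtain ⟨W₀, hW₀, c, hzW₀, hc⟩ := Sub.mem_graphLocus.mp hσ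
  obtain ⟨W, hzW, hW⟩ := exists_affine_mem_le hzW₀
  exact ⟨W, hzW, hW.trans hW₀, σ.trans τ, _, hc.res hW⟩

lemma coord_shear_pull {φ : E ⟶ F} (D : NormalForm φ p (r + 1)) {T : Scheme.{u}} (f : T ⟶ X)
    {W : T.Opens} (hW : W ≤ f ⁻¹ᵁ D.U.1) (σ : Fin r ⊕ Fin (p + 1) ≃ Fin p ⊕ Fin (r + 1))
    (c : Fin (p + 1) → Fin r → Γ(T, W)) (j : Fin r) (s : Fin r ⊕ Fin (p + 1)) :
    (D.isFrame_e.pull f).coord hW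
      (shear (fun i => res _ hW (pull f E D.U.1 (D.e (σ i)))) c (.inl j)) (σ s) =
      Sum.elim (Pi.single j 1) (fun k => c k j) s := by
  have he := (D.isFrame_e.pull f).reindex σ
  rw [← (D.isFrame_e.pull f).coord_reindex σ hW]
  refine congr_fun (he.coord_eq hW ?_) s
  rw [Fintype.sum_sum_type]
  simp only [Sum.elim_inl, Sum.elim_inr, shear]
  congr 1
  rw [Finset.sum_eq_single j]
  · rw [Pi.single_eq_same, one_smul]
  · intro i _ hi
    rw [Pi.single_eq_of_ne hi, zero_smul]
  · exact fun h => absurd (Finset.mem_univ j) h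

/-- The charts are affine spaces of finite dimension over opens of `X`, and they cover. -/
lemma isLocallyNoetherian [IsLocallyNoetherian X] (hE : IsLocallyFreeOfRank E (r + p)) :
    IsLocallyNoetherian Gr.scheme := by
  have key : ∀ z : Gr.scheme, ∃ W : Gr.scheme.affineOpens, z ∈ W.1 ∧
      IsNoetherianRing Γ(Gr.scheme, W) := by
    intro z
    obtain ⟨C, hC⟩ := exists_chart hE Gr.point z
    obtain ⟨a, ha, -, hw⟩ := C.exists_isOpenImmersion Gr
    obtain ⟨w, rfl⟩ := hw z hC
    obtain ⟨W, hzW, hW⟩ := exists_affine_mem_le (show a w ∈ a.opensRange from ⟨w, rfl⟩)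
    have : LocallyOfFiniteType C.toX := by unfold Chart.toX; infer_instance
    have : IsLocallyNoetherian C.scheme := LocallyOfFiniteType.isLocallyNoetherian C.toX
    have hW' : IsAffineOpen (a ⁻¹ᵁ W.1) := W.2.preimage_of_isOpenImmersion a hW
    have : IsNoetherianRing Γ(C.scheme, a ⁻¹ᵁ W.1) :=
      IsLocallyNoetherian.component_noetherian ⟨_, hW'⟩
    exact ⟨W, hzW, isNoetherianRing_of_ringEquiv _
      (RingEquiv.ofBijective (funPull a W.1) (Sub.funPull_bijective a W.1 hW)).symm⟩
  choose W hW hW' using key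
  refine isLocallyNoetherian_of_affine_cover (S := W) ?_ hW'
  exact top_le_iff.mp fun z _ => Opens.mem_iSup.mpr ⟨z, hW z⟩

variable (φ : E ⟶ F) {P : Gr.scheme.Modules}
  (θ : (Scheme.Modules.pullback Gr.π).obj F ⟶ P) [IsIso θ]

open RingTheory.Sequence MvPolynomial in
-- The computation behind both the regularity of the section and the Cartier property. Applying the
-- normal form to the graph vectors of a chart gives equations of the shape treated in
-- `isRegular_chart_equations`; the distinguished index is the one left over by the chart.
lemma exists_local_equations [IsLocallyNoetherian X] [IsLocallyNoetherian Gr.scheme]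
    (D : NormalForm φ p (r + 1)) {z : Gr.scheme}
    (hz : Gr.π z ∈ D.U.1) (hreg : (∀ j, X.presheaf.germ D.U.1 _ hz (D.g j) ∈
      IsLocalRing.maximalIdeal (X.presheaf.stalk (Gr.π z))) →
        IsRegular (X.presheaf.stalk (Gr.π z))
          (List.ofFn fun j => X.presheaf.germ D.U.1 _ hz (D.g j))) :
    ∃ (W : Gr.scheme.affineOpens) (hzW : z ∈ W.1) (hW : W.1 ≤ Gr.π ⁻¹ᵁ D.U.1) (N : ℕ)
      (d : Fin N → Γ(sheafHom Gr.S P, W)) (hd : IsFrame (sheafHom Gr.S P) W d),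
      (∀ i, Gr.scheme.presheaf.germ W.1 z hzW (hd.coord le_rfl
        (res _ le_top (Gr.bundleSection φ θ)) i) ∈
          IsLocalRing.maximalIdeal (Gr.scheme.presheaf.stalk z)) →
      IsRegular (Gr.scheme.presheaf.stalk z) (List.ofFn fun i => Gr.scheme.presheaf.germ W.1 z hzW
        (hd.coord le_rfl (res _ le_top (Gr.bundleSection φ θ)) i)) ∧
      ∃ l₀, (∀ l, resFun Gr.scheme hW (funPull Gr.π D.U.1 (D.g l)) ∈
          Ideal.span (Set.range (hd.coord le_rfl (res _ le_top (Gr.bundleSection φ θ)))) ⊔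
            Ideal.span {resFun Gr.scheme hW (funPull Gr.π D.U.1 (D.g l₀))}) ∧
        ∀ b, Gr.scheme.presheaf.germ W.1 z hzW
            (resFun Gr.scheme hW (funPull Gr.π D.U.1 (D.g l₀))) * b ∈
            Ideal.span (Set.range fun i => Gr.scheme.presheaf.germ W.1 z hzW
              (hd.coord le_rfl (res _ le_top (Gr.bundleSection φ θ)) i)) →
          b ∈ Ideal.span (Set.range fun i => Gr.scheme.presheaf.germ W.1 z hzW
              (hd.coord le_rfl (res _ le_top (Gr.bundleSection φ θ)) i)) := by
  obtain ⟨W, hzW, hW, σ, c, hc⟩ := Gr.exists_affine_isGraph D hz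
  obtain ⟨k, hk, hkv⟩ := exists_isFrame hc
  replace hkv : ∀ i, Gr.incl.app W.1 (k i) =
    shear (fun i => res _ hW (pull Gr.π E D.U.1 (D.e (σ i)))) c (.inl i) := hkv
  let fr := hk.hom (((D.isFrame_f.pull Gr.π).map_iso θ).res hW)
  let N := Fintype.card ((Fin p ⊕ Unit) × Fin r)
  let ε : Fin N ≃ (Fin p ⊕ Unit) × Fin r := (Fintype.equivFin _).symm
  refine ⟨W, hzW, hW, N, _, fr.reindex ε, ?_⟩
  let x (t : (Fin p ⊕ Unit) × Fin r) : Γ(Gr.scheme, W) :=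
    fr.coord le_rfl (res _ le_top (Gr.bundleSection φ θ)) t
  have hcoord : ∀ i, (fr.reindex ε).coord le_rfl (res _ le_top (Gr.bundleSection φ θ)) i =
      x (ε i) := fun i => fr.coord_reindex ε le_rfl _ i
  let G (l : Fin (r + 1)) := resFun Gr.scheme hW (funPull Gr.π D.U.1 (D.g l))
  let V (j : Fin r) (s : Fin r ⊕ Fin (p + 1)) : Γ(Gr.scheme, W) :=
    Sum.elim (Pi.single j 1) (fun k => c k j) s
  have hx (t) (j) : x (t, j) = t.elim (fun i => V j (σ.symm (.inl i)))
      fun _ => ∑ l, V j (σ.symm (.inr l)) * G l := by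
    have h1 : x (t, j) = _ := hk.coord_homSection (((D.isFrame_f.pull Gr.π).map_iso θ).res hW)
      le_rfl (Gr.incl ≫ (Scheme.Modules.pullback Gr.π).map φ ≫ θ) t j
    rw [h1, res_self]
    rw [coord_bundleSection φ θ hkv D.isFrame_f hW t j, D.coord_app Gr.π hW]
    have h2 (a) := coord_shear_pull D Gr.π hW σ c j (σ.symm a)
    simp only [Equiv.apply_symm_apply] at h2
    obtain i | _ := t
    · exact h2 (.inl i)
    · exact Finset.sum_congr rfl fun l _ => congr_arg (· * G l) (h2 (.inr l))
  clear_value x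
  simp only [funext hcoord, hcoord]
  let γ : Γ(Gr.scheme, W) →+* Gr.scheme.presheaf.stalk z := (Gr.scheme.presheaf.germ W.1 z hzW).hom
  let β : Γ(X, D.U) →+* X.presheaf.stalk (Gr.π z) := (X.presheaf.germ D.U.1 (Gr.π z) hz).hom
  change (∀ i, γ (x (ε i)) ∈ _) → IsRegular _ (List.ofFn fun i => γ (x (ε i))) ∧ ∃ l₀, (∀ l, G l ∈
    Ideal.span (Set.range fun i => x (ε i)) ⊔ Ideal.span {G l₀}) ∧ ∀ b, γ (G l₀) * b ∈
      Ideal.span (Set.range fun i => γ (x (ε i))) → b ∈ Ideal.span (Set.range fun i => γ (x (ε i)))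
  change (∀ j, β (D.g j) ∈ _) → IsRegular _ (List.ofFn fun j => β (D.g j)) at hreg
  intro hm
  replace hm : ∀ t, γ (x t) ∈ IsLocalRing.maximalIdeal (Gr.scheme.presheaf.stalk z) := fun t => by
    have := hm (ε.symm t)
    rwa [Equiv.apply_symm_apply] at this
  -- If a free vector of the chart belonged to the identity block, one of the equations would be
  -- `1`, and the section could not vanish at `z`.
  have hσ : ∀ i j, σ (.inl j) ≠ .inl i := fun i j hij => by
    have h1 := hm (.inl i, j)
    rw [hx] at h1
    have h2 : V j (σ.symm (.inl i)) = 1 := by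
      rw [← hij, Equiv.symm_apply_apply]
      exact Pi.single_eq_same j 1
    rw [Sum.elim_inl, h2, map_one] at h1
    exact (Ideal.ne_top_iff_one _).mp (IsLocalRing.maximalIdeal.isMaximal _).ne_top h1
  obtain ⟨κ, k₀, e, hκ, hk₀, he⟩ := exists_equiv_option σ hσ
  have hx₁ (i j) : x (.inl i, j) = c (κ i) j := by
    rw [hx, Sum.elim_inl, ← hκ, Equiv.symm_apply_apply]
    rfl
  have hx₂ (j) : x (.inr (), j) = G (e (some j)) + c k₀ j * G (e none) := by
    rw [hx, Sum.elim_inr, ← e.sum_comp, Fintype.sum_option, ← hk₀, Equiv.symm_apply_apply, add_comm]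
    congr 1
    rw [Finset.sum_eq_single j]
    · rw [← he, Equiv.symm_apply_apply]
      simp [V]
    · intro i _ hi
      rw [← he, Equiv.symm_apply_apply]
      simp [V, Pi.single_eq_of_ne hi]
    · exact fun h => absurd (Finset.mem_univ j) h
  -- The local ring at `z` as a flat algebra over the polynomial ring in the graph coordinates over
  -- the local ring at the image of `z`.
  let ψ := eval₂Hom (Gr.π.stalkMap z).hom fun kj : Fin (p + 1) × Fin r => γ (c kj.1 kj.2)
  have hψ : ψ.Flat := Chart.flat_stalk ⟨D.U.1, fun i => D.e (σ i), D.isFrame_e.reindex σ⟩ D.U.2 Gr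
    hW hc hzW
  have hψC (b) : ψ (C b) = (Gr.π.stalkMap z).hom b := eval₂_C _ _ _
  have hψX (kj) : ψ (.X kj) = γ (c kj.1 kj.2) := eval₂_X _ _ _
  have hlocal : IsLocalHom (ψ.comp C) := by
    have : ψ.comp C = (Gr.π.stalkMap z).hom := RingHom.ext hψC
    rw [this]
    infer_instance
  have hψG (l) : ψ (C (β (D.g l))) = γ (G l) := by
    refine (hψC _).trans ((stalkMap_germ Gr.π D.U.1 z hz _).trans ?_)
    exact (germ_resFun hW hzW _).symm
  let η : (Fin p × Fin r) ⊕ Fin r ≃ (Fin p ⊕ Unit) × Fin r :=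
    ((Equiv.refl _).sumCongr (Equiv.punitProd _).symm).trans (Equiv.sumProdDistrib _ _ _).symm
  have hperm : (List.ofFn fun j => β (D.g j)).Perm
      (β (D.g (e none)) :: enum fun j => β (D.g (e (some j)))) :=
    (ofFn_perm_enum (fun j => β (D.g j)) (Equiv.refl _)).trans
      ((enum_comp_equiv (fun j => β (D.g j)) e).symm.trans (enum_option _))
  have hrange : (Set.range fun i => γ (x (ε i))) = Set.range fun s => γ (x (η s)) :=
    (ε.surjective.range_comp fun t => γ (x t)).trans (η.surjective.range_comp fun t => γ (x t)).symm
  obtain ⟨h1, h2⟩ := isRegular_chart_equations ψ hψ (J := Fin r) (K := Fin p × Fin r)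
    (β (D.g (e none))) (fun j => β (D.g (e (some j))))
    (fun h h' => by
      have hall : ∀ l, β (D.g l) ∈ IsLocalRing.maximalIdeal (X.presheaf.stalk (Gr.π z)) := fun l => by
        obtain ⟨_ | j, rfl⟩ := e.surjective l
        · exact h
        · exact h' j
      exact (IsLocalRing.isRegular_of_perm (hreg hall) hperm).toIsWeaklyRegular)
    (Sum.elim (fun ij => (κ ij.1, ij.2)) fun j => (k₀, j))
    (by
      have hκ₀ : ∀ i, κ i ≠ k₀ := fun i h => by
        have := (hκ i).symm.trans ((congr_arg (fun k => σ (.inr k)) h).trans hk₀)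
        simp at this
      have hκi : Function.Injective κ := fun i i' h => Sum.inl_injective
        ((hκ i).symm.trans ((congr_arg (fun k => σ (.inr k)) h).trans (hκ i')))
      rintro (⟨i, j⟩ | j) (⟨i', j'⟩ | j') h
      · simp only [Sum.elim_inl, Prod.mk.injEq] at h
        rw [hκi h.1, h.2]
      · exact absurd (congr_arg Prod.fst h) (hκ₀ i)
      · exact absurd (congr_arg Prod.fst h).symm (hκ₀ i')
      · exact congr_arg Sum.inr (congr_arg Prod.snd h))
    (fun s => γ (x (η s)))
    (fun k => by
      rw [hψX]
      exact congr_arg γ (hx₁ k.1 k.2))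
    (fun j => by
      rw [hψX, hψG, hψG, ← map_mul, ← map_add]
      exact congr_arg γ (hx₂ j))
    (fun s => hm _)
  refine ⟨IsLocalRing.isRegular_of_perm h1 ?_, e none, fun l => ?_, fun b hb => ?_⟩
  · exact (enum_comp_equiv (fun t => γ (x t)) η).trans (ofFn_perm_enum (fun t => γ (x t)) ε).symm
  · obtain ⟨_ | j, rfl⟩ := e.surjective l
    · exact Ideal.mem_sup_right (Ideal.mem_span_singleton_self _)
    · rw [← add_sub_cancel_right (G (e (some j))) (c k₀ j * G (e none)), ← hx₂]
      refine sub_mem (Ideal.mem_sup_left (Ideal.subset_span ⟨ε.symm (.inr (), j), ?_⟩))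
        (Ideal.mem_sup_right (Ideal.mul_mem_left _ _ (Ideal.mem_span_singleton_self _)))
      exact congr_arg x (ε.apply_symm_apply _)
  · rw [hrange] at hb ⊢
    refine h2 b ?_
    rwa [hψG]

end GrassmannBundle

end

section

variable {X : Scheme.{u}}

/-! ### The zero locus of the tautological section is the blow-up -/

/-- A germ that dies in the subscheme is zero on a neighbourhood of `w` there. The topology being
induced, this neighbourhood contains the preimage of an affine open of `X`, over which the section
lies in the ideal. -/
lemma ker_stalkMap_subschemeι_le (J : X.IdealSheafData) (w : J.subscheme) (W : X.affineOpens)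
    (hw : J.subschemeι w ∈ W.1) : RingHom.ker (J.subschemeι.stalkMap w).hom ≤
      (J.ideal W).map (X.presheaf.germ W.1 (J.subschemeι w) hw).hom := by
  intro a ha
  obtain ⟨U, hU, s, rfl⟩ := X.presheaf.exists_germ_eq (C := CommRingCat) a
  have h1 := (stalkMap_germ J.subschemeι U w hU s).symm.trans ha
  obtain ⟨N, hN, i, i', h2⟩ := J.subscheme.presheaf.germ_eq (C := CommRingCat)
    (V := J.subschemeι ⁻¹ᵁ U) w hU hU _ 0 (h1.trans (map_zero _).symm)
  rw [map_zero] at h2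
  obtain ⟨N', hN', hNN'⟩ := J.subschemeι.isClosedEmbedding.isInducing.isOpen_iff.mp N.2
  obtain ⟨V, hV, hVU⟩ := exists_affine_mem_le (x := J.subschemeι w) (U := ⟨N', hN'⟩ ⊓ (U ⊓ W.1))
    ⟨(Set.ext_iff.mp hNN' w).mpr hN, hU, hw⟩
  have hVN : J.subschemeι ⁻¹ᵁ V.1 ≤ N := fun v hv =>
    (Set.ext_iff.mp hNN' v).mp (hVU.trans inf_le_left hv)
  have hV₁ : V.1 ≤ U := hVU.trans (inf_le_right.trans inf_le_left)
  have hV₂ : V ≤ W := hVU.trans (inf_le_right.trans inf_le_right)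
  have h3 : funPull J.subschemeι V.1 (resFun X hV₁ s) = 0 := by
    rw [← resFun_funPull, ← resFun_resFun (leOfHom i) hVN]
    exact (congr_arg (resFun J.subscheme hVN) h2).trans (map_zero _)
  have h4 : resFun X hV₁ s ∈ J.ideal V := by
    rw [← J.ker_subschemeι_app V]
    exact h3
  rw [← J.map_ideal hV₂] at h4
  have h5 := Ideal.mem_map_of_mem (X.presheaf.germ V.1 (J.subschemeι w) hV).hom h4
  rw [Ideal.map_map] at h5
  have h6 : (X.presheaf.germ V.1 (J.subschemeι w) hV).hom.comp
      (X.presheaf.map (homOfLE hV₂).op).hom = (X.presheaf.germ W.1 (J.subschemeι w) hw).hom :=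
    RingHom.ext fun s => germ_resFun hV₂ hV s
  rw [h6] at h5
  convert! h5 using 1
  exact (germ_resFun hV₁ hV s).symm

lemma isEffectiveCartier_top : IsEffectiveCartier (⊤ : X.IdealSheafData) := fun x => by
  obtain ⟨U, hx, -⟩ := exists_affine_mem_le (show x ∈ (⊤ : X.Opens) from trivial)
  exact ⟨U, hx, 1, one_mem _, Ideal.span_singleton_one.symm⟩

namespace GrassmannBundle

variable {E F : X.Modules} {r p : ℕ} (Gr : GrassmannBundle E r) (φ : E ⟶ F) {P : Gr.scheme.Modules}
  (θ : (Scheme.Modules.pullback Gr.π).obj F ⟶ P) [IsIso θ]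

open RingTheory.Sequence

/-- The morphism `φ` has local normal forms in which the row `g` is a regular sequence in the local
rings at the points where it vanishes. -/
def _root_.GrassmannBlowup.HasRegularNormalForm (φ : E ⟶ F) (p q : ℕ) : Prop :=
  ∀ x : X, ∃ (D : NormalForm φ p q) (hx : x ∈ D.U.1),
    (∀ j, X.presheaf.germ D.U.1 x hx (D.g j) ∈ IsLocalRing.maximalIdeal (X.presheaf.stalk x)) →
      IsRegular (X.presheaf.stalk x) (List.ofFn fun j => X.presheaf.germ D.U.1 x hx (D.g j))

variable {φ} in
theorem isRegularSection_bundleSection [IsLocallyNoetherian X]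
    (hE : IsLocallyFreeOfRank E (r + (p + 1))) (hφ : HasRegularNormalForm φ p (r + 1)) :
    IsRegularSection (Gr.bundleSection φ θ) := by
  have := Gr.isLocallyNoetherian hE
  intro z
  obtain ⟨D, hz, hreg⟩ := hφ (Gr.π z)
  obtain ⟨W, hzW, hW, N, d, hd, h⟩ := Gr.exists_local_equations φ θ D hz hreg
  refine ⟨W, hzW, N, hd.toFrame, ?_⟩
  simp only [hd.toFrame_repr]
  exact fun hm => (h hm).1

variable {φ} in
-- On the zero locus every `g_l` is a multiple of `g_{l₀}`. The latter is a nonzerodivisor there,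
-- because the local ring of the zero locus is the quotient by the equations, modulo which `g_{l₀}`
-- cancels.
lemma isEffectiveCartier_comap [IsLocallyNoetherian X]
    (hE : IsLocallyFreeOfRank E (r + (p + 1))) (hF : IsLocallyFree F)
    (hφ : HasRegularNormalForm φ p (r + 1)) : IsEffectiveCartier ((minorIdeal φ (p + 1)).comap
      ((zeroIdeal (Gr.bundleSection φ θ)).subschemeι ≫ Gr.π)) := by
  have := Gr.isLocallyNoetherian hE
  set J := zeroIdeal (Gr.bundleSection φ θ) with hJdef
  have : IsLocallyNoetherian J.subscheme := LocallyOfFiniteType.isLocallyNoetherian J.subschemeι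
  refine isEffectiveCartier_of_germ fun w => ?_
  obtain ⟨D, hz, hreg⟩ := hφ (Gr.π (J.subschemeι w))
  obtain ⟨W, hzW, hW, N, d, hd, h⟩ := Gr.exists_local_equations φ θ D hz hreg
  have hSP : IsLocallyFree (sheafHom Gr.S P) := isLocallyFree_sheafHom
    Gr.isSubbundle.isLocallyFreeOfRank.isLocallyFree ((hF.pullback Gr.π).of_iso θ)
  have hJ : J.ideal W = Ideal.span (Set.range (hd.coord le_rfl
      (res _ le_top (Gr.bundleSection φ θ)))) := zeroIdeal_ideal hSP _ hd W le_rfl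
  generalize hd.coord le_rfl (res _ le_top (Gr.bundleSection φ θ)) = x at h hJ
  let ι := J.subschemeι
  have hker : ∀ a ∈ J.ideal W, funPull ι W.1 a = 0 := fun a ha => by
    rw [← J.ker_subschemeι_app W] at ha
    exact ha
  have hm : ∀ i, Gr.scheme.presheaf.germ W.1 (ι w) hzW (x i) ∈
      IsLocalRing.maximalIdeal (Gr.scheme.presheaf.stalk (ι w)) := fun i hu => by
    have h1 : IsUnit (ι.stalkMap w (Gr.scheme.presheaf.germ W.1 (ι w) hzW (x i))) :=
      hu.map (ι.stalkMap w).hom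
    rw [stalkMap_germ, hker _ (hJ ▸ Ideal.subset_span ⟨i, rfl⟩), map_zero] at h1
    exact not_isUnit_zero h1
  obtain ⟨-, l₀, hl, hcancel⟩ := h hm
  set G := fun l => resFun Gr.scheme hW (funPull Gr.π D.U.1 (D.g l)) with hG
  have hV : ι ⁻¹ᵁ W.1 ≤ (ι ≫ Gr.π) ⁻¹ᵁ D.U.1 := fun v hv => hW hv
  refine ⟨⟨ι ⁻¹ᵁ W.1, W.2.preimage ι⟩, hzW, funPull ι W.1 (G l₀), ?_, ?_⟩
  · rw [D.comap_minorIdeal_ideal hE.isLocallyFree hF _ _ hV]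
    have h1 : ∀ l, resFun J.subscheme hV (funPull (ι ≫ Gr.π) D.U.1 (D.g l)) =
        funPull ι W.1 (G l) := fun l => by
      refine Eq.trans ?_ (resFun_funPull ι hW (funPull Gr.π D.U.1 (D.g l)))
      rfl
    refine (congr_arg (fun q => Ideal.span (Set.range q)) (funext h1)).trans ?_
    apply le_antisymm
    · rw [Ideal.span_le]
      rintro _ ⟨l, rfl⟩
      have h2 := Ideal.mem_map_of_mem (funPull ι W.1) (hl l)
      rw [Ideal.map_sup, Ideal.map_span (funPull ι W.1) {_}, Set.image_singleton, ← hJ] at h2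
      have h3 : (J.ideal W).map (funPull ι W.1) = ⊥ :=
        (Ideal.map_eq_bot_iff_le_ker _).mpr fun a ha => hker a ha
      rw [h3, bot_sup_eq] at h2
      exact h2
    · rw [Ideal.span_singleton_le_iff_mem]
      exact Ideal.subset_span ⟨l₀, rfl⟩
  · rw [mem_nonZeroDivisors_iff_left]
    intro b hb
    obtain ⟨b, rfl⟩ := SurjectiveOnStalks.stalkMap_surjective ι w b
    have h1 : (ι.stalkMap w).hom (Gr.scheme.presheaf.germ W.1 (ι w) hzW (G l₀) * b) = 0 := by
      rw [map_mul]
      exact (congr_arg (· * _) (stalkMap_germ ι W.1 w hzW (G l₀))).trans hb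
    have h2 := ker_stalkMap_subschemeι_le J w W hzW h1
    have h3 : (J.ideal W).map (Gr.scheme.presheaf.germ W.1 (ι w) hzW).hom =
        Ideal.span (Set.range fun i => Gr.scheme.presheaf.germ W.1 (ι w) hzW (x i)) := by
      rw [hJ, Ideal.map_span, ← Set.range_comp]
      rfl
    have h4 := hcancel b (h3 ▸ h2)
    rw [← h3] at h4
    have h5 : (J.ideal W).map (Gr.scheme.presheaf.germ W.1 (ι w) hzW).hom ≤
        RingHom.ker (ι.stalkMap w).hom := by
      rw [Ideal.map_le_iff_le_comap]
      intro a ha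
      refine (stalkMap_germ ι W.1 w hzW a).trans ?_
      rw [hker a ha, map_zero]
    exact h5 h4

variable {φ} in
theorem isBlowup_bundleSection [IsLocallyNoetherian X]
    (hE : IsLocallyFreeOfRank E (r + (p + 1))) (hF : IsLocallyFree F)
    (hφ : HasRegularNormalForm φ p (r + 1)) :
    IsBlowup ((zeroIdeal (Gr.bundleSection φ θ)).subschemeι ≫ Gr.π) (minorIdeal φ (p + 1)) :=
  isBlowup_of_isRank_ker φ θ hF _ (Gr.isEffectiveCartier_comap θ hE hF hφ) fun _ f hf =>
    isRank_ker hE.isLocallyFree hF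
      (fun x => by obtain ⟨D, hx, -⟩ := hφ x; exact ⟨D, hx⟩) f hf

/-! ### Targets of rank zero -/

section rankZero

lemma _root_.GrassmannBlowup.IsFrame.eq_zero {M : X.Modules} {U V : X.Opens} {b : Fin 0 → Γ(M, U)}
    (hb : IsFrame M U b) (h : V ≤ U) (m : Γ(M, V)) : m = 0 :=
  (hb.sum_coord h m).symm.trans (Fintype.sum_empty _)

/-- The empty determinant is `1`. -/
lemma _root_.GrassmannBlowup.minorIdeal_zero (hE : IsLocallyFree E) (hF : IsLocallyFree F) :
    minorIdeal φ 0 = ⊤ := by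
  rw [eq_top_iff]
  refine eq_of_forall_good {V | (minorIdeal φ 0).ideal V = ⊤} (fun x => ?_)
    fun V hV => le_top.trans hV.ge
  obtain ⟨U, hx, m, ⟨e⟩⟩ := hE x
  obtain ⟨U', hx', n, ⟨f⟩⟩ := hF x
  obtain ⟨V, hxV, hV⟩ := exists_affine_mem_le (show x ∈ U ⊓ U' from ⟨hx, hx'⟩)
  refine ⟨V, ?_, hxV⟩
  change (minorIdeal φ 0).ideal V = ⊤
  rw [minorIdeal_ideal hE hF φ 0 (e.isFrame.res inf_le_left) (f.isFrame.res inf_le_right) V hV]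
  have : Ideal.span (minors ((e.isFrame.res inf_le_left).matrix (f.isFrame.res inf_le_right) φ) 0) =
      ⊤ := (Ideal.eq_top_iff_one _).mpr
    (Ideal.subset_span ⟨Fin.elim0, Fin.elim0, Matrix.det_fin_zero.symm⟩)
  rw [this, Ideal.map_top]

theorem isRegularSection_bundleSection_of_rank_zero (hF : IsLocallyFreeOfRank F 0) :
    IsRegularSection (Gr.bundleSection φ θ) := by
  intro z
  obtain ⟨U, n, v, hzU, hv⟩ := Gr.point.isRank z
  obtain ⟨k, hk, -⟩ := exists_isFrame hv
  obtain ⟨U', hzU', ⟨b⟩⟩ := hF (Gr.π z)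
  let σ : Fin 0 ≃ Fin 0 × Fin r := Equiv.equivOfIsEmpty _ _
  refine ⟨U ⊓ Gr.π ⁻¹ᵁ U', ⟨hzU, hzU'⟩, 0, (((hk.res inf_le_left).hom
    (((b.isFrame.pull Gr.π).map_iso θ).res inf_le_right)).reindex σ).toFrame, fun _ => ?_⟩
  rw [List.ofFn_zero]
  exact IsRegular.nil _ _

/-- The centre is empty, so every `f` qualifies in the universal property, and the kernel of `f^*φ`
is all of `f^*E`, which has rank `r`. -/
theorem isBlowup_bundleSection_of_rank_zero (hE : IsLocallyFreeOfRank E r)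
    (hF : IsLocallyFreeOfRank F 0) :
    IsBlowup ((zeroIdeal (Gr.bundleSection φ θ)).subschemeι ≫ Gr.π) (minorIdeal φ 0) := by
  rw [minorIdeal_zero φ hE.isLocallyFree hF.isLocallyFree]
  refine isBlowup_of_isRank_ker φ θ hF.isLocallyFree ⊤ ?_ fun T f _ t => ?_
  · rw [Scheme.IdealSheafData.comap_top]
    exact isEffectiveCartier_top
  · obtain ⟨U, hx, ⟨e⟩⟩ := hE (f t)
    obtain ⟨U', hx', ⟨b⟩⟩ := hF (f t)
    let σ := Equiv.sumEmpty (Fin r) (Fin 0)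
    refine ⟨f ⁻¹ᵁ (U ⊓ U'), 0, _, ⟨hx, hx'⟩,
      (((e.isFrame.res (inf_le_left : U ⊓ U' ≤ U)).pull f).reindex σ), fun V hV m => ?_⟩
    rw [Sub.mem_ker]
    refine iff_of_true ?_ fun j => j.elim0
    exact ((b.isFrame.res (inf_le_right : U ⊓ U' ≤ U')).pull f).eq_zero hV _

end rankZero

end GrassmannBundle

end

section

variable {X : Scheme.{u}}

/-! ### Zero loci of sections of direct sums of line bundles -/

/-- The unit section is a frame of the structure sheaf. -/
lemma isFrame_unitSec (U : X.Opens) {κ : Type} [Fintype κ] [Unique κ] :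
    IsFrame (structureModule X) U fun _ : κ => unitSec U 1 := by
  intro V h
  have h1 : (fun a : κ → Γ(X, V) => ∑ i, a i • res (structureModule X) h (unitSec U 1)) =
      fun a => unitSec V (a default) := by
    funext a
    rw [Fintype.sum_unique, res_unitSec, map_one, ← map_smul, smul_eq_mul, mul_one]
  rw [h1]
  exact (unitSec V).bijective.comp (Equiv.funUnique κ Γ(X, V)).bijective

lemma isLocallyFreeOfRank_structureModule : IsLocallyFreeOfRank (structureModule X) 1 := fun _ =>
  ⟨⊤, trivial, ⟨(isFrame_unitSec ⊤).toFrame⟩⟩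

lemma IsFrame.isIso_of_isFrame_app {M N : X.Modules} {φ : M ⟶ N} {ι : Type} [Fintype ι]
    {b : ι → Γ(M, ⊤)} (hb : IsFrame M ⊤ b) (h : IsFrame N ⊤ fun i => φ.app ⊤ (b i)) : IsIso φ := by
  refine isIso_of_bijective φ fun V => ?_
  have h1 : (fun a : ι → Γ(X, V) => ∑ i, a i • GrassmannBlowup.res N le_top (φ.app ⊤ (b i))) =
      φ.app V ∘ fun a => ∑ i, a i • GrassmannBlowup.res M le_top (b i) := by
    funext a
    rw [Function.comp_apply, app_sum_smul]
    exact Finset.sum_congr rfl fun i _ => by rw [res_app]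
  have h2 := h V le_top
  rw [h1] at h2
  exact (Function.Bijective.of_comp_iff _ (hb V le_top)).mp h2

/-- The pulled-back unit section is a frame and is sent to the unit section, again a frame. -/
instance isIso_pullbackStructure {T : Scheme.{u}} (f : T ⟶ X) : IsIso (pullbackStructure f) := by
  have hb : IsFrame ((Scheme.Modules.pullback f).obj (structureModule X)) ⊤ _ :=
    (isFrame_unitSec (X := X) ⊤ (κ := Unit)).pull f
  refine hb.isIso_of_isFrame_app ?_
  have h1 : (pullbackStructure f).app (f ⁻¹ᵁ ⊤) (pull f (structureModule X) ⊤ (unitSec ⊤ 1)) =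
      unitSec (⊤ : T.Opens) 1 := by
    refine (pullDesc_pull f _ ⊤ (unitSec ⊤ 1)).trans ?_
    exact map_one (funPull f ⊤)
  have h2 : (fun _ : Unit => (pullbackStructure f).app ⊤
      (pull f (structureModule X) ⊤ (unitSec ⊤ 1))) = fun _ => unitSec (⊤ : T.Opens) 1 := funext fun _ => h1
  rw [h2]
  exact isFrame_unitSec ⊤

lemma app_finset_sum {M N : X.Modules} {ι : Type*} (s : Finset ι) (φ : ι → (M ⟶ N)) {U : X.Opens}
    (m : Γ(M, U)) : (∑ i ∈ s, φ i).app U m = ∑ i ∈ s, (φ i).app U m := by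
  classical
  induction s using Finset.induction_on with
  | empty => rfl
  | insert i s hi ih =>
    rw [Finset.sum_insert hi, Finset.sum_insert hi, ← ih]
    rfl

lemma isFrame_biproduct [HasFiniteBiproducts X.Modules] {n : ℕ} {L : Fin n → X.Modules}
    {U : X.Opens} {b : ∀ i, Fin 1 → Γ(L i, U)} (hb : ∀ i, IsFrame (L i) U (b i)) :
    IsFrame (⨁ L) U fun i => (biproduct.ι L i).app U (b i 0) := by
  intro V h
  have hπι : ∀ i j (m : Γ(L i, V)), (biproduct.π L j).app V ((biproduct.ι L i).app V m) =
      if h : i = j then h ▸ m else 0 := by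
    intro i j m
    rw [← comp_app_apply]
    by_cases hij : i = j
    · subst hij
      rw [biproduct.ι_π_self, dif_pos rfl]
      rfl
    · rw [biproduct.ι_π_ne L hij, dif_neg hij]
      rfl
  constructor
  · intro a a' haa
    have key : ∀ (a : Fin n → Γ(X, V)) j, (biproduct.π L j).app V
        (∑ i, a i • res _ h ((biproduct.ι L i).app U (b i 0))) = a j • res _ h (b j 0) := by
      intro a j
      rw [app_sum_smul, Finset.sum_eq_single j]
      · rw [res_app, hπι, dif_pos rfl]
      · intro i _ hij
        rw [res_app, hπι, dif_neg hij, smul_zero]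
      · exact fun hj => absurd (Finset.mem_univ j) hj
    funext j
    have h1 := congr_arg ((biproduct.π L j).app V) haa
    rw [key, key] at h1
    have h2 := @(hb j V h).1 (fun _ => a j) (fun _ => a' j) (by simpa using h1)
    exact congr_fun h2 0
  · intro m
    refine ⟨fun i => (hb i).coord h ((biproduct.π L i).app V m) 0, ?_⟩
    have h1 : m = ∑ i, (biproduct.ι L i).app V ((biproduct.π L i).app V m) := by
      have h2 : m = (𝟙 (⨁ L)  : ⨁ L ⟶ ⨁ L).app V m := rfl
      rw [← biproduct.total, app_finset_sum] at h2
      exact h2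
    conv_rhs => rw [h1]
    refine Finset.sum_congr rfl fun i _ => ?_
    have h3 := (hb i).sum_coord h ((biproduct.π L i).app V m)
    rw [Fintype.sum_unique] at h3
    conv_rhs => rw [← h3]
    exact (congr_arg (_ • ·) (res_app _ h _)).trans
      (Scheme.Modules.Hom.app_smul (biproduct.ι L i) _ _).symm

lemma isLocallyFreeOfRank_directSum {n : ℕ} {L : Fin n → X.Modules}
    (hL : ∀ i, IsLocallyFreeOfRank (L i) 1) : IsLocallyFreeOfRank (directSum L) n := by
  intro x
  choose U hU b using fun i => hL i x
  obtain ⟨V, hxV, hV⟩ := exists_open_le U hU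
  have : HasFiniteBiproducts X.Modules := Abelian.hasFiniteBiproducts
  exact ⟨V, hxV, ⟨(isFrame_biproduct fun i => ((b i).some.isFrame.res (hV i))).toFrame⟩⟩

variable {E : X.Modules} {n : ℕ}

/-- The dual frame. -/
lemma IsFrame.isFrame_dual {U : X.Opens} {b : Fin n → Γ(E, U)} (hb : IsFrame E U b) :
    IsFrame (dual E) U fun i => hb.elementaryHom (fun _ : Unit => unitSec U 1) ((), i) :=
  (hb.hom (isFrame_unitSec U)).reindex (Equiv.punitProd (Fin n)).symm

lemma isLocallyFreeOfRank_dual (hE : IsLocallyFreeOfRank E n) : IsLocallyFreeOfRank (dual E) n :=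
  fun x => by
    obtain ⟨U, hx, ⟨b⟩⟩ := hE x
    exact ⟨U, hx, ⟨b.isFrame.isFrame_dual.toFrame⟩⟩

lemma IsFrame.evalAt_dual {U : X.Opens} {b : Fin n → Γ(E, U)} (hb : IsFrame E U b) (s : Γ(E, ⊤))
    (i : Fin n) : (evalAt s).app U (hb.elementaryHom (fun _ : Unit => unitSec U 1) ((), i)) =
      hb.coord le_rfl (GrassmannBlowup.res E le_top s) i • unitSec U 1 :=
  (show _ = hb.coord le_rfl (GrassmannBlowup.res E le_top s) i • GrassmannBlowup.res _ le_rfl (unitSec U 1)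
    from rfl).trans (by rw [res_self])

/-- The normal form of the evaluation at a section of a locally free sheaf with a frame. -/
def evalAtNormalForm (U : X.affineOpens) {b : Fin n → Γ(E, U)} (hb : IsFrame E U b) (s : Γ(E, ⊤)) :
    NormalForm (evalAt s) 0 n where
  U := U
  e i := hb.elementaryHom (fun _ : Unit => unitSec U.1 1) ((), Equiv.emptySum (Fin 0) (Fin n) i)
  f _ := unitSec U.1 1
  g := hb.coord le_rfl (res E le_top s)
  isFrame_e := hb.isFrame_dual.reindex (Equiv.emptySum (Fin 0) (Fin n))
  isFrame_f := (isFrame_unitSec U.1 (κ := Unit)).reindex (Equiv.emptySum (Fin 0) Unit)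
  app_inl i := i.elim0
  app_inr j := hb.evalAt_dual s j

/-- In the dual frame the matrix of `α ↦ α(s)` is the row of coordinates of `s`, and its `1 × 1`
minors are these coordinates. -/
lemma minorIdeal_evalAt (hE : IsLocallyFreeOfRank E n) (s : Γ(E, ⊤)) :
    minorIdeal (evalAt s) 1 = zeroIdeal s := by
  have key : ∀ x : X, ∃ V : X.affineOpens, x ∈ V.1 ∧
      (minorIdeal (evalAt s) 1).ideal V = (zeroIdeal s).ideal V := by
    intro x
    obtain ⟨U, hx, ⟨b⟩⟩ := hE x
    obtain ⟨V, hxV, hV⟩ := exists_affine_mem_le hx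
    have hb := b.isFrame.res hV
    refine ⟨V, hxV, ?_⟩
    rw [zeroIdeal_ideal hE.isLocallyFree s hb V le_rfl]
    exact (evalAtNormalForm V hb s).minorIdeal_ideal (isLocallyFreeOfRank_dual hE).isLocallyFree
      isLocallyFreeOfRank_structureModule.isLocallyFree
  refine le_antisymm (eq_of_forall_good {V | _} (fun x => ?_) fun V hV => le_of_eq hV)
    (eq_of_forall_good {V | _} (fun x => ?_) fun V hV => ge_of_eq hV) <;>
  · obtain ⟨V, hxV, hV⟩ := key x
    exact ⟨V, hV, hxV⟩

/-- The frames in `IsRegularSection` have unspecified size; this identifies it with the rank. -/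
lemma IsLocallyFreeOfRank.eq_of_isFrame (hE : IsLocallyFreeOfRank E n) {m : ℕ} {U : X.Opens}
    {b : Fin m → Γ(E, U)} (hb : IsFrame E U b) {x : X} (hx : x ∈ U) : m = n := by
  obtain ⟨U', hx', ⟨b'⟩⟩ := hE x
  have : Nonempty (U ⊓ U' : X.Opens) := ⟨⟨x, hx, hx'⟩⟩
  have := Fintype.card_congr ((hb.res (inf_le_left : U ⊓ U' ≤ U)).toBasis.indexEquiv
    (b'.isFrame.res (inf_le_right : U ⊓ U' ≤ U')).toBasis)
  simpa using this

lemma Frame.repr_eq_coord {M : X.Modules} {U : X.Opens} {ι : Type} [Fintype ι] (b : Frame M U ι)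
    (m : Γ(M, U)) (i : ι) : b.basis.repr m i = b.isFrame.coord le_rfl m i := by
  refine (congr_fun (b.isFrame.coord_eq le_rfl (a := b.basis.repr m) ?_) i).symm
  simp only [res_self]
  exact b.basis.sum_repr m

lemma hasRegularNormalForm_evalAt (hE : IsLocallyFreeOfRank E n) {s : Γ(E, ⊤)}
    (hs : IsRegularSection s) : HasRegularNormalForm (evalAt s) 0 n := by
  intro x
  obtain ⟨U, hx, m, b, hreg⟩ := hs x
  obtain rfl := hE.eq_of_isFrame b.isFrame hx
  obtain ⟨V, hxV, hV⟩ := exists_affine_mem_le hx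
  refine ⟨evalAtNormalForm V (b.isFrame.res hV) s, hxV, ?_⟩
  have key : ∀ j, X.presheaf.germ V x hxV
      ((b.isFrame.res hV).coord le_rfl (res E le_top s) j) =
        X.presheaf.germ U x hx (b.basis.repr (res E le_top s) j) := fun j => by
    rw [b.isFrame.coord_res_res hV le_rfl, ← res_res E le_top hV, b.isFrame.coord_res le_rfl hV]
    refine (germ_resFun hV hxV _).trans ?_
    rw [b.repr_eq_coord]
  change (∀ j, X.presheaf.germ V x hxV ((b.isFrame.res hV).coord le_rfl (res E le_top s) j) ∈ _) →
    RingTheory.Sequence.IsRegular _ (List.ofFn fun j => X.presheaf.germ V x hxV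
      ((b.isFrame.res hV).coord le_rfl (res E le_top s) j))
  simp only [key]
  exact hreg

theorem grassmannBundle_dual_directSum [IsLocallyNoetherian X] (r : ℕ)
    (L : Fin (r + 1) → X.Modules) (hL : ∀ i, IsLocallyFreeOfRank (L i) 1) (s : Γ(directSum L, ⊤))
    (hs : IsRegularSection s) :
    Nonempty (GrassmannBundle (dual (directSum L)) r) ∧
      ∀ Gr : GrassmannBundle (dual (directSum L)) r,
        IsRegularSection (Gr.tautDualSection s) ∧
        IsBlowup ((zeroIdeal (Gr.tautDualSection s)).subschemeι ≫ Gr.π) (zeroIdeal s) := by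
  have hE := isLocallyFreeOfRank_directSum hL
  have hE' : IsLocallyFreeOfRank (dual (directSum L)) (r + (0 + 1)) := isLocallyFreeOfRank_dual hE
  have hφ := hasRegularNormalForm_evalAt hE hs
  refine ⟨nonempty_grassmannBundle hE', fun Gr =>
    ⟨Gr.isRegularSection_bundleSection (pullbackStructure Gr.π) hE' hφ, ?_⟩⟩
  rw [← minorIdeal_evalAt hE s]
  exact Gr.isBlowup_bundleSection (pullbackStructure Gr.π) hE'
    isLocallyFreeOfRank_structureModule.isLocallyFree hφ

end

/-! ### Differentials of minors, and ideals with formally smooth quotient -/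

section

open IsLocalRing RingTheory.Sequence
open scoped TensorProduct

section derivation

variable {R A M : Type*} [CommRing R] [CommRing A] [Algebra R A] [AddCommGroup M] [Module A M]
  [Module R M]

lemma derivation_prod {ι : Type*} [DecidableEq ι] (D : Derivation R A M) (s : Finset ι)
    (f : ι → A) : D (∏ i ∈ s, f i) = ∑ k ∈ s, (∏ i ∈ s.erase k, f i) • D (f k) := by
  induction s using Finset.induction_on with
  | empty => simp
  | insert a s ha ih =>
    rw [Finset.prod_insert ha, D.leibniz, ih, Finset.sum_insert ha, Finset.erase_insert ha,
      add_comm, Finset.smul_sum]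
    refine congr_arg _ (Finset.sum_congr rfl fun k hk => ?_)
    rw [Finset.erase_insert_of_ne (ne_of_mem_of_not_mem hk ha).symm,
      Finset.prod_insert (fun h => ha (Finset.mem_of_mem_erase h)), smul_smul]

/-- Jacobi's formula: in the expansion over permutations, the terms in which the derivation hits the
entry `(l, k)` add up to the cofactor of that entry. -/
lemma derivation_det {n : Type*} [Fintype n] [DecidableEq n] (D : Derivation R A M)
    (B : Matrix n n A) : D B.det = ∑ k, ∑ l, B.adjugate k l • D (B l k) := by
  have h (k l) : B.adjugate k l = ∑ σ : Equiv.Perm n,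
      if σ k = l then (Equiv.Perm.sign σ : ℤ) • ∏ i ∈ Finset.univ.erase k, B (σ i) i else 0 := by
    rw [← Matrix.transpose_apply B.adjugate, Matrix.adjugate_transpose, Matrix.adjugate_apply,
      Matrix.updateRow_transpose, Matrix.det_transpose, Matrix.det_apply]
    refine Finset.sum_congr rfl fun σ _ => ?_
    rw [← Finset.mul_prod_erase _ _ (Finset.mem_univ k), Matrix.updateCol_self, Pi.single_apply]
    split_ifs with h
    · rw [one_mul, Units.smul_def]
      congr 1
      refine Finset.prod_congr rfl fun i hi => ?_
      rw [Matrix.updateCol_ne (Finset.ne_of_mem_erase hi)]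
    · rw [zero_mul, smul_zero]
  simp only [h, Finset.sum_smul, ite_smul, zero_smul]
  rw [Matrix.det_apply, map_sum]
  simp only [Finset.sum_comm (s := Finset.univ (α := n)) (t := Finset.univ (α := Equiv.Perm n))]
  refine Finset.sum_congr rfl fun σ _ => ?_
  rw [Units.smul_def, map_zsmul, derivation_prod, Finset.smul_sum]
  refine Finset.sum_congr rfl fun k _ => ?_
  rw [Finset.sum_ite_eq Finset.univ (σ k), if_pos (Finset.mem_univ _), smul_assoc]

lemma derivation_mem_smul_top_of_mem_span (D : Derivation R A M) {I : Ideal A} {s : Set A}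
    (hs : s ⊆ I) (hD : ∀ a ∈ s, D a ∈ I • (⊤ : Submodule A M)) {a : A} (ha : a ∈ Ideal.span s) :
    D a ∈ I • (⊤ : Submodule A M) := by
  induction ha using Submodule.span_induction with
  | mem a ha => exact hD a ha
  | zero => rw [map_zero]; exact zero_mem _
  | add x y _ _ hx hy => rw [map_add]; exact add_mem hx hy
  | smul t x hx h =>
    rw [smul_eq_mul, D.leibniz]
    exact add_mem (Submodule.smul_mem _ _ h)
      (Submodule.smul_mem_smul (Ideal.span_le.mpr hs hx) Submodule.mem_top)

end derivation

section smooth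

variable {k T : Type u} [CommRing k] [CommRing T] [Algebra k T]

/-- Formal smoothness of `T ⧸ J` splits the conormal map `J/J² ⟶ (T/J) ⊗ Ω`. Applying the splitting
to the differential of `a` puts the class of `a` in `I (J/J²)`, so `a ∈ I J + J²`, and `J² ≤ I J`
because `J ≤ I`. -/
lemma mem_mul_of_D_mem [Algebra.FormallySmooth k T] {J I : Ideal T}
    [Algebra.FormallySmooth k (T ⧸ J)] (hJ : J ≤ I) {a : T} (ha : a ∈ J)
    (hD : KaehlerDifferential.D k T a ∈ I • (⊤ : Submodule T Ω[T⁄k])) : a ∈ I * J := by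
  have hker : RingHom.ker (algebraMap T (T ⧸ J)) = J := Ideal.mk_ker
  set K := RingHom.ker (algebraMap T (T ⧸ J)) with hK
  obtain ⟨l, hl⟩ : ∃ l : (T ⧸ J) ⊗[T] Ω[T⁄k] →ₗ[T] K.Cotangent,
      l ∘ₗ KaehlerDifferential.kerCotangentToTensor k T (T ⧸ J) = LinearMap.id :=
    (Algebra.FormallySmooth.iff_split_injection (R := k) (P := T) (A := T ⧸ J)
    Ideal.Quotient.mk_surjective).mp inferInstance
  let h : Ω[T⁄k] →ₗ[T] K.Cotangent := l ∘ₗ TensorProduct.mk T (T ⧸ J) Ω[T⁄k] 1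
  have h1 : K.toCotangent ⟨a, hker.symm ▸ ha⟩ ∈ I • (⊤ : Submodule T K.Cotangent) := by
    have h2 : h (KaehlerDifferential.D k T a) = K.toCotangent ⟨a, hker.symm ▸ ha⟩ :=
      LinearMap.congr_fun hl (K.toCotangent ⟨a, hker.symm ▸ ha⟩)
    rw [← h2]
    have h3 := Submodule.mem_map_of_mem (f := h) hD
    rw [Submodule.map_smul''] at h3
    exact Submodule.smul_mono le_rfl le_top h3
  rw [← LinearMap.range_eq_top.mpr K.toCotangent_surjective, ← Submodule.map_top,
    ← Submodule.map_smul''] at h1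
  obtain ⟨b, hb, hba⟩ := h1
  have h4 : (b : T) ∈ I * K := by
    have := Submodule.mem_map_of_mem (f := K.subtype) hb
    rw [Submodule.map_smul'', Submodule.map_top, Submodule.range_subtype] at this
    exact this
  have h5 := (K.toCotangent_eq).mp hba.symm
  rw [← hker]
  have h6 : a - b ∈ I * K := by
    refine Ideal.mul_mono_left (hker.le.trans hJ) ?_
    rw [← pow_two]
    exact h5
  exact (sub_add_cancel a (b : T)) ▸ add_mem h6 h4

/-- By `mem_mul_of_D_mem` with `I = 𝔪` one gets `J ≤ 𝔪 J`, and Nakayama's lemma applies. -/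
lemma eq_bot_of_forall_D_mem [IsLocalRing T] [IsNoetherianRing T] [Algebra.FormallySmooth k T]
    {J : Ideal T} [Algebra.FormallySmooth k (T ⧸ J)] {s : Set T} (hJ : J = Ideal.span s)
    (hs : s ⊆ maximalIdeal T)
    (hD : ∀ a ∈ s, KaehlerDifferential.D k T a ∈ maximalIdeal T • (⊤ : Submodule T Ω[T⁄k])) :
    J = ⊥ := by
  have hJm : J ≤ maximalIdeal T := hJ ▸ Ideal.span_le.mpr hs
  refine Submodule.eq_bot_of_le_smul_of_le_jacobson_bot (maximalIdeal T) J
    (IsNoetherian.noetherian J) (fun a ha => ?_) (IsLocalRing.maximalIdeal_le_jacobson _)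
  exact mem_mul_of_D_mem hJm ha (derivation_mem_smul_top_of_mem_span _ hs hD (hJ ▸ ha))

/-- By Laplace expansion and Jacobi's formula, the `(p+1)`-minors and their differentials are
combinations with coefficients among the `p`-minors up to sign, which lie in `𝔪`. -/
lemma eq_bot_of_minors_mem [IsLocalRing T] [IsNoetherianRing T] [Algebra.FormallySmooth k T]
    {ι κ : Type*} {p : ℕ} (Φ : Matrix ι κ T) (hΦ : minors Φ p ⊆ maximalIdeal T)
    [Algebra.FormallySmooth k (T ⧸ Ideal.span (minors Φ (p + 1)))] :
    Ideal.span (minors Φ (p + 1)) = ⊥ := by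
  have hadj (row : Fin (p + 1) → ι) (col : Fin (p + 1) → κ) (i j) :
      (Φ.submatrix row col).adjugate i j ∈ maximalIdeal T := by
    rw [Matrix.adjugate_fin_succ_eq_det_submatrix]
    exact Ideal.mul_mem_left _ _ (hΦ ⟨_, _, rfl⟩)
  refine eq_bot_of_forall_D_mem (k := k) rfl ?_ ?_
  · rintro _ ⟨row, col, rfl⟩
    rw [Matrix.det_eq_sum_mul_adjugate_row _ 0]
    exact sum_mem fun j _ => Ideal.mul_mem_left _ _ (hadj _ _ _ _)
  · rintro _ ⟨row, col, rfl⟩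
    rw [derivation_det]
    exact sum_mem fun i _ => sum_mem fun j _ =>
      Submodule.smul_mem_smul (hadj _ _ _ _) Submodule.mem_top

end smooth

end

/-! ### Regular sequences from independent differentials -/

section

open IsLocalRing RingTheory.Sequence
open scoped TensorProduct

section smooth

/-- The splitting makes `Ω[T⁄S]` a direct summand of the projective module `Ω[T⁄R]`. In the
Jacobi–Zariski sequence the connecting map of `H1Cotangent S T` vanishes by injectivity, so that
module is the image of `H1Cotangent R T`, which is zero. -/
lemma formallySmooth_of_split_injective_mapBaseChange {R S T : Type u} [CommRing R] [CommRing S]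
    [CommRing T] [Algebra R S] [Algebra R T] [Algebra S T] [IsScalarTower R S T]
    [Algebra.FormallySmooth R T] {l : Ω[T⁄R] →ₗ[T] T ⊗[S] Ω[S⁄R]}
    (hl : l ∘ₗ KaehlerDifferential.mapBaseChange R S T = LinearMap.id) :
    Algebra.FormallySmooth S T := by
  have hinj : Function.Injective (KaehlerDifferential.mapBaseChange R S T) :=
    Function.LeftInverse.injective fun x => LinearMap.congr_fun hl x
  refine ⟨?_, ⟨fun a b => ?_⟩⟩
  · have hex := KaehlerDifferential.exact_mapBaseChange_map R S T
    have hs := KaehlerDifferential.map_surjective R S T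
    have hex' : Function.Exact (KaehlerDifferential.mapBaseChange R S T)
      (KaehlerDifferential.map R S T T) := hex
    have hsplit : ∃ l, l ∘ₗ KaehlerDifferential.mapBaseChange R S T = LinearMap.id := ⟨l, hl⟩
    have htfae := hex'.split_tfae'.out 1 0
    obtain ⟨-, i, hi⟩ := htfae.mp ⟨hs, hsplit⟩
    exact Module.Projective.of_split i _ hi
  · have hz (x : Algebra.H1Cotangent S T) : x = 0 := by
      have h1 : Algebra.H1Cotangent.δ R S T x = 0 := by
        apply hinj
        rw [map_zero]
        exact (Algebra.H1Cotangent.exact_δ_mapBaseChange R S T).apply_apply_eq_zero x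
      obtain ⟨y, rfl⟩ := (Algebra.H1Cotangent.exact_map_δ R S T x).mp h1
      rw [Subsingleton.elim y 0, map_zero]
    rw [hz a, hz b]

/-- `T` is a quotient of a localization `L` of a polynomial ring over `B`. As `L` is noetherian and
flat over `B`, formal smoothness passes flatness on to `T`. -/
lemma flat_of_essFiniteType_of_formallySmooth (B T : Type u) [CommRing B] [CommRing T]
    [Algebra B T] [IsNoetherianRing B] [Algebra.EssFiniteType B T] [Algebra.FormallySmooth B T] :
    Module.Flat B T := by
  obtain ⟨n, q, hq⟩ := (Algebra.FiniteType.iff_quotient_mvPolynomial'' (R := B)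
    (S := Algebra.EssFiniteType.subalgebra B T)).mp inferInstance
  let P := MvPolynomial (Fin n) B
  let q' : P →ₐ[B] T := (Subalgebra.val _).comp q
  let N : Submonoid P := (IsUnit.submonoid T).comap q'
  let L := Localization N
  have hu (y : N) : IsUnit (q' y) := y.2
  let F : L →ₐ[B] T := IsLocalization.liftAlgHom (M := N) (f := q') hu
  have hF : Function.Surjective F := by
    intro t
    obtain ⟨⟨a, s⟩, h⟩ := IsLocalization.surj (Algebra.EssFiniteType.submonoid B T) t
    obtain ⟨a', rfl⟩ := hq a
    obtain ⟨s', hs'⟩ := hq s.1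
    have hs : q' s' = (s.1 : T) := congr_arg Subtype.val hs'
    have hN : s' ∈ N := by
      change IsUnit (q' s')
      rw [hs]
      exact s.2
    refine ⟨IsLocalization.mk' L a' ⟨s', hN⟩, ?_⟩
    refine (IsLocalization.lift_mk'_spec (g := q'.toRingHom) (hg := hu) (S := L)
      a' t ⟨s', hN⟩).mpr ?_
    change q' a' = q' s' * t
    rw [hs, mul_comm]
    exact h.symm
  have : Module.Flat P L := IsLocalization.flat L N
  have : Module.Flat B L := Module.Flat.trans B P L
  have : IsNoetherianRing L := IsLocalization.isNoetherianRing N L inferInstance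
  exact Algebra.FormallySmooth.flat_of_algHom_of_isNoetherianRing F hF

lemma mem_smul_top_of_residue_tmul_eq_zero {T M : Type*} [CommRing T] [IsLocalRing T]
    [AddCommGroup M] [Module T M] {x : M} (hx : (1 : ResidueField T) ⊗ₜ[T] x = 0) :
    x ∈ maximalIdeal T • (⊤ : Submodule T M) := by
  have h := TensorProduct.quotTensorEquivQuotSMul_mk_one_tmul (maximalIdeal T) x
  have h' : (1 : T ⧸ maximalIdeal T) ⊗ₜ[T] x = 0 := hx
  rw [h', map_zero] at h
  exact (Submodule.Quotient.mk_eq_zero _).mp h.symm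

/-- Send the variables of a polynomial ring `B` over `k` to `g`. Independence modulo `𝔪` makes `T ⊗
Ω[B⁄k] ⟶ Ω[T⁄k]` injective over the residue field, hence split injective. So `T` is formally smooth
and flat over `B`, and the regular sequence of variables maps to `g`. -/
lemma isWeaklyRegular_of_D_independent {k T : Type u} [Field k] [CommRing T] [Algebra k T]
    [IsLocalRing T] [Algebra.FormallySmooth k T] [Algebra.EssFiniteType k T] {c : ℕ} (g : Fin c → T)
    (hg : ∀ t : Fin c → T, ∑ i, t i • KaehlerDifferential.D k T (g i) ∈
      maximalIdeal T • (⊤ : Submodule T Ω[T⁄k]) → ∀ i, t i ∈ maximalIdeal T) :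
    IsWeaklyRegular T (List.ofFn g) := by
  let σ := ULift.{u} (Fin c)
  let B := MvPolynomial σ k
  let ψ : B →ₐ[k] T := MvPolynomial.aeval fun i => g i.down
  let := ψ.toAlgebra
  have : IsScalarTower k B T := IsScalarTower.of_algHom ψ
  let b : Module.Basis σ T (T ⊗[B] Ω[B⁄k]) :=
    (KaehlerDifferential.mvPolynomialBasis k σ).baseChange T
  have : Module.Free T (T ⊗[B] Ω[B⁄k]) := .of_basis b
  have : Module.Finite T (T ⊗[B] Ω[B⁄k]) := .of_basis b
  have hb (i : σ) : KaehlerDifferential.mapBaseChange k B T (b i) =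
      KaehlerDifferential.D k T (g i.down) := by
    have : b i = 1 ⊗ₜ KaehlerDifferential.D k B (MvPolynomial.X i) := by
      rw [Module.Basis.baseChange_apply, KaehlerDifferential.mvPolynomialBasis_apply]
    rw [this, KaehlerDifferential.mapBaseChange_tmul, one_smul, KaehlerDifferential.map_D]
    congr 1
    exact MvPolynomial.aeval_X _ _
  have : Module.Free T Ω[T⁄k] := Module.free_of_flat_of_isLocalRing
  obtain ⟨l, hl⟩ := (IsLocalRing.split_injective_iff_lTensor_residueField_injective
      (KaehlerDifferential.mapBaseChange k B T)).mpr (by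
    rw [injective_iff_map_eq_zero]
    intro z hz
    obtain ⟨x, rfl⟩ : ∃ x : T ⊗[B] Ω[B⁄k], (1 : ResidueField T) ⊗ₜ[T] x = z := by
      have := TensorProduct.mk_surjective T (T ⊗[B] Ω[B⁄k]) (ResidueField T)
        (Ideal.Quotient.mk_surjective)
      exact this z
    rw [LinearMap.lTensor_tmul] at hz
    have h1 := mem_smul_top_of_residue_tmul_eq_zero hz
    rw [← b.sum_repr x, map_sum] at h1
    simp only [map_smul, hb] at h1
    have h2 := hg (fun i => b.repr x ⟨i⟩) (by
      rw [← Equiv.sum_comp (Equiv.ulift : σ ≃ Fin c)]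
      exact h1)
    rw [← b.sum_repr x, TensorProduct.tmul_sum]
    refine Finset.sum_eq_zero fun i _ => ?_
    rw [TensorProduct.tmul_smul, TensorProduct.smul_tmul']
    have h3 : (b.repr x i) • (1 : ResidueField T) = 0 := by
      rw [Algebra.smul_def, mul_one]
      exact (IsLocalRing.residue_eq_zero_iff _).mpr (h2 i.down)
    rw [h3, TensorProduct.zero_tmul])
  have := formallySmooth_of_split_injective_mapBaseChange hl
  have := Algebra.EssFiniteType.of_comp k B T
  have hflat := flat_of_essFiniteType_of_formallySmooth B T
  have h1 := isWeaklyRegular_map_C_append (A := k) (σ := σ) (IsWeaklyRegular.nil k k)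
    (l := List.ofFn fun i : Fin c => (⟨i⟩ : σ))
    (List.nodup_ofFn.mpr fun i j h => congr_arg ULift.down h)
  have h2 := isWeaklyRegular_map_of_flat (algebraMap B T) hflat (l := _) h1
  convert h2 using 1
  simp only [List.map_nil, List.nil_append, List.map_ofFn]
  congr 1
  funext i
  exact (MvPolynomial.aeval_X (R := k) (fun i : σ => g i.down) ⟨i⟩).symm

/-- If `∑ t_i dg_i ∈ 𝔪 Ω` with `t_j` a unit, then `∑ t_i g_i ∈ 𝔪 J`, and by Nakayama `g_j` is
superfluous. Then `J` has fewer than `c` generators, against Krull's height theorem. -/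
lemma isWeaklyRegular_of_le_height {k T : Type u} [Field k] [CommRing T] [Algebra k T]
    [IsLocalRing T] [IsNoetherianRing T] [Algebra.FormallySmooth k T] [Algebra.EssFiniteType k T]
    {c : ℕ} (g : Fin c → T) (hg : ∀ i, g i ∈ maximalIdeal T)
    [Algebra.FormallySmooth k (T ⧸ Ideal.span (Set.range g))]
    (hc : (c : ℕ∞) ≤ (Ideal.span (Set.range g)).height) : IsWeaklyRegular T (List.ofFn g) := by
  classical
  set J := Ideal.span (Set.range g) with hJ
  have hJm : J ≤ maximalIdeal T := Ideal.span_le.mpr (Set.range_subset_iff.mpr hg)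
  have hgJ (i) : g i ∈ J := Ideal.subset_span ⟨i, rfl⟩
  refine isWeaklyRegular_of_D_independent (k := k) g fun t ht j => ?_
  by_contra htj
  have ha : ∑ i, t i * g i ∈ maximalIdeal T * J := by
    refine mem_mul_of_D_mem (k := k) hJm (sum_mem fun i _ => Ideal.mul_mem_left _ _ (hgJ i)) ?_
    simp only [map_sum, Derivation.leibniz, Finset.sum_add_distrib]
    exact add_mem ht (sum_mem fun i _ => Submodule.smul_mem_smul (hg i) Submodule.mem_top)
  let s := (Finset.univ.erase j).image g
  have hu : IsUnit (t j) := by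
    by_contra h
    exact htj ((mem_maximalIdeal _).mpr h)
  have hs (i) (hi : i ≠ j) : g i ∈ Ideal.span (s : Set T) :=
    Ideal.subset_span (Finset.mem_coe.mpr
      (Finset.mem_image_of_mem g (Finset.mem_erase.mpr ⟨hi, Finset.mem_univ i⟩)))
  have hle : J ≤ Ideal.span (s : Set T) := by
    refine Submodule.le_of_le_smul_of_le_jacobson_bot (IsNoetherian.noetherian J)
      (IsLocalRing.maximalIdeal_le_jacobson _) (Ideal.span_le.mpr ?_)
    rintro _ ⟨i, rfl⟩
    by_cases hi : i = j
    · subst hi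
      have h1 : t i * g i ∈ Ideal.span (s : Set T) ⊔ maximalIdeal T • J := by
        have : t i * g i = -(∑ i' ∈ Finset.univ.erase i, t i' * g i') + ∑ i', t i' * g i' := by
          rw [← Finset.add_sum_erase _ _ (Finset.mem_univ i)]
          ring
        rw [this]
        exact add_mem (Ideal.mem_sup_left (neg_mem (sum_mem fun i' hi' =>
          Ideal.mul_mem_left _ _ (hs i' (Finset.ne_of_mem_erase hi'))))) (Ideal.mem_sup_right ha)
      exact (Ideal.unit_mul_mem_iff_mem _ hu).mp h1
    · exact Ideal.mem_sup_left (hs i hi)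
  have heq : J = Ideal.span (s : Set T) := by
    refine le_antisymm hle (Ideal.span_le.mpr fun x hx => ?_)
    obtain ⟨i, -, rfl⟩ := Finset.mem_image.mp (Finset.mem_coe.mp hx)
    exact hgJ i
  have h1 := J.height_le_spanFinrank (ne_top_of_le_ne_top (Ideal.IsPrime.ne_top inferInstance) hJm)
  have h2 : J.spanFinrank ≤ s.card := by
    rw [heq, ← Set.ncard_coe_finset]
    exact Submodule.spanFinrank_span_le_ncard_of_finite s.finite_toSet
  have h3 : s.card < c := by
    refine Finset.card_image_le.trans_lt ?_
    rw [Finset.card_erase_of_mem (Finset.mem_univ j), Finset.card_univ, Fintype.card_fin]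
    have := j.pos
    omega
  exact absurd (hc.trans h1) (not_le.mpr (by exact_mod_cast h2.trans_lt h3))

/-- Formal smoothness of the local ring of a quotient. -/
lemma formallySmooth_quotient_map (k : Type u) {A : Type u} (T : Type u) [CommRing k] [CommRing A]
    [CommRing T] [Algebra k A] [Algebra A T] [Algebra k T] [IsScalarTower k A T] (M : Submonoid A)
    [IsLocalization M T] (J : Ideal A) [Algebra.FormallySmooth k (A ⧸ J)] :
    Algebra.FormallySmooth k (T ⧸ J.map (algebraMap A T)) := by
  have : Algebra.FormallySmooth A T := .of_isLocalization M
  let e := (Algebra.TensorProduct.quotIdealMapEquivQuotTensor T J).symm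
  have : Algebra.FormallySmooth k ((A ⧸ J) ⊗[A] T) := .comp k (A ⧸ J) _
  have : IsScalarTower k (A ⧸ J) (T ⧸ J.map (algebraMap A T)) := .of_algebraMap_eq fun x =>
    congr_arg (Ideal.Quotient.mk _) (IsScalarTower.algebraMap_apply k A T x)
  exact .of_equiv (e.restrictScalars k)

end smooth

end

section

variable {X : Scheme.{u}}

/-! ### Local rings of smooth schemes -/

section scalar

variable {k : Type u} [Field k] (f : X ⟶ Spec (.of k))

/-- The structure homomorphism of the sections over an open subset of a scheme over `k`. -/
def scalarHom (U : X.Opens) : k →+* Γ(X, U) :=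
  (f.appLE ⊤ U le_top).hom.comp (Scheme.ΓSpecIso (.of k)).inv.hom

lemma smooth_scalarHom [Smooth f] (U : X.affineOpens) : (scalarHom f U.1).Smooth := by
  have h := HasRingHomProperty.appLE @Smooth f inferInstance ⟨⊤, isAffineOpen_top _⟩ U le_top
  exact (RingHom.Smooth.respectsIso.2 (f.appLE ⊤ U.1 le_top).hom
    (Scheme.ΓSpecIso (.of k)).symm.commRingCatIsoToRingEquiv h)

lemma scalarHom_comp {Y : Scheme.{u}} (g : Y ⟶ X) (U : X.Opens) :
    scalarHom (g ≫ f) (g ⁻¹ᵁ U) = (funPull g U).comp (scalarHom f U) := by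
  have h : f.appLE ⊤ U le_top ≫ g.app U = (g ≫ f).appLE ⊤ (g ⁻¹ᵁ U) le_top := by
    rw [← Scheme.Hom.appLE_eq_app]
    exact Scheme.Hom.appLE_comp_appLE g f ⊤ U (g ⁻¹ᵁ U) le_top le_rfl
  rw [scalarHom, scalarHom, ← h]
  rfl

lemma smooth_quotient_mk_comp_scalarHom (I : X.IdealSheafData) [Smooth (I.subschemeι ≫ f)]
    (U : X.affineOpens) : ((Ideal.Quotient.mk (I.ideal U)).comp (scalarHom f U.1)).Smooth := by
  have h := smooth_scalarHom (I.subschemeι ≫ f)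
    ⟨I.subschemeι ⁻¹ᵁ U.1, U.2.preimage I.subschemeι⟩
  have h1 := RingHom.Smooth.respectsIso.1 _ (I.subschemeObjIso U).commRingCatIsoToRingEquiv h
  rw [scalarHom_comp] at h1
  convert! h1 using 1
  refine RingHom.ext fun a => ?_
  have h2 := congr_arg (· ≫ (I.subschemeObjIso U).hom) (I.subschemeι_app U)
  simp only [Category.assoc, Iso.inv_hom_id, Category.comp_id] at h2
  exact (ConcreteCategory.congr_hom h2 (scalarHom f U.1 a)).symm

lemma exists_algebra_stalk [Smooth f] (I : X.IdealSheafData) [Smooth (I.subschemeι ≫ f)]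
    (U : X.affineOpens) {x : X} (hx : x ∈ U.1) :
    ∃ _ : Algebra k (X.presheaf.stalk x), Algebra.FormallySmooth k (X.presheaf.stalk x) ∧
      Algebra.EssFiniteType k (X.presheaf.stalk x) ∧
      Algebra.FormallySmooth k
        (X.presheaf.stalk x ⧸ (I.ideal U).map (X.presheaf.germ U.1 x hx).hom) := by
  let := (scalarHom f U.1).toAlgebra
  have hs : Algebra.Smooth k Γ(X, U) := smooth_scalarHom f U
  have hq : Algebra.Smooth k (Γ(X, U) ⧸ I.ideal U) := by
    have h := smooth_quotient_mk_comp_scalarHom f I U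
    rw [RingHom.Smooth] at h
    convert! h
  let := TopCat.Presheaf.algebra_section_stalk X.presheaf (⟨x, hx⟩ : U.1)
  have hloc := U.2.isLocalization_stalk ⟨x, hx⟩
  let := ((X.presheaf.germ U.1 x hx).hom.comp (scalarHom f U.1)).toAlgebra
  have : IsScalarTower k Γ(X, U) (X.presheaf.stalk x) := .of_algebraMap_eq fun _ => rfl
  let M := (U.2.primeIdealOf ⟨x, hx⟩).asIdeal.primeCompl
  have h1 : Algebra.FormallySmooth Γ(X, U) (X.presheaf.stalk x) := .of_isLocalization M
  have h2 : Algebra.EssFiniteType Γ(X, U) (X.presheaf.stalk x) := .of_isLocalization _ M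
  refine ⟨inferInstance, .comp k Γ(X, U) _, .comp k Γ(X, U) _, ?_⟩
  exact formallySmooth_quotient_map k (X.presheaf.stalk x) M (I.ideal U)

end scalar

/-- A minimal prime over the ideal at `x` is the generization of `x` at a point of the support, and
its height is the dimension of the local ring at that point, which enters the infimum `codim`. -/
lemma le_height_map_germ (I : X.IdealSheafData) {c : ℕ}
    (hc : ((c : ℕ) : WithBot ℕ∞) ≤ codim (I.support : Set X)) (U : X.affineOpens) {x : X}
    (hx : x ∈ U.1) : (c : ℕ∞) ≤ ((I.ideal U).map (X.presheaf.germ U.1 x hx).hom).height := by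
  let := TopCat.Presheaf.algebra_section_stalk X.presheaf (⟨x, hx⟩ : U.1)
  have hloc := U.2.isLocalization_stalk ⟨x, hx⟩
  rw [Ideal.height_eq_inf_minimalPrimes]
  refine le_iInf₂ fun P hP => ?_
  have := hP.isPrime
  have hPle := hP.1.2
  have h1 := IsLocalization.height_under (U.2.primeIdealOf ⟨x, hx⟩).asIdeal.primeCompl P
  rw [← h1]
  let y : PrimeSpectrum Γ(X, U) := ⟨P.under Γ(X, U), inferInstance⟩
  have hy : U.2.fromSpec y ∈ U.1 := by
    have : U.2.fromSpec y ∈ Set.range U.2.fromSpec := ⟨y, rfl⟩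
    rwa [U.2.range_fromSpec] at this
  have hsupp : U.2.fromSpec y ∈ (I.support : Set X) := by
    refine (I.mem_support_iff_of_mem (U := U) hy).mpr ?_
    rw [Scheme.mem_zeroLocus_iff]
    intro a ha hya
    have h2 : y ∈ U.2.fromSpec ⁻¹ᵁ X.basicOpen a := hya
    rw [U.2.fromSpec_preimage_basicOpen] at h2
    exact h2 (hPle (Ideal.mem_map_of_mem _ ha))
  have h3 := hc.trans (iInf₂_le _ hsupp)
  have hloc' := U.2.isLocalization_stalk' y hy
  have h4 := @IsLocalization.AtPrime.ringKrullDim_eq_height Γ(X, U) _ y.asIdeal _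
    (X.presheaf.stalk (U.2.fromSpec y)) _
    (TopCat.Presheaf.algebra_section_stalk X.presheaf (⟨U.2.fromSpec y, hy⟩ : U.1)) hloc'
  exact WithBot.coe_le_coe.mp (h3.trans_eq h4)

end

section

variable {X : Scheme.{u}}

/-! ### Reduction to normal form -/

lemma exists_sum_equiv_of_injective {α β γ : Type*} [Fintype α] [Fintype β] [Fintype γ] {i : α → γ}
    (hi : Function.Injective i) (h : Fintype.card γ = Fintype.card α + Fintype.card β) :
    ∃ s : α ⊕ β ≃ γ, ∀ a, s (.inl a) = i a := by
  classical
  have hc : Fintype.card β = Fintype.card ((Set.range i)ᶜ : Set γ) := by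
    rw [Fintype.card_compl_set, Set.card_range_of_injective hi, h, Nat.add_sub_cancel_left]
  exact ⟨((Equiv.ofInjective i hi).sumCongr (Fintype.equivOfCardEq hc)).trans
    (Equiv.Set.sumCompl (Set.range i)), fun a => rfl⟩

lemma sum_smul_sum_smul {R M ι κ κ' : Type*} [CommRing R] [AddCommGroup M] [Module R M] [Fintype ι]
    [Fintype κ] (A : Matrix κ ι R) (B : Matrix ι κ' R) (v : κ → M) (j : κ') :
    ∑ i, B i j • ∑ l, A l i • v l = ∑ l, (A * B) l j • v l := by
  simp only [Matrix.mul_apply, Finset.sum_smul, Finset.smul_sum, smul_smul]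
  rw [Finset.sum_comm]
  simp only [mul_comm]

section block

variable {R : Type*} [CommRing R] {m n o : Type*} [Fintype m] [DecidableEq m] [Fintype n]
  [DecidableEq n] [Fintype o] [DecidableEq o]

/-- Block elimination: `N` is the Schur complement of the invertible upper left block. -/
lemma exists_mul_eq_mul_fromBlocks_one (Φ : Matrix (m ⊕ o) (m ⊕ n) R)
    (hΦ : IsUnit Φ.toBlocks₁₁.det) :
    ∃ (P : Matrix (m ⊕ o) (m ⊕ o) R) (Q : Matrix (m ⊕ n) (m ⊕ n) R) (N : Matrix o n R),
      IsUnit P ∧ IsUnit Q ∧ Φ * Q = P * Matrix.fromBlocks (1 : Matrix m m R) 0 0 N := by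
  refine ⟨Matrix.fromBlocks Φ.toBlocks₁₁ 0 Φ.toBlocks₂₁ 1,
    Matrix.fromBlocks 1 (-(Φ.toBlocks₁₁⁻¹ * Φ.toBlocks₁₂)) 0 1,
    Φ.toBlocks₂₂ - Φ.toBlocks₂₁ * (Φ.toBlocks₁₁⁻¹ * Φ.toBlocks₁₂), ?_, ?_, ?_⟩
  · rw [Matrix.isUnit_iff_isUnit_det, Matrix.det_fromBlocks_zero₁₂, Matrix.det_one, mul_one]
    exact hΦ
  · rw [Matrix.isUnit_iff_isUnit_det, Matrix.det_fromBlocks_zero₂₁, Matrix.det_one, Matrix.det_one,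
      mul_one]
    exact isUnit_one
  · refine (congr_arg (· * _) (Matrix.fromBlocks_toBlocks Φ).symm).trans ?_
    rw [Matrix.fromBlocks_multiply, Matrix.fromBlocks_multiply]
    congr 1
    · simp
    · rw [Matrix.mul_neg, ← Matrix.mul_assoc, Matrix.mul_nonsing_inv _ hΦ]
      simp
    · simp
    · simp [sub_eq_neg_add]

end block

section

variable {E F : X.Modules} {U : X.Opens} {ι κ : Type} [Fintype ι] [Fintype κ]
  {e : ι → Γ(E, U)} {f : κ → Γ(F, U)}

lemma IsFrame.app_eq_sum_matrix (he : IsFrame E U e) (hf : IsFrame F U f) (φ : E ⟶ F) (j : ι) :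
    φ.app U (e j) = ∑ i, he.matrix hf φ i j • f i := by
  have h := hf.sum_coord le_rfl (φ.app U (e j))
  simp only [res_self] at h
  exact h.symm

lemma IsFrame.matrix_reindex {ι' κ' : Type} [Fintype ι'] [Fintype κ'] (he : IsFrame E U e)
    (hf : IsFrame F U f) (φ : E ⟶ F) (s : ι' ≃ ι) (t : κ' ≃ κ) :
    (he.reindex s).matrix (hf.reindex t) φ = (he.matrix hf φ).submatrix t s := by
  ext i j
  exact hf.coord_reindex t le_rfl _ i

end

variable {E F : X.Modules} {φ : E ⟶ F} {p q : ℕ}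

lemma exists_normalForm_of_isUnit_toBlocks {U : X.affineOpens} {e : Fin p ⊕ Fin q → Γ(E, U)}
    {f : Fin p ⊕ Unit → Γ(F, U)} (he : IsFrame E U e) (hf : IsFrame F U f)
    (h : IsUnit (he.matrix hf φ).toBlocks₁₁.det) : ∃ D : NormalForm φ p q, D.U = U := by
  obtain ⟨P, Q, N, hP, hQ, hPQ⟩ := exists_mul_eq_mul_fromBlocks_one _ h
  have key (j) : φ.app U (∑ i, Q i j • e i) =
      ∑ i, (Matrix.fromBlocks (1 : Matrix (Fin p) (Fin p) _) 0 0 N) i j • ∑ l, P l i • f l := by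
    rw [app_sum_smul]
    simp only [he.app_eq_sum_matrix hf φ]
    rw [sum_smul_sum_smul, sum_smul_sum_smul, hPQ]
  refine ⟨⟨U, _, _, fun j => N () j, he.of_matrix Q hQ, hf.of_matrix P hP, fun i => ?_, fun j => ?_⟩,
    rfl⟩
  · refine (key _).trans ?_
    rw [Finset.sum_eq_single (.inl i)]
    · simp
    · rintro (b | b) - hb
      · rw [Matrix.fromBlocks_apply₁₁, Matrix.one_apply_ne (by simpa using hb), zero_smul]
      · simp
    · simp
  · refine (key _).trans ?_
    simp

/-- A nonzero minor has distinct rows and columns, so reindexing the frames moves it to the upper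
left corner. -/
lemma exists_normalForm_of_isUnit_minor {U : X.affineOpens} [Nontrivial Γ(X, U.1)] {m n : ℕ}
    {e : Fin m → Γ(E, U)} {f : Fin n → Γ(F, U)} (hm : m = p + q) (hn : n = p + 1)
    (he : IsFrame E U e) (hf : IsFrame F U f) {d : Γ(X, U.1)} (hd : d ∈ minors (he.matrix hf φ) p)
    (h : IsUnit d) : ∃ D : NormalForm φ p q, D.U = U := by
  obtain ⟨row, col, rfl⟩ := hd
  have hrow : Function.Injective row := fun i j hij => by
    by_contra hne
    rw [Matrix.det_zero_of_row_eq hne (by ext; simp [hij])] at h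
    exact not_isUnit_zero h
  have hcol : Function.Injective col := fun i j hij => by
    by_contra hne
    rw [Matrix.det_zero_of_column_eq hne (by simp [hij])] at h
    exact not_isUnit_zero h
  obtain ⟨s, hs⟩ := exists_sum_equiv_of_injective (β := Fin q) hcol (by simp [hm])
  obtain ⟨t, ht⟩ := exists_sum_equiv_of_injective (β := Unit) hrow (by simp [hn])
  refine exists_normalForm_of_isUnit_toBlocks (he.reindex s) (hf.reindex t) ?_
  convert h using 2
  ext i j
  rw [Matrix.toBlocks₁₁, Matrix.of_apply, he.matrix_reindex hf, Matrix.submatrix_apply, hs, ht]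
  rfl

open IsLocalRing in
-- Otherwise all `p`-minors lie in the maximal ideal at `x`, and smoothness of the degeneracy locus
-- forces its ideal there to be zero, while its height is at least `c > 0`.
lemma exists_isUnit_minor [IsIntegral X] [IsLocallyNoetherian X] {k : Type u} [Field k]
    (f : X ⟶ Spec (.of k)) [Smooth f] {c : ℕ} (hc : 0 < c) (hE : IsLocallyFree E)
    (hF : IsLocallyFree F) [Smooth ((minorIdeal φ (p + 1)).subschemeι ≫ f)]
    (hcodim : ((c : ℕ) : WithBot ℕ∞) ≤ codim ((minorIdeal φ (p + 1)).support : Set X))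
    {U : X.affineOpens} {ι κ : Type} [Fintype ι] [Fintype κ] {e : ι → Γ(E, U)} {b : κ → Γ(F, U)}
    (he : IsFrame E U e) (hb : IsFrame F U b) {x : X} (hx : x ∈ U.1) :
    ∃ d ∈ minors (he.matrix hb φ) p, x ∈ X.basicOpen d := by
  by_contra! hd
  obtain ⟨_, h1, h2, h3⟩ := exists_algebra_stalk f (minorIdeal φ (p + 1)) U hx
  have h4 := le_height_map_germ (minorIdeal φ (p + 1)) hcodim U hx
  have h5 : ((minorIdeal φ (p + 1)).ideal U).map (X.presheaf.germ U.1 x hx).hom =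
      Ideal.span (minors ((he.matrix hb φ).map (X.presheaf.germ U.1 x hx).hom) (p + 1)) := by
    rw [minorIdeal_ideal hE hF φ (p + 1) he hb U le_rfl, minors_map, ← Ideal.map_span]
    have : resFun X (le_refl U.1) = RingHom.id _ := RingHom.ext fun x => resFun_self x
    rw [this, Ideal.map_id]
  rw [h5] at h3 h4
  have h6 := eq_bot_of_minors_mem (k := k) ((he.matrix hb φ).map (X.presheaf.germ U.1 x hx).hom)
    (p := p) (by
      rw [minors_map]
      rintro _ ⟨d, hd', rfl⟩
      refine (mem_maximalIdeal _).mpr fun hu => hd d hd' ?_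
      exact (X.mem_basicOpen d x hx).mpr hu)
  rw [h6, Ideal.height_bot] at h4
  exact absurd h4 (not_le.mpr (by exact_mod_cast hc))

open IsLocalRing in
/-- A morphism with a smooth degeneracy locus of the expected codimension is locally in normal
form, with a regular sequence of equations. -/
theorem hasRegularNormalForm_of_smooth [IsIntegral X] [IsLocallyNoetherian X] {k : Type u} [Field k]
    (f : X ⟶ Spec (.of k)) [Smooth f] {r : ℕ} (hE : IsLocallyFreeOfRank E (r + (p + 1)))
    (hF : IsLocallyFreeOfRank F (p + 1)) [Smooth ((minorIdeal φ (p + 1)).subschemeι ≫ f)]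
    (hcodim : ((r + 1 : ℕ) : WithBot ℕ∞) ≤ codim ((minorIdeal φ (p + 1)).support : Set X)) :
    HasRegularNormalForm φ p (r + 1) := by
  intro x
  obtain ⟨U₁, hx₁, ⟨e⟩⟩ := hE x
  obtain ⟨U₂, hx₂, ⟨b⟩⟩ := hF x
  obtain ⟨U, hxU, hU⟩ := exists_affine_mem_le (U := U₁ ⊓ U₂) ⟨hx₁, hx₂⟩
  have he := e.isFrame.res (hU.trans inf_le_left)
  have hb := b.isFrame.res (hU.trans inf_le_right)
  obtain ⟨d, hd, hxd⟩ := exists_isUnit_minor f r.succ_pos hE.isLocallyFree hF.isLocallyFree hcodim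
    (φ := φ) he hb hxU
  let V : X.affineOpens := X.affineBasicOpen d
  have hVU : V.1 ≤ U.1 := X.basicOpen_le d
  have : Nonempty V.1 := ⟨⟨x, hxd⟩⟩
  have hu : IsUnit (resFun X hVU d) := isUnit_resFun d hVU le_rfl
  obtain ⟨D, hDV⟩ := exists_normalForm_of_isUnit_minor (φ := φ) (p := p) (q := r + 1) (U := V)
    (by omega) rfl (he.res hVU) (hb.res hVU) (d := resFun X hVU d) (by
      rw [he.matrix_res hb, minors_map]
      exact ⟨d, hd, rfl⟩) hu
  have hxD : x ∈ D.U.1 := hDV ▸ hxd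
  refine ⟨D, hxD, fun hg => ?_⟩
  obtain ⟨_, h1, h2, h3⟩ := exists_algebra_stalk f (minorIdeal φ (p + 1)) D.U hxD
  have h4 := le_height_map_germ (minorIdeal φ (p + 1)) hcodim D.U hxD
  have h5 : ((minorIdeal φ (p + 1)).ideal D.U).map (X.presheaf.germ D.U.1 x hxD).hom =
      Ideal.span (Set.range fun j => X.presheaf.germ D.U.1 x hxD (D.g j)) := by
    rw [D.minorIdeal_ideal hE.isLocallyFree hF.isLocallyFree, Ideal.map_span, ← Set.range_comp]
    rfl
  rw [h5] at h3 h4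
  refine .of_isWeaklyRegular_of_mem_maximalIdeal _ ?_
    (isWeaklyRegular_of_le_height (k := k) _ hg h4)
  intro a ha
  obtain ⟨j, rfl⟩ := List.mem_ofFn.mp ha
  exact hg j

end

end GrassmannBlowup

end

theorem mainTheorem2 {k : Type u} [Field k] {X : Scheme.{u}} (f : X ⟶ Spec (.of k))
    [IsIntegral X] [IsSeparated f] [QuasiCompact f] [Smooth f] :
    (∀ (m n : ℕ), n ≤ m → ∀ (E F : X.Modules) (φ : E ⟶ F),
      GrassmannBlowup.IsLocallyFreeOfRank E m → GrassmannBlowup.IsLocallyFreeOfRank F n →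
      Smooth ((GrassmannBlowup.minorIdeal φ n).subschemeι ≫ f) →
      (((GrassmannBlowup.minorIdeal φ n).support : Set X) = ∅ ∨
        GrassmannBlowup.codim ((GrassmannBlowup.minorIdeal φ n).support : Set X) =
          ((m - n + 1 : ℕ) : WithBot ℕ∞)) →
      Nonempty (GrassmannBlowup.GrassmannBundle E (m - n)) ∧
      ∀ Gr : GrassmannBlowup.GrassmannBundle E (m - n),
        GrassmannBlowup.IsRegularSection (Gr.tautSection φ) ∧
        GrassmannBlowup.IsBlowup
          ((GrassmannBlowup.zeroIdeal (Gr.tautSection φ)).subschemeι ≫ Gr.π)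
          (GrassmannBlowup.minorIdeal φ n)) ∧
    (∀ (r : ℕ) (L : Fin (r + 1) → X.Modules), (∀ i, GrassmannBlowup.IsLocallyFreeOfRank (L i) 1) →
      ∀ s : Γ(GrassmannBlowup.directSum L, ⊤), GrassmannBlowup.IsRegularSection s →
      Nonempty (GrassmannBlowup.GrassmannBundle
        (GrassmannBlowup.dual (GrassmannBlowup.directSum L)) r) ∧
      ∀ Gr : GrassmannBlowup.GrassmannBundle
          (GrassmannBlowup.dual (GrassmannBlowup.directSum L)) r,
        GrassmannBlowup.IsRegularSection (Gr.tautDualSection s) ∧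
        GrassmannBlowup.IsBlowup
          ((GrassmannBlowup.zeroIdeal (Gr.tautDualSection s)).subschemeι ≫ Gr.π)
          (GrassmannBlowup.zeroIdeal s)) := by
  have : IsLocallyNoetherian X := LocallyOfFiniteType.isLocallyNoetherian f
  refine ⟨?_, fun r L hL s hs => GrassmannBlowup.grassmannBundle_dual_directSum r L hL s hs⟩
  intro m n hnm E F φ hE hF hsmooth hcodim
  obtain ⟨r, rfl⟩ := Nat.exists_eq_add_of_le' hnm
  rw [Nat.add_sub_cancel] at hcodim ⊢
  refine ⟨GrassmannBlowup.nonempty_grassmannBundle hE, fun Gr => ?_⟩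
  have htaut : Gr.tautSection φ = Gr.bundleSection φ (𝟙 _) := by
    rw [GrassmannBlowup.GrassmannBundle.bundleSection, Category.comp_id]
    rfl
  rw [htaut]
  -- The normal form has an identity block of size `n - 1`, so `n = 0` is separate.
  obtain _ | p := n
  · exact ⟨Gr.isRegularSection_bundleSection_of_rank_zero φ (𝟙 _) hF,
      Gr.isBlowup_bundleSection_of_rank_zero φ (𝟙 _) hE hF⟩
  · have hcodim' : ((r + 1 : ℕ) : WithBot ℕ∞) ≤
        GrassmannBlowup.codim ((GrassmannBlowup.minorIdeal φ (p + 1)).support : Set X) := by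
      obtain h | h := hcodim
      -- For an empty degeneracy locus `codim` is `⊤`, so the lower bound holds in both cases.
      · rw [h, GrassmannBlowup.codim]
        simp
      · exact h.ge
    have hφ := GrassmannBlowup.hasRegularNormalForm_of_smooth f hE hF hcodim'
    exact ⟨Gr.isRegularSection_bundleSection (𝟙 _) hE hφ,
      Gr.isBlowup_bundleSection (𝟙 _) hE hF.isLocallyFree hφ⟩
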